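/- Let $F$ be a nonarchimedean local field of characteristic zero with ring of integers $\mathfrak o$, maximal ideal $\mathfrak p=\varpi\mathfrak o$ and $q=|\mathfrak o/\mathfrak p|$. All integrals below are taken with respect to the additive Haar measure on $F$ with $\mathrm{vol}(\mathfrak o)=1$ (on $\mathfrak o^\times$ it agrees with the Haar measure of $F^\times$ giving $\mathfrak o^\times$ volume $1-q^{-1}$); the integrands are locally constant on compact sets, so the integrals are finite sums. Let $$J'=\begin{bmatrix}&&&1\\&&1&\\&-1&&\\-1&&&\end{bmatrix},\qquad \mathrm{GSp}(4,F)=\{g\in \mathrm{GL}(4,F): {}^tgJ'g=\lambda(g)J' \text{ for some }\lambda(g)\in F^\times\},$$ and let $\mathrm{GSp}(4,\mathfrak o)$ be the subgroup of $k\in\mathrm{GSp}(4,F)$ with entries in $\mathfrak o$ and $\lambda(k)\in\mathfrak o^\times$. Let $\chi$ be a quadratic character of $F^\times$ of conductor $\mathfrak p$ (so $\chi^2=1$, $\chi$ is trivial on $1+\mathfrak p$ but not on $\mathfrak o^\times$). Let $(\pi,V)$ be a smooth complex representation of $\mathrm{GSp}(4,F)$ on which the center acts trivially, and let $V(0)$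 be the subspace of vectors fixed by $\mathrm{GSp}(4,\mathfrak o)$. Put $\eta=\mathrm{diag}(\varpi^{-1},1,1,\varpi)$, $\tau=\mathrm{diag}(1,\varpi^{-1},\varpi,1)$, $$t_4=\begin{bmatrix}&&&-\varpi^{-4}\\&1&&\\&&1&\\\varpi^4&&&\end{bmatrix},\quad s=\begin{bmatrix}1&&&\\&&1&\\&-1&&\\&&&1\end{bmatrix},\quad L(x)=\begin{bmatrix}1&&&\\&1&&\\&x&1&\\&&&1\end{bmatrix},$$ $$H(\alpha,y,z)=\begin{bmatrix}1&\alpha&y&z\\&1&&y\\&&1&-\alpha\\&&&1\end{bmatrix},\quad A(\alpha)=H(\alpha,0,0),\quad U(x,y,z)=\begin{bmatrix}1&&y&z\\&1&x&y\\&&1&\\&&&1\end{bmatrix},$$ and write $\eta,\tau$ also for $\pi(\eta),\pi(\tau)$. Iterated integrals are written with the outermost integral first and its variable last. Let $T_\chi$ be the local twisting operator on $V(0)$, defined for $v\in V(0)$ by \begin{align*} T_\chi(v)=\;&q^3\int_{\mathfrak o}\int_{\mathfrak o}\int_{\mathfrak o^\times}\int_{\mathfrak o^\times}\chi(ab)\,\pi\big(L(x)H(-a\varpi^{-1},b\varpi^{-2},z\varpi^{-4})\big)\tau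 v\,da\,db\,dx\,dz\\ &+q^3\int_{\mathfrak o}\int_{\mathfrak p}\int_{\mathfrak o^\times}\int_{\mathfrak o^\times}\chi(ab)\,\pi\big(sL(y)H(-a\varpi^{-1},b\varpi^{-2},z\varpi^{-4})\big)\tau v\,da\,db\,dy\,dz\\ &+q^2\int_{\mathfrak o}\int_{\mathfrak o}\int_{\mathfrak o^\times}\int_{\mathfrak o^\times}\chi(ab)\,\pi\big(t_4L(x)H(-a\varpi^{-1},b\varpi^{-2},z\varpi^{-3})\big)\tau v\,da\,db\,dx\,dz\\ &+q^2\int_{\mathfrak o}\int_{\mathfrak p}\int_{\mathfrak o^\times}\int_{\mathfrak o^\times}\chi(ab)\,\pi\big(t_4sL(y)H(-a\varpi^{-1},b\varpi^{-2},z\varpi^{-3})\big)\tau v\,da\,db\,dy\,dz. \end{align*} Then for every $v\in V(0)$ one has $T_\chi(v)=\sum_{k=1}^{14}T^k_\chi(v)$, where, with $\mathfrak o^{*}=\mathfrak o^\times-(1+\mathfrak p)$, \begin{align*} T^1_\chi(v)&=q^2\int_{\mathfrak o}\int_{\mathfrak o^\times}\int_{\mathfrak o^\times}\int_{\mathfrak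 o^\times}\chi(ab)\,\pi\big(A(-(a+xb)\varpi^{-1})\,U(x^{-1}\varpi^{-1},b\varpi^{-2},z\varpi^{-4})\big)v\,da\,db\,dx\,dz,\\ T^2_\chi(v)&=q\,\eta\int_{\mathfrak o^{*}}\int_{\mathfrak o^\times}\int_{\mathfrak o^\times}\int_{\mathfrak o^{*}}\chi(abxy)\,\pi\big(A(b\varpi^{-1})\,U(ab^{-1}(1-x)^{-1}\varpi^{-1},-a\varpi^{-2},ab(1-(1-y)^{-1}x)\varpi^{-3})\big)v\,dx\,da\,db\,dy,\\ T^3_\chi(v)&=\eta\int_{\mathfrak o^{*}}\int_{\mathfrak o^\times}\int_{\mathfrak o^\times}\chi(b(1-z))\,\pi\big(U(a^2b^{-1}z\varpi^{-1},a\varpi^{-2},b\varpi^{-3})\big)v\,da\,db\,dz,\\ T^4_\chi(v)&=q\,\eta\int_{\mathfrak o^\times}\int_{\mathfrak o^\times}\int_{\mathfrak o}\chi(b)\,\pi\big(A(x\varpi^{-2})\,U(0,a\varpi^{-2},(b\varpi-ax)\varpi^{-4})\big)v\,da\,db\,dx,\\ T^5_\chi(v)&=\eta\int_{\mathfrak o}\int_{\mathfrak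 o^\times}\int_{\mathfrak o^\times}\chi(b)\,\pi\big(A(x\varpi^{-1})\,U(0,a\varpi^{-2},(b-ax)\varpi^{-3})\big)v\,da\,db\,dx,\\ T^6_\chi(v)&=q^{-1}\eta^2\int_{\mathfrak o^\times}\int_{\mathfrak o^\times}\int_{\mathfrak o^\times}\chi(bx)\,\pi\big(U(a^2b^{-1}\varpi^{-2},a\varpi^{-2},b(1-x\varpi)\varpi^{-2})\big)v\,da\,db\,dx,\\ T^7_\chi(v)&=q\,\tau\int_{\mathfrak o}\int_{\mathfrak o^\times}\int_{\mathfrak o^\times}\chi(ab)\,\pi\big(A(-a\varpi^{-2})\,U(0,b\varpi^{-1},z\varpi^{-4})\big)v\,da\,db\,dz,\\ T^8_\chi(v)&=\eta\tau\int_{\mathfrak o^{*}}\int_{\mathfrak o^\times}\int_{\mathfrak o^\times}\chi(abz(1-z))\,\pi\big(A(b\varpi^{-2})\,U(0,a\varpi^{-1},-ab(1-z)\varpi^{-3})\big)v\,da\,db\,dz,\\ T^9_\chi(v)&=q^{-2}\eta^2\tau\int_{\mathfrak o^\times}\int_{\mathfrak o^\times}\int_{\mathfrak o^\times}\chi(b)\,\pi\big(A(a\varpi^{-1})\,U(x\varpi^{-1},0,-b\varpi^{-1})\big)v\,da\,db\,dx,\\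 T^{10}_\chi(v)&=q^{-3}\eta^2\tau^2\int_{\mathfrak o^\times}\int_{\mathfrak o^\times}\chi(b)\,\pi\big(H(a\varpi^{-2},0,-b\varpi^{-1})\big)v\,da\,db,\\ T^{11}_\chi(v)&=q^3\tau^{-1}\int_{\mathfrak o}\int_{\mathfrak o}\int_{\mathfrak o^\times}\int_{\mathfrak o^\times}\chi(ab)\,\pi\big(A(b\varpi^{-1})\,U(-x\varpi^{-2},(xb+a\varpi)\varpi^{-3},z\varpi^{-4})\big)v\,da\,db\,dx\,dz,\\ T^{12}_\chi(v)&=q^2\eta\tau^{-1}\int_{\mathfrak o^{*}}\int_{\mathfrak o}\int_{\mathfrak o^\times}\int_{\mathfrak o^\times}\chi(abz(1-z))\,\pi\big(A(a\varpi^{-1})\,U(-a^{-1}(y+b\varpi)\varpi^{-2},y\varpi^{-3},a(b(1-z)\varpi-y)\varpi^{-4})\big)v\,da\,db\,dy\,dz,\\ T^{13}_\chi(v)&=\eta^2\tau^{-1}\int_{\mathfrak o^\times}\int_{\mathfrak o^\times}\int_{\mathfrak o^\times}\chi(bx)\,\pi\big(U(a^2b^{-1}\varpi^{-3},a\varpi^{-2},b(1-x)\varpi^{-1})\big)v\,da\,db\,dx,\\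 T^{14}_\chi(v)&=q\,\eta^2\tau^{-2}\int_{\mathfrak o}\int_{\mathfrak o^\times}\int_{\mathfrak o^\times}\chi(b)\,\pi\big(U(x\varpi^{-4},a\varpi^{-2},-b\varpi^{-1})\big)v\,da\,db\,dx. \end{align*} -/

import Mathlib

open scoped ValuativeRel Matrix

noncomputable section

namespace LocalTwist

/-! ### The group `GSp(4)` and its paramodular subgroups -/

/-- The antidiagonal symplectic form `J'`. -/
def J' (F : Type*) [Field F] : Matrix (Fin 4) (Fin 4) F :=
  !![0, 0, 0, 1; 0, 0, 1, 0; 0, -1, 0, 0; -1, 0, 0, 0]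

theorem det_J' (F : Type*) [Field F] : (J' F).det = 1 := by
  simp [J', Matrix.det_succ_row_zero, Fin.sum_univ_succ, Fin.succAbove]
  norm_num

/-- `GSp(4, F)`: all `g ∈ GL(4, F)` with `ᵗg J' g = c J'` for some `c ∈ Fˣ`. -/
def GSp4 (F : Type*) [Field F] : Subgroup (GL (Fin 4) F) where
  carrier := {g | ∃ c : F, c ≠ 0 ∧
    (g : Matrix (Fin 4) (Fin 4) F)ᵀ * J' F * (g : Matrix (Fin 4) (Fin 4) F) = c • J' F}
  one_mem' := ⟨1, one_ne_zero, by simp⟩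
  mul_mem' := by
    rintro g h ⟨c, hc, hg⟩ ⟨d, hd, hh⟩
    refine ⟨c * d, mul_ne_zero hc hd, ?_⟩
    calc ((g * h : GL (Fin 4) F) : Matrix (Fin 4) (Fin 4) F)ᵀ * J' F *
          ((g * h : GL (Fin 4) F) : Matrix (Fin 4) (Fin 4) F)
        = (h : Matrix (Fin 4) (Fin 4) F)ᵀ *
            ((g : Matrix (Fin 4) (Fin 4) F)ᵀ * J' F * (g : Matrix (Fin 4) (Fin 4) F)) *
            (h : Matrix (Fin 4) (Fin 4) F) := by
          simp only [Units.val_mul, Matrix.transpose_mul, Matrix.mul_assoc]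
      _ = (c * d) • J' F := by
          rw [hg, Matrix.mul_smul, Matrix.smul_mul, hh, smul_smul]
  inv_mem' := by
    rintro g ⟨c, hc, hg⟩
    refine ⟨c⁻¹, inv_ne_zero hc, ?_⟩
    have h1 : (g : Matrix (Fin 4) (Fin 4) F) * ((g⁻¹ : GL (Fin 4) F) : Matrix _ _ F) = 1 := by
      rw [← Units.val_mul, mul_inv_cancel, Units.val_one]
    have h2 : ((g⁻¹ : GL (Fin 4) F) : Matrix (Fin 4) (Fin 4) F)ᵀ *
        (g : Matrix (Fin 4) (Fin 4) F)ᵀ = 1 := by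
      rw [← Matrix.transpose_mul, h1, Matrix.transpose_one]
    have h3 : J' F = c⁻¹ •
        ((g : Matrix (Fin 4) (Fin 4) F)ᵀ * J' F * (g : Matrix (Fin 4) (Fin 4) F)) := by
      rw [hg, smul_smul, inv_mul_cancel₀ hc, one_smul]
    conv_lhs => rw [h3]
    rw [Matrix.mul_smul, Matrix.smul_mul]
    congr 1
    calc ((g⁻¹ : GL (Fin 4) F) : Matrix (Fin 4) (Fin 4) F)ᵀ *
          ((g : Matrix (Fin 4) (Fin 4) F)ᵀ * J' F * (g : Matrix (Fin 4) (Fin 4) F)) *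
          ((g⁻¹ : GL (Fin 4) F) : Matrix (Fin 4) (Fin 4) F)
        = (((g⁻¹ : GL (Fin 4) F) : Matrix (Fin 4) (Fin 4) F)ᵀ *
            (g : Matrix (Fin 4) (Fin 4) F)ᵀ) * J' F *
          ((g : Matrix (Fin 4) (Fin 4) F) *
            ((g⁻¹ : GL (Fin 4) F) : Matrix (Fin 4) (Fin 4) F)) := by
          simp only [Matrix.mul_assoc]
      _ = J' F := by rw [h1, h2, one_mul, mul_one]

section Group

variable {F : Type*} [Field F]

/-- The underlying `4 × 4` matrix. -/
def toMat (g : GSp4 F) : Matrix (Fin 4) (Fin 4) F := ((g : GL (Fin 4) F) : Matrix _ _ F)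

/-- The multiplier `λ(g)`, read off from an entry of `ᵗg J' g = λ(g) J'`. -/
def multiplier (g : GSp4 F) : F := ((toMat g)ᵀ * J' F * toMat g) 0 3

theorem multiplier_spec (g : GSp4 F) :
    multiplier g ≠ 0 ∧ (toMat g)ᵀ * J' F * toMat g = multiplier g • J' F := by
  obtain ⟨c, hc, h⟩ := g.2
  have h' : (toMat g)ᵀ * J' F * toMat g = c • J' F := h
  have : multiplier g = c := by
    rw [multiplier, h']
    simp [J']
  rw [this]
  exact ⟨hc, h'⟩

/-- The element of `GSp(4, F)` given by a matrix `M` with `ᵗM J' M = c J'`, `c ≠ 0`. -/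
def ofMat (M : Matrix (Fin 4) (Fin 4) F) (c : F) (hc : c ≠ 0)
    (h : Mᵀ * J' F * M = c • J' F) : GSp4 F :=
  ⟨Matrix.GeneralLinearGroup.mkOfDetNeZero M (by
    intro h0
    have := congrArg Matrix.det h
    rw [Matrix.det_mul, h0, mul_zero, Matrix.det_smul, det_J', mul_one, Fintype.card_fin] at this
    exact pow_ne_zero 4 hc this.symm), c, hc, h⟩

theorem toMat_ofMat (M : Matrix (Fin 4) (Fin 4) F) (c : F) (hc : c ≠ 0)
    (h : Mᵀ * J' F * M = c • J' F) : toMat (ofMat M c hc h) = M := rfl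

/-- Klingen-type unipotent. -/
def heis (α y z : F) : GSp4 F :=
  ofMat !![1, α, y, z; 0, 1, 0, y; 0, 0, 1, -α; 0, 0, 0, 1] 1 one_ne_zero (by
    ext i j; fin_cases i <;> fin_cases j <;>
      simp [J', Matrix.mul_apply, Fin.sum_univ_succ]
    ring)

/-- Siegel-type unipotent. -/
def siegel (x y z : F) : GSp4 F :=
  ofMat !![1, 0, y, z; 0, 1, x, y; 0, 0, 1, 0; 0, 0, 0, 1] 1 one_ne_zero (by
    ext i j; fin_cases i <;> fin_cases j <;>
      simp [J', Matrix.mul_apply, Fin.sum_univ_succ])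

/-- Lower triangular unipotent with entry `x` in the third row and second column. -/
def lower (x : F) : GSp4 F :=
  ofMat !![1, 0, 0, 0; 0, 1, 0, 0; 0, x, 1, 0; 0, 0, 0, 1] 1 one_ne_zero (by
    ext i j; fin_cases i <;> fin_cases j <;>
      simp [J', Matrix.mul_apply, Fin.sum_univ_succ])

/-- The Weyl element in the middle `2 × 2` block. -/
def weyl (F : Type*) [Field F] : GSp4 F :=
  ofMat !![1, 0, 0, 0; 0, 0, 1, 0; 0, -1, 0, 0; 0, 0, 0, 1] 1 one_ne_zero (by
    ext i j; fin_cases i <;> fin_cases j <;>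
      simp [J', Matrix.mul_apply, Fin.sum_univ_succ])

/-- `η = diag(ϖ⁻¹, 1, 1, ϖ)`. -/
def eta (ϖ : Fˣ) : GSp4 F :=
  ofMat !![(ϖ : F)⁻¹, 0, 0, 0; 0, 1, 0, 0; 0, 0, 1, 0; 0, 0, 0, (ϖ : F)] 1 one_ne_zero (by
    ext i j; fin_cases i <;> fin_cases j <;>
      simp [J', Matrix.mul_apply, Fin.sum_univ_succ])

/-- `τ = diag(1, ϖ⁻¹, ϖ, 1)`. -/
def tau (ϖ : Fˣ) : GSp4 F :=
  ofMat !![1, 0, 0, 0; 0, (ϖ : F)⁻¹, 0, 0; 0, 0, (ϖ : F), 0; 0, 0, 0, 1] 1 one_ne_zero (by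
    ext i j; fin_cases i <;> fin_cases j <;>
      simp [J', Matrix.mul_apply, Fin.sum_univ_succ])

/-- The Atkin-Lehner-type element `t₄`. -/
def t4 (ϖ : Fˣ) : GSp4 F :=
  ofMat !![0, 0, 0, -((ϖ : F) ^ 4)⁻¹; 0, 1, 0, 0; 0, 0, 1, 0; (ϖ : F) ^ 4, 0, 0, 0]
    1 one_ne_zero (by
    ext i j; fin_cases i <;> fin_cases j <;>
      simp [J', Matrix.mul_apply, Fin.sum_univ_succ])

end Group

/-! ### Subsets of the local field, smooth representations, characters -/

section Field

variable (F : Type*) [Field F] [ValuativeRel F]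

/-- The ring of integers `𝔬`, as a subset of `F`. -/
def ringInt : Set F := (𝒪[F] : Set F)

/-- The unit group `𝔬ˣ`. -/
def unitInt : Set F := {x | ValuativeRel.valuation F x = 1}

/-- The maximal ideal `𝔭`. -/
def maxIdeal : Set F := {x | ValuativeRel.valuation F x < 1}

/-- The group `1 + 𝔭`. -/
def oneUnits : Set F := {x | x - 1 ∈ maxIdeal F}

/-- The number `q` of elements of the residue field, as a complex number. -/
def resCard : ℂ := (Nat.card 𝓀[F] : ℂ)

variable {F}

/-- `ϖ` generates the maximal ideal of the ring of integers. -/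
def IsUniformizer (ϖ : Fˣ) : Prop :=
  ∃ w : 𝒪[F], (w : F) = ϖ ∧ 𝓂[F] = Ideal.span {w}

/-- The fractional ideal `𝔭ⁿ = ϖⁿ 𝔬`, for an integer `n`. -/
def primePow (ϖ : Fˣ) (n : ℤ) : Set F := {x | ∃ y ∈ ringInt F, x = (ϖ : F) ^ n * y}

/-- The paramodular group `K(𝔭ⁿ)`; for `n = 0` it is `GSp(4, 𝔬)`. -/
def paramodular (ϖ : Fˣ) (n : ℕ) : Set (GSp4 F) :=
  {k | multiplier k ∈ unitInt F ∧
    ∀ i j, toMat k i j ∈ primePow ϖ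
      ((!![0, 0, 0, -(n : ℤ); n, 0, 0, 0; n, 0, 0, 0; n, n, n, 0] :
        Matrix (Fin 4) (Fin 4) ℤ) i j)}

/-- `χ` has conductor `𝔭`: trivial on `1 + 𝔭` but not on `𝔬ˣ`.  (A `MulChar F ℂ` is a character
`Fˣ → ℂˣ`, extended by zero to `F`.) -/
def HasConductorPrime (χ : MulChar F ℂ) : Prop :=
  (∀ u ∈ oneUnits F, χ u = 1) ∧ ∃ u ∈ unitInt F, χ u ≠ 1

variable {V : Type*} [AddCommGroup V] [Module ℂ V]

/-- Smoothness: every vector is fixed by some open subgroup. -/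
def IsSmooth [TopologicalSpace F] (ρ : Representation ℂ (GSp4 F) V) : Prop :=
  ∀ v : V, ∃ U : Subgroup (GSp4 F), IsOpen (U : Set (GSp4 F)) ∧ ∀ g ∈ U, ρ g v = v

/-- The space `V(n)` of vectors fixed by `K(𝔭ⁿ)`. -/
def paramodularVectors (ρ : Representation ℂ (GSp4 F) V) (ϖ : Fˣ) (n : ℕ) : Submodule ℂ V where
  carrier := {v | ∀ k ∈ paramodular ϖ n, ρ k v = v}
  add_mem' := fun ha hb k hk => by rw [map_add, ha k hk, hb k hk]
  zero_mem' := fun k _ => map_zero _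
  smul_mem' := fun c v hv k hk => by rw [map_smul, hv k hk]

/-- The integral over `S` of a vector-valued function that takes finitely many values on `S`,
such as a locally constant function on a compact set: the sum over the values `w` of
`vol {x ∈ S | f x = w} • w`. No topology on `V` is involved. -/
def integ [MeasurableSpace F] (μ : MeasureTheory.Measure F) (S : Set F) (f : F → V) : V :=
  ∑ᶠ w : V, ((μ.real (S ∩ f ⁻¹' {w}) : ℝ) : ℂ) • w

end Field

/-! ### The twisting operator and the fourteen terms -/

section Operator

variable {F : Type*} [Field F] [ValuativeRel F] [MeasurableSpace F]
  {V : Type*} [AddCommGroup V] [Module ℂ V]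
  (μ : MeasureTheory.Measure F) (ϖ : Fˣ) (χ : MulChar F ℂ)
  (ρ : Representation ℂ (GSp4 F) V) (v : V)

/-- The local twisting operator, given by its four defining integrals. -/
def twist : V :=
  resCard F ^ 3 • (integ μ (ringInt F) fun z => integ μ (ringInt F) fun x =>
    integ μ (unitInt F) fun b => integ μ (unitInt F) fun a =>
      χ (a * b) • ρ (lower x * heis (-a / ϖ) (b / ϖ ^ 2) (z / ϖ ^ 4)) (ρ (tau ϖ) v))
  + resCard F ^ 3 • (integ μ (ringInt F) fun z => integ μ (maxIdeal F) fun y =>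
    integ μ (unitInt F) fun b => integ μ (unitInt F) fun a =>
      χ (a * b) • ρ (weyl F * lower y * heis (-a / ϖ) (b / ϖ ^ 2) (z / ϖ ^ 4)) (ρ (tau ϖ) v))
  + resCard F ^ 2 • (integ μ (ringInt F) fun z => integ μ (ringInt F) fun x =>
    integ μ (unitInt F) fun b => integ μ (unitInt F) fun a =>
      χ (a * b) • ρ (t4 ϖ * lower x * heis (-a / ϖ) (b / ϖ ^ 2) (z / ϖ ^ 3)) (ρ (tau ϖ) v))
  + resCard F ^ 2 • (integ μ (ringInt F) fun z => integ μ (maxIdeal F) fun y =>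
    integ μ (unitInt F) fun b => integ μ (unitInt F) fun a =>
      χ (a * b) •
        ρ (t4 ϖ * weyl F * lower y * heis (-a / ϖ) (b / ϖ ^ 2) (z / ϖ ^ 3)) (ρ (tau ϖ) v))

/-- The term `T^1` of the expansion. -/
def term1 : V :=
  resCard F ^ 2 • (integ μ (ringInt F) fun z => integ μ (unitInt F) fun x =>
    integ μ (unitInt F) fun b => integ μ (unitInt F) fun a =>
      χ (a * b) • ρ (heis (-(a + x * b) / ϖ) 0 0 * siegel (x⁻¹ / ϖ) (b / ϖ ^ 2) (z / ϖ ^ 4)) v)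

/-- The term `T^2` of the expansion. -/
def term2 : V :=
  resCard F • ρ (eta ϖ) (integ μ (unitInt F \ oneUnits F) fun y =>
    integ μ (unitInt F) fun b => integ μ (unitInt F) fun a =>
    integ μ (unitInt F \ oneUnits F) fun x =>
      χ (a * b * x * y) • ρ (heis (b / ϖ) 0 0 *
        siegel (a * b⁻¹ * (1 - x)⁻¹ / ϖ) (-a / ϖ ^ 2) (a * b * (1 - (1 - y)⁻¹ * x) / ϖ ^ 3)) v)

/-- The term `T^3` of the expansion. -/
def term3 : V :=
  ρ (eta ϖ) (integ μ (unitInt F \ oneUnits F) fun z =>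
    integ μ (unitInt F) fun b => integ μ (unitInt F) fun a =>
      χ (b * (1 - z)) • ρ (siegel (a ^ 2 * b⁻¹ * z / ϖ) (a / ϖ ^ 2) (b / ϖ ^ 3)) v)

/-- The term `T^4` of the expansion. -/
def term4 : V :=
  resCard F • ρ (eta ϖ) (integ μ (unitInt F) fun x =>
    integ μ (unitInt F) fun b => integ μ (ringInt F) fun a =>
      χ b • ρ (heis (x / ϖ ^ 2) 0 0 * siegel 0 (a / ϖ ^ 2) ((b * ϖ - a * x) / ϖ ^ 4)) v)

/-- The term `T^5` of the expansion. -/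
def term5 : V :=
  ρ (eta ϖ) (integ μ (ringInt F) fun x =>
    integ μ (unitInt F) fun b => integ μ (unitInt F) fun a =>
      χ b • ρ (heis (x / ϖ) 0 0 * siegel 0 (a / ϖ ^ 2) ((b - a * x) / ϖ ^ 3)) v)

/-- The term `T^6` of the expansion. -/
def term6 : V :=
  (resCard F)⁻¹ • ρ (eta ϖ ^ 2) (integ μ (unitInt F) fun x =>
    integ μ (unitInt F) fun b => integ μ (unitInt F) fun a =>
      χ (b * x) • ρ (siegel (a ^ 2 * b⁻¹ / ϖ ^ 2) (a / ϖ ^ 2) (b * (1 - x * ϖ) / ϖ ^ 2)) v)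

/-- The term `T^7` of the expansion. -/
def term7 : V :=
  resCard F • ρ (tau ϖ) (integ μ (ringInt F) fun z =>
    integ μ (unitInt F) fun b => integ μ (unitInt F) fun a =>
      χ (a * b) • ρ (heis (-a / ϖ ^ 2) 0 0 * siegel 0 (b / ϖ) (z / ϖ ^ 4)) v)

/-- The term `T^8` of the expansion. -/
def term8 : V :=
  ρ (eta ϖ * tau ϖ) (integ μ (unitInt F \ oneUnits F) fun z =>
    integ μ (unitInt F) fun b => integ μ (unitInt F) fun a =>
      χ (a * b * z * (1 - z)) •
        ρ (heis (b / ϖ ^ 2) 0 0 * siegel 0 (a / ϖ) (-(a * b * (1 - z)) / ϖ ^ 3)) v)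

/-- The term `T^9` of the expansion. -/
def term9 : V :=
  (resCard F ^ 2)⁻¹ • ρ (eta ϖ ^ 2 * tau ϖ) (integ μ (unitInt F) fun x =>
    integ μ (unitInt F) fun b => integ μ (unitInt F) fun a =>
      χ b • ρ (heis (a / ϖ) 0 0 * siegel (x / ϖ) 0 (-b / ϖ)) v)

/-- The term `T^10` of the expansion. -/
def term10 : V :=
  (resCard F ^ 3)⁻¹ • ρ (eta ϖ ^ 2 * tau ϖ ^ 2) (integ μ (unitInt F) fun b =>
    integ μ (unitInt F) fun a =>
      χ b • ρ (heis (a / ϖ ^ 2) 0 (-b / ϖ)) v)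

/-- The term `T^11` of the expansion. -/
def term11 : V :=
  resCard F ^ 3 • ρ ((tau ϖ)⁻¹) (integ μ (ringInt F) fun z => integ μ (ringInt F) fun x =>
    integ μ (unitInt F) fun b => integ μ (unitInt F) fun a =>
      χ (a * b) • ρ (heis (b / ϖ) 0 0 *
        siegel (-x / ϖ ^ 2) ((x * b + a * ϖ) / ϖ ^ 3) (z / ϖ ^ 4)) v)

/-- The term `T^12` of the expansion. -/
def term12 : V :=
  resCard F ^ 2 • ρ (eta ϖ * (tau ϖ)⁻¹) (integ μ (unitInt F \ oneUnits F) fun z =>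
    integ μ (ringInt F) fun y => integ μ (unitInt F) fun b => integ μ (unitInt F) fun a =>
      χ (a * b * z * (1 - z)) • ρ (heis (a / ϖ) 0 0 *
        siegel (-a⁻¹ * (y + b * ϖ) / ϖ ^ 2) (y / ϖ ^ 3)
          (a * (b * (1 - z) * ϖ - y) / ϖ ^ 4)) v)

/-- The term `T^13` of the expansion. -/
def term13 : V :=
  ρ (eta ϖ ^ 2 * (tau ϖ)⁻¹) (integ μ (unitInt F) fun x =>
    integ μ (unitInt F) fun b => integ μ (unitInt F) fun a =>
      χ (b * x) • ρ (siegel (a ^ 2 * b⁻¹ / ϖ ^ 3) (a / ϖ ^ 2) (b * (1 - x) / ϖ)) v)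

/-- The term `T^14` of the expansion. -/
def term14 : V :=
  resCard F • ρ (eta ϖ ^ 2 * (tau ϖ)⁻¹ ^ 2) (integ μ (ringInt F) fun x =>
    integ μ (unitInt F) fun b => integ μ (unitInt F) fun a =>
      χ b • ρ (siegel (x / ϖ ^ 4) (a / ϖ ^ 2) (-b / ϖ)) v)

end Operator

end LocalTwist

end

open scoped ValuativeRel Matrix

noncomputable section

namespace LocalTwist

/-! ### The ring of integers, its units and its maximal ideal -/

section Integers

variable {F : Type*} [Field F] [ValuativeRel F] {x y : F}

/-! The proof has an arithmetic half and a group-theoretic half.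

Arithmetic. The representation is smooth, `χ` is trivial on `1 + 𝔭`, and all domains lie in the
compact set `𝔬⁴`. So a single `N` makes every integrand invariant modulo `𝔭ᴺ` (`eventually_invOn`),
and every iterated integral becomes a normalized finite sum `avg` over classes of `(𝔬/𝔭ᴺ)⁴`
(`integ_iterated_eq_avg`). A substitution needs no Jacobian: a bijection that preserves congruences
modulo every power of `𝔭`, together with its inverse, permutes the classes (`avg_bij`). The only
factors are `q⁻¹`, one for each replacement of a variable in `𝔭` by `ϖ` times a variable in `𝔬`
(`avg_scale`).

Group theory. The vector `π(g)v` depends only on the coset of `g` modulo `GSp(4, 𝔬)`, so `g` may be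
replaced by any `h` for which `h⁻¹g` is integral with multiplier 1 (`apply_eq_of_toMat_eq`). Each of
the fourteen terms is a family of upper triangular representatives, that is, of Iwasawa
decompositions. The values of `χ` are compared by `mulChar_congr`: they agree as soon as the
arguments agree modulo `𝔭` up to the square of a unit.

The middle block is reduced first. According to `v(x) = 0`, `v(x) = 1` or `v(x) ≥ 2`, the product of
`L(x)`, the Heisenberg element and `τ` takes a form C, B or A, with torus part `τ⁻¹`, `1` or `τ`.
The integrals containing `s` supply the part of C where the lower variable lies in `𝔭`
(`avg_trm_decomposition`). Without `t₄`, the forms B, A, C are `T¹`, `T⁷`, `T¹¹` after a translation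
of `z`.

With `t₄` a second reduction is needed. The bottom row of the matrix has content `ϖ` if `z` is a
unit and `ϖ²` otherwise, which produces `η` or `η²`; the remaining torus part depends on further
quantities being units or not: A: `z + ab` for unit `z`, giving `T⁵`, `T²`, and `T¹³` for `z ∈ 𝔭`
(`avg_trmA`); C: `z + ab` for unit `z`, giving `T⁴`, `T¹²`, and `T¹⁴` for `z ∈ 𝔭` (`avg_trmC`); B,
for unit `z`: `z + ab`, then `a + xb`, then `xz + a(a + xb)`, giving `T⁵`, `T³`, `T⁸`, `T²`; for `z
∈ 𝔭`: the valuation 0, 1, 2 or at least 3 of `a + x(b + z/a)`, giving `T¹³`, `T⁶`, `T⁹`, `T¹⁰`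
(`avg_trmB`). The terms `T²`, `T⁵`, `T¹³` arise from complementary parts of their domains, one from
A and one from B. A quantity in `𝔭` on which the coset does not depend becomes a dummy variable, and
its volume `q⁻¹` accounts for the powers of `q` in the statement. -/

theorem mem_ringInt_iff : x ∈ ringInt F ↔ ValuativeRel.valuation F x ≤ 1 := Iff.rfl

theorem ring_zero : (0 : F) ∈ ringInt F := zero_mem 𝒪[F]
theorem ring_one : (1 : F) ∈ ringInt F := one_mem 𝒪[F]
theorem ring_add (hx : x ∈ ringInt F) (hy : y ∈ ringInt F) : x + y ∈ ringInt F :=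
  Subring.add_mem 𝒪[F] hx hy
theorem ring_sub (hx : x ∈ ringInt F) (hy : y ∈ ringInt F) : x - y ∈ ringInt F :=
  Subring.sub_mem 𝒪[F] hx hy
theorem ring_neg (hx : x ∈ ringInt F) : -x ∈ ringInt F :=
  Subring.neg_mem 𝒪[F] hx
theorem ring_mul (hx : x ∈ ringInt F) (hy : y ∈ ringInt F) : x * y ∈ ringInt F :=
  Subring.mul_mem 𝒪[F] hx hy
theorem ring_pow (hx : x ∈ ringInt F) (n : ℕ) : x ^ n ∈ ringInt F :=
  Subring.pow_mem 𝒪[F] hx n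

theorem unit_ring (hx : x ∈ unitInt F) : x ∈ ringInt F := le_of_eq hx
theorem mem_maxIdeal_iff_lt : x ∈ maxIdeal F ↔ ValuativeRel.valuation F x < 1 := Iff.rfl
theorem max_ring (hx : x ∈ maxIdeal F) : x ∈ ringInt F :=
  mem_ringInt_iff.2 (mem_maxIdeal_iff_lt.1 hx).le
theorem ring_cases (hx : x ∈ ringInt F) : x ∈ unitInt F ∨ x ∈ maxIdeal F :=
  (eq_or_lt_of_le (mem_ringInt_iff.1 hx))
theorem not_max_of_unit (hx : x ∈ unitInt F) : x ∉ maxIdeal F := fun h => by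
  rw [maxIdeal, Set.mem_ofPred_eq, show ValuativeRel.valuation F x = 1 from hx] at h
  exact lt_irrefl _ h
theorem unit_of_not_max (hx : x ∈ ringInt F) (h : x ∉ maxIdeal F) : x ∈ unitInt F :=
  (ring_cases hx).resolve_right h

theorem unit_ne_zero (hx : x ∈ unitInt F) : x ≠ 0 := by
  rintro rfl
  simp [unitInt] at hx

theorem unit_one : (1 : F) ∈ unitInt F := map_one _
theorem unit_mul (hx : x ∈ unitInt F) (hy : y ∈ unitInt F) : x * y ∈ unitInt F := by
  simp only [unitInt, Set.mem_ofPred_eq] at *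
  rw [map_mul, hx, hy, one_mul]
theorem unit_inv (hx : x ∈ unitInt F) : x⁻¹ ∈ unitInt F := by
  simp only [unitInt, Set.mem_ofPred_eq] at *
  rw [map_inv₀, hx, inv_one]
theorem unit_div (hx : x ∈ unitInt F) (hy : y ∈ unitInt F) : x / y ∈ unitInt F := by
  rw [div_eq_mul_inv]; exact unit_mul hx (unit_inv hy)
theorem unit_neg (hx : x ∈ unitInt F) : -x ∈ unitInt F := by
  simp only [unitInt, Set.mem_ofPred_eq] at *
  rw [Valuation.map_neg, hx]
theorem unit_pow (hx : x ∈ unitInt F) (n : ℕ) : x ^ n ∈ unitInt F := by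
  simp only [unitInt, Set.mem_ofPred_eq] at *
  rw [map_pow, hx, one_pow]
theorem ring_div (hx : x ∈ ringInt F) (hy : y ∈ unitInt F) : x / y ∈ ringInt F := by
  rw [div_eq_mul_inv]; exact ring_mul hx (unit_ring (unit_inv hy))

theorem max_zero : (0 : F) ∈ maxIdeal F := by simp [maxIdeal]
theorem max_add (hx : x ∈ maxIdeal F) (hy : y ∈ maxIdeal F) : x + y ∈ maxIdeal F :=
  mem_maxIdeal_iff_lt.2 (Valuation.map_add_lt _ (mem_maxIdeal_iff_lt.1 hx) (mem_maxIdeal_iff_lt.1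
      hy))
theorem max_neg (hx : x ∈ maxIdeal F) : -x ∈ maxIdeal F := by
  simp only [maxIdeal, Set.mem_ofPred_eq] at *
  rwa [Valuation.map_neg]
theorem max_sub (hx : x ∈ maxIdeal F) (hy : y ∈ maxIdeal F) : x - y ∈ maxIdeal F := by
  rw [sub_eq_add_neg]; exact max_add hx (max_neg hy)
theorem max_mul_right (hx : x ∈ maxIdeal F) (hy : y ∈ ringInt F) : x * y ∈ maxIdeal F := by
  simp only [maxIdeal, Set.mem_ofPred_eq, mem_ringInt_iff, map_mul] at *
  exact mul_lt_one_of_lt_of_le hx hy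
theorem max_div (hx : x ∈ maxIdeal F) (hy : y ∈ unitInt F) : x / y ∈ maxIdeal F := by
  rw [div_eq_mul_inv]; exact max_mul_right hx (unit_ring (unit_inv hy))
theorem unit_add_max (hx : x ∈ unitInt F) (hy : y ∈ maxIdeal F) : x + y ∈ unitInt F := by
  refine unit_of_not_max (ring_add (unit_ring hx) (max_ring hy)) fun h => not_max_of_unit hx ?_
  simpa using max_sub h hy
theorem unit_sub_max (hx : x ∈ unitInt F) (hy : y ∈ maxIdeal F) : x - y ∈ unitInt F := by
  rw [sub_eq_add_neg]; exact unit_add_max hx (max_neg hy)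
theorem unit_congr (h : x - y ∈ maxIdeal F) (hx : x ∈ unitInt F) : y ∈ unitInt F := by
  simpa using unit_sub_max hx h
theorem max_congr (h : x - y ∈ maxIdeal F) (hx : x ∈ maxIdeal F) : y ∈ maxIdeal F := by
  simpa using max_sub hx h

/-- Since `1 - x` is integral, not lying in `𝔭` is the same as being a unit. The substitutions below
check membership in this two-unit form. -/
theorem mem_punctured_iff :
    x ∈ unitInt F \ oneUnits F ↔ x ∈ unitInt F ∧ 1 - x ∈ unitInt F := by
  refine and_congr_right fun hx => ?_
  have h1 : 1 - x ∈ ringInt F := ring_sub ring_one (unit_ring hx)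
  constructor
  · intro h
    exact unit_of_not_max h1 fun hm => h (show x - 1 ∈ maxIdeal F by simpa using max_neg hm)
  · intro h hm
    exact not_max_of_unit h (by simpa using max_neg (show x - 1 ∈ maxIdeal F from hm))

/-! ### Uniformizers -/

variable {ϖ : Fˣ}

theorem IsUniformizer.mem_maxIdeal (h : IsUniformizer ϖ) : (ϖ : F) ∈ maxIdeal F := by
  obtain ⟨w, hw, hm⟩ := h
  have : w ∈ 𝓂[F] := by rw [hm]; exact Ideal.mem_span_singleton_self w
  rw [← hw]
  have h1 : ¬ IsUnit w := (IsLocalRing.mem_maximalIdeal w).1 this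
  rcases ring_cases (show (w : F) ∈ ringInt F from w.2) with hu | hu
  · refine absurd ?_ h1
    have hw0 := unit_ne_zero hu
    exact IsUnit.of_mul_eq_one (⟨(w : F)⁻¹, unit_ring (unit_inv hu)⟩ : 𝒪[F])
      (Subtype.ext (mul_inv_cancel₀ hw0))
  · exact hu

theorem IsUniformizer.mem_ringInt (h : IsUniformizer ϖ) : (ϖ : F) ∈ ringInt F :=
  max_ring h.mem_maxIdeal

theorem mem_maximalIdeal_iff (w : 𝒪[F]) : w ∈ 𝓂[F] ↔ (w : F) ∈ maxIdeal F := by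
  rw [IsLocalRing.mem_maximalIdeal, mem_nonunits_iff]
  constructor
  · intro h
    refine (ring_cases (show (w : F) ∈ ringInt F from w.2)).resolve_left fun hu => h ?_
    exact IsUnit.of_mul_eq_one (⟨(w : F)⁻¹, unit_ring (unit_inv hu)⟩ : 𝒪[F])
      (Subtype.ext (mul_inv_cancel₀ (unit_ne_zero hu)))
  · rintro h ⟨u, rfl⟩
    have h2 : ((u : 𝒪[F]) : F) * ((u⁻¹ : 𝒪[F]ˣ) : 𝒪[F]) = 1 := by
      rw [← Subring.coe_mul (s := _) , Units.mul_inv]; rfl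
    have := max_mul_right h (show (((u⁻¹ : 𝒪[F]ˣ) : 𝒪[F]) : F) ∈ ringInt F from Subtype.mem _)
    rw [h2] at this
    exact not_max_of_unit unit_one this

theorem IsUniformizer.mem_maxIdeal_iff (h : IsUniformizer ϖ) :
    x ∈ maxIdeal F ↔ ∃ y ∈ ringInt F, x = ϖ * y := by
  constructor
  · intro hx
    obtain ⟨w, hw, hm⟩ := h
    have h1 : (⟨x, max_ring hx⟩ : 𝒪[F]) ∈ 𝓂[F] := (mem_maximalIdeal_iff _).2 hx
    rw [hm, Ideal.mem_span_singleton] at h1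
    obtain ⟨y, hy⟩ := h1
    refine ⟨y, y.2, ?_⟩
    rw [← hw]
    exact congrArg Subtype.val hy
  · rintro ⟨y, hy, rfl⟩
    exact max_mul_right h.mem_maxIdeal hy

theorem IsUniformizer.mul_mem_maxIdeal (h : IsUniformizer ϖ) (hx : x ∈ ringInt F) :
    ϖ * x ∈ maxIdeal F := max_mul_right h.mem_maxIdeal hx

theorem IsUniformizer.mul_mem_maxIdeal_iff (h : IsUniformizer ϖ) :
    ϖ * x ∈ maxIdeal F ↔ x ∈ ringInt F := by
  refine ⟨fun hx => ?_, h.mul_mem_maxIdeal⟩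
  obtain ⟨y, hy, hxy⟩ := h.mem_maxIdeal_iff.1 hx
  rwa [mul_left_cancel₀ ϖ.ne_zero hxy]

/-! ### Congruences modulo powers of the maximal ideal -/

/-- Congruence of two integral elements modulo `𝔭ᴺ`. -/
def Cg (ϖ : Fˣ) (N : ℕ) (x y : F) : Prop :=
  x ∈ ringInt F ∧ y ∈ ringInt F ∧ ∃ t ∈ ringInt F, x - y = ϖ ^ N * t

namespace Cg

variable {N : ℕ} {x' y' : F}

theorem refl (hx : x ∈ ringInt F) : Cg ϖ N x x := ⟨hx, hx, 0, ring_zero, by simp⟩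
theorem symm (h : Cg ϖ N x y) : Cg ϖ N y x := by
  obtain ⟨hx, hy, t, ht, e⟩ := h
  exact ⟨hy, hx, -t, ring_neg ht, by rw [mul_neg, ← e]; ring⟩
theorem trans {z : F} (h : Cg ϖ N x y) (h' : Cg ϖ N y z) : Cg ϖ N x z := by
  obtain ⟨hx, hy, t, ht, e⟩ := h
  obtain ⟨-, hz, s, hs, e'⟩ := h'
  exact ⟨hx, hz, t + s, ring_add ht hs, by rw [mul_add, ← e, ← e']; ring⟩
theorem add (h : Cg ϖ N x y) (h' : Cg ϖ N x' y') : Cg ϖ N (x + x') (y + y') := by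
  obtain ⟨hx, hy, t, ht, e⟩ := h
  obtain ⟨hx', hy', s, hs, e'⟩ := h'
  exact ⟨ring_add hx hx', ring_add hy hy', t + s, ring_add ht hs, by
    rw [mul_add, ← e, ← e']; ring⟩
theorem neg (h : Cg ϖ N x y) : Cg ϖ N (-x) (-y) := by
  obtain ⟨hx, hy, t, ht, e⟩ := h
  exact ⟨ring_neg hx, ring_neg hy, -t, ring_neg ht, by rw [mul_neg, ← e]; ring⟩
theorem sub (h : Cg ϖ N x y) (h' : Cg ϖ N x' y') : Cg ϖ N (x - x') (y - y') := by
  rw [sub_eq_add_neg, sub_eq_add_neg]; exact h.add h'.neg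
theorem mul (h : Cg ϖ N x y) (h' : Cg ϖ N x' y') : Cg ϖ N (x * x') (y * y') := by
  obtain ⟨hx, hy, t, ht, e⟩ := h
  obtain ⟨hx', hy', s, hs, e'⟩ := h'
  refine ⟨ring_mul hx hx', ring_mul hy hy', x * s + t * y',
    ring_add (ring_mul hx hs) (ring_mul ht hy'), ?_⟩
  linear_combination x * e' + y' * e
theorem pow (h : Cg ϖ N x y) (n : ℕ) : Cg ϖ N (x ^ n) (y ^ n) := by
  induction n with
  | zero => simpa using refl ring_one
  | succ n ih => rw [pow_succ, pow_succ]; exact ih.mul h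
-- From `x⁻¹ - y⁻¹ = -(x - y) x⁻¹ y⁻¹`, inversion loses no precision on units. This is why every
-- denominator in a later substitution has to be a unit.
theorem inv (h : Cg ϖ N x y) (hx : x ∈ unitInt F) (hy : y ∈ unitInt F) :
    Cg ϖ N x⁻¹ y⁻¹ := by
  obtain ⟨-, -, t, ht, e⟩ := h
  have hx' := unit_inv hx
  have hy' := unit_inv hy
  refine ⟨unit_ring hx', unit_ring hy', -(t * x⁻¹ * y⁻¹),
    ring_neg (ring_mul (ring_mul ht (unit_ring hx')) (unit_ring hy')), ?_⟩
  have := unit_ne_zero hx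
  have := unit_ne_zero hy
  field_simp
  linear_combination -e
theorem div (h : Cg ϖ N x y) (h' : Cg ϖ N x' y') (hx : x' ∈ unitInt F) (hy : y' ∈ unitInt F) :
    Cg ϖ N (x / x') (y / y') := by
  rw [div_eq_mul_inv, div_eq_mul_inv]; exact h.mul (h'.inv hx hy)
theorem varpi (hϖ : IsUniformizer ϖ) : Cg ϖ N (ϖ : F) ϖ := refl hϖ.mem_ringInt
theorem one : Cg ϖ N (1 : F) 1 := refl ring_one
theorem mono {M : ℕ} (hϖ : IsUniformizer ϖ) (hMN : M ≤ N) (h : Cg ϖ N x y) : Cg ϖ M x y := by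
  obtain ⟨hx, hy, t, ht, e⟩ := h
  refine ⟨hx, hy, ϖ ^ (N - M) * t, ring_mul (ring_pow hϖ.mem_ringInt _) ht, ?_⟩
  rw [e, ← mul_assoc, ← pow_add, Nat.add_sub_cancel' hMN]
theorem sub_mem (hϖ : IsUniformizer ϖ) (h : Cg ϖ 1 x y) : x - y ∈ maxIdeal F := by
  obtain ⟨-, -, t, ht, e⟩ := h
  rw [e, pow_one]
  exact hϖ.mul_mem_maxIdeal ht
theorem unit (hϖ : IsUniformizer ϖ) (h : Cg ϖ 1 x y) (hx : x ∈ unitInt F) : y ∈ unitInt F :=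
  unit_congr (h.sub_mem hϖ) hx
theorem max (hϖ : IsUniformizer ϖ) (h : Cg ϖ 1 x y) (hx : x ∈ maxIdeal F) : y ∈ maxIdeal F :=
  max_congr (h.sub_mem hϖ) hx
theorem right (h : Cg ϖ N x y) : y ∈ ringInt F := h.2.1
theorem left (h : Cg ϖ N x y) : x ∈ ringInt F := h.1

end Cg

end Integers

/-! ### Representatives of `𝔬/𝔭ᴺ` -/

section Representatives

variable {F : Type*} [Field F] [ValuativeRel F] [TopologicalSpace F]
  [IsNonarchimedeanLocalField F] {ϖ : Fˣ}

theorem IsUniformizer.mk_eq_mk_iff (hϖ : IsUniformizer ϖ) (N : ℕ) (x y : 𝒪[F]) :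
    Ideal.Quotient.mk (𝓂[F] ^ N) x = Ideal.Quotient.mk (𝓂[F] ^ N) y ↔ Cg ϖ N (x : F) y := by
  obtain ⟨w, hw, hm⟩ := hϖ
  rw [Ideal.Quotient.mk_eq_mk_iff_sub_mem, hm, Ideal.span_singleton_pow,
    Ideal.mem_span_singleton, Cg, ← hw]
  constructor
  · rintro ⟨t, ht⟩
    exact ⟨x.2, y.2, t, t.2, congrArg Subtype.val ht⟩
  · rintro ⟨-, -, t, ht, e⟩
    exact ⟨⟨t, ht⟩, Subtype.ext e⟩

theorem card_quotient_pow (N : ℕ) : Nat.card (𝒪[F] ⧸ 𝓂[F] ^ N) = Nat.card 𝓀[F] ^ N := by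
  have := cardQuot_pow_of_prime (S := 𝒪[F]) (P := 𝓂[F]) (i := N)
    (IsDiscreteValuationRing.not_a_field 𝒪[F])
  rw [Submodule.cardQuot_apply, Submodule.cardQuot_apply] at this
  exact this

theorem exists_reps (hϖ : IsUniformizer ϖ) (N : ℕ) : ∃ s : Finset F,
    (∀ r ∈ s, r ∈ ringInt F) ∧ (∀ x ∈ ringInt F, ∃ r ∈ s, Cg ϖ N x r) ∧
    (∀ r ∈ s, ∀ r' ∈ s, Cg ϖ N r r' → r = r') ∧ s.card = Nat.card 𝓀[F] ^ N := by
  classical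
  have hfin : Finite (𝒪[F] ⧸ 𝓂[F] ^ N) := Nat.finite_of_card_ne_zero (by
    rw [card_quotient_pow]; exact pow_ne_zero _ Nat.card_pos.ne')
  have := Fintype.ofFinite (𝒪[F] ⧸ 𝓂[F] ^ N)
  have hout (c : 𝒪[F] ⧸ 𝓂[F] ^ N) : Ideal.Quotient.mk (𝓂[F] ^ N) c.out = c := Quotient.out_eq c
  have hinj : Function.Injective fun c : 𝒪[F] ⧸ 𝓂[F] ^ N => ((c.out : 𝒪[F]) : F) := by
    intro c d h
    rw [← hout c, ← hout d, Subtype.ext h]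
  refine ⟨Finset.univ.image fun c : 𝒪[F] ⧸ 𝓂[F] ^ N => ((c.out : 𝒪[F]) : F), ?_, ?_, ?_, ?_⟩
  · simp only [Finset.mem_image, Finset.mem_univ, true_and]
    rintro r ⟨c, rfl⟩
    exact c.out.2
  · intro x hx
    refine ⟨_, Finset.mem_image_of_mem _ (Finset.mem_univ
      (Ideal.Quotient.mk (𝓂[F] ^ N) ⟨x, hx⟩)), ?_⟩
    exact (hϖ.mk_eq_mk_iff N ⟨x, hx⟩ _).1 (hout _).symm
  · simp only [Finset.mem_image, Finset.mem_univ, true_and]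
    rintro r ⟨c, rfl⟩ r' ⟨d, rfl⟩ h
    have := (hϖ.mk_eq_mk_iff N _ _).2 h
    rw [hout, hout] at this
    rw [this]
  · rw [Finset.card_image_of_injective _ hinj, Finset.card_univ, ← Nat.card_eq_fintype_card,
      card_quotient_pow]

/-- A set of representatives of `𝔬/𝔭ᴺ`. -/
def reps (hϖ : IsUniformizer ϖ) (N : ℕ) : Finset F := (exists_reps hϖ N).choose

variable (hϖ : IsUniformizer ϖ) {N : ℕ}

theorem reps_ring {r : F} (hr : r ∈ reps hϖ N) : r ∈ ringInt F :=
  (exists_reps hϖ N).choose_spec.1 r hr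

theorem reps_inj {r r' : F} (hr : r ∈ reps hϖ N) (hr' : r' ∈ reps hϖ N) (h : Cg ϖ N r r') :
    r = r' :=
  (exists_reps hϖ N).choose_spec.2.2.1 r hr r' hr' h

theorem card_reps : (reps hϖ N).card = Nat.card 𝓀[F] ^ N :=
  (exists_reps hϖ N).choose_spec.2.2.2

open Classical in
/-- The representative of an integral element. -/
def repOf (hϖ : IsUniformizer ϖ) (N : ℕ) (x : F) : F :=
  if hx : x ∈ ringInt F then ((exists_reps hϖ N).choose_spec.2.1 x hx).choose else 0

theorem repOf_mem {x : F} (hx : x ∈ ringInt F) : repOf hϖ N x ∈ reps hϖ N := by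
  rw [repOf, dif_pos hx]
  exact ((exists_reps hϖ N).choose_spec.2.1 x hx).choose_spec.1

theorem cg_repOf {x : F} (hx : x ∈ ringInt F) : Cg ϖ N x (repOf hϖ N x) := by
  rw [repOf, dif_pos hx]
  exact ((exists_reps hϖ N).choose_spec.2.1 x hx).choose_spec.2

theorem resCard_ne_zero : resCard F ≠ 0 := by
  rw [resCard, Nat.cast_ne_zero]
  exact Nat.card_pos.ne'

/-- Summation over the multiples of `ϖ` among the representatives. -/
theorem sum_reps_varpi_mul {V : Type*} [AddCommGroup V] [Module ℂ V] (hN : 1 ≤ N) (h : F → V)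
    (hinv : ∀ x y, Cg ϖ N x y → h x = h y)
    (hsupp : ∀ x ∈ unitInt F, h x = 0) :
    ∑ x ∈ reps hϖ N, h x = (resCard F)⁻¹ • ∑ x ∈ reps hϖ N, h (ϖ * x) := by
  classical
  obtain ⟨M, rfl⟩ : ∃ M, N = M + 1 := ⟨N - 1, by omega⟩
  set R := reps hϖ (M + 1)
  have hϖR := hϖ.mem_ringInt
  have hmaps : ∀ x ∈ R, repOf hϖ (M + 1) (ϖ * x) ∈ R.filter (· ∈ maxIdeal F) := by
    intro x hx
    have hx' := reps_ring hϖ hx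
    rw [Finset.mem_filter]
    refine ⟨repOf_mem hϖ (ring_mul hϖR hx'), ?_⟩
    exact ((cg_repOf hϖ (ring_mul hϖR hx')).mono hϖ (by omega)).max hϖ (hϖ.mul_mem_maxIdeal hx')
  have hL : ∑ x ∈ R, h x = ∑ x ∈ R.filter (· ∈ maxIdeal F), h x := by
    rw [Finset.sum_filter]
    refine Finset.sum_congr rfl fun x hx => ?_
    rcases ring_cases (reps_ring hϖ hx) with hu | hm
    · rw [hsupp x hu]; simp
    · rw [if_pos hm]
  have hR : ∑ x ∈ R, h (ϖ * x) = ∑ x ∈ R.filter (· ∈ maxIdeal F),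
      ∑ y ∈ R.filter (fun y => repOf hϖ (M + 1) (ϖ * y) = x), h x := by
    rw [← Finset.sum_fiberwise_of_maps_to hmaps]
    refine Finset.sum_congr rfl fun x _ => Finset.sum_congr rfl fun y hy => ?_
    rw [Finset.mem_filter] at hy
    rw [← hy.2]
    exact hinv _ _ (cg_repOf hϖ (ring_mul hϖR (reps_ring hϖ hy.1)))
  -- Multiplication by `ϖ` on `𝔬/𝔭^(M+1)` has kernel `𝔭^M/𝔭^(M+1)`. Hence a class `ϖ x₀` has exactly
  -- `q` preimages, namely `x₀ + ϖ^M s` with `s` modulo `𝔭`.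
  have hcard : ∀ x ∈ R.filter (· ∈ maxIdeal F),
      (R.filter (fun y => repOf hϖ (M + 1) (ϖ * y) = x)).card = Nat.card 𝓀[F] := by
    intro x hx
    rw [Finset.mem_filter] at hx
    obtain ⟨x₀, hx₀, hxx⟩ := hϖ.mem_maxIdeal_iff.1 hx.2
    have hcard1 := card_reps hϖ (N := 1)
    rw [pow_one] at hcard1
    rw [← hcard1]
    symm
    have hring : ∀ s ∈ reps hϖ 1, x₀ + ϖ ^ M * s ∈ ringInt F := fun s hs =>
      ring_add hx₀ (ring_mul (ring_pow hϖR _) (reps_ring hϖ hs))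
    refine Finset.card_bij (fun s _ => repOf hϖ (M + 1) (x₀ + ϖ ^ M * s)) ?_ ?_ ?_
    · intro s hs
      rw [Finset.mem_filter]
      refine ⟨repOf_mem hϖ (hring s hs), ?_⟩
      refine reps_inj hϖ (repOf_mem hϖ (ring_mul hϖR (reps_ring hϖ (repOf_mem hϖ (hring s hs)))))
        hx.1 ?_
      refine (cg_repOf hϖ (ring_mul hϖR (reps_ring hϖ
        (repOf_mem hϖ (hring s hs))))).symm.trans ?_
      refine ((Cg.varpi hϖ).mul (cg_repOf hϖ (hring s hs)).symm).trans ?_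
      refine ⟨ring_mul hϖR (hring s hs), reps_ring hϖ hx.1, s, reps_ring hϖ hs, ?_⟩
      rw [hxx]; ring
    · intro s hs s' hs' heq
      have h1 := (cg_repOf hϖ (N := M + 1) (hring s hs))
      rw [heq] at h1
      obtain ⟨-, -, t, ht, e⟩ := h1.trans (cg_repOf hϖ (N := M + 1) (hring s' hs')).symm
      refine reps_inj hϖ hs hs' ⟨reps_ring hϖ hs, reps_ring hϖ hs', t, ht, ?_⟩
      have hne : (ϖ : F) ^ M ≠ 0 := pow_ne_zero _ ϖ.ne_zero
      apply mul_left_cancel₀ hne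
      rw [pow_succ] at e
      linear_combination e
    · intro y hy
      rw [Finset.mem_filter] at hy
      have hy' := reps_ring hϖ hy.1
      have h1 := cg_repOf hϖ (N := M + 1) (ring_mul hϖR hy')
      rw [hy.2, hxx] at h1
      obtain ⟨-, -, t, ht, e⟩ := h1
      have e' : y - x₀ = ϖ ^ M * t := by
        apply mul_left_cancel₀ ϖ.ne_zero
        rw [pow_succ] at e
        linear_combination e
      refine ⟨repOf hϖ 1 t, repOf_mem hϖ ht, ?_⟩
      have hs := repOf_mem hϖ (N := 1) ht
      refine reps_inj hϖ (repOf_mem hϖ (hring _ hs)) hy.1 ?_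
      refine (cg_repOf hϖ (hring _ hs)).symm.trans ?_
      obtain ⟨-, -, u, hu, e2⟩ := cg_repOf hϖ (N := 1) ht
      refine ⟨hring _ hs, hy', -u, ring_neg hu, ?_⟩
      rw [pow_succ]
      rw [pow_one] at e2
      linear_combination -e' - ϖ ^ M * e2
  rw [hL, hR, Finset.smul_sum]
  refine Finset.sum_congr rfl fun x hx => ?_
  rw [Finset.sum_const, hcard x hx, ← Nat.cast_smul_eq_nsmul ℂ, smul_smul]
  rw [show ((Nat.card 𝓀[F] : ℕ) : ℂ) = resCard F from rfl, inv_mul_cancel₀ resCard_ne_zero,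
    one_smul]

end Representatives

/-! ### Integrals as finite sums -/

section Integral

variable {F : Type*} [Field F] [ValuativeRel F] {V : Type*} [AddCommGroup V] [Module ℂ V]

theorem integ_congr {F : Type*} [MeasurableSpace F] (μ : MeasureTheory.Measure F) {S : Set F} {f g :
    F → V}
    (h : ∀ x ∈ S, f x = g x) : integ μ S f = integ μ S g := by
  unfold integ
  congr 1
  ext w
  congr 3
  ext x
  simp only [Set.mem_inter_iff, Set.mem_preimage, Set.mem_singleton_iff]
  exact and_congr_right fun hx => by rw [h x hx]

/-- Subsets of `𝔬` that are stable under translation by `𝔭`. -/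
def AdmF (ϖ : Fˣ) (S : Set F) : Prop := S ⊆ ringInt F ∧ ∀ x ∈ S, ∀ y, Cg ϖ 1 x y → y ∈ S

theorem admF_ringInt {ϖ : Fˣ} : AdmF ϖ (ringInt F) := ⟨subset_rfl, fun _ _ _ h => h.right⟩
theorem admF_unitInt {ϖ : Fˣ} (hϖ : IsUniformizer ϖ) : AdmF ϖ (unitInt F) :=
  ⟨fun _ => unit_ring, fun _ hx _ h => h.unit hϖ hx⟩
theorem admF_maxIdeal {ϖ : Fˣ} (hϖ : IsUniformizer ϖ) : AdmF ϖ (maxIdeal F) :=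
  ⟨fun _ => max_ring, fun _ hx _ h => h.max hϖ hx⟩
theorem admF_punctured {ϖ : Fˣ} (hϖ : IsUniformizer ϖ) : AdmF ϖ (unitInt F \ oneUnits F) := by
  refine ⟨fun _ hx => unit_ring hx.1, fun x hx y h => ?_⟩
  rw [mem_punctured_iff] at hx ⊢
  exact ⟨h.unit hϖ hx.1, (Cg.one.sub h).unit hϖ hx.2⟩

variable [TopologicalSpace F] [IsNonarchimedeanLocalField F] {ϖ : Fˣ}

/-- Around each of its points a class modulo `𝔭ᴺ` contains the ball of radius `|ϖᴺ|`. -/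
theorem isOpen_cg (hϖ : IsUniformizer ϖ) (N : ℕ) (r : F) :
    IsOpen {x | Cg ϖ N r x} := by
  rw [isOpen_iff_mem_nhds]
  intro x hx
  have h0 : ValuativeRel.valuation F ((ϖ : F) ^ N) ≠ 0 := by simp
  refine (IsValuativeTopology.hasBasis_nhds' x).mem_iff.2 ⟨_, h0, fun y hy => ?_⟩
  have hy' : ValuativeRel.valuation F (y - x) < ValuativeRel.valuation F ((ϖ : F) ^ N) := hy
  have hne : (ϖ : F) ^ N ≠ 0 := pow_ne_zero _ ϖ.ne_zero
  have ht : (y - x) / ϖ ^ N ∈ ringInt F := by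
    rw [mem_ringInt_iff, map_div₀]
    exact div_le_one_of_le₀ hy'.le zero_le
  have hyx : y - x = ϖ ^ N * ((y - x) / ϖ ^ N) := by field_simp
  have hyr : y ∈ ringInt F := by
    have : y = x + ϖ ^ N * ((y - x) / ϖ ^ N) := by rw [← hyx]; ring
    rw [this]
    exact ring_add hx.right (ring_mul (ring_pow hϖ.mem_ringInt _) ht)
  exact Cg.trans hx (Cg.symm ⟨hyr, hx.right, _, ht, hyx⟩)

variable [MeasurableSpace F] [BorelSpace F] (μ : MeasureTheory.Measure F) [μ.IsAddHaarMeasure]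

/-- The set `𝔬` has volume 1 and is the disjoint union of `qᴺ` classes, all translates of `𝔭ᴺ` and
so of equal volume. -/
theorem measure_cg (hϖ : IsUniformizer ϖ) (hμ : μ (ringInt F) = 1) (N : ℕ) {r : F}
    (hr : r ∈ ringInt F) : μ {x | Cg ϖ N r x} = ((Nat.card 𝓀[F] : ENNReal) ^ N)⁻¹ := by
  have htrans : ∀ r ∈ ringInt F, μ {x | Cg ϖ N r x} = μ {x | Cg ϖ N 0 x} := by
    intro r hr
    have : {x | Cg ϖ N 0 x} = (fun x => r + x) ⁻¹' {x | Cg ϖ N r x} := by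
      ext x
      simp only [Set.mem_preimage, Set.mem_ofPred_eq]
      constructor
      · intro h
        have := (Cg.refl (ϖ := ϖ) (N := N) hr).add h
        rwa [add_zero] at this
      · intro h
        have := h.sub (Cg.refl (ϖ := ϖ) (N := N) hr)
        rwa [sub_self, add_sub_cancel_left] at this
    rw [this, MeasureTheory.measure_preimage_add]
  have hunion : ringInt F = ⋃ s ∈ reps hϖ N, {x | Cg ϖ N s x} := by
    ext x
    simp only [Set.mem_iUnion, Set.mem_ofPred_eq, exists_prop]
    exact ⟨fun hx => ⟨_, repOf_mem hϖ hx, (cg_repOf hϖ hx).symm⟩, fun ⟨_, _, h⟩ => h.right⟩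
  have hsum : μ (ringInt F) = ∑ s ∈ reps hϖ N, μ {x | Cg ϖ N s x} := by
    rw [hunion]
    refine MeasureTheory.measure_biUnion_finset ?_ fun s _ =>
      (isOpen_cg hϖ N s).measurableSet
    intro s hs s' hs' hne
    refine Set.disjoint_left.2 fun x hx hx' => hne ?_
    exact reps_inj hϖ hs hs' (Cg.trans hx (Cg.symm hx'))
  rw [hμ, Finset.sum_congr rfl fun s hs => htrans s (reps_ring hϖ hs), Finset.sum_const,
    card_reps, nsmul_eq_mul, Nat.cast_pow] at hsum
  rw [htrans r hr]
  exact ENNReal.eq_inv_of_mul_eq_one_left (by rw [mul_comm]; exact hsum.symm)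

open Classical in
-- By definition `integ` groups points by the value of `f`. Each level set in `S` is a disjoint
-- union of whole classes modulo `𝔭ᴺ`, of volume `q⁻ᴺ` each: stability of `S` under `𝔭` puts a point
-- and its representative in `S` together. Regrouping the representatives by value gives the sum.
theorem integ_eq_sum (hϖ : IsUniformizer ϖ) (hμ : μ (ringInt F) = 1) {N : ℕ} (hN : 1 ≤ N)
    {S : Set F} (hS : AdmF ϖ S) (f : F → V)
    (hf : ∀ x ∈ S, ∀ y ∈ S, Cg ϖ N x y → f x = f y) :
    integ μ S f = (resCard F ^ N)⁻¹ • ∑ r ∈ (reps hϖ N).filter (· ∈ S), f r := by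
  set R := (reps hϖ N).filter (· ∈ S) with hR
  have hvol : ∀ w : V, ((μ.real (S ∩ f ⁻¹' {w}) : ℝ) : ℂ)
      = (resCard F ^ N)⁻¹ * ((R.filter (fun r => f r = w)).card : ℂ) := by
    intro w
    have hunion : S ∩ f ⁻¹' {w} = ⋃ s ∈ R.filter (fun r => f r = w), {x | Cg ϖ N s x} := by
      ext x
      simp only [Set.mem_iUnion, Set.mem_ofPred_eq, exists_prop, Set.mem_inter_iff,
        Set.mem_preimage, Set.mem_singleton_iff, Finset.mem_filter, hR]
      constructor
      · rintro ⟨hx, hw⟩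
        have hxr := hS.1 hx
        have hc := cg_repOf hϖ (N := N) hxr
        have hmem := hS.2 x hx _ (hc.mono hϖ hN)
        exact ⟨_, ⟨⟨repOf_mem hϖ hxr, hmem⟩, by rw [← hf x hx _ hmem hc, hw]⟩, hc.symm⟩
      · rintro ⟨s, ⟨⟨hs, hsS⟩, hsw⟩, hc⟩
        have hx := hS.2 s hsS x (hc.mono hϖ hN)
        exact ⟨hx, by rw [← hf s hsS x hx hc, hsw]⟩
    have hmeas : μ (S ∩ f ⁻¹' {w}) = ((R.filter (fun r => f r = w)).card : ENNReal) *
        ((Nat.card 𝓀[F] : ENNReal) ^ N)⁻¹ := by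
      rw [hunion, MeasureTheory.measure_biUnion_finset, Finset.sum_congr rfl fun s hs =>
        measure_cg μ hϖ hμ N (hS.1 (Finset.mem_filter.1 (Finset.mem_filter.1 hs).1).2),
        Finset.sum_const, nsmul_eq_mul]
      · intro s hs s' hs' hne
        refine Set.disjoint_left.2 fun x hx hx' => hne ?_
        exact reps_inj hϖ (Finset.mem_filter.1 (Finset.mem_filter.1 hs).1).1
          (Finset.mem_filter.1 (Finset.mem_filter.1 hs').1).1 (Cg.trans hx (Cg.symm hx'))
      · exact fun s _ => (isOpen_cg hϖ N s).measurableSet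
    rw [MeasureTheory.measureReal_def, hmeas, ENNReal.toReal_mul, ENNReal.toReal_inv,
      ENNReal.toReal_pow, ENNReal.toReal_natCast, ENNReal.toReal_natCast, resCard]
    push_cast
    ring
  unfold integ
  rw [finsum_eq_sum_of_support_subset (s := R.image f)]
  · rw [Finset.smul_sum, ← Finset.sum_fiberwise_of_maps_to
      (fun r hr => Finset.mem_image_of_mem f hr)]
    refine Finset.sum_congr rfl fun w _ => ?_
    rw [hvol, Finset.sum_congr rfl (g := fun _ => (resCard F ^ N)⁻¹ • w) fun r hr => by
      rw [(Finset.mem_filter.1 hr).2], Finset.sum_const, ← Nat.cast_smul_eq_nsmul ℂ, smul_smul,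
      mul_comm]
  · intro w hw
    rw [Function.mem_support, hvol] at hw
    rw [Finset.mem_coe, Finset.mem_image]
    by_contra hne
    push Not at hne
    apply hw
    rw [Finset.filter_eq_empty_iff.2 fun r hr => hne r hr]
    simp

end Integral

/-! ### Normalized sums over subsets of `𝔬⁴` -/

/-- Componentwise congruence modulo `𝔭ᴺ`. -/
def Cg4 {F : Type*} [Field F] [ValuativeRel F] (ϖ : Fˣ) (N : ℕ) (p p' : F × F × F × F) : Prop :=
  Cg ϖ N p.1 p'.1 ∧ Cg ϖ N p.2.1 p'.2.1 ∧ Cg ϖ N p.2.2.1 p'.2.2.1 ∧ Cg ϖ N p.2.2.2 p'.2.2.2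

section Adm

variable {F : Type*} [Field F] [ValuativeRel F] {ϖ : Fˣ} {V : Type*}

theorem Cg4.symm {N : ℕ} {p p' : F × F × F × F} (h : Cg4 ϖ N p p') : Cg4 ϖ N p' p :=
  ⟨h.1.symm, h.2.1.symm, h.2.2.1.symm, h.2.2.2.symm⟩

theorem Cg4.trans {N : ℕ} {p p' p'' : F × F × F × F} (h : Cg4 ϖ N p p') (h' : Cg4 ϖ N p' p'') :
    Cg4 ϖ N p p'' :=
  ⟨h.1.trans h'.1, h.2.1.trans h'.2.1, h.2.2.1.trans h'.2.2.1, h.2.2.2.trans h'.2.2.2⟩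

theorem Cg4.mono {M N : ℕ} {p p' : F × F × F × F} (hϖ : IsUniformizer ϖ) (hMN : M ≤ N)
    (h : Cg4 ϖ N p p') : Cg4 ϖ M p p' :=
  ⟨h.1.mono hϖ hMN, h.2.1.mono hϖ hMN, h.2.2.1.mono hϖ hMN, h.2.2.2.mono hϖ hMN⟩

/-- Subsets of `𝔬⁴` that are stable under translation by `𝔭⁴`. -/
def Adm (ϖ : Fˣ) (S : Set (F × F × F × F)) : Prop :=
  (∀ p ∈ S, Cg4 ϖ 0 p p) ∧ ∀ p ∈ S, ∀ p', Cg4 ϖ 1 p p' → p' ∈ S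

/-- Functions that are invariant modulo `𝔭ᴺ` on `S`. -/
def InvOn (ϖ : Fˣ) (N : ℕ) (S : Set (F × F × F × F)) (f : F × F × F × F → V) : Prop :=
  ∀ p ∈ S, ∀ p' ∈ S, Cg4 ϖ N p p' → f p = f p'

/-- Functions that preserve all congruences on `S`. -/
def NonExp (ϖ : Fˣ) (S : Set (F × F × F × F)) (e : F × F × F × F → F) : Prop :=
  ∀ N, ∀ p ∈ S, ∀ p' ∈ S, Cg4 ϖ N p p' → Cg ϖ N (e p) (e p')

/-- Maps that preserve all congruences on `S`. -/
def NonExp4 (ϖ : Fˣ) (S : Set (F × F × F × F)) (σ : F × F × F × F → F × F × F × F) : Prop :=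
  ∀ N, ∀ p ∈ S, ∀ p' ∈ S, Cg4 ϖ N p p' → Cg4 ϖ N (σ p) (σ p')

theorem Adm.refl {S : Set (F × F × F × F)} (hS : Adm ϖ S) {p : F × F × F × F} (hp : p ∈ S)
    (N : ℕ) : Cg4 ϖ N p p :=
  have h := hS.1 p hp
  ⟨.refl h.1.left, .refl h.2.1.left, .refl h.2.2.1.left, .refl h.2.2.2.left⟩

theorem adm_prod {S₁ S₂ S₃ S₄ : Set F} (h₁ : AdmF ϖ S₁) (h₂ : AdmF ϖ S₂) (h₃ : AdmF ϖ S₃)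
    (h₄ : AdmF ϖ S₄) : Adm ϖ (S₁ ×ˢ S₂ ×ˢ S₃ ×ˢ S₄) := by
  constructor
  · rintro ⟨a, b, c, d⟩ ⟨ha, hb, hc, hd⟩
    exact ⟨.refl (h₁.1 ha), .refl (h₂.1 hb), .refl (h₃.1 hc), .refl (h₄.1 hd)⟩
  · rintro ⟨a, b, c, d⟩ ⟨ha, hb, hc, hd⟩ ⟨a', b', c', d'⟩ ⟨ka, kb, kc, kd⟩
    exact ⟨h₁.2 _ ha _ ka, h₂.2 _ hb _ kb, h₃.2 _ hc _ kc, h₄.2 _ hd _ kd⟩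

/-- A function that preserves congruences sends points congruent modulo `𝔭` to values congruent
modulo `𝔭`, so a condition on those values that only depends on the class modulo `𝔭` cuts out
another stable set. All case distinctions of the proof have this shape. -/
theorem Adm.sep {S : Set (F × F × F × F)} (hS : Adm ϖ S) {e : F × F × F × F → F}
    (he : NonExp ϖ S e) {T : Set F} (hT : AdmF ϖ T) : Adm ϖ {p ∈ S | e p ∈ T} := by
  refine ⟨fun p hp => hS.1 p hp.1, fun p hp p' h => ?_⟩
  have hp' := hS.2 p hp.1 p' h
  exact ⟨hp', hT.2 _ hp.2 _ (he 1 p hp.1 p' hp' h)⟩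

theorem InvOn.mono {S T : Set (F × F × F × F)} {N : ℕ} {f : F × F × F × F → V}
    (hf : InvOn ϖ N S f) (h : T ⊆ S) : InvOn ϖ N T f :=
  fun p hp p' hp' => hf p (h hp) p' (h hp')

end Adm

/-! ### The domains of summation

The letters `O`, `U`, `M`, `P` stand for `𝔬`, `𝔬ˣ`, `𝔭` and `𝔬ˣ \ (1 + 𝔭)`. -/

section Boxes

variable (F : Type*) [Field F] [ValuativeRel F]

abbrev boxOOUU : Set (F × F × F × F) :=
  ringInt F ×ˢ ringInt F ×ˢ unitInt F ×ˢ unitInt F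
abbrev boxOUUU : Set (F × F × F × F) :=
  ringInt F ×ˢ unitInt F ×ˢ unitInt F ×ˢ unitInt F
abbrev boxMUUU : Set (F × F × F × F) :=
  maxIdeal F ×ˢ unitInt F ×ˢ unitInt F ×ˢ unitInt F
abbrev boxMOUU : Set (F × F × F × F) :=
  maxIdeal F ×ˢ ringInt F ×ˢ unitInt F ×ˢ unitInt F
abbrev boxPUUP : Set (F × F × F × F) :=
  (unitInt F \ oneUnits F) ×ˢ unitInt F ×ˢ unitInt F ×ˢ (unitInt F \ oneUnits F)
abbrev boxOMUU : Set (F × F × F × F) :=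
  ringInt F ×ˢ maxIdeal F ×ˢ unitInt F ×ˢ unitInt F
abbrev boxOPUU : Set (F × F × F × F) :=
  ringInt F ×ˢ (unitInt F \ oneUnits F) ×ˢ unitInt F ×ˢ unitInt F
abbrev boxPOUU : Set (F × F × F × F) :=
  (unitInt F \ oneUnits F) ×ˢ ringInt F ×ˢ unitInt F ×ˢ unitInt F
abbrev boxMMUU : Set (F × F × F × F) :=
  maxIdeal F ×ˢ maxIdeal F ×ˢ unitInt F ×ˢ unitInt F
abbrev boxOUUO : Set (F × F × F × F) :=
  ringInt F ×ˢ unitInt F ×ˢ unitInt F ×ˢ ringInt F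
abbrev boxMPUU : Set (F × F × F × F) :=
  maxIdeal F ×ˢ (unitInt F \ oneUnits F) ×ˢ unitInt F ×ˢ unitInt F

end Boxes

section BoxesAdm

variable {F : Type*} [Field F] [ValuativeRel F] {ϖ : Fˣ}

theorem adm_boxOOUU (hϖ : IsUniformizer ϖ) : Adm ϖ (boxOOUU F) :=
  adm_prod admF_ringInt admF_ringInt (admF_unitInt hϖ) (admF_unitInt hϖ)
theorem adm_boxOUUU (hϖ : IsUniformizer ϖ) : Adm ϖ (boxOUUU F) :=
  adm_prod admF_ringInt (admF_unitInt hϖ) (admF_unitInt hϖ) (admF_unitInt hϖ)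
theorem adm_boxMUUU (hϖ : IsUniformizer ϖ) : Adm ϖ (boxMUUU F) :=
  adm_prod (admF_maxIdeal hϖ) (admF_unitInt hϖ) (admF_unitInt hϖ) (admF_unitInt hϖ)
theorem adm_boxMOUU (hϖ : IsUniformizer ϖ) : Adm ϖ (boxMOUU F) :=
  adm_prod (admF_maxIdeal hϖ) admF_ringInt (admF_unitInt hϖ) (admF_unitInt hϖ)
theorem adm_boxPUUP (hϖ : IsUniformizer ϖ) : Adm ϖ (boxPUUP F) :=
  adm_prod (admF_punctured hϖ) (admF_unitInt hϖ) (admF_unitInt hϖ) (admF_punctured hϖ)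
theorem adm_boxOMUU (hϖ : IsUniformizer ϖ) : Adm ϖ (boxOMUU F) :=
  adm_prod admF_ringInt (admF_maxIdeal hϖ) (admF_unitInt hϖ) (admF_unitInt hϖ)
theorem adm_boxOPUU (hϖ : IsUniformizer ϖ) : Adm ϖ (boxOPUU F) :=
  adm_prod admF_ringInt (admF_punctured hϖ) (admF_unitInt hϖ) (admF_unitInt hϖ)
theorem adm_boxPOUU (hϖ : IsUniformizer ϖ) : Adm ϖ (boxPOUU F) :=
  adm_prod (admF_punctured hϖ) admF_ringInt (admF_unitInt hϖ) (admF_unitInt hϖ)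
theorem adm_boxMMUU (hϖ : IsUniformizer ϖ) : Adm ϖ (boxMMUU F) :=
  adm_prod (admF_maxIdeal hϖ) (admF_maxIdeal hϖ) (admF_unitInt hϖ) (admF_unitInt hϖ)
theorem adm_boxOUUO (hϖ : IsUniformizer ϖ) : Adm ϖ (boxOUUO F) :=
  adm_prod admF_ringInt (admF_unitInt hϖ) (admF_unitInt hϖ) admF_ringInt
theorem adm_boxMPUU (hϖ : IsUniformizer ϖ) : Adm ϖ (boxMPUU F) :=
  adm_prod (admF_maxIdeal hϖ) (admF_punctured hϖ) (admF_unitInt hϖ) (admF_unitInt hϖ)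

end BoxesAdm

section Avg

variable {F : Type*} [Field F] [ValuativeRel F] [TopologicalSpace F]
  [IsNonarchimedeanLocalField F] {ϖ : Fˣ} (hϖ : IsUniformizer ϖ)
  {V : Type*} [AddCommGroup V] [Module ℂ V] {N : ℕ}

/-- Representatives of `(𝔬/𝔭ᴺ)⁴`. -/
def reps4 (N : ℕ) : Finset (F × F × F × F) :=
  reps hϖ N ×ˢ reps hϖ N ×ˢ reps hϖ N ×ˢ reps hϖ N

open Classical in
/-- The sum of `f` over the elements of `S` modulo `𝔭ᴺ`, normalized by the volume of `𝔭ᴺ`. -/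
def avg (N : ℕ) (S : Set (F × F × F × F)) (f : F × F × F × F → V) : V :=
  ((resCard F ^ N)⁻¹) ^ 4 • ∑ p ∈ (reps4 hϖ N).filter (· ∈ S), f p

/-- Freedom in the choice of the decision procedure for membership lets sums over differently
described sets be compared. -/
theorem avg_def (S : Set (F × F × F × F)) [DecidablePred (· ∈ S)] (f : F × F × F × F → V) :
    avg hϖ N S f = ((resCard F ^ N)⁻¹) ^ 4 • ∑ p ∈ (reps4 hϖ N).filter (· ∈ S), f p := by
  unfold avg
  congr!

theorem mem_reps4 {p : F × F × F × F} : p ∈ reps4 hϖ N ↔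
    p.1 ∈ reps hϖ N ∧ p.2.1 ∈ reps hϖ N ∧ p.2.2.1 ∈ reps hϖ N ∧ p.2.2.2 ∈ reps hϖ N := by
  simp only [reps4, Finset.mem_product]

/-- The representative of a quadruple of integral elements. -/
def repOf4 (N : ℕ) (p : F × F × F × F) : F × F × F × F :=
  (repOf hϖ N p.1, repOf hϖ N p.2.1, repOf hϖ N p.2.2.1, repOf hϖ N p.2.2.2)

theorem cg_repOf4 {p : F × F × F × F} (h : Cg4 ϖ 0 p p) : Cg4 ϖ N p (repOf4 hϖ N p) :=
  ⟨cg_repOf hϖ h.1.left, cg_repOf hϖ h.2.1.left, cg_repOf hϖ h.2.2.1.left,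
    cg_repOf hϖ h.2.2.2.left⟩

theorem repOf4_mem {p : F × F × F × F} (h : Cg4 ϖ 0 p p) : repOf4 hϖ N p ∈ reps4 hϖ N :=
  (mem_reps4 hϖ).2 ⟨repOf_mem hϖ h.1.left, repOf_mem hϖ h.2.1.left, repOf_mem hϖ h.2.2.1.left,
    repOf_mem hϖ h.2.2.2.left⟩

theorem reps4_inj {p p' : F × F × F × F} (hp : p ∈ reps4 hϖ N) (hp' : p' ∈ reps4 hϖ N)
    (h : Cg4 ϖ N p p') : p = p' := by
  rw [mem_reps4] at hp hp'
  exact Prod.ext (reps_inj hϖ hp.1 hp'.1 h.1) (Prod.ext (reps_inj hϖ hp.2.1 hp'.2.1 h.2.1)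
    (Prod.ext (reps_inj hϖ hp.2.2.1 hp'.2.2.1 h.2.2.1)
      (reps_inj hϖ hp.2.2.2 hp'.2.2.2 h.2.2.2)))

theorem avg_congr {S : Set (F × F × F × F)} {f g : F × F × F × F → V}
    (h : ∀ p ∈ S, f p = g p) : avg hϖ N S f = avg hϖ N S g := by
  classical
  rw [avg_def, avg_def]
  rw [Finset.sum_congr rfl fun p hp => h p (Finset.mem_filter.1 hp).2]

theorem avg_map {W : Type*} [AddCommGroup W] [Module ℂ W] (l : V →ₗ[ℂ] W)
    (S : Set (F × F × F × F)) (f : F × F × F × F → V) :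
    l (avg hϖ N S f) = avg hϖ N S fun p => l (f p) := by
  unfold avg
  rw [map_smul, map_sum]

/-- Change of variables. -/
theorem avg_bij (hN : 1 ≤ N) {S T : Set (F × F × F × F)} (hS : Adm ϖ S) (hT : Adm ϖ T)
    {f g : F × F × F × F → V} (hf : InvOn ϖ N T f) (σ τ : F × F × F × F → F × F × F × F)
    (hσ : ∀ p ∈ S, σ p ∈ T ∧ τ (σ p) = p ∧ g p = f (σ p))
    (hτ : ∀ p ∈ T, τ p ∈ S ∧ σ (τ p) = p)
    (nσ : NonExp4 ϖ S σ) (nτ : NonExp4 ϖ T τ) :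
    avg hϖ N S g = avg hϖ N T f := by
  classical
  rw [avg_def, avg_def]
  congr 1
  -- The image of a representative need not be a representative, so it is replaced by the one of its
  -- class, which is still in the target because the target is stable under `𝔭`.
  have key : ∀ {A B : Set (F × F × F × F)}, Adm ϖ A → Adm ϖ B →
      ∀ {α : F × F × F × F → F × F × F × F}, (∀ p ∈ A, α p ∈ B) → ∀ p ∈ A,
      repOf4 hϖ N (α p) ∈ B ∧ repOf4 hϖ N (α p) ∈ reps4 hϖ N ∧
        Cg4 ϖ N (α p) (repOf4 hϖ N (α p)) := by
    intro A B _ hB α h p hp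
    have h0 := hB.1 _ (h p hp)
    exact ⟨hB.2 _ (h p hp) _ ((cg_repOf4 hϖ (N := N) h0).mono hϖ hN), repOf4_mem hϖ h0,
      cg_repOf4 hϖ h0⟩
  have kσ := key hS hT fun p hp => (hσ p hp).1
  have kτ := key hT hS fun p hp => (hτ p hp).1
  refine Finset.sum_bij' (fun p _ => repOf4 hϖ N (σ p)) (fun p _ => repOf4 hϖ N (τ p))
    ?_ ?_ ?_ ?_ ?_
  · intro p hp
    rw [Finset.mem_filter] at hp ⊢
    exact ⟨(kσ p hp.2).2.1, (kσ p hp.2).1⟩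
  · intro p hp
    rw [Finset.mem_filter] at hp ⊢
    exact ⟨(kτ p hp.2).2.1, (kτ p hp.2).1⟩
  · intro p hp
    rw [Finset.mem_filter] at hp
    obtain ⟨h1, -, h3⟩ := kσ p hp.2
    obtain ⟨h1', h2', h3'⟩ := kτ _ h1
    refine reps4_inj hϖ h2' hp.1 (h3'.symm.trans ?_)
    -- Applying `τ` to the congruence between `σ p` and its representative shows that the rounded
    -- maps are still inverse to each other on classes.
    have := nτ N _ h1 _ (hσ p hp.2).1 h3.symm
    rwa [(hσ p hp.2).2.1] at this
  · intro p hp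
    rw [Finset.mem_filter] at hp
    obtain ⟨h1, -, h3⟩ := kτ p hp.2
    obtain ⟨h1', h2', h3'⟩ := kσ _ h1
    refine reps4_inj hϖ h2' hp.1 (h3'.symm.trans ?_)
    have := nσ N _ h1 _ (hτ p hp.2).1 h3.symm
    rwa [(hτ p hp.2).2] at this
  · intro p hp
    rw [Finset.mem_filter] at hp
    rw [(hσ p hp.2).2.2]
    -- Invariance is needed only for the target function: the summand on `S` is evaluated at
    -- representatives and rounding happens in `T`.
    exact hf _ (hσ p hp.2).1 _ (kσ p hp.2).1 (kσ p hp.2).2.2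

theorem avg_split {S : Set (F × F × F × F)} (hS : Adm ϖ S) {e : F × F × F × F → F}
    (he : NonExp ϖ S e) (f : F × F × F × F → V) :
    avg hϖ N S f = avg hϖ N {p ∈ S | e p ∈ unitInt F} f
      + avg hϖ N {p ∈ S | e p ∈ maxIdeal F} f := by
  classical
  rw [avg_def, avg_def, avg_def, ← smul_add, ← Finset.sum_filter_add_sum_filter_not _ (fun p =>
      e p ∈ unitInt F),
    Finset.filter_filter, Finset.filter_filter]
  congr 2
  refine Finset.sum_congr (Finset.filter_congr fun p _ => and_congr_right fun hp => ?_)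
    fun _ _ => rfl
  have hr := (he 0 p hp p hp (hS.refl hp 0)).left
  exact ⟨fun h => (ring_cases hr).resolve_left h, fun h h' => not_max_of_unit h' h⟩

/-- Substitution of `ϖ x` for an integration variable in `𝔭`. -/
theorem avg_scale (hN : 1 ≤ N) {S T : Set (F × F × F × F)} (hS : Adm ϖ S)
    {f : F × F × F × F → V} (hf : InvOn ϖ N S f) (hmax : ∀ p ∈ S, p.1 ∈ maxIdeal F)
    (hT : ∀ p, p ∈ T ↔ ((ϖ : F) * p.1, p.2) ∈ S) :
    avg hϖ N S f = (resCard F)⁻¹ • avg hϖ N T fun p => f ((ϖ : F) * p.1, p.2) := by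
  classical
  rw [avg_def, avg_def, reps4, smul_comm]
  congr 1
  rw [Finset.sum_filter, Finset.sum_filter,
    Finset.sum_product_right (reps hϖ N) (reps hϖ N ×ˢ reps hϖ N ×ˢ reps hϖ N),
    Finset.sum_product_right (reps hϖ N) (reps hϖ N ×ˢ reps hϖ N ×ˢ reps hϖ N), Finset.smul_sum]
  refine Finset.sum_congr rfl fun r hr => ?_
  simp only [Finset.mem_product] at hr
  have h3 : ∀ {x y}, Cg ϖ N x y → Cg4 ϖ N (x, r) (y, r) := fun h =>
    ⟨h, .refl (reps_ring hϖ hr.1), .refl (reps_ring hϖ hr.2.1), .refl (reps_ring hϖ hr.2.2)⟩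
  -- The function is extended by 0 outside `S`. It stays invariant modulo `𝔭ᴺ` because `S` is stable
  -- under `𝔭`, and it vanishes at units because the first coordinate lies in `𝔭` on `S`.
  rw [sum_reps_varpi_mul hϖ hN (fun x => if (x, r) ∈ S then f (x, r) else 0)]
  · simp only [hT]
  · intro x y h
    have h4 := h3 h
    by_cases hx : (x, r) ∈ S
    · have hy := hS.2 _ hx _ (h4.mono hϖ hN)
      rw [if_pos hx, if_pos hy]
      exact hf _ hx _ hy h4
    · rw [if_neg hx, if_neg]
      exact fun hy => hx (hS.2 _ hy _ (h4.symm.mono hϖ hN))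
  · intro x hx
    rw [if_neg]
    exact fun h => not_max_of_unit hx (hmax _ h)

end Avg

/-! ### Iterated integrals as normalized sums -/

section Iterated

variable {F : Type*} [Field F] [ValuativeRel F] [TopologicalSpace F]
  [IsNonarchimedeanLocalField F] [MeasurableSpace F]
  (μ : MeasureTheory.Measure F) {ϖ : Fˣ} (hϖ : IsUniformizer ϖ)
  {V : Type*} [AddCommGroup V] [Module ℂ V] {N : ℕ}

/-- As `𝔬` has volume 1, a term with fewer than four integrals can be given dummy variables in `𝔬`
and put on the same footing as the others. -/
theorem integ_const {F : Type*} [Field F] [ValuativeRel F] [MeasurableSpace F]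
    (μ : MeasureTheory.Measure F) (hμ : μ (ringInt F) = 1) (c : V) : (integ μ (ringInt F) fun _ =>
      c) = c := by
  unfold integ
  rw [finsum_eq_single _ c]
  · simp [MeasureTheory.measureReal_def, hμ]
  · intro w hw
    have : (fun _ : F => c) ⁻¹' {w} = ∅ := by
      ext x
      simpa using hw.symm
    rw [this]
    simp

variable [BorelSpace F] [μ.IsAddHaarMeasure]

/-- The integrals are evaluated from the inside out. After each one the new integrand is again
invariant modulo `𝔭ᴺ` in the outer variables, since the inner sum runs over representatives that do
not depend on them. -/
theorem integ_iterated_eq_avg (hμ : μ (ringInt F) = 1) (hN : 1 ≤ N) {S₁ S₂ S₃ S₄ : Set F}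
    (h₁ : AdmF ϖ S₁) (h₂ : AdmF ϖ S₂) (h₃ : AdmF ϖ S₃) (h₄ : AdmF ϖ S₄)
    {f : F × F × F × F → V} (hf : InvOn ϖ N (S₁ ×ˢ S₂ ×ˢ S₃ ×ˢ S₄) f) :
    (integ μ S₁ fun z => integ μ S₂ fun x => integ μ S₃ fun b => integ μ S₄ fun a =>
      f (z, x, b, a)) = avg hϖ N (S₁ ×ˢ S₂ ×ˢ S₃ ×ˢ S₄) f := by
  classical
  set c := (resCard F ^ N)⁻¹
  set R : Set F → Finset F := fun S => (reps hϖ N).filter (· ∈ S) with hR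
  have hRS : ∀ {S : Set F} {r : F}, r ∈ R S → r ∈ S := fun h => (Finset.mem_filter.1 h).2
  have inv : ∀ {z z' x x' b b' a a' : F}, z ∈ S₁ → z' ∈ S₁ → x ∈ S₂ → x' ∈ S₂ → b ∈ S₃ →
      b' ∈ S₃ → a ∈ S₄ → a' ∈ S₄ → Cg ϖ N z z' → Cg ϖ N x x' → Cg ϖ N b b' → Cg ϖ N a a' →
      f (z, x, b, a) = f (z', x', b', a') :=
    fun hz hz' hx hx' hb hb' ha ha' kz kx kb ka =>
      hf _ ⟨hz, hx, hb, ha⟩ _ ⟨hz', hx', hb', ha'⟩ ⟨kz, kx, kb, ka⟩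
  have rfl' : ∀ {S : Set F}, AdmF ϖ S → ∀ {x}, x ∈ S → Cg ϖ N x x := fun h _ hx => .refl (h.1 hx)
  have e4 : ∀ z ∈ S₁, ∀ x ∈ S₂, ∀ b ∈ S₃, (integ μ S₄ fun a => f (z, x, b, a))
      = c • ∑ a ∈ R S₄, f (z, x, b, a) := fun z hz x hx b hb =>
    integ_eq_sum μ hϖ hμ hN h₄ _ fun a ha a' ha' k =>
      inv hz hz hx hx hb hb ha ha' (rfl' h₁ hz) (rfl' h₂ hx) (rfl' h₃ hb) k
  have e3 : ∀ z ∈ S₁, ∀ x ∈ S₂, (integ μ S₃ fun b => integ μ S₄ fun a => f (z, x, b, a))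
      = c • ∑ b ∈ R S₃, c • ∑ a ∈ R S₄, f (z, x, b, a) := fun z hz x hx => by
    rw [integ_congr μ (e4 z hz x hx)]
    refine integ_eq_sum μ hϖ hμ hN h₃ _ fun b hb b' hb' k => ?_
    rw [Finset.sum_congr rfl fun a ha => inv hz hz hx hx hb hb' (hRS ha) (hRS ha) (rfl' h₁ hz)
      (rfl' h₂ hx) k (rfl' h₄ (hRS ha))]
  have e2 : ∀ z ∈ S₁, (integ μ S₂ fun x => integ μ S₃ fun b => integ μ S₄ fun a =>
      f (z, x, b, a)) = c • ∑ x ∈ R S₂, c • ∑ b ∈ R S₃, c • ∑ a ∈ R S₄, f (z, x, b, a) :=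
    fun z hz => by
    rw [integ_congr μ (e3 z hz)]
    refine integ_eq_sum μ hϖ hμ hN h₂ _ fun x hx x' hx' k => ?_
    rw [Finset.sum_congr rfl fun b hb => congrArg (c • ·) (Finset.sum_congr rfl fun a ha =>
      inv hz hz hx hx' (hRS hb) (hRS hb) (hRS ha) (hRS ha) (rfl' h₁ hz) k (rfl' h₃ (hRS hb))
        (rfl' h₄ (hRS ha)))]
  rw [integ_congr μ e2, integ_eq_sum μ hϖ hμ hN h₁]
  · rw [avg_def, reps4]
    have : ((reps hϖ N ×ˢ reps hϖ N ×ˢ reps hϖ N ×ˢ reps hϖ N).filter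
        (· ∈ S₁ ×ˢ S₂ ×ˢ S₃ ×ˢ S₄)) = R S₁ ×ˢ R S₂ ×ˢ R S₃ ×ˢ R S₄ := by
      ext ⟨z, x, b, a⟩
      simp only [hR, Finset.mem_filter, Finset.mem_product, Set.mem_prod]
      tauto
    rw [this, Finset.sum_product]
    simp only [Finset.sum_product, Finset.smul_sum, smul_smul]
    simp only [c, hR]
    ring_nf
  · intro z hz z' hz' k
    rw [Finset.sum_congr rfl fun x hx => congrArg (c • ·) (Finset.sum_congr rfl fun b hb =>
      congrArg (c • ·) (Finset.sum_congr rfl fun a ha =>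
      inv hz hz' (hRS hx) (hRS hx) (hRS hb) (hRS hb) (hRS ha) (hRS ha) k (rfl' h₂ (hRS hx))
        (rfl' h₃ (hRS hb)) (rfl' h₄ (hRS ha))))]

end Iterated

/-! ### Matrices and multipliers -/

section Matrices

variable {F : Type*} [Field F]

theorem toMat_injective : Function.Injective (toMat : GSp4 F → Matrix (Fin 4) (Fin 4) F) :=
  fun _ _ h => Subtype.ext (Units.ext h)

theorem toMat_mul (g h : GSp4 F) : toMat (g * h) = toMat g * toMat h := rfl
theorem toMat_one : toMat (1 : GSp4 F) = 1 := rfl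
theorem toMat_heis (α y z : F) : toMat (heis α y z) =
    !![1, α, y, z; 0, 1, 0, y; 0, 0, 1, -α; 0, 0, 0, 1] := rfl
theorem toMat_siegel (x y z : F) : toMat (siegel x y z) =
    !![1, 0, y, z; 0, 1, x, y; 0, 0, 1, 0; 0, 0, 0, 1] := rfl
theorem toMat_lower (x : F) : toMat (lower x) =
    !![1, 0, 0, 0; 0, 1, 0, 0; 0, x, 1, 0; 0, 0, 0, 1] := rfl
theorem toMat_weyl : toMat (weyl F) =
    !![1, 0, 0, 0; 0, 0, 1, 0; 0, -1, 0, 0; 0, 0, 0, 1] := rfl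
theorem toMat_eta (ϖ : Fˣ) : toMat (eta ϖ) =
    !![(ϖ : F)⁻¹, 0, 0, 0; 0, 1, 0, 0; 0, 0, 1, 0; 0, 0, 0, (ϖ : F)] := rfl
theorem toMat_tau (ϖ : Fˣ) : toMat (tau ϖ) =
    !![1, 0, 0, 0; 0, (ϖ : F)⁻¹, 0, 0; 0, 0, (ϖ : F), 0; 0, 0, 0, 1] := rfl
theorem toMat_t4 (ϖ : Fˣ) : toMat (t4 ϖ) =
    !![0, 0, 0, -((ϖ : F) ^ 4)⁻¹; 0, 1, 0, 0; 0, 0, 1, 0; (ϖ : F) ^ 4, 0, 0, 0] := rfl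

theorem toMat_inv_of_mul {g : GSp4 F} {M : Matrix (Fin 4) (Fin 4) F} (h : toMat g * M = 1) :
    toMat g⁻¹ = M := by
  have h1 : toMat g⁻¹ * toMat g = 1 := by rw [← toMat_mul, inv_mul_cancel, toMat_one]
  rw [← mul_one (toMat g⁻¹), ← h, ← mul_assoc, h1, one_mul]

theorem toMat_tau_inv (ϖ : Fˣ) : toMat (tau ϖ)⁻¹ =
    !![1, 0, 0, 0; 0, (ϖ : F), 0, 0; 0, 0, (ϖ : F)⁻¹, 0; 0, 0, 0, 1] := by
  apply toMat_inv_of_mul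
  rw [toMat_tau]
  ext i j; fin_cases i <;> fin_cases j <;> simp [Matrix.mul_apply, Fin.sum_univ_four]

theorem heis_mul_heis (α y z α' y' z' : F) : heis α y z * heis α' y' z' =
    heis (α + α') (y + y') (z + z' + α * y' - y * α') := by
  apply toMat_injective
  rw [toMat_mul, toMat_heis, toMat_heis, toMat_heis]
  ext i j; fin_cases i <;> fin_cases j <;> simp [Matrix.mul_apply, Fin.sum_univ_four] <;> ring

theorem siegel_mul_siegel (x y z x' y' z' : F) : siegel x y z * siegel x' y' z' =
    siegel (x + x') (y + y') (z + z') := by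
  apply toMat_injective
  rw [toMat_mul, toMat_siegel, toMat_siegel, toMat_siegel]
  ext i j; fin_cases i <;> fin_cases j <;> simp [Matrix.mul_apply, Fin.sum_univ_four] <;> ring

theorem lower_mul_lower (x x' : F) : lower x * lower x' = lower (x + x') := by
  apply toMat_injective
  rw [toMat_mul, toMat_lower, toMat_lower, toMat_lower]
  ext i j; fin_cases i <;> fin_cases j <;> simp [Matrix.mul_apply, Fin.sum_univ_four]

theorem heis_zero : heis (0 : F) 0 0 = 1 := by
  apply toMat_injective
  rw [toMat_heis, toMat_one]
  ext i j; fin_cases i <;> fin_cases j <;> simp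

theorem siegel_zero : siegel (0 : F) 0 0 = 1 := by
  apply toMat_injective
  rw [toMat_siegel, toMat_one]
  ext i j; fin_cases i <;> fin_cases j <;> simp

theorem lower_zero : lower (0 : F) = 1 := by
  apply toMat_injective
  rw [toMat_lower, toMat_one]
  ext i j; fin_cases i <;> fin_cases j <;> simp

theorem heis_inv (α y z : F) : (heis α y z)⁻¹ = heis (-α) (-y) (-z) := by
  apply inv_eq_of_mul_eq_one_right
  rw [heis_mul_heis, ← heis_zero]
  congr 1 <;> ring

theorem siegel_inv (x y z : F) : (siegel x y z)⁻¹ = siegel (-x) (-y) (-z) := by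
  apply inv_eq_of_mul_eq_one_right
  rw [siegel_mul_siegel, ← siegel_zero]
  congr 1 <;> ring

theorem lower_inv (x : F) : (lower x)⁻¹ = lower (-x) := by
  apply inv_eq_of_mul_eq_one_right
  rw [lower_mul_lower, ← lower_zero]
  congr 1; ring

theorem multiplier_eq_of {g : GSp4 F} {c : F} (h : (toMat g)ᵀ * J' F * toMat g = c • J' F) :
    multiplier g = c := by
  rw [multiplier, h]
  simp [J']

theorem multiplier_ofMat (M : Matrix (Fin 4) (Fin 4) F) (c : F) (hc : c ≠ 0)
    (h : Mᵀ * J' F * M = c • J' F) : multiplier (ofMat M c hc h) = c := multiplier_eq_of h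

theorem multiplier_mul (g h : GSp4 F) : multiplier (g * h) = multiplier g * multiplier h := by
  apply multiplier_eq_of
  have hg := (multiplier_spec g).2
  have hh := (multiplier_spec h).2
  calc (toMat (g * h))ᵀ * J' F * toMat (g * h)
      = (toMat h)ᵀ * ((toMat g)ᵀ * J' F * toMat g) * toMat h := by
        simp only [toMat_mul, Matrix.transpose_mul, Matrix.mul_assoc]
    _ = (multiplier g * multiplier h) • J' F := by
        rw [hg, Matrix.mul_smul, Matrix.smul_mul, hh, smul_smul]

theorem multiplier_one : multiplier (1 : GSp4 F) = 1 :=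
  multiplier_eq_of (by simp [toMat_one])

theorem multiplier_inv (g : GSp4 F) : multiplier g⁻¹ = (multiplier g)⁻¹ := by
  apply eq_inv_of_mul_eq_one_left
  rw [← multiplier_mul, inv_mul_cancel, multiplier_one]

theorem multiplier_heis (α y z : F) : multiplier (heis α y z) = 1 := multiplier_ofMat _ _ _ _
theorem multiplier_siegel (x y z : F) : multiplier (siegel x y z) = 1 := multiplier_ofMat _ _ _ _
theorem multiplier_lower (x : F) : multiplier (lower x) = 1 := multiplier_ofMat _ _ _ _
theorem multiplier_weyl : multiplier (weyl F) = 1 := multiplier_ofMat _ _ _ _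
theorem multiplier_eta (ϖ : Fˣ) : multiplier (eta ϖ) = 1 := multiplier_ofMat _ _ _ _
theorem multiplier_tau (ϖ : Fˣ) : multiplier (tau ϖ) = 1 := multiplier_ofMat _ _ _ _
theorem multiplier_t4 (ϖ : Fˣ) : multiplier (t4 ϖ) = 1 := multiplier_ofMat _ _ _ _

variable [ValuativeRel F] {V : Type*} [AddCommGroup V] [Module ℂ V]
  {ρ : Representation ℂ (GSp4 F) V} {ϖ : Fˣ} {v : V}

theorem mem_paramodular_zero {k : GSp4 F} (h1 : multiplier k = 1)
    (h : ∀ i j, toMat k i j ∈ ringInt F) : k ∈ paramodular ϖ 0 := by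
  refine ⟨by rw [h1]; exact unit_one, fun i j => ?_⟩
  have : (!![0, 0, 0, -((0 : ℕ) : ℤ); ((0 : ℕ) : ℤ), 0, 0, 0; ((0 : ℕ) : ℤ), 0, 0, 0;
      ((0 : ℕ) : ℤ), ((0 : ℕ) : ℤ), ((0 : ℕ) : ℤ), 0] : Matrix (Fin 4) (Fin 4) ℤ) i j = 0 := by
    fin_cases i <;> fin_cases j <;> simp
  rw [this]
  exact ⟨_, h i j, by simp⟩

/-- Right multiplication by an integral matrix does not change the image of a fixed vector. -/
theorem apply_eq_of_toMat_eq (hv : v ∈ paramodularVectors ρ ϖ 0) {g h : GSp4 F}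
    (hg : multiplier g = 1) (hh : multiplier h = 1) (K : Matrix (Fin 4) (Fin 4) F)
    (hK : ∀ i j, K i j ∈ ringInt F) (hmul : toMat g = toMat h * K) : ρ g v = ρ h v := by
  have hk : toMat (h⁻¹ * g) = K := by
    rw [toMat_mul, hmul, ← mul_assoc, ← toMat_mul, inv_mul_cancel, toMat_one, one_mul]
  have h1 : multiplier (h⁻¹ * g) = 1 := by
    rw [multiplier_mul, multiplier_inv, hg, hh]; simp
  have := hv (h⁻¹ * g) (mem_paramodular_zero h1 fun i j => by rw [hk]; exact hK i j)
  calc ρ g v = ρ (h * (h⁻¹ * g)) v := by rw [mul_inv_cancel_left]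
    _ = ρ h v := by rw [map_mul, Module.End.mul_apply, this]

end Matrices

/-! ### Local constancy -/

section Continuity

variable {F : Type*} [Field F] [TopologicalSpace F] [IsTopologicalRing F]
  {X : Type*} [TopologicalSpace X]

omit [IsTopologicalRing F] in
-- The topology of a unit group is the one in which both an element and its inverse vary
-- continuously, so the matrix of the inverse has to be supplied as well.
theorem continuous_ofMat {M N : X → Matrix (Fin 4) (Fin 4) F} {g : X → GSp4 F}
    (hM : Continuous M) (hN : Continuous N) (hg : ∀ x, toMat (g x) = M x)
    (hg' : ∀ x, toMat (g x)⁻¹ = N x) : Continuous g := by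
  refine continuous_induced_rng.2 (Units.continuous_iff.2 ⟨?_, ?_⟩)
  · exact hM.congr fun x => (hg x).symm
  · exact hN.congr fun x => (hg' x).symm

theorem continuous_heis : Continuous fun p : F × F × F => heis p.1 p.2.1 p.2.2 := by
  refine continuous_ofMat ?_ ?_ (fun p => toMat_heis _ _ _)
    (fun p => by rw [heis_inv, toMat_heis])
  all_goals
    refine continuous_matrix fun i j => ?_
    fin_cases i <;> fin_cases j <;> simp <;> fun_prop

theorem continuous_siegel : Continuous fun p : F × F × F => siegel p.1 p.2.1 p.2.2 := by
  refine continuous_ofMat ?_ ?_ (fun p => toMat_siegel _ _ _)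
    (fun p => by rw [siegel_inv, toMat_siegel])
  all_goals
    refine continuous_matrix fun i j => ?_
    fin_cases i <;> fin_cases j <;> simp <;> fun_prop

theorem continuous_lower : Continuous fun x : F => lower x := by
  refine continuous_ofMat ?_ ?_ (fun p => toMat_lower _)
    (fun p => by rw [lower_inv, toMat_lower])
  all_goals
    refine continuous_matrix fun i j => ?_
    fin_cases i <;> fin_cases j <;> simp <;> fun_prop

@[fun_prop]
theorem continuousAt_heis {f g h : X → F} {x : X} (hf : ContinuousAt f x)
    (hg : ContinuousAt g x) (hh : ContinuousAt h x) :
    ContinuousAt (fun x => heis (f x) (g x) (h x)) x :=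
  continuous_heis.continuousAt.comp (f := fun x => (f x, g x, h x))
    (hf.prodMk (hg.prodMk hh))

@[fun_prop]
theorem continuousAt_siegel {f g h : X → F} {x : X} (hf : ContinuousAt f x)
    (hg : ContinuousAt g x) (hh : ContinuousAt h x) :
    ContinuousAt (fun x => siegel (f x) (g x) (h x)) x :=
  continuous_siegel.continuousAt.comp (f := fun x => (f x, g x, h x))
    (hf.prodMk (hg.prodMk hh))

@[fun_prop]
theorem continuousAt_lower {f : X → F} {x : X} (hf : ContinuousAt f x) :
    ContinuousAt (fun x => lower (f x)) x :=
  continuous_lower.continuousAt.comp hf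

end Continuity

section LocallyConstant

open Filter Topology

variable {F : Type*} [Field F] [ValuativeRel F] [TopologicalSpace F]
  [IsNonarchimedeanLocalField F] {ϖ : Fˣ}

theorem exists_cg_imp_mem (hϖ : IsUniformizer ϖ) {x : F} {U : Set F} (hU : U ∈ 𝓝 x) :
    ∃ N, ∀ y, Cg ϖ N x y → y ∈ U := by
  obtain ⟨γ, hγ, hγU⟩ := (IsValuativeTopology.hasBasis_nhds' x).mem_iff.1 hU
  have h1 : ValuativeRel.valuation F (ϖ : F) < 1 := mem_maxIdeal_iff_lt.1 hϖ.mem_maxIdeal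
  obtain ⟨N, hN⟩ := exists_pow_lt₀ h1 (Units.mk0 γ hγ)
  refine ⟨N, fun y hy => hγU ?_⟩
  obtain ⟨-, -, t, ht, e⟩ := hy.symm
  change ValuativeRel.valuation F (y - x) < γ
  rw [e, map_mul, map_pow]
  exact (mul_le_of_le_one_right' (mem_ringInt_iff.1 ht)).trans_lt hN

theorem exists_cg4_imp_mem (hϖ : IsUniformizer ϖ) {p : F × F × F × F}
    {U : Set (F × F × F × F)} (hU : U ∈ 𝓝 p) : ∃ N, ∀ p', Cg4 ϖ N p p' → p' ∈ U := by
  obtain ⟨x, y, z, w⟩ := p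
  obtain ⟨A, hA, B, hB, hAB⟩ := mem_nhds_prod_iff.1 hU
  obtain ⟨C, hC, D, hD, hCD⟩ := mem_nhds_prod_iff.1 hB
  obtain ⟨E, hE, G, hG, hEG⟩ := mem_nhds_prod_iff.1 hD
  obtain ⟨a, ha⟩ := exists_cg_imp_mem hϖ hA
  obtain ⟨c, hc⟩ := exists_cg_imp_mem hϖ hC
  obtain ⟨e, he⟩ := exists_cg_imp_mem hϖ hE
  obtain ⟨g, hg⟩ := exists_cg_imp_mem hϖ hG
  refine ⟨a + c + e + g, fun p' h => hAB ⟨ha _ (h.1.mono hϖ (by omega)), hCD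
    ⟨hc _ (h.2.1.mono hϖ (by omega)), hEG ⟨he _ (h.2.2.1.mono hϖ (by omega)),
      hg _ (h.2.2.2.mono hϖ (by omega))⟩⟩⟩⟩

theorem isOpen_cg4 (hϖ : IsUniformizer ϖ) (N : ℕ) (p : F × F × F × F) :
    IsOpen {p' | Cg4 ϖ N p p'} :=
  (isOpen_cg hϖ N p.1).prod ((isOpen_cg hϖ N p.2.1).prod
    ((isOpen_cg hϖ N p.2.2.1).prod (isOpen_cg hϖ N p.2.2.2)))

/-- Compactness of `𝔬⁴` turns pointwise local constancy on `S` into one modulus: finitely many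
classes `p + 𝔭^(M p)` cover `𝔬⁴`, and the largest `M p` among them works everywhere. -/
theorem eventually_invOn_of_nhds (hϖ : IsUniformizer ϖ) {V : Type*} {S : Set (F × F × F × F)}
    (hS : Adm ϖ S) {f : F × F × F × F → V} (hf : ∀ p ∈ S, ∀ᶠ p' in 𝓝 p, f p' = f p) :
    ∀ᶠ N in atTop, InvOn ϖ N S f := by
  have hc : IsCompact (ringInt F) := IsNonarchimedeanLocalField.isCompact_closedBall F 1
  have hC : IsCompact (ringInt F ×ˢ ringInt F ×ˢ ringInt F ×ˢ ringInt F) :=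
    hc.prod (hc.prod (hc.prod hc))
  have hloc : ∀ p : F × F × F × F, ∃ N, ∀ p' ∈ S, ∀ p'' ∈ S, Cg4 ϖ N p p' → Cg4 ϖ N p p'' →
      f p' = f p'' := by
    intro p
    by_cases hp : p ∈ S
    · obtain ⟨N, hN⟩ := exists_cg4_imp_mem hϖ (hf p hp)
      exact ⟨N, fun p' _ p'' _ h' h'' => (hN p' h').trans (hN p'' h'').symm⟩
    -- A point outside `S` also needs a neighbourhood in the cover; its class modulo `𝔭` misses `S`,
    -- so nothing has to be checked there.
    · exact ⟨1, fun p' hp' _ _ h _ => absurd (hS.2 p' hp' p h.symm) hp⟩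
  choose M hM using hloc
  obtain ⟨t, -, ht⟩ := hC.elim_nhds_subcover (fun p => {p' | Cg4 ϖ (M p) p p'}) fun p hp =>
    (isOpen_cg4 hϖ (M p) p).mem_nhds ⟨.refl hp.1, .refl hp.2.1, .refl hp.2.2.1, .refl hp.2.2.2⟩
  filter_upwards [eventually_ge_atTop (t.sup M)] with N hN p hp p' hp' h
  have h0 := hS.1 p hp
  obtain ⟨r, hr, hpr⟩ := Set.mem_iUnion₂.1 (ht (show p ∈ _ from
    ⟨h0.1.left, h0.2.1.left, h0.2.2.1.left, h0.2.2.2.left⟩))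
  exact hM r p hp p' hp' hpr (Cg4.trans hpr (h.mono hϖ ((Finset.le_sup hr).trans hN)))

/-- If `|y - x| < |x|` then `y/x` lies in `1 + 𝔭`, where `χ` is trivial. -/
theorem eventually_mulChar_eq {χ : MulChar F ℂ} (hχ : ∀ u ∈ oneUnits F, χ u = 1) {x : F}
    (hx : x ≠ 0) : ∀ᶠ y in 𝓝 x, χ y = χ x := by
  have h0 : ValuativeRel.valuation F x ≠ 0 := by simpa using hx
  refine (IsValuativeTopology.hasBasis_nhds' x).mem_iff.2 ⟨_, h0, fun y hy => ?_⟩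
  have hy' : ValuativeRel.valuation F (y - x) < ValuativeRel.valuation F x := hy
  have : χ (y / x) = 1 := by
    apply hχ
    change y / x - 1 ∈ maxIdeal F
    rw [mem_maxIdeal_iff_lt, show y / x - 1 = (y - x) / x by field_simp, map_div₀]
    exact (div_lt_one₀ (zero_lt_iff.2 h0)).2 hy'
  change χ y = χ x
  calc χ y = χ (y / x * x) := by rw [div_mul_cancel₀ _ hx]
    _ = χ x := by rw [map_mul, this, one_mul]

variable {V : Type*} [AddCommGroup V] [Module ℂ V] {ρ : Representation ℂ (GSp4 F) V}

/-- An open subgroup `U` fixes `v`, and `gU` is an open neighbourhood of `g` on which the image of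
`v` is constant. -/
theorem eventually_apply_eq (hρ : IsSmooth ρ) (v : V) (g : GSp4 F) :
    ∀ᶠ h in 𝓝 g, ρ h v = ρ g v := by
  obtain ⟨U, hU, hUv⟩ := hρ v
  have : (fun h => g⁻¹ * h) ⁻¹' (U : Set (GSp4 F)) ∈ 𝓝 g :=
    (hU.preimage (continuous_const_mul g⁻¹)).mem_nhds (by simp [U.one_mem])
  filter_upwards [this] with h hh
  calc ρ h v = ρ (g * (g⁻¹ * h)) v := by rw [mul_inv_cancel_left]
    _ = ρ g v := by rw [map_mul, Module.End.mul_apply, hUv _ hh]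

theorem eventually_invOn (hϖ : IsUniformizer ϖ) (hρ : IsSmooth ρ) (v : V) {χ : MulChar F ℂ}
    (hχ : ∀ u ∈ oneUnits F, χ u = 1) {S : Set (F × F × F × F)} (hS : Adm ϖ S)
    {c : F × F × F × F → F} {g : F × F × F × F → GSp4 F}
    (h : ∀ p ∈ S, c p ≠ 0 ∧ ContinuousAt c p ∧ ContinuousAt g p) :
    ∀ᶠ N in atTop, InvOn ϖ N S fun p => χ (c p) • ρ (g p) v := by
  refine eventually_invOn_of_nhds hϖ hS fun p hp => ?_
  obtain ⟨h0, hc, hg⟩ := h p hp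
  filter_upwards [hc.eventually (eventually_mulChar_eq hχ h0),
    hg.eventually (eventually_apply_eq hρ v (g p))] with p' h1 h2
  rw [h1, h2]

end LocallyConstant

/-! ### Coset identities -/

section FourByFour

/-- With products expanded into explicit entries, each coset identity below becomes sixteen scalar
identities in the field. -/
theorem mul_fin_four {R : Type*} [CommRing R] (a00 a01 a02 a03 a10 a11 a12 a13 a20 a21 a22 a23 a30
    a31 a32 a33
    b00 b01 b02 b03 b10 b11 b12 b13 b20 b21 b22 b23 b30 b31 b32 b33 : R) :
    !![a00, a01, a02, a03; a10, a11, a12, a13; a20, a21, a22, a23; a30, a31, a32, a33] *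
    !![b00, b01, b02, b03; b10, b11, b12, b13; b20, b21, b22, b23; b30, b31, b32, b33] =
    !![a00 * b00 + a01 * b10 + a02 * b20 + a03 * b30,
      a00 * b01 + a01 * b11 + a02 * b21 + a03 * b31,
      a00 * b02 + a01 * b12 + a02 * b22 + a03 * b32,
      a00 * b03 + a01 * b13 + a02 * b23 + a03 * b33;
      a10 * b00 + a11 * b10 + a12 * b20 + a13 * b30,
      a10 * b01 + a11 * b11 + a12 * b21 + a13 * b31,
      a10 * b02 + a11 * b12 + a12 * b22 + a13 * b32,
      a10 * b03 + a11 * b13 + a12 * b23 + a13 * b33;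
      a20 * b00 + a21 * b10 + a22 * b20 + a23 * b30,
      a20 * b01 + a21 * b11 + a22 * b21 + a23 * b31,
      a20 * b02 + a21 * b12 + a22 * b22 + a23 * b32,
      a20 * b03 + a21 * b13 + a22 * b23 + a23 * b33;
      a30 * b00 + a31 * b10 + a32 * b20 + a33 * b30,
      a30 * b01 + a31 * b11 + a32 * b21 + a33 * b31,
      a30 * b02 + a31 * b12 + a32 * b22 + a33 * b32,
      a30 * b03 + a31 * b13 + a32 * b23 + a33 * b33] := by
  ext i j
  fin_cases i <;> fin_cases j <;> simp [Matrix.mul_apply, Fin.sum_univ_four]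

theorem ext_fin_four {R : Type*} {a00 a01 a02 a03 a10 a11 a12 a13 a20 a21 a22 a23 a30 a31 a32 a33
    b00 b01 b02 b03 b10 b11 b12 b13 b20 b21 b22 b23 b30 b31 b32 b33 : R}
    (h00 : a00 = b00) (h01 : a01 = b01) (h02 : a02 = b02) (h03 : a03 = b03)
    (h10 : a10 = b10) (h11 : a11 = b11) (h12 : a12 = b12) (h13 : a13 = b13)
    (h20 : a20 = b20) (h21 : a21 = b21) (h22 : a22 = b22) (h23 : a23 = b23)
    (h30 : a30 = b30) (h31 : a31 = b31) (h32 : a32 = b32) (h33 : a33 = b33) :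
    !![a00, a01, a02, a03; a10, a11, a12, a13; a20, a21, a22, a23; a30, a31, a32, a33] =
    !![b00, b01, b02, b03; b10, b11, b12, b13; b20, b21, b22, b23; b30, b31, b32, b33] := by
  subst h00 h01 h02 h03 h10 h11 h12 h13 h20 h21 h22 h23 h30 h31 h32 h33
  rfl

theorem forall_fin_four {R : Type*} {a00 a01 a02 a03 a10 a11 a12 a13 a20 a21 a22 a23 a30 a31 a32 a33
    : R} {S : Set R}
    (h00 : a00 ∈ S) (h01 : a01 ∈ S) (h02 : a02 ∈ S) (h03 : a03 ∈ S)
    (h10 : a10 ∈ S) (h11 : a11 ∈ S) (h12 : a12 ∈ S) (h13 : a13 ∈ S)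
    (h20 : a20 ∈ S) (h21 : a21 ∈ S) (h22 : a22 ∈ S) (h23 : a23 ∈ S)
    (h30 : a30 ∈ S) (h31 : a31 ∈ S) (h32 : a32 ∈ S) (h33 : a33 ∈ S) :
    ∀ i j, !![a00, a01, a02, a03; a10, a11, a12, a13; a20, a21, a22, a23; a30, a31, a32,
        a33] i j ∈ S := by
  intro i j
  fin_cases i <;> fin_cases j <;> assumption

end FourByFour

/-- The matrices of products of the elements below, as a set of rewriting rules. -/
theorem toMat_calc {F : Type*} [Field F] :
    (∀ g h : GSp4 F, toMat (g * h) = toMat g * toMat h) ∧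
    (∀ α y z : F, toMat (heis α y z) = !![1, α, y, z; 0, 1, 0, y; 0, 0, 1, -α; 0, 0, 0, 1]) ∧
    (∀ x y z : F, toMat (siegel x y z) = !![1, 0, y, z; 0, 1, x, y; 0, 0, 1, 0; 0, 0, 0, 1]) ∧
    (∀ x : F, toMat (lower x) = !![1, 0, 0, 0; 0, 1, 0, 0; 0, x, 1, 0; 0, 0, 0, 1]) ∧
    toMat (weyl F) = !![1, 0, 0, 0; 0, 0, 1, 0; 0, -1, 0, 0; 0, 0, 0, 1] ∧
    (∀ ϖ : Fˣ, toMat (eta ϖ) =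
      !![(ϖ : F)⁻¹, 0, 0, 0; 0, 1, 0, 0; 0, 0, 1, 0; 0, 0, 0, (ϖ : F)]) ∧
    (∀ ϖ : Fˣ, toMat (tau ϖ) =
      !![1, 0, 0, 0; 0, (ϖ : F)⁻¹, 0, 0; 0, 0, (ϖ : F), 0; 0, 0, 0, 1]) ∧
    (∀ ϖ : Fˣ, toMat (tau ϖ)⁻¹ =
      !![1, 0, 0, 0; 0, (ϖ : F), 0, 0; 0, 0, (ϖ : F)⁻¹, 0; 0, 0, 0, 1]) ∧
    (∀ ϖ : Fˣ, toMat (t4 ϖ) =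
      !![0, 0, 0, -((ϖ : F) ^ 4)⁻¹; 0, 1, 0, 0; 0, 0, 1, 0; (ϖ : F) ^ 4, 0, 0, 0]) ∧
    ∀ g : GSp4 F, toMat (g ^ 2) = toMat g * toMat g :=
  ⟨toMat_mul, toMat_heis, toMat_siegel, toMat_lower, toMat_weyl, toMat_eta, toMat_tau,
    toMat_tau_inv, toMat_t4, fun g => by rw [pow_two, toMat_mul]⟩

theorem multiplier_pow {F : Type*} [Field F] (g : GSp4 F) (n : ℕ) :
    multiplier (g ^ n) = multiplier g ^ n := by
  induction n with
  | zero => simp [multiplier_one]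
  | succ n ih => rw [pow_succ, pow_succ, multiplier_mul, ih]

attribute [simp] multiplier_pow multiplier_mul multiplier_inv multiplier_heis multiplier_siegel
    multiplier_lower
  multiplier_weyl multiplier_eta multiplier_tau multiplier_t4

/-! ### The group elements and their matrices -/

section Elements

variable {F : Type*} [Field F] (ϖ : Fˣ)

/-- The element in the first and third parts of the twisting operator. -/
def elt (g₀ : GSp4 F) (m : ℕ) (z x b a : F) : GSp4 F :=
  g₀ * (lower x * heis (-a / ϖ) (b / ϖ ^ 2) (z / ϖ ^ m) * tau ϖ)

/-- The element in the second and fourth parts of the twisting operator. -/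
def eltW (g₀ : GSp4 F) (m : ℕ) (z y b a : F) : GSp4 F :=
  g₀ * (weyl F * lower y * heis (-a / ϖ) (b / ϖ ^ 2) (z / ϖ ^ m) * tau ϖ)

/-- The reduced form of `elt` on the part `v(x) ≥ 2`. -/
def eltA (g₀ : GSp4 F) (m : ℕ) (z b a : F) : GSp4 F :=
  g₀ * (tau ϖ * heis (-a / ϖ ^ 2) (b / ϖ) (z / ϖ ^ m))

/-- The reduced form of `elt` on the part `v(x) = 1`. -/
def eltB (g₀ : GSp4 F) (m : ℕ) (z x b a : F) : GSp4 F :=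
  g₀ * (heis (-(a + x * b) / ϖ) (b / ϖ ^ 2) (z / ϖ ^ m) * siegel (x⁻¹ / ϖ) 0 0)

/-- The reduced form of `elt` on the part `v(x) = 0`, and of `eltW`. -/
def eltC (g₀ : GSp4 F) (m : ℕ) (z x b a : F) : GSp4 F :=
  g₀ * ((tau ϖ)⁻¹ * siegel (-x / ϖ ^ 2) 0 0 * heis (b / ϖ) (a / ϖ ^ 2) (z / ϖ ^ m))

/-- The element in `term1`. -/
def elt1 (z x b a : F) : GSp4 F :=
  heis (-(a + x * b) / ϖ) 0 0 * siegel (x⁻¹ / ϖ) (b / ϖ ^ 2) (z / ϖ ^ 4)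

/-- The element in `term2`. -/
def elt2 (y b a x : F) : GSp4 F :=
  eta ϖ * (heis (b / ϖ) 0 0 *
    siegel (a * b⁻¹ * (1 - x)⁻¹ / ϖ) (-a / ϖ ^ 2) (a * b * (1 - (1 - y)⁻¹ * x) / ϖ ^ 3))

/-- The element in `term3`. -/
def elt3 (z b a : F) : GSp4 F :=
  eta ϖ * siegel (a ^ 2 * b⁻¹ * z / ϖ) (a / ϖ ^ 2) (b / ϖ ^ 3)

/-- The element in `term4`. -/
def elt4 (x b a : F) : GSp4 F :=
  eta ϖ * (heis (x / ϖ ^ 2) 0 0 * siegel 0 (a / ϖ ^ 2) ((b * ϖ - a * x) / ϖ ^ 4))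

/-- The element in `term5`. -/
def elt5 (x b a : F) : GSp4 F :=
  eta ϖ * (heis (x / ϖ) 0 0 * siegel 0 (a / ϖ ^ 2) ((b - a * x) / ϖ ^ 3))

/-- The element in `term6`. -/
def elt6 (x b a : F) : GSp4 F :=
  eta ϖ ^ 2 *
    siegel (a ^ 2 * b⁻¹ / ϖ ^ 2) (a / ϖ ^ 2) (b * (1 - x * ϖ) / ϖ ^ 2)

/-- The element in `term7`. -/
def elt7 (z b a : F) : GSp4 F :=
  tau ϖ * (heis (-a / ϖ ^ 2) 0 0 * siegel 0 (b / ϖ) (z / ϖ ^ 4))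

/-- The element in `term8`. -/
def elt8 (z b a : F) : GSp4 F :=
  eta ϖ * tau ϖ *
    (heis (b / ϖ ^ 2) 0 0 * siegel 0 (a / ϖ) (-(a * b * (1 - z)) / ϖ ^ 3))

/-- The element in `term9`. -/
def elt9 (x b a : F) : GSp4 F :=
  eta ϖ ^ 2 * tau ϖ * (heis (a / ϖ) 0 0 * siegel (x / ϖ) 0 (-b / ϖ))

/-- The element in `term10`. -/
def elt10 (b a : F) : GSp4 F :=
  eta ϖ ^ 2 * tau ϖ ^ 2 * heis (a / ϖ ^ 2) 0 (-b / ϖ)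

/-- The element in `term11`. -/
def elt11 (z x b a : F) : GSp4 F :=
  (tau ϖ)⁻¹ * (heis (b / ϖ) 0 0 *
    siegel (-x / ϖ ^ 2) ((x * b + a * ϖ) / ϖ ^ 3) (z / ϖ ^ 4))

/-- The element in `term12`. -/
def elt12 (z y b a : F) : GSp4 F :=
  eta ϖ * (tau ϖ)⁻¹ * (heis (a / ϖ) 0 0 *
    siegel (-a⁻¹ * (y + b * ϖ) / ϖ ^ 2) (y / ϖ ^ 3) (a * (b * (1 - z) * ϖ - y) / ϖ ^ 4))

/-- The element in `term13`. -/
def elt13 (x b a : F) : GSp4 F :=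
  eta ϖ ^ 2 * (tau ϖ)⁻¹ *
    siegel (a ^ 2 * b⁻¹ / ϖ ^ 3) (a / ϖ ^ 2) (b * (1 - x) / ϖ)

/-- The element in `term14`. -/
def elt14 (x b a : F) : GSp4 F :=
  eta ϖ ^ 2 * (tau ϖ)⁻¹ ^ 2 * siegel (x / ϖ ^ 4) (a / ϖ ^ 2) (-b / ϖ)

/-- The factor `t₄` brings the last row of the Heisenberg element to the bottom multiplied by `ϖ⁴`.
The least valuation in that row is 1, attained at `zϖ`, when `z` is a unit. It is 2, attained at
`aϖ²`, when `z ∈ 𝔭` and `a` is a unit. An integral matrix of unit determinant on the right does not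
change it, so it must equal the exponent of `η` in the target; the same reading applies to the B and
C forms. -/
theorem toMat_eltA (z b a : F) : toMat (eltA ϖ (t4 ϖ) 3 z b a) =
    (!![0, 0, 0, -1 / ϖ ^ 4;
      0, 1 / ϖ, 0, b / ϖ ^ 2;
      0, 0, ϖ, a / ϖ;
      ϖ ^ 4, -(a * ϖ ^ 2), b * ϖ ^ 3, z * ϖ] : Matrix (Fin 4) (Fin 4) F) := by
  have := ϖ.ne_zero
  simp only [eltA, toMat_calc, mul_fin_four, zero_mul, mul_zero, add_zero, zero_add, one_mul,
    mul_one]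
  apply ext_fin_four <;> first | rfl | field_simp

theorem toMat_eltB (z x b a : F) (hx : x ≠ 0) : toMat (eltB ϖ (t4 ϖ) 3 z x b a) =
    (!![0, 0, 0, -1 / ϖ ^ 4;
      0, 1, 1 / (x * ϖ), b / ϖ ^ 2;
      0, 0, 1, (a + x * b) / ϖ;
      ϖ ^ 4, -((a + x * b) * ϖ ^ 3), -(a * ϖ ^ 2) / x, z * ϖ] : Matrix (Fin 4) (Fin 4) F) := by
  have := ϖ.ne_zero
  simp only [eltB, toMat_calc, mul_fin_four, zero_mul, mul_zero, add_zero, zero_add, one_mul,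
    mul_one]
  apply ext_fin_four <;> first | rfl | (field_simp; done) | (field_simp; ring)

theorem toMat_eltC (z x b a : F) : toMat (eltC ϖ (t4 ϖ) 3 z x b a) =
    (!![0, 0, 0, -1 / ϖ ^ 4;
      0, ϖ, -x / ϖ, (a * ϖ + x * b) / ϖ ^ 2;
      0, 0, 1 / ϖ, -b / ϖ ^ 2;
      ϖ ^ 4, b * ϖ ^ 3, a * ϖ ^ 2, z * ϖ] : Matrix (Fin 4) (Fin 4) F) := by
  have := ϖ.ne_zero
  simp only [eltC, toMat_calc, mul_fin_four, zero_mul, mul_zero, add_zero, zero_add, one_mul,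
    mul_one]
  apply ext_fin_four <;> first | rfl | field_simp

/-- The entries involve `(1 - x)⁻¹` and `(1 - y)⁻¹`; taking the complements as parameters leaves
monomial denominators, and it is the complements that the coset identities produce. -/
theorem toMat_elt2 (y b a x : F) (hb : b ≠ 0) (hx : x ≠ 0) (hy : y ≠ 0) : toMat (elt2 ϖ (1 - y) b a
    (1 - x)) =
    (!![1 / ϖ, b / ϖ ^ 2, a * (1 - x) / (x * ϖ ^ 3), -(a * b * (1 - x)) / (y * ϖ ^ 4);
      0, 1, a / (b * x * ϖ), -a / ϖ ^ 2;
      0, 0, 1, -b / ϖ;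
      0, 0, 0, ϖ] : Matrix (Fin 4) (Fin 4) F) := by
  have := ϖ.ne_zero
  simp only [elt2, toMat_calc, mul_fin_four, zero_mul, mul_zero, add_zero, zero_add, one_mul,
    mul_one, sub_sub_cancel]
  apply ext_fin_four <;> first | rfl | (field_simp; done) | (field_simp; ring)

/-- The parameter `c` is the middle Siegel coordinate `a² z / b`, in terms of which all entries are
linear. -/
theorem toMat_elt3 (c b a : F) (hb : b ≠ 0) (ha : a ≠ 0) : toMat (elt3 ϖ (b * c / a ^ 2) b a) =
    (!![1 / ϖ, 0, a / ϖ ^ 3, b / ϖ ^ 4;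
      0, 1, c / ϖ, a / ϖ ^ 2;
      0, 0, 1, 0;
      0, 0, 0, ϖ] : Matrix (Fin 4) (Fin 4) F) := by
  have := ϖ.ne_zero
  simp only [elt3, toMat_calc, mul_fin_four, zero_mul, mul_zero, add_zero, zero_add, one_mul,
    mul_one]
  apply ext_fin_four <;> first | rfl | field_simp

theorem toMat_elt4 (x b a : F) : toMat (elt4 ϖ x b a) =
    (!![1 / ϖ, x / ϖ ^ 3, a / ϖ ^ 3, b / ϖ ^ 4;
      0, 1, 0, a / ϖ ^ 2;
      0, 0, 1, -x / ϖ ^ 2;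
      0, 0, 0, ϖ] : Matrix (Fin 4) (Fin 4) F) := by
  have := ϖ.ne_zero
  simp only [elt4, toMat_calc, mul_fin_four, zero_mul, mul_zero, add_zero, zero_add, one_mul,
    mul_one]
  apply ext_fin_four <;> first | rfl | (field_simp; done) | (field_simp; ring)

theorem toMat_elt5 (x b a : F) : toMat (elt5 ϖ x b a) =
    (!![1 / ϖ, x / ϖ ^ 2, a / ϖ ^ 3, b / ϖ ^ 4;
      0, 1, 0, a / ϖ ^ 2;
      0, 0, 1, -x / ϖ;
      0, 0, 0, ϖ] : Matrix (Fin 4) (Fin 4) F) := by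
  have := ϖ.ne_zero
  simp only [elt5, toMat_calc, mul_fin_four, zero_mul, mul_zero, add_zero, zero_add, one_mul,
    mul_one]
  apply ext_fin_four <;> first | rfl | (field_simp; done) | (field_simp; ring)

theorem toMat_elt6 (x b a : F) (hb : b ≠ 0) : toMat (elt6 ϖ x b a) =
    (!![1 / ϖ ^ 2, 0, a / ϖ ^ 4, b * (1 - x * ϖ) / ϖ ^ 4;
      0, 1, a ^ 2 / (b * ϖ ^ 2), a / ϖ ^ 2;
      0, 0, 1, 0;
      0, 0, 0, ϖ ^ 2] : Matrix (Fin 4) (Fin 4) F) := by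
  have := ϖ.ne_zero
  simp only [elt6, toMat_calc, mul_fin_four, zero_mul, mul_zero, add_zero, zero_add, one_mul,
    mul_one]
  apply ext_fin_four <;> first | rfl | field_simp

theorem toMat_elt8 (z b a : F) : toMat (elt8 ϖ z b a) =
    (!![1 / ϖ, b / ϖ ^ 3, a / ϖ ^ 2, a * b * z / ϖ ^ 4;
      0, 1 / ϖ, 0, a / ϖ ^ 2;
      0, 0, ϖ, -b / ϖ;
      0, 0, 0, ϖ] : Matrix (Fin 4) (Fin 4) F) := by
  have := ϖ.ne_zero
  simp only [elt8, toMat_calc, mul_fin_four, zero_mul, mul_zero, add_zero, zero_add, one_mul,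
    mul_one]
  apply ext_fin_four <;> first | rfl | (field_simp; done) | (field_simp; ring)

theorem toMat_elt9 (x b a : F) : toMat (elt9 ϖ x b a) =
    (!![1 / ϖ ^ 2, a / ϖ ^ 3, a * x / ϖ ^ 4, -b / ϖ ^ 3;
      0, 1 / ϖ, x / ϖ ^ 2, 0;
      0, 0, ϖ, -a;
      0, 0, 0, ϖ ^ 2] : Matrix (Fin 4) (Fin 4) F) := by
  have := ϖ.ne_zero
  simp only [elt9, toMat_calc, mul_fin_four, zero_mul, mul_zero, add_zero, zero_add, one_mul,
    mul_one]
  apply ext_fin_four <;> first | rfl | field_simp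

theorem toMat_elt10 (b a : F) : toMat (elt10 ϖ b a) =
    (!![1 / ϖ ^ 2, a / ϖ ^ 4, 0, -b / ϖ ^ 3;
      0, 1 / ϖ ^ 2, 0, 0;
      0, 0, ϖ ^ 2, -a;
      0, 0, 0, ϖ ^ 2] : Matrix (Fin 4) (Fin 4) F) := by
  have := ϖ.ne_zero
  simp only [elt10, toMat_calc, mul_fin_four, zero_mul, mul_zero, add_zero, zero_add, one_mul,
    mul_one]
  apply ext_fin_four <;> first | rfl | field_simp

theorem toMat_elt12 (z y b a : F) (ha : a ≠ 0) : toMat (elt12 ϖ z y b a) =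
    (!![1 / ϖ, a / ϖ ^ 2, -b / ϖ ^ 3, a * b * (1 - z) / ϖ ^ 4;
      0, ϖ, -(y + b * ϖ) / (a * ϖ), y / ϖ ^ 2;
      0, 0, 1 / ϖ, -a / ϖ ^ 2;
      0, 0, 0, ϖ] : Matrix (Fin 4) (Fin 4) F) := by
  have := ϖ.ne_zero
  simp only [elt12, toMat_calc, mul_fin_four, zero_mul, mul_zero, add_zero, zero_add, one_mul,
    mul_one]
  apply ext_fin_four <;> first | rfl | (field_simp; done) | (field_simp; ring)

theorem toMat_elt13 (x b a : F) (hb : b ≠ 0) : toMat (elt13 ϖ x b a) =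
    (!![1 / ϖ ^ 2, 0, a / ϖ ^ 4, b * (1 - x) / ϖ ^ 3;
      0, ϖ, a ^ 2 / (b * ϖ ^ 2), a / ϖ;
      0, 0, 1 / ϖ, 0;
      0, 0, 0, ϖ ^ 2] : Matrix (Fin 4) (Fin 4) F) := by
  have := ϖ.ne_zero
  simp only [elt13, toMat_calc, mul_fin_four, zero_mul, mul_zero, add_zero, zero_add, one_mul,
    mul_one]
  apply ext_fin_four <;> first | rfl | field_simp

theorem toMat_elt14 (x b a : F) : toMat (elt14 ϖ x b a) =
    (!![1 / ϖ ^ 2, 0, a / ϖ ^ 4, -b / ϖ ^ 3;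
      0, ϖ ^ 2, x / ϖ ^ 2, a;
      0, 0, 1 / ϖ ^ 2, 0;
      0, 0, 0, ϖ ^ 2] : Matrix (Fin 4) (Fin 4) F) := by
  have := ϖ.ne_zero
  simp only [elt14, toMat_calc, mul_fin_four, zero_mul, mul_zero, add_zero, zero_add, one_mul,
    mul_one]
  apply ext_fin_four <;> first | rfl | field_simp

end Elements

/-! ### Explicit representatives modulo `GSp(4, 𝔬)` -/

section Cosets

variable {F : Type*} [Field F] [ValuativeRel F] {V : Type*} [AddCommGroup V] [Module ℂ V]
  {ρ : Representation ℂ (GSp4 F) V} {ϖ : Fˣ} {v : V}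

omit [ValuativeRel F] in
theorem apply_mul_left_congr (g₀ : GSp4 F) {g h : GSp4 F} (e : ρ g v = ρ h v) :
    ρ (g₀ * g) v = ρ (g₀ * h) v := by
  rw [map_mul, map_mul, Module.End.mul_apply, Module.End.mul_apply, e]

/-- Conjugation by `τ⁻¹` turns `L(ϖ²x)` into the integral matrix `L(x)`, so it can be moved to the
right and dropped. Passing the Heisenberg element on the way shifts `a` by `ϖxb`. -/
theorem elt_apply_of_sq (hv : v ∈ paramodularVectors ρ ϖ 0)
    (g₀ : GSp4 F) (m : ℕ) (z b a : F) {x : F} (hx : x ∈ ringInt F) :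
    ρ (elt ϖ g₀ m z (ϖ * (ϖ * x)) b a) v = ρ (eltA ϖ g₀ m z b (a + ϖ * x * b)) v := by
  refine apply_mul_left_congr g₀ ?_
  generalize z / (ϖ : F) ^ m = z
  have := ϖ.ne_zero
  refine apply_eq_of_toMat_eq hv (by simp) (by simp)
    !![1, 0, 0, 0; 0, 1, 0, 0; 0, x, 1, 0; 0, 0, 0, 1] ?_ ?_
  · apply forall_fin_four <;> first | exact ring_zero | exact ring_one | exact hx
  · simp only [toMat_calc, mul_fin_four, zero_mul, mul_zero, add_zero, zero_add, one_mul,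
      mul_one]
    apply ext_fin_four <;> field_simp <;> ring

/-- Past `τ` the lower unipotent becomes `L(x/ϖ)`, whose Iwasawa decomposition has torus part `τ⁻¹`
up to units. It cancels `τ` and leaves an upper unipotent with entry `x⁻¹/ϖ`. -/
theorem elt_apply_of_mul (hϖ : IsUniformizer ϖ) (hv : v ∈ paramodularVectors ρ ϖ 0)
    (g₀ : GSp4 F) (m : ℕ) (z b a : F) {x : F} (hx : x ∈ unitInt F) :
    ρ (elt ϖ g₀ m z (ϖ * x) b a) v = ρ (eltB ϖ g₀ m z x b a) v := by
  refine apply_mul_left_congr g₀ ?_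
  generalize z / (ϖ : F) ^ m = z
  have := ϖ.ne_zero
  have := unit_ne_zero hx
  refine apply_eq_of_toMat_eq hv (by simp) (by simp)
    !![1, 0, 0, 0; 0, 0, -1 / x, 0; 0, x, ϖ, 0; 0, 0, 0, 1] ?_ ?_
  · exact forall_fin_four ring_one ring_zero ring_zero ring_zero ring_zero ring_zero
      (ring_div (ring_neg ring_one) hx) ring_zero ring_zero (unit_ring hx) hϖ.mem_ringInt ring_zero
      ring_zero ring_zero ring_zero ring_one
  · simp only [toMat_calc, mul_fin_four, zero_mul, mul_zero, add_zero, zero_add, one_mul,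
      mul_one]
    apply ext_fin_four <;> field_simp <;> ring

/-- Here the lower unipotent becomes `L(x/ϖ²)` past `τ`, with torus part `τ⁻²` up to units, so that
`τ⁻¹` remains. -/
theorem elt_apply_of_unit (hϖ : IsUniformizer ϖ) (hv : v ∈ paramodularVectors ρ ϖ 0)
    (g₀ : GSp4 F) (m : ℕ) (z b a : F) {x : F} (hx : x ∈ unitInt F) :
    ρ (elt ϖ g₀ m z x b a) v = ρ (eltC ϖ g₀ m z (-1 / x) (-(a * ϖ + x * b)) (-a / x)) v := by
  refine apply_mul_left_congr g₀ ?_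
  generalize z / (ϖ : F) ^ m = z
  have := ϖ.ne_zero
  have := unit_ne_zero hx
  refine apply_eq_of_toMat_eq hv (by simp) (by simp)
    !![1, 0, 0, 0; 0, 0, -1 / x, 0; 0, x, ϖ ^ 2, 0; 0, 0, 0, 1] ?_ ?_
  · exact forall_fin_four ring_one ring_zero ring_zero ring_zero ring_zero ring_zero
      (ring_div (ring_neg ring_one) hx) ring_zero ring_zero (unit_ring hx) (ring_pow hϖ.mem_ringInt
        _) ring_zero
      ring_zero ring_zero ring_zero ring_one
  · simp only [toMat_calc, mul_fin_four, zero_mul, mul_zero, add_zero, zero_add, one_mul,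
      mul_one]
    apply ext_fin_four <;> field_simp <;> ring

/-- The Weyl element is integral, it inverts `τ`, and it turns `L(y)` into an upper unipotent.
Moving it to the right gives the same shape as the unit case of `elt`. -/
theorem eltW_apply (hv : v ∈ paramodularVectors ρ ϖ 0)
    (g₀ : GSp4 F) (m : ℕ) (z y b a : F) :
    ρ (eltW ϖ g₀ m z y b a) v = ρ (eltC ϖ g₀ m z y b a) v := by
  refine apply_mul_left_congr g₀ ?_
  generalize z / (ϖ : F) ^ m = z
  have := ϖ.ne_zero
  refine apply_eq_of_toMat_eq hv (by simp) (by simp)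
    !![1, 0, 0, 0; 0, 0, 1, 0; 0, -1, 0, 0; 0, 0, 0, 1] ?_ ?_
  · apply forall_fin_four <;>
      first | exact ring_zero | exact ring_one | exact ring_neg ring_one
  · simp only [toMat_calc, mul_fin_four, zero_mul, mul_zero, add_zero, zero_add, one_mul,
      mul_one]
    apply ext_fin_four <;> field_simp <;> ring

/-- In this identity and the similar ones below the displayed matrix is `h⁻¹g`, with `h` the new
representative; its last row is the bottom row of `g` divided by `ϖ` or `ϖ²`. The condition `z + ab
∈ 𝔭` enters through `s = (z + ab)/ϖ`, which has to be integral. -/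
theorem eltA_apply_eq_elt5 (hϖ : IsUniformizer ϖ) (hv : v ∈ paramodularVectors ρ ϖ 0)
    {z b a s : F}
    (hz : z ∈ unitInt F) (hb : b ∈ unitInt F) (ha : a ∈ unitInt F) (hs : s ∈ ringInt F)
    (ez : z = ϖ * s - a * b) :
    ρ (eltA ϖ (t4 ϖ) 3 z b a) v =
      ρ (elt5 ϖ (-a / z) (-1 / z) (b / z)) v := by
  have := unit_ne_zero hz
  have := unit_ne_zero hb
  have := unit_ne_zero ha
  have := ϖ.ne_zero
  have hw := hϖ.mem_ringInt
  refine apply_eq_of_toMat_eq hv (by simp [eltA]) (by simp [elt5])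
    !![1 / z, 0, 0, 0;
      -ϖ * b / z, s / z, -b ^ 2 / z, 0;
      -ϖ ^ 2 * a / z, a ^ 2 / z, (z - a * b) * ϖ / z, 0;
      ϖ ^ 3, -ϖ * a, ϖ ^ 2 * b, z] ?_ ?_
  · exact forall_fin_four (ring_div ring_one hz) ring_zero ring_zero ring_zero
      (ring_div (ring_mul (ring_neg hw) (unit_ring hb)) hz) (ring_div hs hz)
      (ring_div (ring_neg (ring_pow (unit_ring hb) _)) hz) ring_zero
      (ring_div (ring_mul (ring_neg (ring_pow hw _)) (unit_ring ha)) hz)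
      (ring_div (ring_pow (unit_ring ha) _) hz)
      (ring_div (ring_mul (ring_sub (unit_ring hz) (ring_mul (unit_ring ha) (unit_ring hb))) hw) hz)
      ring_zero (ring_pow hw _) (ring_mul (ring_neg hw) (unit_ring ha))
      (ring_mul (ring_pow hw _) (unit_ring hb)) (unit_ring hz)
  · rw [toMat_eltA, toMat_elt5, mul_fin_four]
    apply ext_fin_four <;> field_simp <;>
      try simp only [ez]
    all_goals ring

/-- The left side does not involve `d`: every `d ∈ 𝔭` gives an element of `T²` in the same coset.
This freedom absorbs the dummy variable of the A form. -/
theorem eltA_apply_eq_elt2 (hϖ : IsUniformizer ϖ) (hv : v ∈ paramodularVectors ρ ϖ 0)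
    {z b a s u c d n : F}
    (hz : z ∈ unitInt F) (hb : b ∈ unitInt F) (ha : a ∈ unitInt F) (hu : u ∈ unitInt F)
    (hc : c ∈ unitInt F) (hn : n ∈ unitInt F) (hs : s ∈ ringInt F) (hd : d ∈ ringInt F)
    (eu : u = z + a * b) (ec : c = 1 + d) (ed : d = ϖ * s) (en : n = a * b - z * d) :
    ρ (eltA ϖ (t4 ϖ) 3 z b a) v =
      ρ (elt2 ϖ (1 - a * b * c / u) (-a / z) (-b / z) (1 - n / u)) v := by
  have := unit_ne_zero hz
  have := unit_ne_zero hb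
  have := unit_ne_zero ha
  have := unit_ne_zero hu
  have := unit_ne_zero hc
  have := unit_ne_zero hn
  have := ϖ.ne_zero
  have hw := hϖ.mem_ringInt
  refine apply_eq_of_toMat_eq hv (by simp [eltA]) (by simp [elt2])
    !![1 / z, 0, 0, 0;
      ϖ * b * c / n, -s * u / n, -b * (z - a * b * d) / (a * n), 0;
      -ϖ ^ 2 * a / z, a ^ 2 / z, (z - a * b) * ϖ / z, 0;
      ϖ ^ 3, -ϖ * a, ϖ ^ 2 * b, z] ?_ ?_
  · exact forall_fin_four (ring_div ring_one hz) ring_zero ring_zero ring_zero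
      (ring_div (ring_mul (ring_mul hw (unit_ring hb)) (unit_ring hc)) hn)
      (ring_div (ring_mul (ring_neg hs) (unit_ring hu)) hn)
      (ring_div (ring_mul (ring_neg (unit_ring hb)) (ring_sub (unit_ring hz) (ring_mul (ring_mul
        (unit_ring ha) (unit_ring hb)) hd))) (unit_mul ha hn))
      ring_zero (ring_div (ring_mul (ring_neg (ring_pow hw _)) (unit_ring ha)) hz)
      (ring_div (ring_pow (unit_ring ha) _) hz)
      (ring_div (ring_mul (ring_sub (unit_ring hz) (ring_mul (unit_ring ha) (unit_ring hb))) hw) hz)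
      ring_zero (ring_pow hw _) (ring_mul (ring_neg hw) (unit_ring ha))
      (ring_mul (ring_pow hw _) (unit_ring hb)) (unit_ring hz)
  · rw [toMat_eltA, toMat_elt2 _ _ _ _ _ (unit_ne_zero (unit_div (unit_neg ha) hz)) (unit_ne_zero
        (unit_div hn hu)) (unit_ne_zero (unit_div (unit_mul (unit_mul ha hb) hc) hu)), mul_fin_four]
    apply ext_fin_four <;> field_simp <;>
      try simp only [eu, ec, en, ed]
    all_goals ring

/-- With `z ∈ 𝔭` the pivot of the bottom row is `-aϖ²`, so `η²` appears and the last row of the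
integral matrix is divided by `ϖ²`. -/
theorem eltA_apply_eq_elt13 (hϖ : IsUniformizer ϖ) (hv : v ∈ paramodularVectors ρ ϖ 0)
    {z b a s u : F}
    (hb : b ∈ unitInt F) (ha : a ∈ unitInt F) (hu : u ∈ unitInt F) (hs : s ∈ ringInt F)
    (ez : z = ϖ * s) (eu : u = a * b + z) :
    ρ (eltA ϖ (t4 ϖ) 3 z b a) v =
      ρ (elt13 ϖ (1 + z) (1 / u) (-1 / a)) v := by
  have := unit_ne_zero hb
  have := unit_ne_zero ha
  have := unit_ne_zero hu
  have := ϖ.ne_zero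
  have hw := hϖ.mem_ringInt
  refine apply_eq_of_toMat_eq hv (by simp [eltA]) (by simp [elt13])
    !![ϖ ^ 2 * s / u, -a * s / u, (ϖ * a * b * s + u) / (a * u), s ^ 2 / u;
      1 / a, 0, -s / a ^ 2, 0;
      0, 0, ϖ ^ 2, a;
      ϖ ^ 2, -a, ϖ * b, s] ?_ ?_
  · exact forall_fin_four (ring_div (ring_mul (ring_pow hw _) hs) hu)
      (ring_div (ring_mul (ring_neg (unit_ring ha)) hs) hu)
      (ring_div (ring_add (ring_mul (ring_mul (ring_mul hw (unit_ring ha)) (unit_ring hb)) hs)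
        (unit_ring hu)) (unit_mul ha hu))
      (ring_div (ring_pow hs _) hu) (ring_div ring_one ha) ring_zero
      (ring_div (ring_neg hs) (unit_pow ha _)) ring_zero ring_zero ring_zero (ring_pow hw _)
      (unit_ring ha) (ring_pow hw _) (ring_neg (unit_ring ha)) (ring_mul hw (unit_ring hb)) hs
  · rw [toMat_eltA, toMat_elt13 _ _ _ _ (unit_ne_zero (unit_div unit_one hu)), mul_fin_four]
    apply ext_fin_four <;> field_simp <;>
      try simp only [eu, ez]
    all_goals ring

theorem eltB_apply_eq_elt5 (hϖ : IsUniformizer ϖ) (hv : v ∈ paramodularVectors ρ ϖ 0)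
    {z x b a s : F}
    (hz : z ∈ unitInt F) (hx : x ∈ unitInt F) (hb : b ∈ unitInt F) (ha : a ∈ unitInt F)
    (hs : s ∈ ringInt F) (ez : z = ϖ * s - a * b) :
    ρ (eltB ϖ (t4 ϖ) 3 z x b a) v =
      ρ (elt5 ϖ (-(a + x * b) / z) (-1 / z) (b / z)) v := by
  have := unit_ne_zero hz
  have := unit_ne_zero hx
  have := unit_ne_zero hb
  have := unit_ne_zero ha
  have := ϖ.ne_zero
  have hw := hϖ.mem_ringInt
  refine apply_eq_of_toMat_eq hv (by simp [eltB]) (by simp [elt5])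
    !![1 / z, 0, 0, 0;
      -ϖ * b / z, (ϖ * s + b ^ 2 * x) / z, s / (x * z), 0;
      -(a + x * b) * ϖ ^ 2 / z, (a + x * b) ^ 2 * ϖ / z, (a ^ 2 + ϖ * x * s) / (x * z), 0;
      ϖ ^ 3, -(a + x * b) * ϖ ^ 2, -ϖ * a / x, z] ?_ ?_
  · exact forall_fin_four (ring_div ring_one hz) ring_zero ring_zero ring_zero
      (ring_div (ring_mul (ring_neg hw) (unit_ring hb)) hz)
      (ring_div (ring_add (ring_mul hw hs) (ring_mul (ring_pow (unit_ring hb) _) (unit_ring hx)))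
        hz)
      (ring_div hs (unit_mul hx hz)) ring_zero
      (ring_div (ring_mul (ring_neg (ring_add (unit_ring ha) (ring_mul (unit_ring hx) (unit_ring
        hb)))) (ring_pow hw _)) hz)
      (ring_div (ring_mul (ring_pow (ring_add (unit_ring ha) (ring_mul (unit_ring hx) (unit_ring
        hb))) _) hw) hz)
      (ring_div (ring_add (ring_pow (unit_ring ha) _) (ring_mul (ring_mul hw (unit_ring hx)) hs))
        (unit_mul hx hz))
      ring_zero (ring_pow hw _)
      (ring_mul (ring_neg (ring_add (unit_ring ha) (ring_mul (unit_ring hx) (unit_ring hb))))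
        (ring_pow hw _))
      (ring_div (ring_mul (ring_neg hw) (unit_ring ha)) hx) (unit_ring hz)
  · rw [toMat_eltB _ _ _ _ _ (unit_ne_zero hx), toMat_elt5, mul_fin_four]
    apply ext_fin_four <;> field_simp <;>
      try simp only [ez]
    all_goals ring

/-- The Iwasawa form first has a factor `A(l/ϖ)` with `l = -(a + xb)/z`. Since `l ∈ 𝔭` this factor
is integral, and it is moved to the right past the Siegel unipotent with middle coordinate `c =
-bu/(az)`. That conjugation adds `lc` to the second coordinate and changes the third quadratically
in `l`, whence `a₃` and `b₃`. -/
theorem eltB_apply_eq_elt3 (hϖ : IsUniformizer ϖ) (hv : v ∈ paramodularVectors ρ ϖ 0)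
    {z x b a s u a₃ b₃ : F}
    (hz : z ∈ unitInt F) (hx : x ∈ unitInt F) (hb : b ∈ unitInt F) (ha : a ∈ unitInt F)
    (ha₃ : a₃ ∈ unitInt F) (hb₃ : b₃ ∈ unitInt F) (hs : s ∈ ringInt F) (hu : u ∈ ringInt F)
    (eu : u = z + a * b) (ea : a = ϖ * s - x * b)
    (ea₃ : a₃ = b / z + -(ϖ * s) / z * (-b * u / (a * z)))
    (eb₃ : b₃ = -1 / z + -(ϖ * s) / z * (b / z) + (-(ϖ * s) / z) ^ 2 * (-b * u / (a * z))) :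
    ρ (eltB ϖ (t4 ϖ) 3 z x b a) v =
      ρ (elt3 ϖ (b₃ * (-b * u / (a * z)) / a₃ ^ 2) b₃ a₃) v := by
  have := unit_ne_zero hz
  have := unit_ne_zero hx
  have := unit_ne_zero hb
  have := unit_ne_zero ha
  have := unit_ne_zero ha₃
  have := unit_ne_zero hb₃
  have := ϖ.ne_zero
  have hw := hϖ.mem_ringInt
  refine apply_eq_of_toMat_eq hv (by simp [eltB]) (by simp [elt3])
    !![(ϖ ^ 2 * b * s ^ 2 * u + ϖ * a * b * z * s + a * z ^ 2) / (a * z ^ 3), -(ϖ ^ 2 * b * s ^ 2 *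
      u + ϖ * a * b * z * s + a * z ^ 2) * s / (a * z ^ 3), -s ^ 2 * u ^ 2 / (a * z ^ 3 * x), 0;
      -ϖ * b * (a * z + ϖ * s * u) / (a * z ^ 2), (ϖ ^ 2 * b * s ^ 2 * u + ϖ * a * b * z * s + a *
          z ^ 2) / (a * z ^ 2), s * u ^ 2 / (a * z ^ 2 * x), 0;
      0, 0, 1, s;
      ϖ ^ 3, -ϖ ^ 3 * s, -ϖ * a / x, z] ?_ ?_
  · exact forall_fin_four
      (ring_div (ring_add (ring_add (ring_mul (ring_mul (ring_mul (ring_pow hw _) (unit_ring hb))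
        (ring_pow hs _)) hu) (ring_mul (ring_mul (ring_mul (ring_mul hw (unit_ring ha)) (unit_ring
        hb)) (unit_ring hz)) hs)) (ring_mul (unit_ring ha) (ring_pow (unit_ring hz) _))) (unit_mul
        ha (unit_pow hz _)))
      (ring_div (ring_mul (ring_neg (ring_add (ring_add (ring_mul (ring_mul (ring_mul (ring_pow hw
        _) (unit_ring hb)) (ring_pow hs _)) hu) (ring_mul (ring_mul (ring_mul (ring_mul hw
        (unit_ring ha)) (unit_ring hb)) (unit_ring hz)) hs)) (ring_mul (unit_ring ha) (ring_pow
        (unit_ring hz) _)))) hs) (unit_mul ha (unit_pow hz _)))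
      (ring_div (ring_mul (ring_neg (ring_pow hs _)) (ring_pow hu _)) (unit_mul (unit_mul ha
        (unit_pow hz _)) hx))
      ring_zero
      (ring_div (ring_mul (ring_mul (ring_neg hw) (unit_ring hb)) (ring_add (ring_mul (unit_ring ha)
        (unit_ring hz)) (ring_mul (ring_mul hw hs) hu))) (unit_mul ha (unit_pow hz _)))
      (ring_div (ring_add (ring_add (ring_mul (ring_mul (ring_mul (ring_pow hw _) (unit_ring hb))
        (ring_pow hs _)) hu) (ring_mul (ring_mul (ring_mul (ring_mul hw (unit_ring ha)) (unit_ring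
        hb)) (unit_ring hz)) hs)) (ring_mul (unit_ring ha) (ring_pow (unit_ring hz) _))) (unit_mul
        ha (unit_pow hz _)))
      (ring_div (ring_mul hs (ring_pow hu _)) (unit_mul (unit_mul ha (unit_pow hz _)) hx))
      ring_zero ring_zero ring_zero ring_one hs (ring_pow hw _)
      (ring_mul (ring_neg (ring_pow hw _)) hs)
      (ring_div (ring_mul (ring_neg hw) (unit_ring ha)) hx) (unit_ring hz)
  · rw [toMat_eltB _ _ _ _ _ (unit_ne_zero hx), toMat_elt3 _ _ _ _ (unit_ne_zero hb₃) (unit_ne_zero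
        ha₃), mul_fin_four]
    rw [ea₃, eb₃]
    apply ext_fin_four <;> field_simp <;>
      try simp only [eu, ea]
    all_goals ring

/-- The generic case: with `z`, `z + ab`, `h = a + xb` and `D = xz + ah` all units, the middle block
of the integral matrix is diagonal with unit entries modulo `𝔭`. -/
theorem eltB_apply_eq_elt2 (hϖ : IsUniformizer ϖ) (hv : v ∈ paramodularVectors ρ ϖ 0)
    {z x b a u h D : F}
    (hz : z ∈ unitInt F) (hx : x ∈ unitInt F) (hb : b ∈ unitInt F) (ha : a ∈ unitInt F)
    (hu : u ∈ unitInt F) (hh : h ∈ unitInt F) (hD : D ∈ unitInt F) (eu : u = z + a * b)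
    (eh : h = a + x * b) (eD : D = x * z + a * h) :
    ρ (eltB ϖ (t4 ϖ) 3 z x b a) v =
      ρ (elt2 ϖ (1 - a * b / u) (-h / z) (-b / z) (1 - b * D / (h * u))) v := by
  have := unit_ne_zero hz
  have := unit_ne_zero hx
  have := unit_ne_zero hb
  have := unit_ne_zero ha
  have := unit_ne_zero hu
  have := unit_ne_zero hh
  have := unit_ne_zero hD
  have := ϖ.ne_zero
  have hw := hϖ.mem_ringInt
  refine apply_eq_of_toMat_eq hv (by simp [eltB]) (by simp [elt2])
    !![1 / z, 0, 0, 0;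
      ϖ * a / D, x * z / D, 0, 0;
      -ϖ ^ 2 * h / z, ϖ * h ^ 2 / z, D / (x * z), 0;
      ϖ ^ 3, -ϖ ^ 2 * h, -ϖ * a / x, z] ?_ ?_
  · exact forall_fin_four (ring_div ring_one hz) ring_zero ring_zero ring_zero
      (ring_div (ring_mul hw (unit_ring ha)) hD)
      (ring_div (ring_mul (unit_ring hx) (unit_ring hz)) hD) ring_zero ring_zero
      (ring_div (ring_mul (ring_neg (ring_pow hw _)) (unit_ring hh)) hz)
      (ring_div (ring_mul hw (ring_pow (unit_ring hh) _)) hz)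
      (ring_div (unit_ring hD) (unit_mul hx hz)) ring_zero (ring_pow hw _)
      (ring_mul (ring_neg (ring_pow hw _)) (unit_ring hh))
      (ring_div (ring_mul (ring_neg hw) (unit_ring ha)) hx) (unit_ring hz)
  · rw [toMat_eltB _ _ _ _ _ (unit_ne_zero hx), toMat_elt2 _ _ _ _ _ (unit_ne_zero (unit_div
        (unit_neg hh) hz)) (unit_ne_zero (unit_div (unit_mul hb hD) (unit_mul hh hu))) (unit_ne_zero
        (unit_div (unit_mul ha hb) hu)), mul_fin_four]
    apply ext_fin_four <;> field_simp <;>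
      try simp only [eD, eh, eu]
    all_goals ring

/-- With `h = a + xb`, the condition `xz + ah = ϖs` reads `x(z - bh) = ϖs - h²`. Solving it for `x`,
and then `h = a + xb` for `a`, builds the constraint into the entries and leaves only unit
denominators. -/
theorem eltB_apply_eq_elt8 (hϖ : IsUniformizer ϖ) (hv : v ∈ paramodularVectors ρ ϖ 0)
    {z x b a s h n r : F}
    (hz : z ∈ unitInt F) (hb : b ∈ unitInt F) (hh : h ∈ unitInt F) (hn : n ∈ unitInt F)
    (hr : r ∈ unitInt F) (hs : s ∈ ringInt F) (en : n = z - b * h) (er : r = ϖ * s - h ^ 2)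
    (ex : x = r / n) (ea : a = h - x * b) :
    ρ (eltB ϖ (t4 ϖ) 3 z x b a) v =
      ρ (elt8 ϖ (z / (h * b)) (-h / z) (b / z)) v := by
  subst ea ex
  have := unit_ne_zero hz
  have := unit_ne_zero hb
  have := unit_ne_zero hh
  have := unit_ne_zero hn
  have := unit_ne_zero hr
  have := ϖ.ne_zero
  have hw := hϖ.mem_ringInt
  refine apply_eq_of_toMat_eq hv (by simp [eltB]) (by simp [elt8])
    !![1 / z, 0, 0, 0;
      -ϖ ^ 2 * b / z, (b * h + z) * ϖ / z, (z ^ 2 - ϖ * b ^ 2 * s) / (r * z), 0;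
      -ϖ * h / z, h ^ 2 / z, s * n / (r * z), 0;
      ϖ ^ 3, -ϖ ^ 2 * h, -ϖ * (h * n - b * r) / r, z] ?_ ?_
  · exact forall_fin_four (ring_div ring_one hz) ring_zero ring_zero ring_zero
      (ring_div (ring_mul (ring_neg (ring_pow hw _)) (unit_ring hb)) hz)
      (ring_div (ring_mul (ring_add (ring_mul (unit_ring hb) (unit_ring hh)) (unit_ring hz)) hw) hz)
      (ring_div (ring_sub (ring_pow (unit_ring hz) _) (ring_mul (ring_mul hw (ring_pow (unit_ring
        hb) _)) hs)) (unit_mul hr hz))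
      ring_zero (ring_div (ring_mul (ring_neg hw) (unit_ring hh)) hz)
      (ring_div (ring_pow (unit_ring hh) _) hz)
      (ring_div (ring_mul hs (unit_ring hn)) (unit_mul hr hz)) ring_zero (ring_pow hw _)
      (ring_mul (ring_neg (ring_pow hw _)) (unit_ring hh))
      (ring_div (ring_mul (ring_neg hw) (ring_sub (ring_mul (unit_ring hh) (unit_ring hn)) (ring_mul
        (unit_ring hb) (unit_ring hr)))) hr)
      (unit_ring hz)
  · rw [toMat_eltB _ _ _ _ _ (unit_ne_zero (unit_div hr hn)), toMat_elt8, mul_fin_four]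
    apply ext_fin_four <;> field_simp <;>
      try simp only [er, en]
    all_goals ring

/-- The shift `t = b + z/a` is the natural coordinate for `z ∈ 𝔭`: it makes `aE = xz + a(a + xb)`,
and the case at hand is that of a unit `E`. -/
theorem eltB_apply_eq_elt13 (hϖ : IsUniformizer ϖ) (hv : v ∈ paramodularVectors ρ ϖ 0)
    {z x b a s E t : F}
    (hx : x ∈ unitInt F) (ha : a ∈ unitInt F) (hE : E ∈ unitInt F) (ht : t ∈ unitInt F)
    (hs : s ∈ ringInt F) (ez : z = ϖ * s) (eb : b = t - z / a) (eE : E = a + x * t) :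
    ρ (eltB ϖ (t4 ϖ) 3 z x b a) v =
      ρ (elt13 ϖ (E / a) (1 / (E * t)) (-1 / E)) v := by
  subst eb ez
  have := unit_ne_zero hx
  have := unit_ne_zero ha
  have := unit_ne_zero hE
  have := unit_ne_zero ht
  have := ϖ.ne_zero
  have hw := hϖ.mem_ringInt
  refine apply_eq_of_toMat_eq hv (by simp [eltB]) (by simp [elt13])
    !![ϖ * x / (a * E), -x * (E - ϖ * x * s / a) / (a * E), 0, 0;
      1 / E, x * s / (a * E), 0, 0;
      0, 0, ϖ, E - ϖ * x * s / a;
      ϖ ^ 2, -ϖ * (E - ϖ * x * s / a), -a / x, s] ?_ ?_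
  · exact forall_fin_four (ring_div (ring_mul hw (unit_ring hx)) (unit_mul ha hE))
      (ring_div (ring_mul (ring_neg (unit_ring hx)) (ring_sub (unit_ring hE) (ring_div (ring_mul
        (ring_mul hw (unit_ring hx)) hs) ha))) (unit_mul ha hE))
      ring_zero ring_zero (ring_div ring_one hE)
      (ring_div (ring_mul (unit_ring hx) hs) (unit_mul ha hE)) ring_zero ring_zero ring_zero
      ring_zero hw
      (ring_sub (unit_ring hE) (ring_div (ring_mul (ring_mul hw (unit_ring hx)) hs) ha))
      (ring_pow hw _)
      (ring_mul (ring_neg hw) (ring_sub (unit_ring hE) (ring_div (ring_mul (ring_mul hw (unit_ring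
        hx)) hs) ha)))
      (ring_div (ring_neg (unit_ring ha)) hx) hs
  · rw [toMat_eltB _ _ _ _ _ (unit_ne_zero hx), toMat_elt13 _ _ _ _ (unit_ne_zero (unit_div unit_one
        (unit_mul hE ht))), mul_fin_four]
    apply ext_fin_four <;> field_simp <;>
      try simp only [eE]
    all_goals ring

/-- Here `ϖe = a + x(b + z/a)` has valuation 1; the hypotheses are this relation solved for `b`. -/
theorem eltB_apply_eq_elt6 (hϖ : IsUniformizer ϖ) (hv : v ∈ paramodularVectors ρ ϖ 0)
    {z x b a s e r : F}
    (hx : x ∈ unitInt F) (ha : a ∈ unitInt F) (he : e ∈ unitInt F) (hr : r ∈ unitInt F)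
    (hs : s ∈ ringInt F) (ez : z = ϖ * s) (er : r = ϖ * e - a) (eb : b = r / x - z / a) :
    ρ (eltB ϖ (t4 ϖ) 3 z x b a) v =
      ρ (elt6 ϖ (e / a) (x / (e * r)) (-1 / e)) v := by
  subst eb ez
  have := unit_ne_zero hx
  have := unit_ne_zero ha
  have := unit_ne_zero he
  have := unit_ne_zero hr
  have := ϖ.ne_zero
  have hw := hϖ.mem_ringInt
  refine apply_eq_of_toMat_eq hv (by simp [eltB]) (by simp [elt6])
    !![x / (a * e), (x * s - a * e) * x / (a ^ 2 * e), 0, 0;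
      1 / e, x * s / (a * e), 0, 0;
      0, 0, 1, (a * e - x * s) / a;
      ϖ ^ 2, (x * s - a * e) * ϖ ^ 2 / a, -a / x, s] ?_ ?_
  · exact forall_fin_four (ring_div (unit_ring hx) (unit_mul ha he))
      (ring_div (ring_mul (ring_sub (ring_mul (unit_ring hx) hs) (ring_mul (unit_ring ha) (unit_ring
        he))) (unit_ring hx)) (unit_mul (unit_pow ha _) he))
      ring_zero ring_zero (ring_div ring_one he)
      (ring_div (ring_mul (unit_ring hx) hs) (unit_mul ha he)) ring_zero ring_zero ring_zero
      ring_zero ring_one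
      (ring_div (ring_sub (ring_mul (unit_ring ha) (unit_ring he)) (ring_mul (unit_ring hx) hs)) ha)
      (ring_pow hw _)
      (ring_div (ring_mul (ring_sub (ring_mul (unit_ring hx) hs) (ring_mul (unit_ring ha) (unit_ring
        he))) (ring_pow hw _)) ha)
      (ring_div (ring_neg (unit_ring ha)) hx) hs
  · rw [toMat_eltB _ _ _ _ _ (unit_ne_zero hx), toMat_elt6 _ _ _ _ (unit_ne_zero (unit_div hx
        (unit_mul he hr))), mul_fin_four]
    apply ext_fin_four <;> field_simp <;>
      try simp only [er]
    all_goals ring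

/-- Here `a + x(b + z/a) = ϖ²e` has valuation 2, and one factor `τ` appears. -/
theorem eltB_apply_eq_elt9 (hϖ : IsUniformizer ϖ) (hv : v ∈ paramodularVectors ρ ϖ 0)
    {z x b a s e : F}
    (hx : x ∈ unitInt F) (ha : a ∈ unitInt F) (he : e ∈ unitInt F) (hs : s ∈ ringInt F)
    (ez : z = ϖ * s) (eb : b = (ϖ * (ϖ * e) - a) / x - z / a) :
    ρ (eltB ϖ (t4 ϖ) 3 z x b a) v =
      ρ (elt9 ϖ (-a / (x * e)) (-x / a ^ 2) (x / a)) v := by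
  subst eb ez
  have := unit_ne_zero hx
  have := unit_ne_zero ha
  have := unit_ne_zero he
  have := ϖ.ne_zero
  have hw := hϖ.mem_ringInt
  refine apply_eq_of_toMat_eq hv (by simp [eltB]) (by simp [elt9])
    !![-ϖ * x / a ^ 2, (ϖ ^ 2 * a * e - ϖ * x * s - a ^ 2) * x / a ^ 3, 0, -e / a;
      1 / e, x * s / (a * e), 1 / x, (ϖ * a * e - x * s) / (a * x);
      ϖ * x / a, (x * s - ϖ * a * e) * ϖ * x / a ^ 2, 0, e;
      ϖ ^ 2, (x * s - ϖ * a * e) * ϖ ^ 2 / a, -a / x, s] ?_ ?_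
  · exact forall_fin_four (ring_div (ring_mul (ring_neg hw) (unit_ring hx)) (unit_pow ha _))
      (ring_div (ring_mul (ring_sub (ring_sub (ring_mul (ring_mul (ring_pow hw _) (unit_ring ha))
        (unit_ring he)) (ring_mul (ring_mul hw (unit_ring hx)) hs)) (ring_pow (unit_ring ha) _))
        (unit_ring hx)) (unit_pow ha _))
      ring_zero (ring_div (ring_neg (unit_ring he)) ha) (ring_div ring_one he)
      (ring_div (ring_mul (unit_ring hx) hs) (unit_mul ha he)) (ring_div ring_one hx)
      (ring_div (ring_sub (ring_mul (ring_mul hw (unit_ring ha)) (unit_ring he)) (ring_mul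
        (unit_ring hx) hs)) (unit_mul ha hx))
      (ring_div (ring_mul hw (unit_ring hx)) ha)
      (ring_div (ring_mul (ring_mul (ring_sub (ring_mul (unit_ring hx) hs) (ring_mul (ring_mul hw
        (unit_ring ha)) (unit_ring he))) hw) (unit_ring hx)) (unit_pow ha _))
      ring_zero (unit_ring he) (ring_pow hw _)
      (ring_div (ring_mul (ring_sub (ring_mul (unit_ring hx) hs) (ring_mul (ring_mul hw (unit_ring
        ha)) (unit_ring he))) (ring_pow hw _)) ha)
      (ring_div (ring_neg (unit_ring ha)) hx) hs
  · rw [toMat_eltB _ _ _ _ _ (unit_ne_zero hx), toMat_elt9, mul_fin_four]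
    apply ext_fin_four <;> field_simp
    all_goals ring

/-- From valuation 3 on, the torus part stays at `τ²`: `e` occurs only in the integral factor and
need not be a unit. -/
theorem eltB_apply_eq_elt10 (hϖ : IsUniformizer ϖ) (hv : v ∈ paramodularVectors ρ ϖ 0)
    {z x b a s e : F}
    (hx : x ∈ unitInt F) (ha : a ∈ unitInt F) (hs : s ∈ ringInt F) (he : e ∈ ringInt F)
    (ez : z = ϖ * s) (eb : b = (ϖ * (ϖ * (ϖ * e)) - a) / x - z / a) :
    ρ (eltB ϖ (t4 ϖ) 3 z x b a) v =
      ρ (elt10 ϖ (-x / a ^ 2) (x / a)) v := by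
  subst eb ez
  have := unit_ne_zero hx
  have := unit_ne_zero ha
  have := ϖ.ne_zero
  have hw := hϖ.mem_ringInt
  refine apply_eq_of_toMat_eq hv (by simp [eltB]) (by simp [elt10])
    !![-ϖ * x / a ^ 2, (ϖ ^ 3 * a * e - ϖ * x * s - a ^ 2) * x / a ^ 3, 0, -ϖ * e / a;
      0, ϖ ^ 2, ϖ / x, (ϖ ^ 3 * a * e - ϖ * x * s - a ^ 2) / (a * x);
      x / a, (x * s - ϖ ^ 2 * a * e) * x / a ^ 2, 0, e;
      ϖ ^ 2, (x * s - ϖ ^ 2 * a * e) * ϖ ^ 2 / a, -a / x, s] ?_ ?_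
  · exact forall_fin_four (ring_div (ring_mul (ring_neg hw) (unit_ring hx)) (unit_pow ha _))
      (ring_div (ring_mul (ring_sub (ring_sub (ring_mul (ring_mul (ring_pow hw _) (unit_ring ha))
        he) (ring_mul (ring_mul hw (unit_ring hx)) hs)) (ring_pow (unit_ring ha) _)) (unit_ring hx))
        (unit_pow ha _))
      ring_zero (ring_div (ring_mul (ring_neg hw) he) ha) ring_zero (ring_pow hw _)
      (ring_div hw hx)
      (ring_div (ring_sub (ring_sub (ring_mul (ring_mul (ring_pow hw _) (unit_ring ha)) he)
        (ring_mul (ring_mul hw (unit_ring hx)) hs)) (ring_pow (unit_ring ha) _)) (unit_mul ha hx))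
      (ring_div (unit_ring hx) ha)
      (ring_div (ring_mul (ring_sub (ring_mul (unit_ring hx) hs) (ring_mul (ring_mul (ring_pow hw _)
        (unit_ring ha)) he)) (unit_ring hx)) (unit_pow ha _))
      ring_zero he (ring_pow hw _)
      (ring_div (ring_mul (ring_sub (ring_mul (unit_ring hx) hs) (ring_mul (ring_mul (ring_pow hw _)
        (unit_ring ha)) he)) (ring_pow hw _)) ha)
      (ring_div (ring_neg (unit_ring ha)) hx) hs
  · rw [toMat_eltB _ _ _ _ _ (unit_ne_zero hx), toMat_elt10, mul_fin_four]
    apply ext_fin_four <;> field_simp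
    all_goals ring

theorem eltC_apply_eq_elt12 (hϖ : IsUniformizer ϖ) (hv : v ∈ paramodularVectors ρ ϖ 0)
    {z x b a u : F}
    (hz : z ∈ unitInt F) (hb : b ∈ unitInt F) (ha : a ∈ unitInt F) (hu : u ∈ unitInt F)
    (eu : u = z + a * b) :
    ρ (eltC ϖ (t4 ϖ) 3 z x b a) v =
      ρ (elt12 ϖ (-z / (a * b)) ((b * x + a * ϖ) / z) (-a / u) (b / z)) v := by
  have := unit_ne_zero hz
  have := unit_ne_zero hb
  have := unit_ne_zero ha
  have := unit_ne_zero hu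
  have := ϖ.ne_zero
  have hw := hϖ.mem_ringInt
  refine apply_eq_of_toMat_eq hv (by simp [eltC]) (by simp [elt12])
    !![1 / z, 0, 0, 0;
      -ϖ * a / u, z / u, 0, 0;
      ϖ ^ 2 * b / z, ϖ * b ^ 2 / z, u / z, 0;
      ϖ ^ 3, ϖ ^ 2 * b, ϖ * a, z] ?_ ?_
  · exact forall_fin_four (ring_div ring_one hz) ring_zero ring_zero ring_zero
      (ring_div (ring_mul (ring_neg hw) (unit_ring ha)) hu) (ring_div (unit_ring hz) hu)
      ring_zero ring_zero (ring_div (ring_mul (ring_pow hw _) (unit_ring hb)) hz)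
      (ring_div (ring_mul hw (ring_pow (unit_ring hb) _)) hz) (ring_div (unit_ring hu) hz)
      ring_zero (ring_pow hw _) (ring_mul (ring_pow hw _) (unit_ring hb))
      (ring_mul hw (unit_ring ha)) (unit_ring hz)
  · rw [toMat_eltC, toMat_elt12 _ _ _ _ _ (unit_ne_zero (unit_div hb hz)), mul_fin_four]
    apply ext_fin_four <;> field_simp <;>
      try simp only [eu]
    all_goals ring

theorem eltC_apply_eq_elt4 (hϖ : IsUniformizer ϖ) (hv : v ∈ paramodularVectors ρ ϖ 0)
    {z x b a s : F}
    (hz : z ∈ unitInt F) (hb : b ∈ unitInt F) (ha : a ∈ unitInt F) (hs : s ∈ ringInt F)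
    (hx : x ∈ ringInt F) (ez : z = ϖ * s - a * b) :
    ρ (eltC ϖ (t4 ϖ) 3 z x b a) v =
      ρ (elt4 ϖ (b / z) (-1 / z) ((a * ϖ + x * b) / z)) v := by
  have := unit_ne_zero hz
  have := unit_ne_zero hb
  have := unit_ne_zero ha
  have := ϖ.ne_zero
  have hw := hϖ.mem_ringInt
  refine apply_eq_of_toMat_eq hv (by simp [eltC]) (by simp [elt4])
    !![1 / z, 0, 0, 0;
      -(ϖ * a + b * x) * ϖ / z, (ϖ * (z - a * b) - b ^ 2 * x) / z, -(a ^ 2 + x * s) / z, 0;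
      ϖ * b / z, b ^ 2 / z, s / z, 0;
      ϖ ^ 3, ϖ ^ 2 * b, ϖ * a, z] ?_ ?_
  · exact forall_fin_four (ring_div ring_one hz) ring_zero ring_zero ring_zero
      (ring_div (ring_mul (ring_neg (ring_add (ring_mul hw (unit_ring ha)) (ring_mul (unit_ring hb)
        hx))) hw) hz)
      (ring_div (ring_sub (ring_mul hw (ring_sub (unit_ring hz) (ring_mul (unit_ring ha) (unit_ring
        hb)))) (ring_mul (ring_pow (unit_ring hb) _) hx)) hz)
      (ring_div (ring_neg (ring_add (ring_pow (unit_ring ha) _) (ring_mul hx hs))) hz) ring_zero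
      (ring_div (ring_mul hw (unit_ring hb)) hz) (ring_div (ring_pow (unit_ring hb) _) hz)
      (ring_div hs hz) ring_zero (ring_pow hw _) (ring_mul (ring_pow hw _) (unit_ring hb))
      (ring_mul hw (unit_ring ha)) (unit_ring hz)
  · rw [toMat_eltC, toMat_elt4, mul_fin_four]
    apply ext_fin_four <;> field_simp <;>
      try simp only [ez]
    all_goals ring

theorem eltC_apply_eq_elt14 (hϖ : IsUniformizer ϖ) (hv : v ∈ paramodularVectors ρ ϖ 0)
    {z x b a s u : F}
    (hb : b ∈ unitInt F) (ha : a ∈ unitInt F) (hu : u ∈ unitInt F) (hs : s ∈ ringInt F)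
    (ez : z = ϖ * s) (eu : u = a * b + z) :
    ρ (eltC ϖ (t4 ϖ) 3 z x b a) v =
      ρ (elt14 ϖ (-(x + a ^ 2 * ϖ / u)) (1 / u) (a / u)) v := by
  have := unit_ne_zero hb
  have := unit_ne_zero ha
  have := unit_ne_zero hu
  have := ϖ.ne_zero
  have hw := hϖ.mem_ringInt
  refine apply_eq_of_toMat_eq hv (by simp [eltC]) (by simp [elt14])
    !![ϖ / u, b / u, 0, 0;
      -a / u, s / u, 0, 0;
      0, 0, ϖ, -b;
      ϖ ^ 2, ϖ * b, a, s] ?_ ?_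
  · exact forall_fin_four (ring_div hw hu) (ring_div (unit_ring hb) hu) ring_zero ring_zero
      (ring_div (ring_neg (unit_ring ha)) hu) (ring_div hs hu) ring_zero ring_zero ring_zero
      ring_zero hw (ring_neg (unit_ring hb)) (ring_pow hw _) (ring_mul hw (unit_ring hb))
      (unit_ring ha) hs
  · rw [toMat_eltC, toMat_elt14, mul_fin_four]
    apply ext_fin_four <;> field_simp <;>
      try simp only [eu, ez]
    all_goals ring

end Cosets

/-! ### Changes of variables -/

section Calculus

variable {F : Type*} [Field F] [ValuativeRel F] {ϖ : Fˣ} {S : Set (F × F × F × F)}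
  {e f : F × F × F × F → F}

/-- Functions with values in `𝔬ˣ` on `S` that preserve all congruences. -/
def UnitOn (ϖ : Fˣ) (S : Set (F × F × F × F)) (e : F × F × F × F → F) : Prop :=
  NonExp ϖ S e ∧ ∀ p ∈ S, e p ∈ unitInt F

/-- Functions with values in `𝔭` on `S` that preserve all congruences. -/
def MaxOn (ϖ : Fˣ) (S : Set (F × F × F × F)) (e : F × F × F × F → F) : Prop :=
  NonExp ϖ S e ∧ ∀ p ∈ S, e p ∈ maxIdeal F

theorem nonExp₁ : NonExp ϖ S fun p => p.1 := fun _ _ _ _ _ h => h.1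
theorem nonExp₂ : NonExp ϖ S fun p => p.2.1 := fun _ _ _ _ _ h => h.2.1
theorem nonExp₃ : NonExp ϖ S fun p => p.2.2.1 := fun _ _ _ _ _ h => h.2.2.1
theorem nonExp₄ : NonExp ϖ S fun p => p.2.2.2 := fun _ _ _ _ _ h => h.2.2.2
theorem NonExp.one : NonExp ϖ S fun _ => 1 := fun _ _ _ _ _ _ => Cg.one
theorem NonExp.varpi (hϖ : IsUniformizer ϖ) : NonExp ϖ S fun _ => (ϖ : F) :=
  fun _ _ _ _ _ _ => Cg.varpi hϖ
theorem NonExp.add (he : NonExp ϖ S e) (hf : NonExp ϖ S f) : NonExp ϖ S fun p => e p + f p :=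
  fun N p hp p' hp' h => (he N p hp p' hp' h).add (hf N p hp p' hp' h)
theorem NonExp.sub (he : NonExp ϖ S e) (hf : NonExp ϖ S f) : NonExp ϖ S fun p => e p - f p :=
  fun N p hp p' hp' h => (he N p hp p' hp' h).sub (hf N p hp p' hp' h)
theorem NonExp.mul (he : NonExp ϖ S e) (hf : NonExp ϖ S f) : NonExp ϖ S fun p => e p * f p :=
  fun N p hp p' hp' h => (he N p hp p' hp' h).mul (hf N p hp p' hp' h)
theorem NonExp.neg (he : NonExp ϖ S e) : NonExp ϖ S fun p => -e p :=
  fun N p hp p' hp' h => (he N p hp p' hp' h).neg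
theorem NonExp.pow (he : NonExp ϖ S e) (n : ℕ) : NonExp ϖ S fun p => e p ^ n :=
  fun N p hp p' hp' h => (he N p hp p' hp' h).pow n
theorem NonExp.div (he : NonExp ϖ S e) (hf : UnitOn ϖ S f) : NonExp ϖ S fun p => e p / f p :=
  fun N p hp p' hp' h =>
    (he N p hp p' hp' h).div (hf.1 N p hp p' hp' h) (hf.2 p hp) (hf.2 p' hp')

theorem NonExp.mem_ringInt (hS : Adm ϖ S) (he : NonExp ϖ S e) :
    ∀ p ∈ S, e p ∈ ringInt F := fun p hp => (he 0 p hp p hp (hS.refl hp 0)).left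

theorem UnitOn.ne_zero (he : UnitOn ϖ S e) {p : F × F × F × F} (hp : p ∈ S) : e p ≠ 0 :=
  unit_ne_zero (he.2 p hp)
-- A difference of two units need not be a unit. Such an expression is handled through an identity
-- on `S` with a product or quotient already known to be a unit; the sets of auxiliary identities in
-- the substitutions below serve this purpose.
theorem UnitOn.congr (he : UnitOn ϖ S e) (h : ∀ p ∈ S, f p = e p) : UnitOn ϖ S f :=
  ⟨fun N p hp p' hp' k => by rw [h p hp, h p' hp']; exact he.1 N p hp p' hp' k,
    fun p hp => by rw [h p hp]; exact he.2 p hp⟩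
theorem MaxOn.congr (he : MaxOn ϖ S e) (h : ∀ p ∈ S, f p = e p) : MaxOn ϖ S f :=
  ⟨fun N p hp p' hp' k => by rw [h p hp, h p' hp']; exact he.1 N p hp p' hp' k,
    fun p hp => by rw [h p hp]; exact he.2 p hp⟩

theorem UnitOn.one : UnitOn ϖ S fun _ => 1 := ⟨.one, fun _ _ => unit_one⟩
theorem UnitOn.mul (he : UnitOn ϖ S e) (hf : UnitOn ϖ S f) : UnitOn ϖ S fun p => e p * f p :=
  ⟨he.1.mul hf.1, fun p hp => unit_mul (he.2 p hp) (hf.2 p hp)⟩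
theorem UnitOn.div (he : UnitOn ϖ S e) (hf : UnitOn ϖ S f) : UnitOn ϖ S fun p => e p / f p :=
  ⟨he.1.div hf, fun p hp => unit_div (he.2 p hp) (hf.2 p hp)⟩
theorem UnitOn.neg (he : UnitOn ϖ S e) : UnitOn ϖ S fun p => -e p :=
  ⟨he.1.neg, fun p hp => unit_neg (he.2 p hp)⟩
theorem UnitOn.pow (he : UnitOn ϖ S e) (n : ℕ) : UnitOn ϖ S fun p => e p ^ n :=
  ⟨he.1.pow n, fun p hp => unit_pow (he.2 p hp) n⟩
theorem UnitOn.add (he : UnitOn ϖ S e) (hf : MaxOn ϖ S f) : UnitOn ϖ S fun p => e p + f p :=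
  ⟨he.1.add hf.1, fun p hp => unit_add_max (he.2 p hp) (hf.2 p hp)⟩
theorem UnitOn.sub (he : UnitOn ϖ S e) (hf : MaxOn ϖ S f) : UnitOn ϖ S fun p => e p - f p :=
  ⟨he.1.sub hf.1, fun p hp => unit_sub_max (he.2 p hp) (hf.2 p hp)⟩

theorem MaxOn.zero : MaxOn ϖ S fun _ => 0 := ⟨fun _ _ _ _ _ _ => .refl ring_zero, fun _ _ =>
    max_zero⟩
theorem MaxOn.varpi (hϖ : IsUniformizer ϖ) : MaxOn ϖ S fun _ => (ϖ : F) :=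
  ⟨.varpi hϖ, fun _ _ => hϖ.mem_maxIdeal⟩
theorem MaxOn.sub (he : MaxOn ϖ S e) (hf : MaxOn ϖ S f) : MaxOn ϖ S fun p => e p - f p :=
  ⟨he.1.sub hf.1, fun p hp => max_sub (he.2 p hp) (hf.2 p hp)⟩
theorem MaxOn.neg (he : MaxOn ϖ S e) : MaxOn ϖ S fun p => -e p :=
  ⟨he.1.neg, fun p hp => max_neg (he.2 p hp)⟩
theorem MaxOn.mul (hS : Adm ϖ S) (he : MaxOn ϖ S e) (hf : NonExp ϖ S f) :
    MaxOn ϖ S fun p => e p * f p :=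
  ⟨he.1.mul hf, fun p hp => max_mul_right (he.2 p hp) (hf.mem_ringInt hS p hp)⟩
theorem MaxOn.div (he : MaxOn ϖ S e) (hf : UnitOn ϖ S f) : MaxOn ϖ S fun p => e p / f p :=
  ⟨he.1.div hf, fun p hp => max_div (he.2 p hp) (hf.2 p hp)⟩
theorem MaxOn.add_unit (he : MaxOn ϖ S e) (hf : UnitOn ϖ S f) : UnitOn ϖ S fun p => e p + f p :=
  (hf.add he).congr fun _ _ => add_comm _ _
theorem MaxOn.sub_unit (he : MaxOn ϖ S e) (hf : UnitOn ϖ S f) : UnitOn ϖ S fun p => e p - f p :=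
  (hf.sub he).neg.congr fun _ _ => (neg_sub _ _).symm

theorem nonExp4 {e₁ e₂ e₃ e₄ : F × F × F × F → F} (h₁ : NonExp ϖ S e₁) (h₂ : NonExp ϖ S e₂)
    (h₃ : NonExp ϖ S e₃) (h₄ : NonExp ϖ S e₄) :
    NonExp4 ϖ S fun p => (e₁ p, e₂ p, e₃ p, e₄ p) := fun N p hp p' hp' h =>
  ⟨h₁ N p hp p' hp' h, h₂ N p hp p' hp' h, h₃ N p hp p' hp' h, h₄ N p hp p' hp' h⟩

/-- The part of `S` on which `e` is a unit. -/
def sepU (S : Set (F × F × F × F)) (e : F × F × F × F → F) : Set (F × F × F × F) :=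
  {p ∈ S | e p ∈ unitInt F}

/-- The part of `S` on which `e` is not a unit. -/
def sepM (S : Set (F × F × F × F)) (e : F × F × F × F → F) : Set (F × F × F × F) :=
  {p ∈ S | e p ∈ maxIdeal F}

theorem InvOn.comp {N : ℕ} {V : Type*} {T : Set (F × F × F × F)} {g : F × F × F × F → V}
    (hg : InvOn ϖ N S g) {τ : F × F × F × F → F × F × F × F} (hτ : ∀ p ∈ T, τ p ∈ S)
    (nτ : NonExp4 ϖ T τ) : InvOn ϖ N T fun p => g (τ p) :=
  fun p hp p' hp' h => hg _ (hτ p hp) _ (hτ p' hp') (nτ N p hp p' hp' h)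

end Calculus

/-! ### Values of the quadratic character -/

section Character

variable {F : Type*} [Field F] [ValuativeRel F] {χ : MulChar F ℂ}

/-- As `χ` is quadratic, `χ(t²) = 1`; as its conductor is `𝔭`, it is trivial on `x / (y t²) ∈ 1 +
𝔭`. -/
theorem mulChar_congr (hχ : χ.IsQuadratic) (hcond : HasConductorPrime χ) {x y t : F}
    (ht : t ≠ 0) (hyt : y * t ^ 2 ∈ unitInt F) (h : x - y * t ^ 2 ∈ maxIdeal F) :
    χ x = χ y := by
  have h1 : χ (x / (y * t ^ 2)) = 1 := by
    apply hcond.1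
    change x / (y * t ^ 2) - 1 ∈ maxIdeal F
    rw [show x / (y * t ^ 2) - 1 = (x - y * t ^ 2) / (y * t ^ 2) by
      rw [sub_div, div_self (unit_ne_zero hyt)]]
    exact max_div h hyt
  have h2 : χ (t ^ 2) = 1 := by
    have h0 : χ t * χ t⁻¹ = 1 := by rw [← map_mul, mul_inv_cancel₀ ht, map_one]
    rw [map_pow]
    rcases hχ t with h | h | h
    · simp [h] at h0
    · simp [h]
    · simp [h]
  calc χ x = χ (x / (y * t ^ 2) * (y * t ^ 2)) := by rw [div_mul_cancel₀ _ (unit_ne_zero hyt)]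
    _ = χ y := by rw [map_mul, map_mul, h1, h2, one_mul, mul_one]

end Character

section Bijections

variable {F : Type*} [Field F] [ValuativeRel F] [TopologicalSpace F]
  [IsNonarchimedeanLocalField F] {ϖ : Fˣ} {χ : MulChar F ℂ}
  {V : Type*} [AddCommGroup V] [Module ℂ V] {ρ : Representation ℂ (GSp4 F) V} {v : V} {N : ℕ}

omit [TopologicalSpace F] [IsNonarchimedeanLocalField F] in
theorem Adm.sepU (hϖ : IsUniformizer ϖ) {S : Set (F × F × F × F)} (hS : Adm ϖ S)
    {e : F × F × F × F → F} (he : NonExp ϖ S e) : Adm ϖ (sepU S e) := hS.sep he (admF_unitInt hϖ)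

omit [TopologicalSpace F] [IsNonarchimedeanLocalField F] in
theorem Adm.sepM (hϖ : IsUniformizer ϖ) {S : Set (F × F × F × F)} (hS : Adm ϖ S)
    {e : F × F × F × F → F} (he : NonExp ϖ S e) : Adm ϖ (sepM S e) := hS.sep he (admF_maxIdeal hϖ)

/-- The function `p ↦ χ(c(p)) π(g(p)) v`. -/
def summand (χ : MulChar F ℂ) (ρ : Representation ℂ (GSp4 F) V) (v : V) (c : F × F × F × F → F)
    (g : F × F × F × F → GSp4 F) (p : F × F × F × F) : V := χ (c p) • ρ (g p) v

theorem avg_sep (hϖ : IsUniformizer ϖ) {S : Set (F × F × F × F)} (hS : Adm ϖ S)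
    {e : F × F × F × F → F} (he : NonExp ϖ S e) (f : F × F × F × F → V) :
    avg hϖ N S f = avg hϖ N (sepU S e) f + avg hϖ N (sepM S e) f := avg_split hϖ hS he f

/-- Change of variables for sums of functions `χ(c(p)) π(g(p)) v`. -/
theorem avg_summand_bij (hϖ : IsUniformizer ϖ) (hχ : χ.IsQuadratic) (hcond : HasConductorPrime χ)
    (hN : 1 ≤ N) {S T : Set (F × F × F × F)} (hS : Adm ϖ S) (hT : Adm ϖ T)
    {c c' t : F × F × F × F → F} {g g' : F × F × F × F → GSp4 F}
    (hf : InvOn ϖ N T (summand χ ρ v c' g')) (σ τ : F × F × F × F → F × F × F × F)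
    (nσ : NonExp4 ϖ S σ) (nτ : NonExp4 ϖ T τ)
    (hσ : ∀ p ∈ S, σ p ∈ T) (hτ : ∀ p ∈ T, τ p ∈ S)
    (hτσ : ∀ p ∈ S, τ (σ p) = p) (hστ : ∀ p ∈ T, σ (τ p) = p)
    (hc : UnitOn ϖ S c) (ht : UnitOn ϖ S t)
    (hcc' : MaxOn ϖ S fun p => c' (σ p) - c p * t p ^ 2)
    (hg : ∀ p ∈ S, ρ (g p) v = ρ (g' (σ p)) v) :
    avg hϖ N S (summand χ ρ v c g) = avg hϖ N T (summand χ ρ v c' g') := by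
  refine avg_bij hϖ hN hS hT hf σ τ (fun p hp => ⟨hσ p hp, hτσ p hp, ?_⟩)
    (fun p hp => ⟨hτ p hp, hστ p hp⟩) nσ nτ
  unfold summand
  rw [hg p hp, mulChar_congr hχ hcond (ht.ne_zero hp)
    (unit_mul (hc.2 p hp) (unit_pow (ht.2 p hp) 2)) (hcc'.2 p hp)]

end Bijections

section Summands

variable {F : Type*} [Field F] [ValuativeRel F] {V : Type*} [AddCommGroup V] [Module ℂ V]
  (ϖ : Fˣ) (χ : MulChar F ℂ) (ρ : Representation ℂ (GSp4 F) V) (v : V)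

/-- Summand of the first and third parts of the twisting operator. -/
def trm (g₀ : GSp4 F) (m : ℕ) : F × F × F × F → V :=
  summand χ ρ v (fun p => p.2.2.2 * p.2.2.1) fun p => elt ϖ g₀ m p.1 p.2.1 p.2.2.1 p.2.2.2

/-- Summand of the second and fourth parts of the twisting operator. -/
def trmW (g₀ : GSp4 F) (m : ℕ) : F × F × F × F → V :=
  summand χ ρ v (fun p => p.2.2.2 * p.2.2.1) fun p => eltW ϖ g₀ m p.1 p.2.1 p.2.2.1 p.2.2.2

/-- Reduced summand; the first variable is not used. -/
def trmA (g₀ : GSp4 F) (m : ℕ) : F × F × F × F → V :=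
  summand χ ρ v (fun p => p.2.2.2 * p.2.2.1) fun p => eltA ϖ g₀ m p.2.1 p.2.2.1 p.2.2.2

/-- Reduced summand. -/
def trmB (g₀ : GSp4 F) (m : ℕ) : F × F × F × F → V :=
  summand χ ρ v (fun p => p.2.2.2 * p.2.2.1) fun p => eltB ϖ g₀ m p.1 p.2.1 p.2.2.1 p.2.2.2

/-- Reduced summand. -/
def trmC (g₀ : GSp4 F) (m : ℕ) : F × F × F × F → V :=
  summand χ ρ v (fun p => p.2.2.2 * p.2.2.1) fun p => eltC ϖ g₀ m p.1 p.2.1 p.2.2.1 p.2.2.2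

/-- Summand of `term1`. -/
def trm1 : F × F × F × F → V :=
  summand χ ρ v (fun p => p.2.2.2 * p.2.2.1) fun p => elt1 ϖ p.1 p.2.1 p.2.2.1 p.2.2.2

/-- Summand of `term2`. -/
def trm2 : F × F × F × F → V :=
  summand χ ρ v (fun p => p.2.2.1 * p.2.1 * p.2.2.2 * p.1) fun p => elt2 ϖ p.1 p.2.1 p.2.2.1 p.2.2.2

/-- Summand of `term3`. -/
def trm3 : F × F × F × F → V :=
  summand χ ρ v (fun p => p.2.2.1 * (1 - p.2.1)) fun p => elt3 ϖ p.2.1 p.2.2.1 p.2.2.2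

/-- Summand of `term4`. -/
def trm4 : F × F × F × F → V :=
  summand χ ρ v (fun p => p.2.2.1) fun p => elt4 ϖ p.2.1 p.2.2.1 p.2.2.2

/-- Summand of `term5`. -/
def trm5 : F × F × F × F → V :=
  summand χ ρ v (fun p => p.2.2.1) fun p => elt5 ϖ p.2.1 p.2.2.1 p.2.2.2

/-- Summand of `term6`. -/
def trm6 : F × F × F × F → V :=
  summand χ ρ v (fun p => p.2.2.1 * p.2.1) fun p => elt6 ϖ p.2.1 p.2.2.1 p.2.2.2

/-- Summand of `term7`. -/
def trm7 : F × F × F × F → V :=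
  summand χ ρ v (fun p => p.2.2.2 * p.2.2.1) fun p => elt7 ϖ p.2.1 p.2.2.1 p.2.2.2

/-- Summand of `term8`. -/
def trm8 : F × F × F × F → V :=
  summand χ ρ v (fun p => p.2.2.2 * p.2.2.1 * p.2.1 * (1 - p.2.1)) fun p =>
      elt8 ϖ p.2.1 p.2.2.1 p.2.2.2

/-- Summand of `term9`. -/
def trm9 : F × F × F × F → V :=
  summand χ ρ v (fun p => p.2.2.1) fun p => elt9 ϖ p.2.1 p.2.2.1 p.2.2.2

/-- Summand of `term10`. -/
def trm10 : F × F × F × F → V :=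
  summand χ ρ v (fun p => p.2.2.1) fun p => elt10 ϖ p.2.2.1 p.2.2.2

/-- Summand of `term11`. -/
def trm11 : F × F × F × F → V :=
  summand χ ρ v (fun p => p.2.2.2 * p.2.2.1) fun p => elt11 ϖ p.1 p.2.1 p.2.2.1 p.2.2.2

/-- Summand of `term12`. -/
def trm12 : F × F × F × F → V :=
  summand χ ρ v (fun p => p.2.2.2 * p.2.2.1 * p.1 * (1 - p.1)) fun p =>
      elt12 ϖ p.1 p.2.1 p.2.2.1 p.2.2.2

/-- Summand of `term13`. -/
def trm13 : F × F × F × F → V :=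
  summand χ ρ v (fun p => p.2.2.1 * p.2.1) fun p => elt13 ϖ p.2.1 p.2.2.1 p.2.2.2

/-- Summand of `term14`. -/
def trm14 : F × F × F × F → V :=
  summand χ ρ v (fun p => p.2.2.1) fun p => elt14 ϖ p.2.1 p.2.2.1 p.2.2.2

end Summands

/-! ### Substitutions for the A and C forms with `t₄` -/

section Bijections

variable {F : Type*} [Field F] [ValuativeRel F] [TopologicalSpace F]
  [IsNonarchimedeanLocalField F] {ϖ : Fˣ} {χ : MulChar F ℂ}
  {V : Type*} [AddCommGroup V] [Module ℂ V] {ρ : Representation ℂ (GSp4 F) V} {v : V} {N : ℕ}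

/-- The new coordinates are read off from `eltA_apply_eq_elt5`. Under them `b + ax` becomes `-(z +
ab)/z²`, so only the part of `T⁵` with `b + ax ∈ 𝔭` is reached; the B form supplies the rest. The
first variable is a dummy on both sides. -/
theorem avg_trmA_eq_trm5 (hϖ : IsUniformizer ϖ) (hχ : χ.IsQuadratic)
    (hcond : HasConductorPrime χ) (hv : v ∈ paramodularVectors ρ ϖ 0) (hN : 1 ≤ N)
    (hf : InvOn ϖ N (boxOOUU F) (trm5 ϖ χ ρ v)) :
    avg hϖ N (sepM (sepU (boxOOUU F) fun p => p.2.1)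
          fun p => p.2.1 + p.2.2.2 * p.2.2.1) (trmA ϖ χ ρ v (t4 ϖ) 3) =
      avg hϖ N (sepM (boxOOUU F) fun p => p.2.2.1 + p.2.2.2 * p.2.1) (trm5 ϖ χ ρ v) := by
  have hS := ((adm_boxOOUU hϖ).sepU hϖ (nonExp₂)).sepM hϖ (nonExp₂.add (nonExp₄.mul nonExp₃))
  have hT := (adm_boxOOUU hϖ).sepM hϖ (nonExp₃.add (nonExp₄.mul nonExp₂))
  change avg (V := V) hϖ N ?S _ = avg (V := V) hϖ N ?T _
  set S := ?S
  set T := ?T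
  have s1 : UnitOn ϖ S fun p => p.2.2.1 := ⟨nonExp₃, fun p hp => hp.1.1.2.2.1⟩
  have s2 : UnitOn ϖ S fun p => p.2.2.2 := ⟨nonExp₄, fun p hp => hp.1.1.2.2.2⟩
  have s3 : UnitOn ϖ S fun p => p.2.1 := ⟨nonExp₂, fun p hp => hp.1.2⟩
  have s4 : MaxOn ϖ S fun p => p.2.1 + p.2.2.2 * p.2.2.1 := ⟨nonExp₂.add (s2.1.mul s1.1),
      fun p hp => hp.2⟩
  have nS : ∀ p ∈ S, p.2.2.1 ≠ 0 ∧ p.2.2.2 ≠ 0 ∧ p.2.1 ≠ 0 :=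
    fun p hp => ⟨s1.ne_zero hp, s2.ne_zero hp, s3.ne_zero hp⟩
  have es1 : ∀ p ∈ S, -1 / p.2.1 + p.2.2.1 / p.2.1 * (-p.2.2.2 / p.2.1) = -((p.2.1 + p.2.2.2 *
      p.2.2.1) / p.2.1 ^ 2) := fun p hp => by
    obtain ⟨n1, n2, n3⟩ := nS p hp
    field_simp
    ring
  have s5 := ((s4.div (s3.pow 2)).neg).congr es1
  have t1 : UnitOn ϖ T fun p => p.2.2.1 := ⟨nonExp₃, fun p hp => hp.1.2.2.1⟩
  have t2 : UnitOn ϖ T fun p => p.2.2.2 := ⟨nonExp₄, fun p hp => hp.1.2.2.2⟩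
  have t3 : MaxOn ϖ T fun p => p.2.2.1 + p.2.2.2 * p.2.1 := ⟨t1.1.add (t2.1.mul nonExp₂),
      fun p hp => hp.2⟩
  have nT : ∀ p ∈ T, p.2.2.1 ≠ 0 ∧ p.2.2.2 ≠ 0 :=
    fun p hp => ⟨t1.ne_zero hp, t2.ne_zero hp⟩
  have et1 : ∀ p ∈ T, p.2.1 = (p.2.2.1 + p.2.2.2 * p.2.1 - p.2.2.1) / p.2.2.2 := fun p hp => by
    obtain ⟨n1, n2⟩ := nT p hp
    field_simp
    ring
  have t4 := ((t3.sub_unit t1).div t2).congr et1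
  have et2 : ∀ p ∈ T, -1 / p.2.2.1 + p.2.1 / p.2.2.1 * (-p.2.2.2 / p.2.2.1) = -((p.2.2.1 + p.2.2.2 *
      p.2.1) / p.2.2.1 ^ 2) := fun p hp => by
    obtain ⟨n1, n2⟩ := nT p hp
    have n4 := t4.ne_zero hp
    field_simp
    ring
  have t5 := ((t3.div (t1.pow 2)).neg).congr et2
  -- Since `z ≡ -ab` modulo `𝔭`, the new character argument `-1/z` is congruent to `ab · (ab)⁻²`.
  refine avg_summand_bij (t := fun p => 1 / (p.2.2.2 * p.2.2.1)) hϖ hχ hcond hN hS hT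
    (hf.mono fun p hp => hp.1) (fun p => (p.1, -p.2.2.2 / p.2.1, -1 / p.2.1, p.2.2.1 / p.2.1))
    (fun p => (p.1, -1 / p.2.2.1, -p.2.2.2 / p.2.2.1, p.2.1 / p.2.2.1))
    (nonExp4 nonExp₁ (s2.1.neg.div s3) (NonExp.one.neg.div s3) (s1.1.div s3))
    (nonExp4 nonExp₁ (NonExp.one.neg.div t1) (t2.1.neg.div t1) (nonExp₂.div t1))
    (fun p hp => ⟨⟨((nonExp₁).mem_ringInt hS) p hp, ((s2.1.neg.div s3).mem_ringInt hS) p hp,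
      (UnitOn.one.neg.div s3).2 p hp, (s1.div s3).2 p hp⟩, (s5).2 p hp⟩)
    (fun p hp => ⟨⟨⟨((nonExp₁).mem_ringInt hT) p hp, ((NonExp.one.neg.div t1).mem_ringInt hT) p hp,
      (t2.neg.div t1).2 p hp, (t4.div t1).2 p hp⟩, (UnitOn.one.neg.div t1).2 p hp⟩,
      (t5).2 p hp⟩) ?_ ?_
    (s2.mul s1) (UnitOn.one.div (s2.mul s1))
    (((s4.div (s3.mul (s2.mul s1))).neg).congr fun p hp => ?_) ?_
  · intro p hp
    obtain ⟨n1, n2, n3⟩ := nS p hp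
    refine Prod.ext ?_ (Prod.ext ?_ (Prod.ext ?_ ?_)) <;> dsimp only
    all_goals try field_simp
  · intro p hp
    obtain ⟨n1, n2⟩ := nT p hp
    have n4 := t4.ne_zero hp
    refine Prod.ext ?_ (Prod.ext ?_ (Prod.ext ?_ ?_)) <;> dsimp only
    all_goals try field_simp
  · obtain ⟨n1, n2, n3⟩ := nS p hp
    dsimp only
    field_simp
    ring
  · intro p hp
    obtain ⟨s, hs, e⟩ := hϖ.mem_maxIdeal_iff.1 (s4.2 p hp)
    exact eltA_apply_eq_elt5 hϖ hv (s3.2 p hp) (s1.2 p hp) (s2.2 p hp) hs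
      (eq_sub_of_add_eq e)

/-- The dummy variable, restricted to `𝔭`, becomes the difference `x - y` of the two punctured
variables of `T²`. -/
theorem avg_trmA_eq_trm2 (hϖ : IsUniformizer ϖ) (hχ : χ.IsQuadratic)
    (hcond : HasConductorPrime χ) (hv : v ∈ paramodularVectors ρ ϖ 0) (hN : 1 ≤ N)
    (hf : InvOn ϖ N (boxPUUP F) (trm2 ϖ χ ρ v)) :
    avg hϖ N (sepU (sepU (boxMOUU F) fun p => p.2.1)
          fun p => p.2.1 + p.2.2.2 * p.2.2.1) (trmA ϖ χ ρ v (t4 ϖ) 3) =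
      avg hϖ N (sepM (boxPUUP F) fun p => p.2.2.2 - p.1) (trm2 ϖ χ ρ v) := by
  have hS := ((adm_boxMOUU hϖ).sepU hϖ (nonExp₂)).sepU hϖ (nonExp₂.add (nonExp₄.mul nonExp₃))
  have hT := (adm_boxPUUP hϖ).sepM hϖ (nonExp₄.sub nonExp₁)
  change avg (V := V) hϖ N ?S _ = avg (V := V) hϖ N ?T _
  set S := ?S
  set T := ?T
  have s1 : MaxOn ϖ S fun p => p.1 := ⟨nonExp₁, fun p hp => hp.1.1.1⟩
  have s2 : UnitOn ϖ S fun p => p.2.2.1 := ⟨nonExp₃, fun p hp => hp.1.1.2.2.1⟩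
  have s3 : UnitOn ϖ S fun p => p.2.2.2 := ⟨nonExp₄, fun p hp => hp.1.1.2.2.2⟩
  have s4 : UnitOn ϖ S fun p => p.2.1 := ⟨nonExp₂, fun p hp => hp.1.2⟩
  have s5 : UnitOn ϖ S fun p => p.2.1 + p.2.2.2 * p.2.2.1 := ⟨nonExp₂.add (s3.1.mul s2.1),
      fun p hp => hp.2⟩
  have nS : ∀ p ∈ S, p.2.2.1 ≠ 0 ∧ p.2.2.2 ≠ 0 ∧ p.2.1 ≠ 0 ∧ p.2.1 + p.2.2.2 * p.2.2.1 ≠ 0 :=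
    fun p hp => ⟨s2.ne_zero hp, s3.ne_zero hp, s4.ne_zero hp, s5.ne_zero hp⟩
  have s6 : UnitOn ϖ S fun p => 1 + p.1 := UnitOn.one.add s1
  have es1 : ∀ p ∈ S, p.2.2.2 * p.2.2.1 - p.2.1 * p.1 = p.2.2.2 * p.2.2.1 - p.1 * p.2.1 :=
      fun p hp => by
    obtain ⟨n2, n3, n4, n5⟩ := nS p hp
    have n6 := s6.ne_zero hp
    field_simp
  have s7 := ((s3.mul s2).sub (s1.mul hS nonExp₂)).congr es1
  have es2 : ∀ p ∈ S, 1 - (1 - p.2.2.2 * p.2.2.1 * (1 + p.1) / (p.2.1 + p.2.2.2 * p.2.2.1)) =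
      p.2.2.2 * p.2.2.1 * (1 + p.1) / (p.2.1 + p.2.2.2 * p.2.2.1) := fun p hp => by
    obtain ⟨n2, n3, n4, n5⟩ := nS p hp
    have n6 := s6.ne_zero hp
    -- The sums occurring in denominators are treated as independent nonzero quantities while
    -- denominators are cleared, and expanded afterwards.
    generalize h1 : p.2.1 + p.2.2.2 * p.2.2.1 = u1 at n5 ⊢
    generalize h2 : 1 + p.1 = u2 at n6 ⊢
    field_simp
    subst h1 h2
    ring
  have s8 := (((s3.mul s2).mul s6).div s5).congr es2
  have es3 : ∀ p ∈ S, 1 - (1 - (p.2.2.2 * p.2.2.1 - p.2.1 * p.1) / (p.2.1 + p.2.2.2 * p.2.2.1)) =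
      (p.2.2.2 * p.2.2.1 - p.2.1 * p.1) / (p.2.1 + p.2.2.2 * p.2.2.1) := fun p hp => by
    obtain ⟨n2, n3, n4, n5⟩ := nS p hp
    have n6 := s6.ne_zero hp
    generalize h1 : p.2.1 + p.2.2.2 * p.2.2.1 = u1 at n5 ⊢
    field_simp
    subst h1
    ring
  have s9 := (s7.div s5).congr es3
  have es4 : ∀ p ∈ S, 1 - p.2.2.2 * p.2.2.1 * (1 + p.1) / (p.2.1 + p.2.2.2 * p.2.2.1) =
      (p.2.1 - p.1 * (p.2.2.2 * p.2.2.1)) / (p.2.1 + p.2.2.2 * p.2.2.1) := fun p hp => by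
    obtain ⟨n2, n3, n4, n5⟩ := nS p hp
    have n6 := s6.ne_zero hp
    generalize h1 : p.2.1 + p.2.2.2 * p.2.2.1 = u1 at n5 ⊢
    generalize h2 : 1 + p.1 = u2 at n6 ⊢
    field_simp
    subst h1 h2
    ring
  have s10 := ((s4.sub (s1.mul hS (s3.1.mul s2.1))).div s5).congr es4
  have es5 : ∀ p ∈ S, 1 - (p.2.2.2 * p.2.2.1 - p.2.1 * p.1) / (p.2.1 + p.2.2.2 * p.2.2.1) = p.2.1 *
      (1 + p.1) / (p.2.1 + p.2.2.2 * p.2.2.1) := fun p hp => by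
    obtain ⟨n2, n3, n4, n5⟩ := nS p hp
    have n6 := s6.ne_zero hp
    generalize h1 : p.2.1 + p.2.2.2 * p.2.2.1 = u1 at n5 ⊢
    generalize h2 : 1 + p.1 = u2 at n6 ⊢
    field_simp
    subst h1 h2
    ring
  have s11 := ((s4.mul s6).div s5).congr es5
  have es6 : ∀ p ∈ S, 1 - (p.2.2.2 * p.2.2.1 - p.2.1 * p.1) / (p.2.1 + p.2.2.2 *
      p.2.2.1) - (1 - p.2.2.2 * p.2.2.1 * (1 + p.1) / (p.2.1 + p.2.2.2 * p.2.2.1)) = p.1 :=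
      fun p hp => by
    obtain ⟨n2, n3, n4, n5⟩ := nS p hp
    have n6 := s6.ne_zero hp
    generalize h1 : p.2.1 + p.2.2.2 * p.2.2.1 = u1 at n5 ⊢
    generalize h2 : 1 + p.1 = u2 at n6 ⊢
    field_simp
    subst h1 h2
    ring
  have s12 := (s1).congr es6
  have t1 : UnitOn ϖ T fun p => p.1 := ⟨nonExp₁, fun p hp => (mem_punctured_iff.1 hp.1.1).1⟩
  have t2 : UnitOn ϖ T fun p => 1 - p.1 := ⟨.sub .one nonExp₁, fun p hp =>
      (mem_punctured_iff.1 hp.1.1).2⟩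
  have t3 : UnitOn ϖ T fun p => p.2.1 := ⟨nonExp₂, fun p hp => hp.1.2.1⟩
  have t4 : UnitOn ϖ T fun p => p.2.2.1 := ⟨nonExp₃, fun p hp => hp.1.2.2.1⟩
  have t5 : UnitOn ϖ T fun p => p.2.2.2 := ⟨nonExp₄, fun p hp => (mem_punctured_iff.1 hp.1.2.2.2).1⟩
  have t6 : UnitOn ϖ T fun p => 1 - p.2.2.2 := ⟨.sub .one nonExp₄, fun p hp =>
      (mem_punctured_iff.1 hp.1.2.2.2).2⟩
  have t7 : MaxOn ϖ T fun p => p.2.2.2 - p.1 := ⟨t5.1.sub t1.1, fun p hp => hp.2⟩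
  have nT : ∀ p ∈ T, p.1 ≠ 0 ∧ 1 - p.1 ≠ 0 ∧ p.2.1 ≠ 0 ∧ p.2.2.1 ≠ 0 ∧ p.2.2.2 ≠ 0 ∧
      1 - p.2.2.2 ≠ 0 :=
    fun p hp => ⟨t1.ne_zero hp, t2.ne_zero hp, t3.ne_zero hp, t4.ne_zero hp, t5.ne_zero hp,
        t6.ne_zero hp⟩
  have t8 : UnitOn ϖ T fun p => 1 + (p.2.2.2 - p.1) := UnitOn.one.add t7
  have et1 : ∀ p ∈ T, (1 - p.1) / (p.2.2.1 * p.2.1 * p.2.2.2) + -p.2.1 * ((1 - p.1) / (p.2.2.1 *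
      p.2.1 * p.2.2.2)) * (-p.2.2.1 * ((1 - p.1) / (p.2.2.1 * p.2.1 * p.2.2.2))) = (1 - p.1) * (1 +
      (p.2.2.2 - p.1)) / (p.2.2.1 * p.2.1 * p.2.2.2 ^ 2) := fun p hp => by
    obtain ⟨n1, n2, n3, n4, n5, n6⟩ := nT p hp
    have n8 := t8.ne_zero hp
    generalize h1 : 1 + (p.2.2.2 - p.1) = u1 at n8 ⊢
    generalize h2 : 1 - p.1 = u2 at n2 ⊢
    field_simp
    subst h1 h2
    ring
  have t9 := ((t2.mul t8).div ((t4.mul t3).mul (t5.pow 2))).congr et1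
  -- Modulo `𝔭` both punctured variables become `z/(z + ab)`, and the product of the other two is
  -- `ab/z²`; this gives `ab/(z + ab)²`.
  refine avg_summand_bij (t := fun p => 1 / (p.2.1 + p.2.2.2 * p.2.2.1)) hϖ hχ hcond hN hS hT
    (hf.mono fun p hp => hp.1) (fun p => (1 - p.2.2.2 * p.2.2.1 * (1 + p.1) / (p.2.1 + p.2.2.2 *
      p.2.2.1), -p.2.2.2 / p.2.1, -p.2.2.1 / p.2.1, 1 - (p.2.2.2 * p.2.2.1 - p.2.1 * p.1) / (p.2.1 +
      p.2.2.2 * p.2.2.1)))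
    (fun p => (p.2.2.2 - p.1, (1 - p.1) / (p.2.2.1 * p.2.1 * p.2.2.2), -p.2.2.1 *
      ((1 - p.1) / (p.2.2.1 * p.2.1 * p.2.2.2)), -p.2.1 * ((1 - p.1) / (p.2.2.1 * p.2.1 *
      p.2.2.2))))
    (nonExp4 s10.1 (s3.1.neg.div s4) (s2.1.neg.div s4) s11.1)
    (nonExp4 t7.1 (t2.1.div ((t4.mul t3).mul t5)) (t4.1.neg.mul (t2.1.div ((t4.mul t3).mul t5)))
      (t3.1.neg.mul (t2.1.div ((t4.mul t3).mul t5))))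
    (fun p hp => ⟨⟨mem_punctured_iff.2 ⟨(s10).2 p hp, (s8).2 p hp⟩, (s3.neg.div s4).2 p hp,
      (s2.neg.div s4).2 p hp, mem_punctured_iff.2 ⟨(s11).2 p hp, (s9).2 p hp⟩⟩, (s12).2 p hp⟩)
    (fun p hp => ⟨⟨⟨(t7).2 p hp, ((t2.1.div ((t4.mul t3).mul t5)).mem_ringInt hT) p hp,
      (t4.neg.mul (t2.div ((t4.mul t3).mul t5))).2 p hp, (t3.neg.mul (t2.div ((t4.mul t3).mul
      t5))).2 p hp⟩, (t2.div ((t4.mul t3).mul t5)).2 p hp⟩, (t9).2 p hp⟩) ?_ ?_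
    (s3.mul s2) (UnitOn.one.div s5)
    (((s1.mul hS ((s3.1.mul s2.1).mul (nonExp₂.sub ((s3.1.mul s2.1).mul s6.1)))).div (s4.mul (s5.pow
      2))).congr fun p hp => ?_) ?_
  · intro p hp
    obtain ⟨n2, n3, n4, n5⟩ := nS p hp
    have n6 := s6.ne_zero hp
    refine Prod.ext ?_ (Prod.ext ?_ (Prod.ext ?_ ?_)) <;> dsimp only
    all_goals try simp only [es5 p hp]
    all_goals generalize h1 : p.2.1 + p.2.2.2 * p.2.2.1 = u1 at n5 ⊢
    all_goals generalize h2 : 1 + p.1 = u2 at n6 ⊢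
    all_goals try field_simp
    all_goals subst h1 h2
    all_goals ring
  · intro p hp
    obtain ⟨n1, n2, n3, n4, n5, n6⟩ := nT p hp
    have n8 := t8.ne_zero hp
    refine Prod.ext ?_ (Prod.ext ?_ (Prod.ext ?_ ?_)) <;> dsimp only
    all_goals try simp only [et1 p hp]
    all_goals generalize h1 : 1 + (p.2.2.2 - p.1) = u1 at n8 ⊢
    all_goals generalize h2 : 1 - p.1 = u2 at n2 ⊢
    all_goals generalize h3 : 1 - p.2.2.2 = u3 at n6 ⊢
    all_goals try field_simp
    all_goals subst h1 h2 h3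
    all_goals ring
  · obtain ⟨n2, n3, n4, n5⟩ := nS p hp
    have n6 := s6.ne_zero hp
    dsimp only
    generalize h1 : p.2.1 + p.2.2.2 * p.2.2.1 = u1 at n5 ⊢
    generalize h2 : 1 + p.1 = u2 at n6 ⊢
    field_simp
    subst h1 h2
    ring
  · intro p hp
    obtain ⟨s, hs, e⟩ := hϖ.mem_maxIdeal_iff.1 (s1.2 p hp)
    exact eltA_apply_eq_elt2 hϖ hv (s4.2 p hp) (s2.2 p hp) (s3.2 p hp) (s5.2 p hp) (s6.2 p hp) (s7.2
        p hp) hs (max_ring (s1.2 p hp))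
      rfl rfl e rfl

/-- Here `1 - x = -z` in the coordinate of `T¹³`, so the part with `x ∈ 1 + 𝔭` is covered. -/
theorem avg_trmA_eq_trm13 (hϖ : IsUniformizer ϖ) (hχ : χ.IsQuadratic)
    (hcond : HasConductorPrime χ) (hv : v ∈ paramodularVectors ρ ϖ 0) (hN : 1 ≤ N)
    (hf : InvOn ϖ N (boxOUUU F) (trm13 ϖ χ ρ v)) :
    avg hϖ N (sepM (boxOOUU F) fun p => p.2.1) (trmA ϖ χ ρ v (t4 ϖ) 3) =
      avg hϖ N (sepM (boxOUUU F) fun p => 1 - p.2.1) (trm13 ϖ χ ρ v) := by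
  have hS := (adm_boxOOUU hϖ).sepM hϖ (nonExp₂)
  have hT := (adm_boxOUUU hϖ).sepM hϖ (NonExp.one.sub nonExp₂)
  change avg (V := V) hϖ N ?S _ = avg (V := V) hϖ N ?T _
  set S := ?S
  set T := ?T
  have s1 : UnitOn ϖ S fun p => p.2.2.1 := ⟨nonExp₃, fun p hp => hp.1.2.2.1⟩
  have s2 : UnitOn ϖ S fun p => p.2.2.2 := ⟨nonExp₄, fun p hp => hp.1.2.2.2⟩
  have s3 : MaxOn ϖ S fun p => p.2.1 := ⟨nonExp₂, fun p hp => hp.2⟩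
  have nS : ∀ p ∈ S, p.2.2.1 ≠ 0 ∧ p.2.2.2 ≠ 0 :=
    fun p hp => ⟨s1.ne_zero hp, s2.ne_zero hp⟩
  have s4 : UnitOn ϖ S fun p => p.2.2.2 * p.2.2.1 + p.2.1 := (s2.mul s1).add s3
  have es1 : ∀ p ∈ S, 1 - (1 + p.2.1) = -p.2.1 := fun p hp => by
    obtain ⟨n1, n2⟩ := nS p hp
    have n4 := s4.ne_zero hp
    field_simp
    ring
  have s5 := (s3.neg).congr es1
  have t1 : UnitOn ϖ T fun p => p.2.1 := ⟨nonExp₂, fun p hp => hp.1.2.1⟩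
  have t2 : UnitOn ϖ T fun p => p.2.2.1 := ⟨nonExp₃, fun p hp => hp.1.2.2.1⟩
  have t3 : UnitOn ϖ T fun p => p.2.2.2 := ⟨nonExp₄, fun p hp => hp.1.2.2.2⟩
  have t4 : MaxOn ϖ T fun p => 1 - p.2.1 := ⟨NonExp.one.sub t1.1, fun p hp => hp.2⟩
  have nT : ∀ p ∈ T, p.2.1 ≠ 0 ∧ p.2.2.1 ≠ 0 ∧ p.2.2.2 ≠ 0 :=
    fun p hp => ⟨t1.ne_zero hp, t2.ne_zero hp, t3.ne_zero hp⟩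
  have et1 : ∀ p ∈ T, p.2.1 - 1 = -(1 - p.2.1) := fun p hp => by
    obtain ⟨n1, n2, n3⟩ := nT p hp
    field_simp
    ring
  have t5 := (t4.neg).congr et1
  have et2 : ∀ p ∈ T, -1 / p.2.2.2 * (-p.2.2.2 * (1 / p.2.2.1 - (p.2.1 - 1))) + (p.2.1 - 1) =
      1 / p.2.2.1 := fun p hp => by
    obtain ⟨n1, n2, n3⟩ := nT p hp
    field_simp
    ring
  have t6 := (UnitOn.one.div t2).congr et2
  refine avg_summand_bij (t := fun p => 1 / (p.2.2.2 * p.2.2.1)) hϖ hχ hcond hN hS hT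
    (hf.mono fun p hp => hp.1) (fun p => (p.1, 1 + p.2.1, 1 / (p.2.2.2 * p.2.2.1 + p.2.1),
      -1 / p.2.2.2))
    (fun p => (p.1, p.2.1 - 1, -p.2.2.2 * (1 / p.2.2.1 - (p.2.1 - 1)), -1 / p.2.2.2))
    (nonExp4 nonExp₁ (NonExp.one.add nonExp₂) (NonExp.one.div s4) (NonExp.one.neg.div s2))
    (nonExp4 nonExp₁ t5.1 (t3.1.neg.mul ((NonExp.one.div t2).sub t5.1)) (NonExp.one.neg.div t3))
    (fun p hp => ⟨⟨((nonExp₁).mem_ringInt hS) p hp, (UnitOn.one.add s3).2 p hp,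
      (UnitOn.one.div s4).2 p hp, (UnitOn.one.neg.div s2).2 p hp⟩, (s5).2 p hp⟩)
    (fun p hp => ⟨⟨((nonExp₁).mem_ringInt hT) p hp, ((t5.1).mem_ringInt hT) p hp,
      (t3.neg.mul ((UnitOn.one.div t2).sub t5)).2 p hp, (UnitOn.one.neg.div t3).2 p hp⟩,
      (t5).2 p hp⟩) ?_ ?_
    (s2.mul s1) (UnitOn.one.div (s2.mul s1))
    (((s3.mul hS ((s2.1.mul s1.1).sub NonExp.one)).div (s4.mul (s2.mul s1))).congr fun p hp =>
      ?_) ?_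
  · intro p hp
    obtain ⟨n1, n2⟩ := nS p hp
    have n4 := s4.ne_zero hp
    refine Prod.ext ?_ (Prod.ext ?_ (Prod.ext ?_ ?_)) <;> dsimp only
    all_goals generalize h1 : p.2.2.2 * p.2.2.1 + p.2.1 = u1 at n4 ⊢
    all_goals try field_simp
    all_goals subst h1
    all_goals ring
  · intro p hp
    obtain ⟨n1, n2, n3⟩ := nT p hp
    refine Prod.ext ?_ (Prod.ext ?_ (Prod.ext ?_ ?_)) <;> dsimp only
    all_goals try simp only [et2 p hp]
    all_goals try field_simp
    all_goals ring
  · obtain ⟨n1, n2⟩ := nS p hp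
    have n4 := s4.ne_zero hp
    dsimp only
    generalize h1 : p.2.2.2 * p.2.2.1 + p.2.1 = u1 at n4 ⊢
    field_simp
    subst h1
    ring
  · intro p hp
    obtain ⟨s, hs, e⟩ := hϖ.mem_maxIdeal_iff.1 (s3.2 p hp)
    exact eltA_apply_eq_elt13 hϖ hv (s1.2 p hp) (s2.2 p hp) (s4.2 p hp) hs e rfl

/-- For the coordinate `-z/(ab)` the complement to 1 is `(z + ab)/(ab)`. The two unit conditions
thus say exactly that it avoids `1 + 𝔭`, and all of `T¹²` is covered. -/
theorem avg_trmC_eq_trm12 (hϖ : IsUniformizer ϖ) (hχ : χ.IsQuadratic)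
    (hcond : HasConductorPrime χ) (hv : v ∈ paramodularVectors ρ ϖ 0) (hN : 1 ≤ N)
    (hf : InvOn ϖ N (boxPOUU F) (trm12 ϖ χ ρ v)) :
    avg hϖ N (sepU (sepU (boxOOUU F) fun p => p.1)
          fun p => p.1 + p.2.2.2 * p.2.2.1) (trmC ϖ χ ρ v (t4 ϖ) 3) =
      avg hϖ N (boxPOUU F) (trm12 ϖ χ ρ v) := by
  have hS := ((adm_boxOOUU hϖ).sepU hϖ (nonExp₁)).sepU hϖ (nonExp₁.add (nonExp₄.mul nonExp₃))
  have hT := adm_boxPOUU hϖ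
  change avg (V := V) hϖ N ?S _ = avg (V := V) hϖ N ?T _
  set S := ?S
  set T := ?T
  have s1 : UnitOn ϖ S fun p => p.2.2.1 := ⟨nonExp₃, fun p hp => hp.1.1.2.2.1⟩
  have s2 : UnitOn ϖ S fun p => p.2.2.2 := ⟨nonExp₄, fun p hp => hp.1.1.2.2.2⟩
  have s3 : UnitOn ϖ S fun p => p.1 := ⟨nonExp₁, fun p hp => hp.1.2⟩
  have s4 : UnitOn ϖ S fun p => p.1 + p.2.2.2 * p.2.2.1 := ⟨nonExp₁.add (s2.1.mul s1.1), fun p hp =>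
      hp.2⟩
  have nS : ∀ p ∈ S, p.2.2.1 ≠ 0 ∧ p.2.2.2 ≠ 0 ∧ p.1 ≠ 0 ∧ p.1 + p.2.2.2 * p.2.2.1 ≠ 0 :=
    fun p hp => ⟨s1.ne_zero hp, s2.ne_zero hp, s3.ne_zero hp, s4.ne_zero hp⟩
  have es1 : ∀ p ∈ S, 1 - -p.1 / (p.2.2.2 * p.2.2.1) = (p.1 + p.2.2.2 * p.2.2.1) / (p.2.2.2 *
      p.2.2.1) := fun p hp => by
    obtain ⟨n1, n2, n3, n4⟩ := nS p hp
    generalize h1 : p.1 + p.2.2.2 * p.2.2.1 = u1 at n4 ⊢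
    field_simp
    subst h1
    ring
  have s5 := (s4.div (s2.mul s1)).congr es1
  have t1 : UnitOn ϖ T fun p => p.1 := ⟨nonExp₁, fun p hp => (mem_punctured_iff.1 hp.1).1⟩
  have t2 : UnitOn ϖ T fun p => 1 - p.1 := ⟨.sub .one nonExp₁, fun p hp =>
      (mem_punctured_iff.1 hp.1).2⟩
  have t3 : UnitOn ϖ T fun p => p.2.2.1 := ⟨nonExp₃, fun p hp => hp.2.2.1⟩
  have t4 : UnitOn ϖ T fun p => p.2.2.2 := ⟨nonExp₄, fun p hp => hp.2.2.2⟩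
  have nT : ∀ p ∈ T, p.1 ≠ 0 ∧ 1 - p.1 ≠ 0 ∧ p.2.2.1 ≠ 0 ∧ p.2.2.2 ≠ 0 :=
    fun p hp => ⟨t1.ne_zero hp, t2.ne_zero hp, t3.ne_zero hp, t4.ne_zero hp⟩
  have et1 : ∀ p ∈ T, -1 / (p.2.2.2 * p.2.2.1 * (1 - p.1)) + -1 / (p.2.2.2 * p.1) * (-1 / (p.2.2.1 *
      (1 - p.1))) = 1 / (p.2.2.2 * p.2.2.1 * p.1) := fun p hp => by
    obtain ⟨n1, n2, n3, n4⟩ := nT p hp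
    generalize h1 : 1 - p.1 = u1 at n2 ⊢
    field_simp
    subst h1
    ring
  have t5 := (UnitOn.one.div ((t4.mul t3).mul t1)).congr et1
  refine avg_summand_bij (t := fun p => 1 / (p.2.2.2 * p.2.2.1)) hϖ hχ hcond hN hS hT
    hf (fun p => (-p.1 / (p.2.2.2 * p.2.2.1), (p.2.2.1 * p.2.1 + p.2.2.2 * (ϖ : F)) / p.1,
        -p.2.2.2 / (p.1 + p.2.2.2 * p.2.2.1), p.2.2.1 / p.1))
    (fun p => (-1 / (p.2.2.2 * p.2.2.1 * (1 - p.1)), p.2.1 / p.2.2.2 - p.2.2.1 * (1 - p.1) *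
      (ϖ : F) / (p.2.2.2 * p.1), -1 / (p.2.2.1 * (1 - p.1)), -1 / (p.2.2.2 * p.1)))
    (nonExp4 (nonExp₁.neg.div (s2.mul s1)) (((s1.1.mul nonExp₂).add (s2.1.mul ((NonExp.varpi
      hϖ)))).div s3) (s2.1.neg.div s4) (s1.1.div s3))
    (nonExp4 (NonExp.one.neg.div ((t4.mul t3).mul t2)) ((nonExp₂.div t4).sub (((t3.1.mul t2.1).mul
      ((NonExp.varpi hϖ))).div (t4.mul t1))) (NonExp.one.neg.div (t3.mul t2)) (NonExp.one.neg.div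
      (t4.mul t1)))
    (fun p hp => ⟨mem_punctured_iff.2 ⟨(s3.neg.div (s2.mul s1)).2 p hp, (s5).2 p hp⟩,
      ((((s1.1.mul nonExp₂).add (s2.1.mul ((NonExp.varpi hϖ)))).div s3).mem_ringInt hS) p hp,
      (s2.neg.div s4).2 p hp, (s1.div s3).2 p hp⟩)
    (fun p hp => ⟨⟨⟨((NonExp.one.neg.div ((t4.mul t3).mul t2)).mem_ringInt hT) p hp,
      (((nonExp₂.div t4).sub (((t3.1.mul t2.1).mul ((NonExp.varpi hϖ))).div (t4.mul
      t1))).mem_ringInt hT) p hp, (UnitOn.one.neg.div (t3.mul t2)).2 p hp,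
      (UnitOn.one.neg.div (t4.mul t1)).2 p hp⟩, (UnitOn.one.neg.div ((t4.mul t3).mul t2)).2 p hp⟩,
      (t5).2 p hp⟩) ?_ ?_
    (s2.mul s1) (UnitOn.one.div (s2.mul s1))
    ((MaxOn.zero).congr fun p hp => ?_) ?_
  · intro p hp
    obtain ⟨n1, n2, n3, n4⟩ := nS p hp
    refine Prod.ext ?_ (Prod.ext ?_ (Prod.ext ?_ ?_)) <;> dsimp only
    all_goals try simp only [es1 p hp]
    all_goals generalize h1 : p.1 + p.2.2.2 * p.2.2.1 = u1 at n4 ⊢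
    all_goals try field_simp
    all_goals subst h1
    all_goals ring
  · intro p hp
    obtain ⟨n1, n2, n3, n4⟩ := nT p hp
    refine Prod.ext ?_ (Prod.ext ?_ (Prod.ext ?_ ?_)) <;> dsimp only
    all_goals try simp only [et1 p hp]
    all_goals generalize h1 : 1 - p.1 = u1 at n2 ⊢
    all_goals try field_simp
    all_goals subst h1
    all_goals ring
  · obtain ⟨n1, n2, n3, n4⟩ := nS p hp
    dsimp only
    generalize h1 : p.1 + p.2.2.2 * p.2.2.1 = u1 at n4 ⊢
    field_simp
    subst h1
    ring
  · intro p hp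
    exact eltC_apply_eq_elt12 hϖ hv (s3.2 p hp) (s1.2 p hp) (s2.2 p hp) (s4.2 p hp) rfl

/-- The quantity `z + ab ∈ 𝔭` becomes a coordinate on which the element of `T⁴` does not depend. The
variable `x`, free in `𝔬`, passes to the last variable of `T⁴`. -/
theorem avg_trmC_eq_trm4 (hϖ : IsUniformizer ϖ) (hχ : χ.IsQuadratic)
    (hcond : HasConductorPrime χ) (hv : v ∈ paramodularVectors ρ ϖ 0) (hN : 1 ≤ N)
    (hf : InvOn ϖ N (maxIdeal F ×ˢ unitInt F ×ˢ unitInt F ×ˢ ringInt F) (trm4 ϖ χ ρ v)) :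
    avg hϖ N (sepM (sepU (boxOOUU F) fun p => p.1)
          fun p => p.1 + p.2.2.2 * p.2.2.1) (trmC ϖ χ ρ v (t4 ϖ) 3) =
      avg hϖ N (maxIdeal F ×ˢ unitInt F ×ˢ unitInt F ×ˢ ringInt F) (trm4 ϖ χ ρ v) := by
  have hS := ((adm_boxOOUU hϖ).sepU hϖ (nonExp₁)).sepM hϖ (nonExp₁.add (nonExp₄.mul nonExp₃))
  have hT := adm_prod (admF_maxIdeal hϖ) (admF_unitInt hϖ) (admF_unitInt hϖ) admF_ringInt
  change avg (V := V) hϖ N ?S _ = avg (V := V) hϖ N ?T _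
  set S := ?S
  set T := ?T
  have s1 : UnitOn ϖ S fun p => p.2.2.1 := ⟨nonExp₃, fun p hp => hp.1.1.2.2.1⟩
  have s2 : UnitOn ϖ S fun p => p.2.2.2 := ⟨nonExp₄, fun p hp => hp.1.1.2.2.2⟩
  have s3 : UnitOn ϖ S fun p => p.1 := ⟨nonExp₁, fun p hp => hp.1.2⟩
  have s4 : MaxOn ϖ S fun p => p.1 + p.2.2.2 * p.2.2.1 := ⟨nonExp₁.add (s2.1.mul s1.1), fun p hp =>
      hp.2⟩
  have nS : ∀ p ∈ S, p.2.2.1 ≠ 0 ∧ p.2.2.2 ≠ 0 ∧ p.1 ≠ 0 :=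
    fun p hp => ⟨s1.ne_zero hp, s2.ne_zero hp, s3.ne_zero hp⟩
  have t1 : MaxOn ϖ T fun p => p.1 := ⟨nonExp₁, fun p hp => hp.1⟩
  have t2 : UnitOn ϖ T fun p => p.2.1 := ⟨nonExp₂, fun p hp => hp.2.1⟩
  have t3 : UnitOn ϖ T fun p => p.2.2.1 := ⟨nonExp₃, fun p hp => hp.2.2.1⟩
  have nT : ∀ p ∈ T, p.2.1 ≠ 0 ∧ p.2.2.1 ≠ 0 :=
    fun p hp => ⟨t2.ne_zero hp, t3.ne_zero hp⟩
  have et1 : ∀ p ∈ T, -1 / p.2.2.1 + -(1 + p.1 * p.2.2.1) / p.2.1 * (-p.2.1 / p.2.2.1) = p.1 :=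
      fun p hp => by
    obtain ⟨n2, n3⟩ := nT p hp
    field_simp
    ring
  have t4 := (t1).congr et1
  refine avg_summand_bij (t := fun p => 1 / (p.2.2.2 * p.2.2.1)) hϖ hχ hcond hN hS hT
    hf (fun p => (p.1 + p.2.2.2 * p.2.2.1, p.2.2.1 / p.1, -1 / p.1, (p.2.2.2 * (ϖ : F) + p.2.1 *
        p.2.2.1) / p.1))
    (fun p => (-1 / p.2.2.1, p.2.2.2 / p.2.1 - p.2.2.1 * (1 + p.1 * p.2.2.1) * (ϖ : F) / p.2.1 ^ 2,
      -p.2.1 / p.2.2.1, -(1 + p.1 * p.2.2.1) / p.2.1))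
    (nonExp4 s4.1 (s1.1.div s3) (NonExp.one.neg.div s3) (((s2.1.mul ((NonExp.varpi hϖ))).add
      (nonExp₂.mul s1.1)).div s3))
    (nonExp4 (NonExp.one.neg.div t3) ((nonExp₄.div t2).sub (((t3.1.mul (NonExp.one.add (t1.1.mul
      t3.1))).mul ((NonExp.varpi hϖ))).div (t2.pow 2))) (t2.1.neg.div t3) (((NonExp.one.add
      (t1.1.mul t3.1)).neg).div t2))
    (fun p hp => ⟨(s4).2 p hp, (s1.div s3).2 p hp, (UnitOn.one.neg.div s3).2 p hp,
      ((((s2.1.mul ((NonExp.varpi hϖ))).add (nonExp₂.mul s1.1)).div s3).mem_ringInt hS) p hp⟩)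
    (fun p hp => ⟨⟨⟨((NonExp.one.neg.div t3).mem_ringInt hT) p hp,
      (((nonExp₄.div t2).sub (((t3.1.mul (NonExp.one.add (t1.1.mul t3.1))).mul ((NonExp.varpi
      hϖ))).div (t2.pow 2))).mem_ringInt hT) p hp, (t2.neg.div t3).2 p hp,
      (((UnitOn.one.add (t1.mul hT t3.1)).neg).div t2).2 p hp⟩, (UnitOn.one.neg.div t3).2 p hp⟩,
      (t4).2 p hp⟩) ?_ ?_
    (s2.mul s1) (UnitOn.one.div (s2.mul s1))
    (((s4.div (s3.mul (s2.mul s1))).neg).congr fun p hp => ?_) ?_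
  · intro p hp
    obtain ⟨n1, n2, n3⟩ := nS p hp
    refine Prod.ext ?_ (Prod.ext ?_ (Prod.ext ?_ ?_)) <;> dsimp only
    all_goals try field_simp
    all_goals ring
  · intro p hp
    obtain ⟨n2, n3⟩ := nT p hp
    refine Prod.ext ?_ (Prod.ext ?_ (Prod.ext ?_ ?_)) <;> dsimp only
    all_goals try field_simp
    all_goals ring
  · obtain ⟨n1, n2, n3⟩ := nS p hp
    dsimp only
    field_simp
    ring
  · intro p hp
    obtain ⟨s, hs, e⟩ := hϖ.mem_maxIdeal_iff.1 (s4.2 p hp)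
    exact eltC_apply_eq_elt4 hϖ hv (s3.2 p hp) (s1.2 p hp) (s2.2 p hp) hs
      ((nonExp₂.mem_ringInt hS) p hp) (eq_sub_of_add_eq e)

/-- Here `z ∈ 𝔭` becomes the dummy coordinate, and `x` is reflected and translated within `𝔬`. -/
theorem avg_trmC_eq_trm14 (hϖ : IsUniformizer ϖ) (hχ : χ.IsQuadratic)
    (hcond : HasConductorPrime χ) (hv : v ∈ paramodularVectors ρ ϖ 0) (hN : 1 ≤ N)
    (hf : InvOn ϖ N (boxMOUU F) (trm14 ϖ χ ρ v)) :
    avg hϖ N (sepM (boxOOUU F) fun p => p.1) (trmC ϖ χ ρ v (t4 ϖ) 3) =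
      avg hϖ N (boxMOUU F) (trm14 ϖ χ ρ v) := by
  have hS := (adm_boxOOUU hϖ).sepM hϖ (nonExp₁)
  have hT := adm_boxMOUU hϖ
  change avg (V := V) hϖ N ?S _ = avg (V := V) hϖ N ?T _
  set S := ?S
  set T := ?T
  have s1 : UnitOn ϖ S fun p => p.2.2.1 := ⟨nonExp₃, fun p hp => hp.1.2.2.1⟩
  have s2 : UnitOn ϖ S fun p => p.2.2.2 := ⟨nonExp₄, fun p hp => hp.1.2.2.2⟩
  have s3 : MaxOn ϖ S fun p => p.1 := ⟨nonExp₁, fun p hp => hp.2⟩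
  have nS : ∀ p ∈ S, p.2.2.1 ≠ 0 ∧ p.2.2.2 ≠ 0 :=
    fun p hp => ⟨s1.ne_zero hp, s2.ne_zero hp⟩
  have s4 : UnitOn ϖ S fun p => p.2.2.2 * p.2.2.1 + p.1 := (s2.mul s1).add s3
  have t1 : MaxOn ϖ T fun p => p.1 := ⟨nonExp₁, fun p hp => hp.1⟩
  have t2 : UnitOn ϖ T fun p => p.2.2.1 := ⟨nonExp₃, fun p hp => hp.2.2.1⟩
  have t3 : UnitOn ϖ T fun p => p.2.2.2 := ⟨nonExp₄, fun p hp => hp.2.2.2⟩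
  have nT : ∀ p ∈ T, p.2.2.1 ≠ 0 ∧ p.2.2.2 ≠ 0 :=
    fun p hp => ⟨t2.ne_zero hp, t3.ne_zero hp⟩
  have et1 : ∀ p ∈ T, p.2.2.2 / p.2.2.1 * ((1 - p.1 * p.2.2.1) / p.2.2.2) + p.1 = 1 / p.2.2.1 :=
      fun p hp => by
    obtain ⟨n2, n3⟩ := nT p hp
    field_simp
    ring
  have t4 := (UnitOn.one.div t2).congr et1
  refine avg_summand_bij (t := fun p => 1 / (p.2.2.2 * p.2.2.1)) hϖ hχ hcond hN hS hT
    hf (fun p => (p.1, -(p.2.1 + p.2.2.2 ^ 2 * (ϖ : F) / (p.2.2.2 * p.2.2.1 + p.1)), 1 / (p.2.2.2 *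
        p.2.2.1 + p.1), p.2.2.2 / (p.2.2.2 * p.2.2.1 + p.1)))
    (fun p => (p.1, -p.2.1 - p.2.2.2 ^ 2 * (ϖ : F) / p.2.2.1, (1 - p.1 * p.2.2.1) / p.2.2.2,
      p.2.2.2 / p.2.2.1))
    (nonExp4 nonExp₁ ((nonExp₂.add (((s2.1.pow 2).mul ((NonExp.varpi hϖ))).div s4)).neg)
      (NonExp.one.div s4) (s2.1.div s4))
    (nonExp4 t1.1 (nonExp₂.neg.sub (((t3.1.pow 2).mul ((NonExp.varpi hϖ))).div t2)) ((NonExp.one.sub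
      (t1.1.mul t2.1)).div t3) (t3.1.div t2))
    (fun p hp => ⟨(s3).2 p hp, (((nonExp₂.add (((s2.1.pow 2).mul ((NonExp.varpi hϖ))).div
      s4)).neg).mem_ringInt hS) p hp, (UnitOn.one.div s4).2 p hp, (s2.div s4).2 p hp⟩)
    (fun p hp => ⟨⟨((t1.1).mem_ringInt hT) p hp, ((nonExp₂.neg.sub (((t3.1.pow 2).mul ((NonExp.varpi
      hϖ))).div t2)).mem_ringInt hT) p hp, ((UnitOn.one.sub (t1.mul hT t2.1)).div t3).2 p hp,
      (t3.div t2).2 p hp⟩, (t1).2 p hp⟩) ?_ ?_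
    (s2.mul s1) (UnitOn.one.div (s2.mul s1))
    (((s3.div (s4.mul (s2.mul s1))).neg).congr fun p hp => ?_) ?_
  · intro p hp
    obtain ⟨n1, n2⟩ := nS p hp
    have n4 := s4.ne_zero hp
    refine Prod.ext ?_ (Prod.ext ?_ (Prod.ext ?_ ?_)) <;> dsimp only
    all_goals generalize h1 : p.2.2.2 * p.2.2.1 + p.1 = u1 at n4 ⊢
    all_goals try field_simp
    all_goals subst h1
    all_goals ring
  · intro p hp
    obtain ⟨n2, n3⟩ := nT p hp
    refine Prod.ext ?_ (Prod.ext ?_ (Prod.ext ?_ ?_)) <;> dsimp only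
    all_goals try simp only [et1 p hp]
    all_goals try field_simp
    all_goals ring
  · obtain ⟨n1, n2⟩ := nS p hp
    have n4 := s4.ne_zero hp
    dsimp only
    generalize h1 : p.2.2.2 * p.2.2.1 + p.1 = u1 at n4 ⊢
    field_simp
    subst h1
    ring
  · intro p hp
    obtain ⟨s, hs, e⟩ := hϖ.mem_maxIdeal_iff.1 (s3.2 p hp)
    exact eltC_apply_eq_elt14 hϖ hv (s1.2 p hp) (s2.2 p hp) (s4.2 p hp) hs e rfl

end Bijections

/-! ### Auxiliary coordinates for the B form with `z ∈ 𝔭` -/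

section Summands

variable {F : Type*} [Field F] [ValuativeRel F] {V : Type*} [AddCommGroup V] [Module ℂ V]
  (ϖ : Fˣ) (χ : MulChar F ℂ) (ρ : Representation ℂ (GSp4 F) V) (v : V)

/-- `trmB` after a translation of the third variable. -/
def trmD : F × F × F × F → V :=
  summand χ ρ v (fun p => p.2.2.2 * (p.2.2.1 - p.1 / p.2.2.2)) fun p =>
      eltB ϖ (t4 ϖ) 3 p.1 p.2.1 (p.2.2.1 - p.1 / p.2.2.2) p.2.2.2

/-- `trmB` in terms of a new first variable replacing the third one. -/
def trmE : F × F × F × F → V :=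
  summand χ ρ v (fun p => p.2.2.2 * ((p.1 - p.2.2.2) / p.2.2.1 - p.2.1 / p.2.2.2)) fun p =>
      eltB ϖ (t4 ϖ) 3 p.2.1 p.2.2.1 ((p.1 - p.2.2.2) / p.2.2.1 - p.2.1 / p.2.2.2) p.2.2.2

end Summands

/-! ### Substitutions for the B form with `t₄` -/

section Bijections

variable {F : Type*} [Field F] [ValuativeRel F] [TopologicalSpace F]
  [IsNonarchimedeanLocalField F] {ϖ : Fˣ} {χ : MulChar F ℂ}
  {V : Type*} [AddCommGroup V] [Module ℂ V] {ρ : Representation ℂ (GSp4 F) V} {v : V} {N : ℕ}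

/-! Abbreviations for the expressions that govern the substitutions. -/

local notation "𝔲(" p ")" => (p.2.2.2 + p.2.1 * p.2.2.1)
local notation "𝔳(" p ")" => (p.1 + p.2.2.2 * p.2.2.1)
local notation "𝔴(" p ")" => (p.2.1 * p.1 + p.2.2.2 * 𝔲(p))

-- These serve `T³`. On the source, `𝔩` and `𝔵` are the `l` and `c` of the coset identity and `𝔞`,
-- `𝔟` its conjugated coordinates. On the target, whose first coordinate is `l`, `𝔨` recovers `𝔵`;
-- then `𝔱 = b - la` is the old `-1/z` and `𝔰 = a - lk` the old `b/z`. The remaining source variable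
-- `a` is `𝔰/𝔡`.
local notation "𝔵(" p ")" => (-p.2.2.1 * 𝔳(p) / (p.2.2.2 * p.1))
local notation "𝔩(" p ")" => (-𝔲(p) / p.1)
local notation "𝔞(" p ")" => (p.2.2.1 / p.1 + 𝔩(p) * 𝔵(p))
local notation "𝔟(" p ")" => (-1 / p.1 + 𝔩(p) * 𝔞(p))
local notation "𝔨(" p ")" => (p.2.1 * p.2.2.2 ^ 2 / p.2.2.1)
local notation "𝔰(" p ")" => (p.2.2.2 - p.1 * 𝔨(p))
local notation "𝔱(" p ")" => (p.2.2.1 - p.1 * p.2.2.2)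
local notation "𝔡(" p ")" => (𝔱(p) * 𝔨(p) - 𝔰(p) ^ 2)

/-- The vanishing of `z + ab` modulo `𝔭` makes it the dummy coordinate. Now `b + ax` becomes `-((z +
ab) + xb²)/z²`, a unit, so this is the part of `T⁵` that the A form misses. -/
theorem avg_trmB_eq_trm5 (hϖ : IsUniformizer ϖ) (hχ : χ.IsQuadratic)
    (hcond : HasConductorPrime χ) (hv : v ∈ paramodularVectors ρ ϖ 0) (hN : 1 ≤ N)
    (hf : InvOn ϖ N (boxMOUU F) (trm5 ϖ χ ρ v)) :
    avg hϖ N (sepM (sepU (boxOUUU F) fun p => p.1)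
          fun p => 𝔳(p)) (trmB ϖ χ ρ v (t4 ϖ) 3) =
      avg hϖ N (sepU (boxMOUU F) fun p => p.2.2.1 + p.2.2.2 * p.2.1) (trm5 ϖ χ ρ v) := by
  have hS := ((adm_boxOUUU hϖ).sepU hϖ (nonExp₁)).sepM hϖ (nonExp₁.add (nonExp₄.mul nonExp₃))
  have hT := (adm_boxMOUU hϖ).sepU hϖ (nonExp₃.add (nonExp₄.mul nonExp₂))
  change avg (V := V) hϖ N ?S _ = avg (V := V) hϖ N ?T _
  set S := ?S
  set T := ?T
  have s1 : UnitOn ϖ S fun p => p.2.1 := ⟨nonExp₂, fun p hp => hp.1.1.2.1⟩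
  have s2 : UnitOn ϖ S fun p => p.2.2.1 := ⟨nonExp₃, fun p hp => hp.1.1.2.2.1⟩
  have s3 : UnitOn ϖ S fun p => p.2.2.2 := ⟨nonExp₄, fun p hp => hp.1.1.2.2.2⟩
  have s4 : UnitOn ϖ S fun p => p.1 := ⟨nonExp₁, fun p hp => hp.1.2⟩
  have s5 : MaxOn ϖ S fun p => 𝔳(p) := ⟨nonExp₁.add (s3.1.mul s2.1), fun p hp => hp.2⟩
  have nS : ∀ p ∈ S, p.2.1 ≠ 0 ∧ p.2.2.1 ≠ 0 ∧ p.2.2.2 ≠ 0 ∧ p.1 ≠ 0 :=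
    fun p hp => ⟨s1.ne_zero hp, s2.ne_zero hp, s3.ne_zero hp, s4.ne_zero hp⟩
  have es1 : ∀ p ∈ S, -1 / p.1 + p.2.2.1 / p.1 * (-𝔲(p) / p.1) = -((𝔳(p) + p.2.1 *
      p.2.2.1 ^ 2) / p.1 ^ 2) := fun p hp => by
    obtain ⟨n1, n2, n3, n4⟩ := nS p hp
    field_simp
    ring
  have s6 := (((s5.add_unit (s1.mul (s2.pow 2))).div (s4.pow 2)).neg).congr es1
  have t1 : MaxOn ϖ T fun p => p.1 := ⟨nonExp₁, fun p hp => hp.1.1⟩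
  have t2 : UnitOn ϖ T fun p => p.2.2.1 := ⟨nonExp₃, fun p hp => hp.1.2.2.1⟩
  have t3 : UnitOn ϖ T fun p => p.2.2.2 := ⟨nonExp₄, fun p hp => hp.1.2.2.2⟩
  have t4 : UnitOn ϖ T fun p => p.2.2.1 + p.2.2.2 * p.2.1 := ⟨t2.1.add (t3.1.mul nonExp₂),
      fun p hp => hp.2⟩
  have nT : ∀ p ∈ T, p.2.2.1 ≠ 0 ∧ p.2.2.2 ≠ 0 ∧ p.2.2.1 + p.2.2.2 * p.2.1 ≠ 0 :=
    fun p hp => ⟨t2.ne_zero hp, t3.ne_zero hp, t4.ne_zero hp⟩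
  have et1 : ∀ p ∈ T, -1 / p.2.2.1 + -(1 + p.1 * p.2.2.1) / p.2.2.2 * (-p.2.2.2 / p.2.2.1) = p.1 :=
      fun p hp => by
    obtain ⟨n2, n3, n4⟩ := nT p hp
    field_simp
    ring
  have t5 := (t1).congr et1
  refine avg_summand_bij (t := fun p => 1 / (p.2.2.2 * p.2.2.1)) hϖ hχ hcond hN hS hT
    (hf.mono fun p hp => hp.1) (fun p => (𝔳(p), -𝔲(p) / p.1, -1 / p.1, p.2.2.1 / p.1))
    (fun p => (-1 / p.2.2.1, -(p.2.2.1 + p.2.2.2 * p.2.1 + p.1 * p.2.2.1 ^ 2) / p.2.2.2 ^ 2,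
      -p.2.2.2 / p.2.2.1, -(1 + p.1 * p.2.2.1) / p.2.2.2))
    (nonExp4 s5.1 (((s3.1.add (s1.1.mul s2.1)).neg).div s4) (NonExp.one.neg.div s4) (s2.1.div s4))
    (nonExp4 (NonExp.one.neg.div t2) (((t4.1.add (t1.1.mul (t2.1.pow 2))).neg).div (t3.pow 2))
      (t3.1.neg.div t2) (((NonExp.one.add (t1.1.mul t2.1)).neg).div t3))
    (fun p hp => ⟨⟨(s5).2 p hp, ((((s3.1.add (s1.1.mul s2.1)).neg).div s4).mem_ringInt hS) p hp,
      (UnitOn.one.neg.div s4).2 p hp, (s2.div s4).2 p hp⟩, (s6).2 p hp⟩)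
    (fun p hp => ⟨⟨⟨((NonExp.one.neg.div t2).mem_ringInt hT) p hp,
      (((t4.add (t1.mul hT (t2.1.pow 2))).neg).div (t3.pow 2)).2 p hp, (t3.neg.div t2).2 p hp,
      (((UnitOn.one.add (t1.mul hT t2.1)).neg).div t3).2 p hp⟩, (UnitOn.one.neg.div t2).2 p hp⟩,
      (t5).2 p hp⟩) ?_ ?_
    (s3.mul s2) (UnitOn.one.div (s3.mul s2))
    (((s5.div (s4.mul (s3.mul s2))).neg).congr fun p hp => ?_) ?_
  · intro p hp
    obtain ⟨n1, n2, n3, n4⟩ := nS p hp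
    refine Prod.ext ?_ (Prod.ext ?_ (Prod.ext ?_ ?_)) <;> dsimp only
    all_goals try field_simp
    all_goals ring
  · intro p hp
    obtain ⟨n2, n3, n4⟩ := nT p hp
    refine Prod.ext ?_ (Prod.ext ?_ (Prod.ext ?_ ?_)) <;> dsimp only
    all_goals generalize h1 : p.2.2.1 + p.2.2.2 * p.2.1 = u1 at n4 ⊢
    all_goals try field_simp
    all_goals subst h1
    all_goals ring
  · obtain ⟨n1, n2, n3, n4⟩ := nS p hp
    dsimp only
    field_simp
    ring
  · intro p hp
    obtain ⟨s, hs, e⟩ := hϖ.mem_maxIdeal_iff.1 (s5.2 p hp)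
    exact eltB_apply_eq_elt5 hϖ hv (s4.2 p hp) (s1.2 p hp) (s2.2 p hp) (s3.2 p hp) hs
      (eq_sub_of_add_eq e)

/-- The dummy coordinate is `l = -(a + xb)/z ∈ 𝔭`. All other changes are small perturbations of
their values at `l = 0`, which is why unit conditions survive. -/
theorem avg_trmB_eq_trm3 (hϖ : IsUniformizer ϖ) (hχ : χ.IsQuadratic)
    (hcond : HasConductorPrime χ) (hv : v ∈ paramodularVectors ρ ϖ 0) (hN : 1 ≤ N)
    (hf : InvOn ϖ N (boxMPUU F) (trm3 ϖ χ ρ v)) :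
    avg hϖ N (sepM (sepU (sepU (boxOUUU F) fun p => p.1)
          fun p => 𝔳(p))
          fun p => 𝔲(p)) (trmB ϖ χ ρ v (t4 ϖ) 3) =
      avg hϖ N (boxMPUU F) (trm3 ϖ χ ρ v) := by
  have hS := (((adm_boxOUUU hϖ).sepU hϖ (nonExp₁)).sepU hϖ (nonExp₁.add (nonExp₄.mul nonExp₃))).sepM
      hϖ (nonExp₄.add (nonExp₂.mul nonExp₃))
  have hT := adm_boxMPUU hϖ
  change avg (V := V) hϖ N ?S _ = avg (V := V) hϖ N ?T _
  set S := ?S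
  set T := ?T
  have s1 : UnitOn ϖ S fun p => p.2.1 := ⟨nonExp₂, fun p hp => hp.1.1.1.2.1⟩
  have s2 : UnitOn ϖ S fun p => p.2.2.1 := ⟨nonExp₃, fun p hp => hp.1.1.1.2.2.1⟩
  have s3 : UnitOn ϖ S fun p => p.2.2.2 := ⟨nonExp₄, fun p hp => hp.1.1.1.2.2.2⟩
  have s4 : UnitOn ϖ S fun p => p.1 := ⟨nonExp₁, fun p hp => hp.1.1.2⟩
  have s5 : UnitOn ϖ S fun p => 𝔳(p) := ⟨nonExp₁.add (s3.1.mul s2.1), fun p hp => hp.1.2⟩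
  have s6 : MaxOn ϖ S fun p => 𝔲(p) := ⟨s3.1.add (s1.1.mul s2.1), fun p hp => hp.2⟩
  have nS : ∀ p ∈ S, p.2.1 ≠ 0 ∧ p.2.2.1 ≠ 0 ∧ p.2.2.2 ≠ 0 ∧ p.1 ≠ 0 ∧ 𝔳(p) ≠ 0 :=
    fun p hp => ⟨s1.ne_zero hp, s2.ne_zero hp, s3.ne_zero hp, s4.ne_zero hp, s5.ne_zero hp⟩
  have s7 : UnitOn ϖ S fun p => 𝔞(p) := (s2.div s4).add ((s6.neg.div s4).mul hS ((s2.1.neg.mul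
      s5.1).div (s3.mul s4)))
  have s8 : UnitOn ϖ S fun p => 𝔟(p) := (UnitOn.one.neg.div s4).add ((s6.neg.div s4).mul hS s7.1)
  -- Modulo `𝔭` the numerator is `-b/(az)`, a unit, so the coordinate `z` of `T³` avoids `1 + 𝔭`.
  have es1 : ∀ p ∈ S, 1 - 𝔟(p) * 𝔵(p) / 𝔞(p) ^ 2 = (-p.2.2.1 / (p.2.2.2 * p.1) + 𝔩(p) *
      (p.2.2.1 / p.1 * 𝔵(p))) / 𝔞(p) ^ 2 := fun p hp => by
    obtain ⟨n1, n2, n3, n4, n5⟩ := nS p hp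
    have n7 := s7.ne_zero hp
    have n8 := s8.ne_zero hp
    rw [eq_div_iff (pow_ne_zero 2 n7), sub_mul, div_mul_cancel₀ _ (pow_ne_zero 2 n7), one_mul]
    field_simp
    ring
  have s9 := (((s2.neg.div (s3.mul s4)).add ((s6.neg.div s4).mul hS ((s2.1.div s4).mul
      ((s2.1.neg.mul s5.1).div (s3.mul s4))))).div (s7.pow 2)).congr es1
  have t1 : MaxOn ϖ T fun p => p.1 := ⟨nonExp₁, fun p hp => hp.1⟩
  have t2 : UnitOn ϖ T fun p => p.2.1 := ⟨nonExp₂, fun p hp => (mem_punctured_iff.1 hp.2.1).1⟩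
  have t3 : UnitOn ϖ T fun p => 1 - p.2.1 := ⟨.sub .one nonExp₂, fun p hp =>
      (mem_punctured_iff.1 hp.2.1).2⟩
  have t4 : UnitOn ϖ T fun p => p.2.2.1 := ⟨nonExp₃, fun p hp => hp.2.2.1⟩
  have t5 : UnitOn ϖ T fun p => p.2.2.2 := ⟨nonExp₄, fun p hp => hp.2.2.2⟩
  have nT : ∀ p ∈ T, p.2.1 ≠ 0 ∧ 1 - p.2.1 ≠ 0 ∧ p.2.2.1 ≠ 0 ∧ p.2.2.2 ≠ 0 :=
    fun p hp => ⟨t2.ne_zero hp, t3.ne_zero hp, t4.ne_zero hp, t5.ne_zero hp⟩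
  have t6 : UnitOn ϖ T fun p => 𝔰(p) := t5.sub (t1.mul hT ((t2.1.mul (t5.1.pow 2)).div t4))
  have t7 : UnitOn ϖ T fun p => 𝔱(p) := t4.sub (t1.mul hT t5.1)
  -- Modulo `𝔭` this is `-a²(1 - z)`, so the removal of `1 + 𝔭` from the range of `z` is what makes
  -- the inverse map defined.
  have et1 : ∀ p ∈ T, 𝔡(p) = -(p.2.2.2 ^ 2 * (1 - p.2.1)) + p.1 * (𝔨(p) * 𝔰(p)) := fun p hp => by
    obtain ⟨n2, n3, n4, n5⟩ := nT p hp
    have n6 := t6.ne_zero hp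
    have n7 := t7.ne_zero hp
    field_simp
    ring
  have t8 := ((((t5.pow 2).mul t3).neg).add (t1.mul hT (((t2.1.mul (t5.1.pow 2)).div t4).mul
      t6.1))).congr et1
  have et2 : ∀ p ∈ T, -1 / 𝔱(p) + 𝔰(p) / 𝔡(p) * (-𝔰(p) / 𝔱(p)) = -(𝔨(p) / 𝔡(p)) := fun p hp => by
    obtain ⟨n2, n3, n4, n5⟩ := nT p hp
    have n6 := t6.ne_zero hp
    have n7 := t7.ne_zero hp
    have n8 := t8.ne_zero hp
    generalize h1 : 𝔡(p) = u1 at n8 ⊢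
    generalize h2 : 𝔰(p) = u2 at n6 ⊢
    generalize h3 : 𝔱(p) = u3 at n7 ⊢
    field_simp
    subst h1 h2 h3
    first | ring1 | (field_simp; ring1)
  have t9 := ((((t2.mul (t5.pow 2)).div t4).div t8).neg).congr et2
  have et3 : ∀ p ∈ T, 𝔰(p) / 𝔡(p) + (p.1 / 𝔱(p) - 𝔰(p) / 𝔡(p)) / (-𝔰(p) / 𝔱(p)) * (-𝔰(p) / 𝔱(p)) =
      p.1 / 𝔱(p) := fun p hp => by
    obtain ⟨n2, n3, n4, n5⟩ := nT p hp
    have n6 := t6.ne_zero hp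
    have n7 := t7.ne_zero hp
    have n8 := t8.ne_zero hp
    generalize h1 : 𝔡(p) = u1 at n8 ⊢
    generalize h2 : 𝔰(p) = u2 at n6 ⊢
    generalize h3 : 𝔱(p) = u3 at n7 ⊢
    field_simp
    subst h1 h2 h3
    ring1
  have t10 := (t1.div t7).congr et3
  have et4 : ∀ p ∈ T, -𝔰(p) / 𝔱(p) / (-1 / 𝔱(p)) + -(p.1 / 𝔱(p)) / (-1 / 𝔱(p)) * (-(-𝔰(p) / 𝔱(p)) *
      -(𝔨(p) / 𝔡(p)) / (𝔰(p) / 𝔡(p) * (-1 / 𝔱(p)))) = p.2.2.2 := fun p hp => by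
    obtain ⟨n2, n3, n4, n5⟩ := nT p hp
    have n6 := t6.ne_zero hp
    have n7 := t7.ne_zero hp
    have n8 := t8.ne_zero hp
    generalize h1 : 𝔡(p) = u1 at n8 ⊢
    generalize h2 : 𝔰(p) = u2 at n6 ⊢
    generalize h3 : 𝔱(p) = u3 at n7 ⊢
    field_simp
    subst h1 h2 h3
    first | ring1 | (field_simp; ring1)
  have et5 : ∀ p ∈ T, -1 / (-1 / 𝔱(p)) + -(p.1 / 𝔱(p)) / (-1 / 𝔱(p)) * p.2.2.2 = p.2.2.1 :=
      fun p hp => by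
    obtain ⟨n2, n3, n4, n5⟩ := nT p hp
    have n6 := t6.ne_zero hp
    have n7 := t7.ne_zero hp
    have n8 := t8.ne_zero hp
    generalize h1 : 𝔱(p) = u1 at n7 ⊢
    field_simp
    subst h1
    ring1
  refine avg_summand_bij (t := fun p => 1 / (p.2.2.2 * p.2.2.1)) hϖ hχ hcond hN hS hT
    hf (fun p => (𝔩(p), 𝔟(p) * 𝔵(p) / 𝔞(p) ^ 2, 𝔟(p), 𝔞(p)))
    (fun p => (-1 / 𝔱(p), (p.1 / 𝔱(p) - 𝔰(p) / 𝔡(p)) / (-𝔰(p) / 𝔱(p)), -𝔰(p) / 𝔱(p), 𝔰(p) / 𝔡(p)))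
    (nonExp4 (s6.1.neg.div s4) ((s8.1.mul ((s2.1.neg.mul s5.1).div (s3.mul s4))).div (s7.pow 2))
      s8.1 s7.1)
    (nonExp4 (NonExp.one.neg.div t7) (((t1.1.div t7).sub (t6.1.div t8)).div (t6.neg.div t7))
      (t6.1.neg.div t7) (t6.1.div t8))
    (fun p hp => ⟨(s6.neg.div s4).2 p hp, mem_punctured_iff.2 ⟨((s8.mul ((s2.neg.mul s5).div (s3.mul
      s4))).div (s7.pow 2)).2 p hp, (s9).2 p hp⟩, (s8).2 p hp, (s7).2 p hp⟩)
    (fun p hp => ⟨⟨⟨⟨((NonExp.one.neg.div t7).mem_ringInt hT) p hp,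
      (((t1.div t7).sub_unit (t6.div t8)).div (t6.neg.div t7)).2 p hp, (t6.neg.div t7).2 p hp,
      (t6.div t8).2 p hp⟩, (UnitOn.one.neg.div t7).2 p hp⟩, (t9).2 p hp⟩, (t10).2 p hp⟩) ?_ ?_
    (s3.mul s2) (UnitOn.one.div (s3.mul s2))
    ((((s6.neg.div s4).mul hS ((((s7.1.mul ((s2.1.neg.div (s3.mul s4)).add ((s6.1.neg.div s4).mul
      ((s2.1.div s4).mul ((s2.1.neg.mul s5.1).div (s3.mul s4)))))).mul (s3.1.mul s2.1)).add
      (((NonExp.one.neg.div s4).mul ((s2.1.div s4).mul ((s2.1.neg.mul s5.1).div (s3.mul s4)))).mul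
      (s3.1.mul s2.1))).sub (((s2.1.neg.mul s5.1).div (s3.mul s4)).mul ((s2.1.div s4).add
      s7.1)))).div ((s7.pow 2).mul (s3.mul s2))).congr fun p hp => ?_) ?_
  · intro p hp
    obtain ⟨n1, n2, n3, n4, n5⟩ := nS p hp
    have n7 := s7.ne_zero hp
    have n8 := s8.ne_zero hp
    -- The middle Siegel coordinate is unchanged by conjugation with `A`, and from it the inverse
    -- map recovers everything else.
    have e2 : 𝔟(p) * 𝔵(p) / 𝔞(p) ^ 2 * 𝔞(p) ^ 2 / 𝔟(p) = 𝔵(p) := by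
      generalize 𝔞(p) = a₃ at n7 n8 ⊢
      generalize -1 / p.1 + 𝔩(p) * a₃ = b₃ at n8 ⊢
      field_simp
    have e3 : -1 / p.1 * 𝔵(p) - (p.2.2.1 / p.1) ^ 2 = p.2.2.1 / (p.2.2.2 * p.1) := by
      field_simp
      ring
    refine Prod.ext ?_ (Prod.ext ?_ (Prod.ext ?_ ?_)) <;> dsimp only <;>
      simp only [e2, add_sub_cancel_right, e3] <;> field_simp
    all_goals ring
  · intro p hp
    obtain ⟨n2, n3, n4, n5⟩ := nT p hp
    have n6 := t6.ne_zero hp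
    have n7 := t7.ne_zero hp
    have n8 := t8.ne_zero hp
    refine Prod.ext ?_ (Prod.ext ?_ (Prod.ext ?_ ?_)) <;> dsimp only
    all_goals try simp only [et2 p hp, et3 p hp, et4 p hp, et5 p hp]
    all_goals generalize h1 : 𝔡(p) = u1 at n8 ⊢
    all_goals generalize h2 : 𝔰(p) = u2 at n6 ⊢
    all_goals generalize h3 : 𝔱(p) = u3 at n7 ⊢
    all_goals generalize h4 : 1 - p.2.1 = u4 at n3 ⊢
    all_goals try field_simp
  · obtain ⟨n1, n2, n3, n4, n5⟩ := nS p hp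
    have n7 := s7.ne_zero hp
    have n8 := s8.ne_zero hp
    dsimp only
    rw [es1 p hp]
    generalize h : 𝔞(p) = a₃ at n7 ⊢
    field_simp
    subst h
    field_simp
    ring
  · intro p hp
    obtain ⟨s, hs, e⟩ := hϖ.mem_maxIdeal_iff.1 (s6.2 p hp)
    dsimp only at e
    refine eltB_apply_eq_elt3 hϖ hv (s4.2 p hp) (s1.2 p hp) (s2.2 p hp) (s3.2 p hp) (s7.2 p hp)
        (s8.2 p hp) hs (unit_ring (s5.2 p hp)) rfl
      (eq_sub_of_add_eq e) ?_ ?_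
    · rw [e]
    · rw [e]; ring

/-- The generic part. The difference of the two punctured variables is `-zxb/((a + xb)(z + ab))`, a
unit, so this complements the part of `T²` coming from the A form. -/
theorem avg_trmB_eq_trm2 (hϖ : IsUniformizer ϖ) (hχ : χ.IsQuadratic)
    (hcond : HasConductorPrime χ) (hv : v ∈ paramodularVectors ρ ϖ 0) (hN : 1 ≤ N)
    (hf : InvOn ϖ N (boxPUUP F) (trm2 ϖ χ ρ v)) :
    avg hϖ N (sepU (sepU (sepU (sepU (boxOUUU F) fun p => p.1)
          fun p => 𝔳(p))
          fun p => 𝔲(p))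
          fun p => 𝔴(p)) (trmB ϖ χ ρ v (t4 ϖ) 3) =
      avg hϖ N (sepU (boxPUUP F) fun p => p.2.2.2 - p.1) (trm2 ϖ χ ρ v) := by
  have hS := ((((adm_boxOUUU hϖ).sepU hϖ (nonExp₁)).sepU hϖ (nonExp₁.add (nonExp₄.mul
      nonExp₃))).sepU hϖ (nonExp₄.add (nonExp₂.mul nonExp₃))).sepU hϖ ((nonExp₂.mul nonExp₁).add
      (nonExp₄.mul (nonExp₄.add (nonExp₂.mul nonExp₃))))
  have hT := (adm_boxPUUP hϖ).sepU hϖ (nonExp₄.sub nonExp₁)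
  change avg (V := V) hϖ N ?S _ = avg (V := V) hϖ N ?T _
  set S := ?S
  set T := ?T
  have s1 : UnitOn ϖ S fun p => p.2.1 := ⟨nonExp₂, fun p hp => hp.1.1.1.1.2.1⟩
  have s2 : UnitOn ϖ S fun p => p.2.2.1 := ⟨nonExp₃, fun p hp => hp.1.1.1.1.2.2.1⟩
  have s3 : UnitOn ϖ S fun p => p.2.2.2 := ⟨nonExp₄, fun p hp => hp.1.1.1.1.2.2.2⟩
  have s4 : UnitOn ϖ S fun p => p.1 := ⟨nonExp₁, fun p hp => hp.1.1.1.2⟩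
  have s5 : UnitOn ϖ S fun p => 𝔳(p) := ⟨nonExp₁.add (s3.1.mul s2.1), fun p hp => hp.1.1.2⟩
  have s6 : UnitOn ϖ S fun p => 𝔲(p) := ⟨s3.1.add (s1.1.mul s2.1), fun p hp => hp.1.2⟩
  have s7 : UnitOn ϖ S fun p => 𝔴(p) := ⟨(s1.1.mul nonExp₁).add (s3.1.mul s6.1), fun p hp => hp.2⟩
  have nS : ∀ p ∈ S, p.2.1 ≠ 0 ∧ p.2.2.1 ≠ 0 ∧ p.2.2.2 ≠ 0 ∧ p.1 ≠ 0 ∧ 𝔳(p) ≠ 0 ∧ 𝔲(p) ≠ 0 ∧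
      𝔴(p) ≠ 0 :=
    fun p hp => ⟨s1.ne_zero hp, s2.ne_zero hp, s3.ne_zero hp, s4.ne_zero hp, s5.ne_zero hp,
        s6.ne_zero hp, s7.ne_zero hp⟩
  have es1 : ∀ p ∈ S, 1 - (1 - p.2.2.2 * p.2.2.1 / 𝔳(p)) = p.2.2.2 * p.2.2.1 / 𝔳(p) := fun p hp =>
      by
    obtain ⟨n1, n2, n3, n4, n5, n6, n7⟩ := nS p hp
    generalize h1 : 𝔳(p) = u1 at n5 ⊢
    field_simp
    subst h1
    ring
  have s8 := ((s3.mul s2).div s5).congr es1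
  have es2 : ∀ p ∈ S, 1 - p.2.2.2 * p.2.2.1 / 𝔳(p) = p.1 / 𝔳(p) := fun p hp => by
    obtain ⟨n1, n2, n3, n4, n5, n6, n7⟩ := nS p hp
    generalize h1 : 𝔳(p) = u1 at n5 ⊢
    field_simp
    subst h1
    ring
  have s9 := (s4.div s5).congr es2
  have es3 : ∀ p ∈ S, 1 - (1 - p.2.2.1 * 𝔴(p) / (𝔲(p) * 𝔳(p))) = p.2.2.1 * 𝔴(p) / (𝔲(p) * 𝔳(p)) :=
      fun p hp => by
    obtain ⟨n1, n2, n3, n4, n5, n6, n7⟩ := nS p hp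
    generalize h1 : 𝔴(p) = u1 at n7 ⊢
    generalize h2 : 𝔳(p) = u2 at n5 ⊢
    generalize h3 : 𝔲(p) = u3 at n6 ⊢
    field_simp
    subst h1 h2 h3
    ring
  have s10 := ((s2.mul s7).div (s6.mul s5)).congr es3
  have es4 : ∀ p ∈ S, 1 - p.2.2.1 * 𝔴(p) / (𝔲(p) * 𝔳(p)) = p.1 * p.2.2.2 / (𝔲(p) * 𝔳(p)) :=
      fun p hp => by
    obtain ⟨n1, n2, n3, n4, n5, n6, n7⟩ := nS p hp
    generalize h1 : 𝔴(p) = u1 at n7 ⊢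
    generalize h2 : 𝔳(p) = u2 at n5 ⊢
    generalize h3 : 𝔲(p) = u3 at n6 ⊢
    field_simp
    subst h1 h2 h3
    ring
  have s11 := ((s4.mul s3).div (s6.mul s5)).congr es4
  have es5 : ∀ p ∈ S, 1 - p.2.2.1 * 𝔴(p) / (𝔲(p) * 𝔳(p)) - (1 - p.2.2.2 * p.2.2.1 / 𝔳(p)) = -(p.1 *
      p.2.1 * p.2.2.1 / (𝔲(p) * 𝔳(p))) := fun p hp => by
    obtain ⟨n1, n2, n3, n4, n5, n6, n7⟩ := nS p hp
    generalize h1 : 𝔴(p) = u1 at n7 ⊢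
    generalize h2 : 𝔳(p) = u2 at n5 ⊢
    generalize h3 : 𝔲(p) = u3 at n6 ⊢
    field_simp
    subst h1 h2 h3
    ring
  have s12 := ((((s4.mul s1).mul s2).div (s6.mul s5)).neg).congr es5
  have t1 : UnitOn ϖ T fun p => p.1 := ⟨nonExp₁, fun p hp => (mem_punctured_iff.1 hp.1.1).1⟩
  have t2 : UnitOn ϖ T fun p => 1 - p.1 := ⟨.sub .one nonExp₁, fun p hp =>
      (mem_punctured_iff.1 hp.1.1).2⟩
  have t3 : UnitOn ϖ T fun p => p.2.1 := ⟨nonExp₂, fun p hp => hp.1.2.1⟩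
  have t4 : UnitOn ϖ T fun p => p.2.2.1 := ⟨nonExp₃, fun p hp => hp.1.2.2.1⟩
  have t5 : UnitOn ϖ T fun p => p.2.2.2 := ⟨nonExp₄, fun p hp => (mem_punctured_iff.1 hp.1.2.2.2).1⟩
  have t6 : UnitOn ϖ T fun p => 1 - p.2.2.2 := ⟨.sub .one nonExp₄, fun p hp =>
      (mem_punctured_iff.1 hp.1.2.2.2).2⟩
  have t7 : UnitOn ϖ T fun p => p.2.2.2 - p.1 := ⟨t5.1.sub t1.1, fun p hp => hp.2⟩
  have nT : ∀ p ∈ T, p.1 ≠ 0 ∧ 1 - p.1 ≠ 0 ∧ p.2.1 ≠ 0 ∧ p.2.2.1 ≠ 0 ∧ p.2.2.2 ≠ 0 ∧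
      1 - p.2.2.2 ≠ 0 ∧ p.2.2.2 - p.1 ≠ 0 :=
    fun p hp => ⟨t1.ne_zero hp, t2.ne_zero hp, t3.ne_zero hp, t4.ne_zero hp, t5.ne_zero hp,
        t6.ne_zero hp, t7.ne_zero hp⟩
  have et1 : ∀ p ∈ T, (1 - p.1) / (p.2.2.1 * p.2.1 * p.2.2.2) + -(1 - p.1) / (p.2.2.1 * p.1) *
      (-(1 - p.1) / (p.2.1 * p.2.2.2)) = (1 - p.1) / (p.2.2.1 * p.2.1 * p.2.2.2 * p.1) :=
      fun p hp => by
    obtain ⟨n1, n2, n3, n4, n5, n6, n7⟩ := nT p hp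
    generalize h1 : 1 - p.1 = u1 at n2 ⊢
    field_simp
    subst h1
    ring
  have t8 := (t2.div (((t4.mul t3).mul t5).mul t1)).congr et1
  have et2 : ∀ p ∈ T, -(1 - p.1) / (p.2.2.1 * p.1) + -p.2.1 * (p.2.2.2 - p.1) / (p.2.2.1 * p.1) *
      (-(1 - p.1) / (p.2.1 * p.2.2.2)) = -(1 - p.1) / (p.2.2.1 * p.2.2.2) := fun p hp => by
    obtain ⟨n1, n2, n3, n4, n5, n6, n7⟩ := nT p hp
    generalize h1 : 1 - p.1 = u1 at n2 ⊢
    generalize h2 : p.2.2.2 - p.1 = u2 at n7 ⊢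
    field_simp
    subst h1 h2
    ring
  have t9 := (t2.neg.div (t4.mul t5)).congr et2
  have et3 : ∀ p ∈ T, -p.2.1 * (p.2.2.2 - p.1) / (p.2.2.1 * p.1) * ((1 - p.1) / (p.2.2.1 * p.2.1 *
      p.2.2.2)) + -(1 - p.1) / (p.2.2.1 * p.1) * (-(1 - p.1) / (p.2.2.1 * p.1) + -p.2.1 *
      (p.2.2.2 - p.1) / (p.2.2.1 * p.1) * (-(1 - p.1) / (p.2.1 * p.2.2.2))) = (1 - p.1) *
      (1 - p.2.2.2) / (p.2.2.1 ^ 2 * p.2.2.2 * p.1) := fun p hp => by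
    obtain ⟨n1, n2, n3, n4, n5, n6, n7⟩ := nT p hp
    generalize h1 : 1 - p.1 = u1 at n2 ⊢
    generalize h2 : 1 - p.2.2.2 = u2 at n6 ⊢
    generalize h3 : p.2.2.2 - p.1 = u3 at n7 ⊢
    field_simp
    subst h1 h2 h3
    ring
  have t10 := ((t2.mul t6).div (((t4.pow 2).mul t5).mul t1)).congr et3
  refine avg_summand_bij (t := fun p => 1 / 𝔳(p)) hϖ hχ hcond hN hS hT
    (hf.mono fun p hp => hp.1) (fun p => (1 - p.2.2.2 * p.2.2.1 / 𝔳(p), -𝔲(p) / p.1, -p.2.2.1 / p.1,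
      1 - p.2.2.1 * 𝔴(p) / (𝔲(p) * 𝔳(p))))
    (fun p => ((1 - p.1) / (p.2.2.1 * p.2.1 * p.2.2.2), -p.2.1 * (p.2.2.2 - p.1) / (p.2.2.1 * p.1),
      -(1 - p.1) / (p.2.1 * p.2.2.2), -(1 - p.1) / (p.2.2.1 * p.1)))
    (nonExp4 s9.1 (s6.1.neg.div s4) (s2.1.neg.div s4) s11.1)
    (nonExp4 (t2.1.div ((t4.mul t3).mul t5)) ((t3.1.neg.mul t7.1).div (t4.mul t1)) (t2.1.neg.div
      (t3.mul t5)) (t2.1.neg.div (t4.mul t1)))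
    (fun p hp => ⟨⟨mem_punctured_iff.2 ⟨(s9).2 p hp, (s8).2 p hp⟩, (s6.neg.div s4).2 p hp,
      (s2.neg.div s4).2 p hp, mem_punctured_iff.2 ⟨(s11).2 p hp, (s10).2 p hp⟩⟩, (s12).2 p hp⟩)
    (fun p hp => ⟨⟨⟨⟨⟨((t2.1.div ((t4.mul t3).mul t5)).mem_ringInt hT) p hp,
      ((t3.neg.mul t7).div (t4.mul t1)).2 p hp, (t2.neg.div (t3.mul t5)).2 p hp,
      (t2.neg.div (t4.mul t1)).2 p hp⟩, (t2.div ((t4.mul t3).mul t5)).2 p hp⟩, (t8).2 p hp⟩,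
      (t9).2 p hp⟩, (t10).2 p hp⟩) ?_ ?_
    (s3.mul s2) (UnitOn.one.div s5)
    ((MaxOn.zero).congr fun p hp => ?_) ?_
  · intro p hp
    obtain ⟨n1, n2, n3, n4, n5, n6, n7⟩ := nS p hp
    refine Prod.ext ?_ (Prod.ext ?_ (Prod.ext ?_ ?_)) <;> dsimp only
    all_goals try simp only [es2 p hp, es4 p hp]
    all_goals generalize h1 : 𝔴(p) = u1 at n7 ⊢
    all_goals generalize h2 : 𝔳(p) = u2 at n5 ⊢
    all_goals generalize h3 : 𝔲(p) = u3 at n6 ⊢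
    all_goals try field_simp
    all_goals subst h1 h2 h3
    all_goals ring
  · intro p hp
    obtain ⟨n1, n2, n3, n4, n5, n6, n7⟩ := nT p hp
    refine Prod.ext ?_ (Prod.ext ?_ (Prod.ext ?_ ?_)) <;> dsimp only
    all_goals try simp only [et1 p hp, et2 p hp]
    all_goals generalize h1 : 1 - p.1 = u1 at n2 ⊢
    all_goals generalize h2 : 1 - p.2.2.2 = u2 at n6 ⊢
    all_goals generalize h3 : p.2.2.2 - p.1 = u3 at n7 ⊢
    all_goals try field_simp
    all_goals subst h1 h2 h3
    all_goals ring
  · obtain ⟨n1, n2, n3, n4, n5, n6, n7⟩ := nS p hp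
    dsimp only
    simp only [es2 p hp, es4 p hp]
    generalize h1 : 𝔴(p) = u1 at n7 ⊢
    generalize h2 : 𝔳(p) = u2 at n5 ⊢
    generalize h3 : 𝔲(p) = u3 at n6 ⊢
    field_simp
    subst h1 h2 h3
    ring
  · intro p hp
    exact eltB_apply_eq_elt2 hϖ hv (s4.2 p hp) (s1.2 p hp) (s2.2 p hp) (s3.2 p hp) (s5.2 p hp) (s6.2
        p hp) (s7.2 p hp) rfl rfl rfl

/-- The quantity `xz + a(a + xb) ∈ 𝔭` becomes the dummy coordinate; the relation it satisfies,
solved for `x` and `a`, gives the inverse map. -/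
theorem avg_trmB_eq_trm8 (hϖ : IsUniformizer ϖ) (hχ : χ.IsQuadratic)
    (hcond : HasConductorPrime χ) (hv : v ∈ paramodularVectors ρ ϖ 0) (hN : 1 ≤ N)
    (hf : InvOn ϖ N (boxMPUU F) (trm8 ϖ χ ρ v)) :
    avg hϖ N (sepM (sepU (sepU (sepU (boxOUUU F) fun p => p.1)
          fun p => 𝔳(p))
          fun p => 𝔲(p))
          fun p => 𝔴(p)) (trmB ϖ χ ρ v (t4 ϖ) 3) =
      avg hϖ N (boxMPUU F) (trm8 ϖ χ ρ v) := by
  have hS := ((((adm_boxOUUU hϖ).sepU hϖ (nonExp₁)).sepU hϖ (nonExp₁.add (nonExp₄.mul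
      nonExp₃))).sepU hϖ (nonExp₄.add (nonExp₂.mul nonExp₃))).sepM hϖ ((nonExp₂.mul nonExp₁).add
      (nonExp₄.mul (nonExp₄.add (nonExp₂.mul nonExp₃))))
  have hT := adm_boxMPUU hϖ
  change avg (V := V) hϖ N ?S _ = avg (V := V) hϖ N ?T _
  set S := ?S
  set T := ?T
  have s1 : UnitOn ϖ S fun p => p.2.1 := ⟨nonExp₂, fun p hp => hp.1.1.1.1.2.1⟩
  have s2 : UnitOn ϖ S fun p => p.2.2.1 := ⟨nonExp₃, fun p hp => hp.1.1.1.1.2.2.1⟩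
  have s3 : UnitOn ϖ S fun p => p.2.2.2 := ⟨nonExp₄, fun p hp => hp.1.1.1.1.2.2.2⟩
  have s4 : UnitOn ϖ S fun p => p.1 := ⟨nonExp₁, fun p hp => hp.1.1.1.2⟩
  have s5 : UnitOn ϖ S fun p => 𝔳(p) := ⟨nonExp₁.add (s3.1.mul s2.1), fun p hp => hp.1.1.2⟩
  have s6 : UnitOn ϖ S fun p => 𝔲(p) := ⟨s3.1.add (s1.1.mul s2.1), fun p hp => hp.1.2⟩
  have s7 : MaxOn ϖ S fun p => 𝔴(p) := ⟨(s1.1.mul nonExp₁).add (s3.1.mul s6.1), fun p hp => hp.2⟩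
  have nS : ∀ p ∈ S, p.2.1 ≠ 0 ∧ p.2.2.1 ≠ 0 ∧ p.2.2.2 ≠ 0 ∧ p.1 ≠ 0 ∧ 𝔳(p) ≠ 0 ∧ 𝔲(p) ≠ 0 :=
    fun p hp => ⟨s1.ne_zero hp, s2.ne_zero hp, s3.ne_zero hp, s4.ne_zero hp, s5.ne_zero hp,
        s6.ne_zero hp⟩
  have es1 : ∀ p ∈ S, p.1 - p.2.2.1 * 𝔲(p) = (𝔴(p) - 𝔲(p) ^ 2) / p.2.1 := fun p hp => by
    obtain ⟨n1, n2, n3, n4, n5, n6⟩ := nS p hp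
    generalize h1 : 𝔲(p) = u1 at n6 ⊢
    field_simp
    subst h1
    ring
  have s8 := ((s7.sub_unit (s6.pow 2)).div s1).congr es1
  have es2 : ∀ p ∈ S, 1 - p.1 / (𝔲(p) * p.2.2.1) = -((p.1 - p.2.2.1 * 𝔲(p)) / (𝔲(p) * p.2.2.1)) :=
      fun p hp => by
    obtain ⟨n1, n2, n3, n4, n5, n6⟩ := nS p hp
    have n8 := s8.ne_zero hp
    generalize h1 : p.1 - p.2.2.1 * 𝔲(p) = u1 at n8 ⊢
    generalize h2 : 𝔲(p) = u2 at n6 ⊢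
    field_simp
    subst h1 h2
    ring
  have s9 := ((s8.div (s6.mul s2)).neg).congr es2
  have t1 : MaxOn ϖ T fun p => p.1 := ⟨nonExp₁, fun p hp => hp.1⟩
  have t2 : UnitOn ϖ T fun p => p.2.1 := ⟨nonExp₂, fun p hp => (mem_punctured_iff.1 hp.2.1).1⟩
  have t3 : UnitOn ϖ T fun p => 1 - p.2.1 := ⟨.sub .one nonExp₂, fun p hp =>
      (mem_punctured_iff.1 hp.2.1).2⟩
  have t4 : UnitOn ϖ T fun p => p.2.2.1 := ⟨nonExp₃, fun p hp => hp.2.2.1⟩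
  have t5 : UnitOn ϖ T fun p => p.2.2.2 := ⟨nonExp₄, fun p hp => hp.2.2.2⟩
  have nT : ∀ p ∈ T, p.2.1 ≠ 0 ∧ 1 - p.2.1 ≠ 0 ∧ p.2.2.1 ≠ 0 ∧ p.2.2.2 ≠ 0 :=
    fun p hp => ⟨t2.ne_zero hp, t3.ne_zero hp, t4.ne_zero hp, t5.ne_zero hp⟩
  have et1 : ∀ p ∈ T, -1 / (p.2.2.2 * p.2.2.1 * p.2.1) + (p.1 * (p.2.2.2 *
      p.2.1) - 1 / p.2.2.2) / (1 - p.2.1) * (-1 / (p.2.2.1 * p.2.1)) = (1 / p.2.2.2 - p.1 *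
      p.2.2.2) / ((1 - p.2.1) * p.2.2.1) := fun p hp => by
    obtain ⟨n2, n3, n4, n5⟩ := nT p hp
    generalize h1 : 1 - p.2.1 = u1 at n3 ⊢
    field_simp
    subst h1
    ring
  have t6 := (((UnitOn.one.div t5).sub (t1.mul hT t5.1)).div (t3.mul t4)).congr et1
  have et2 : ∀ p ∈ T, (p.1 * (p.2.2.2 * p.2.1) - 1 / p.2.2.2) / (1 - p.2.1) + (p.1 * (p.2.2.2 *
      p.2.2.1 * p.2.1 ^ 2) - p.2.2.1 / p.2.2.2) / (1 - p.2.1) * (-1 / (p.2.2.1 * p.2.1)) =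
      1 / (p.2.2.2 * p.2.1) := fun p hp => by
    obtain ⟨n2, n3, n4, n5⟩ := nT p hp
    generalize h1 : 1 - p.2.1 = u1 at n3 ⊢
    field_simp
    subst h1
    ring
  have t7 := (UnitOn.one.div (t5.mul t2)).congr et2
  have et3 : ∀ p ∈ T, (p.1 * (p.2.2.2 * p.2.2.1 * p.2.1 ^ 2) - p.2.2.1 / p.2.2.2) / (1 - p.2.1) *
      (-1 / (p.2.2.2 * p.2.2.1 * p.2.1)) + (p.1 * (p.2.2.2 * p.2.1) - 1 / p.2.2.2) / (1 - p.2.1) *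
      ((p.1 * (p.2.2.2 * p.2.1) - 1 / p.2.2.2) / (1 - p.2.1) + (p.1 * (p.2.2.2 * p.2.2.1 *
      p.2.1 ^ 2) - p.2.2.1 / p.2.2.2) / (1 - p.2.1) * (-1 / (p.2.2.1 * p.2.1))) = p.1 := fun p hp =>
      by
    obtain ⟨n2, n3, n4, n5⟩ := nT p hp
    generalize h1 : 1 - p.2.1 = u1 at n3 ⊢
    field_simp
    subst h1
    ring
  have t8 := (t1).congr et3
  -- The new character argument equals `t` itself, and `ab · t ≡ 1` modulo `𝔭` because `a(z - b(a +
  -- xb)) ≡ z(a + xb)` there.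
  refine avg_summand_bij (t := fun p => (p.1 - p.2.2.1 * 𝔲(p)) / (p.1 * 𝔲(p) *
      p.2.2.1)) hϖ hχ hcond hN hS hT
    hf (fun p => (𝔴(p), p.1 / (𝔲(p) * p.2.2.1), -𝔲(p) / p.1, p.2.2.1 / p.1))
    (fun p => (-1 / (p.2.2.2 * p.2.2.1 * p.2.1), (p.1 * (p.2.2.2 * p.2.2.1 *
      p.2.1 ^ 2) - p.2.2.1 / p.2.2.2) / (1 - p.2.1), -1 / (p.2.2.1 * p.2.1), (p.1 * (p.2.2.2 *
      p.2.1) - 1 / p.2.2.2) / (1 - p.2.1)))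
    (nonExp4 s7.1 (nonExp₁.div (s6.mul s2)) (s6.1.neg.div s4) (s2.1.div s4))
    (nonExp4 (NonExp.one.neg.div ((t5.mul t4).mul t2)) (((t1.1.mul ((t5.1.mul t4.1).mul (t2.1.pow
      2))).sub (t4.1.div t5)).div t3) (NonExp.one.neg.div (t4.mul t2)) (((t1.1.mul (t5.1.mul
      t2.1)).sub (NonExp.one.div t5)).div t3))
    (fun p hp => ⟨(s7).2 p hp, mem_punctured_iff.2 ⟨(s4.div (s6.mul s2)).2 p hp, (s9).2 p hp⟩,
      (s6.neg.div s4).2 p hp, (s2.div s4).2 p hp⟩)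
    (fun p hp => ⟨⟨⟨⟨⟨((NonExp.one.neg.div ((t5.mul t4).mul t2)).mem_ringInt hT) p hp,
      (((t1.mul hT ((t5.1.mul t4.1).mul (t2.1.pow 2))).sub_unit (t4.div t5)).div t3).2 p hp,
      (UnitOn.one.neg.div (t4.mul t2)).2 p hp, (((t1.mul hT (t5.1.mul t2.1)).sub_unit
      (UnitOn.one.div t5)).div t3).2 p hp⟩, (UnitOn.one.neg.div ((t5.mul t4).mul t2)).2 p hp⟩,
      (t6).2 p hp⟩, (t7).2 p hp⟩, (t8).2 p hp⟩) ?_ ?_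
    (s3.mul s2) (s8.div ((s4.mul s6).mul s2))
    ((s7.mul hS (((s8.1.div ((s4.mul s6).mul s2)).mul s2.1).div (s4.mul s6))).congr fun p hp =>
      ?_) ?_
  · intro p hp
    obtain ⟨n1, n2, n3, n4, n5, n6⟩ := nS p hp
    have n8 := s8.ne_zero hp
    refine Prod.ext ?_ (Prod.ext ?_ (Prod.ext ?_ ?_)) <;> dsimp only
    all_goals try simp only [es2 p hp]
    all_goals generalize h1 : p.1 - p.2.2.1 * 𝔲(p) = u1 at n8 ⊢
    all_goals generalize h2 : 𝔳(p) = u2 at n5 ⊢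
    all_goals generalize h3 : 𝔲(p) = u3 at n6 ⊢
    all_goals try field_simp
    all_goals subst h1 h2 h3
    all_goals ring
  · intro p hp
    obtain ⟨n2, n3, n4, n5⟩ := nT p hp
    refine Prod.ext ?_ (Prod.ext ?_ (Prod.ext ?_ ?_)) <;> dsimp only
    all_goals try simp only [et2 p hp]
    all_goals generalize h1 : 1 - p.2.1 = u1 at n3 ⊢
    all_goals try field_simp
    all_goals subst h1
    all_goals ring
  · obtain ⟨n1, n2, n3, n4, n5, n6⟩ := nS p hp
    have n8 := s8.ne_zero hp
    dsimp only
    simp only [es2 p hp]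
    generalize h1 : p.1 - p.2.2.1 * 𝔲(p) = u1 at n8 ⊢
    generalize h2 : 𝔳(p) = u2 at n5 ⊢
    generalize h3 : 𝔲(p) = u3 at n6 ⊢
    field_simp
    subst h1 h2 h3
    ring
  · intro p hp
    obtain ⟨s, hs, e⟩ := hϖ.mem_maxIdeal_iff.1 (s7.2 p hp)
    have hr : (ϖ : F) * s - 𝔲(p) ^ 2 ∈ unitInt F := by
      rw [← e]; exact (s7.sub_unit (s6.pow 2)).2 p hp
    refine eltB_apply_eq_elt8 hϖ hv (s4.2 p hp) (s2.2 p hp) (s6.2 p hp) (s8.2 p hp) hr hs rfl rfl ?_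
        ?_
    · rw [← e, eq_div_iff (unit_ne_zero (s8.2 p hp))]; ring
    · ring

/-- For `z ∈ 𝔭`, replacing `b` by `b + z/a` moves it within its class. In the new variable `a + xb`
stands for the old `(xz + a(a + xb))/a`, whose valuation decides the torus part. -/
theorem avg_trmB_eq_trmD (hϖ : IsUniformizer ϖ) (hχ : χ.IsQuadratic)
    (hcond : HasConductorPrime χ) (hN : 1 ≤ N)
    (hf : InvOn ϖ N (boxMUUU F) (trmD ϖ χ ρ v)) :
    avg hϖ N (sepM (boxOUUU F) fun p => p.1) (trmB ϖ χ ρ v (t4 ϖ) 3) =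
      avg hϖ N (boxMUUU F) (trmD ϖ χ ρ v) := by
  have hS := (adm_boxOUUU hϖ).sepM hϖ (nonExp₁)
  have hT := adm_boxMUUU hϖ
  change avg (V := V) hϖ N ?S _ = avg (V := V) hϖ N ?T _
  set S := ?S
  set T := ?T
  have s1 : UnitOn ϖ S fun p => p.2.1 := ⟨nonExp₂, fun p hp => hp.1.2.1⟩
  have s2 : UnitOn ϖ S fun p => p.2.2.1 := ⟨nonExp₃, fun p hp => hp.1.2.2.1⟩
  have s3 : UnitOn ϖ S fun p => p.2.2.2 := ⟨nonExp₄, fun p hp => hp.1.2.2.2⟩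
  have s4 : MaxOn ϖ S fun p => p.1 := ⟨nonExp₁, fun p hp => hp.2⟩
  have nS : ∀ p ∈ S, p.2.1 ≠ 0 ∧ p.2.2.1 ≠ 0 ∧ p.2.2.2 ≠ 0 :=
    fun p hp => ⟨s1.ne_zero hp, s2.ne_zero hp, s3.ne_zero hp⟩
  have t1 : MaxOn ϖ T fun p => p.1 := ⟨nonExp₁, fun p hp => hp.1⟩
  have t2 : UnitOn ϖ T fun p => p.2.1 := ⟨nonExp₂, fun p hp => hp.2.1⟩
  have t3 : UnitOn ϖ T fun p => p.2.2.1 := ⟨nonExp₃, fun p hp => hp.2.2.1⟩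
  have t4 : UnitOn ϖ T fun p => p.2.2.2 := ⟨nonExp₄, fun p hp => hp.2.2.2⟩
  have nT : ∀ p ∈ T, p.2.1 ≠ 0 ∧ p.2.2.1 ≠ 0 ∧ p.2.2.2 ≠ 0 :=
    fun p hp => ⟨t2.ne_zero hp, t3.ne_zero hp, t4.ne_zero hp⟩
  refine avg_summand_bij (t := fun p => 1) hϖ hχ hcond hN hS hT
    hf (fun p => (p.1, p.2.1, p.2.2.1 + p.1 / p.2.2.2, p.2.2.2))
    (fun p => (p.1, p.2.1, p.2.2.1 - p.1 / p.2.2.2, p.2.2.2))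
    (nonExp4 nonExp₁ s1.1 (s2.1.add (nonExp₁.div s3)) s3.1)
    (nonExp4 t1.1 t2.1 (t3.1.sub (t1.1.div t4)) t4.1)
    (fun p hp => ⟨(s4).2 p hp, (s1).2 p hp, (s2.add (s4.div s3)).2 p hp, (s3).2 p hp⟩)
    (fun p hp => ⟨⟨((t1.1).mem_ringInt hT) p hp, (t2).2 p hp, (t3.sub (t1.div t4)).2 p hp,
      (t4).2 p hp⟩, (t1).2 p hp⟩) ?_ ?_
    (s3.mul s2) (UnitOn.one)
    ((MaxOn.zero).congr fun p hp => ?_) ?_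
  · intro p hp
    obtain ⟨n1, n2, n3⟩ := nS p hp
    refine Prod.ext ?_ (Prod.ext ?_ (Prod.ext ?_ ?_)) <;> dsimp only
    all_goals try field_simp
    all_goals ring
  · intro p hp
    obtain ⟨n2, n3, n4⟩ := nT p hp
    refine Prod.ext ?_ (Prod.ext ?_ (Prod.ext ?_ ?_)) <;> dsimp only
    all_goals try field_simp
    all_goals ring
  · obtain ⟨n1, n2, n3⟩ := nS p hp
    dsimp only
    field_simp
    ring
  · intro p hp
    dsimp only
    rw [add_sub_cancel_right]

/-- In the coordinate `(a + xb)/a` of `T¹³` the complement to 1 is `-xb/a`, a unit: the part of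
`T¹³` missed by the A form. -/
theorem avg_trmD_eq_trm13 (hϖ : IsUniformizer ϖ) (hχ : χ.IsQuadratic)
    (hcond : HasConductorPrime χ) (hv : v ∈ paramodularVectors ρ ϖ 0) (hN : 1 ≤ N)
    (hf : InvOn ϖ N (boxMUUU F) (trm13 ϖ χ ρ v)) :
    avg hϖ N (sepU (boxMUUU F) fun p => 𝔲(p)) (trmD ϖ χ ρ v) =
      avg hϖ N (sepU (boxMUUU F) fun p => 1 - p.2.1) (trm13 ϖ χ ρ v) := by
  have hS := (adm_boxMUUU hϖ).sepU hϖ (nonExp₄.add (nonExp₂.mul nonExp₃))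
  have hT := (adm_boxMUUU hϖ).sepU hϖ (NonExp.one.sub nonExp₂)
  change avg (V := V) hϖ N ?S _ = avg (V := V) hϖ N ?T _
  set S := ?S
  set T := ?T
  have s1 : MaxOn ϖ S fun p => p.1 := ⟨nonExp₁, fun p hp => hp.1.1⟩
  have s2 : UnitOn ϖ S fun p => p.2.1 := ⟨nonExp₂, fun p hp => hp.1.2.1⟩
  have s3 : UnitOn ϖ S fun p => p.2.2.1 := ⟨nonExp₃, fun p hp => hp.1.2.2.1⟩
  have s4 : UnitOn ϖ S fun p => p.2.2.2 := ⟨nonExp₄, fun p hp => hp.1.2.2.2⟩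
  have s5 : UnitOn ϖ S fun p => 𝔲(p) := ⟨s4.1.add (s2.1.mul s3.1), fun p hp => hp.2⟩
  have nS : ∀ p ∈ S, p.2.1 ≠ 0 ∧ p.2.2.1 ≠ 0 ∧ p.2.2.2 ≠ 0 ∧ 𝔲(p) ≠ 0 :=
    fun p hp => ⟨s2.ne_zero hp, s3.ne_zero hp, s4.ne_zero hp, s5.ne_zero hp⟩
  have es1 : ∀ p ∈ S, 1 - 𝔲(p) / p.2.2.2 = -(p.2.1 * p.2.2.1 / p.2.2.2) := fun p hp => by
    obtain ⟨n2, n3, n4, n5⟩ := nS p hp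
    generalize h1 : 𝔲(p) = u1 at n5 ⊢
    field_simp
    subst h1
    ring
  have s6 := (((s2.mul s3).div s4).neg).congr es1
  have t1 : MaxOn ϖ T fun p => p.1 := ⟨nonExp₁, fun p hp => hp.1.1⟩
  have t2 : UnitOn ϖ T fun p => p.2.1 := ⟨nonExp₂, fun p hp => hp.1.2.1⟩
  have t3 : UnitOn ϖ T fun p => p.2.2.1 := ⟨nonExp₃, fun p hp => hp.1.2.2.1⟩
  have t4 : UnitOn ϖ T fun p => p.2.2.2 := ⟨nonExp₄, fun p hp => hp.1.2.2.2⟩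
  have t5 : UnitOn ϖ T fun p => 1 - p.2.1 := ⟨NonExp.one.sub t2.1, fun p hp => hp.2⟩
  have nT : ∀ p ∈ T, p.2.1 ≠ 0 ∧ p.2.2.1 ≠ 0 ∧ p.2.2.2 ≠ 0 ∧ 1 - p.2.1 ≠ 0 :=
    fun p hp => ⟨t2.ne_zero hp, t3.ne_zero hp, t4.ne_zero hp, t5.ne_zero hp⟩
  have et1 : ∀ p ∈ T, -1 / (p.2.2.2 * p.2.1) + -p.2.2.1 * (1 - p.2.1) / (p.2.2.2 ^ 2 * p.2.1) *
      (-p.2.2.2 / p.2.2.1) = -1 / p.2.2.2 := fun p hp => by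
    obtain ⟨n2, n3, n4, n5⟩ := nT p hp
    generalize h1 : 1 - p.2.1 = u1 at n5 ⊢
    field_simp
    subst h1
    ring
  have t6 := (UnitOn.one.neg.div t4).congr et1
  refine avg_summand_bij (t := fun p => 1 / (p.2.2.2 * p.2.2.1)) hϖ hχ hcond hN hS hT
    (hf.mono fun p hp => hp.1) (fun p => (p.1, 𝔲(p) / p.2.2.2, 1 / (𝔲(p) * p.2.2.1), -1 / 𝔲(p)))
    (fun p => (p.1, -p.2.2.1 * (1 - p.2.1) / (p.2.2.2 ^ 2 * p.2.1), -p.2.2.2 / p.2.2.1,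
      -1 / (p.2.2.2 * p.2.1)))
    (nonExp4 s1.1 (s5.1.div s4) (NonExp.one.div (s5.mul s3)) (NonExp.one.neg.div s5))
    (nonExp4 t1.1 ((t3.1.neg.mul t5.1).div ((t4.pow 2).mul t2)) (t4.1.neg.div t3)
      (NonExp.one.neg.div (t4.mul t2)))
    (fun p hp => ⟨⟨(s1).2 p hp, (s5.div s4).2 p hp, (UnitOn.one.div (s5.mul s3)).2 p hp,
      (UnitOn.one.neg.div s5).2 p hp⟩, (s6).2 p hp⟩)
    (fun p hp => ⟨⟨(t1).2 p hp, ((t3.neg.mul t5).div ((t4.pow 2).mul t2)).2 p hp,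
      (t4.neg.div t3).2 p hp, (UnitOn.one.neg.div (t4.mul t2)).2 p hp⟩, (t6).2 p hp⟩) ?_ ?_
    (s4.mul (s3.sub (s1.div s4))) (UnitOn.one.div (s4.mul s3))
    ((s1.div ((s4.mul s3).pow 2)).congr fun p hp => ?_) ?_
  · intro p hp
    obtain ⟨n2, n3, n4, n5⟩ := nS p hp
    refine Prod.ext ?_ (Prod.ext ?_ (Prod.ext ?_ ?_)) <;> dsimp only
    all_goals generalize h1 : 𝔲(p) = u1 at n5 ⊢
    all_goals try field_simp
    all_goals subst h1
    all_goals ring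
  · intro p hp
    obtain ⟨n2, n3, n4, n5⟩ := nT p hp
    refine Prod.ext ?_ (Prod.ext ?_ (Prod.ext ?_ ?_)) <;> dsimp only
    all_goals try simp only [et1 p hp]
    all_goals generalize h1 : 1 - p.2.1 = u1 at n5 ⊢
    all_goals try field_simp
  · obtain ⟨n2, n3, n4, n5⟩ := nS p hp
    dsimp only
    generalize h1 : 𝔲(p) = u1 at n5 ⊢
    field_simp
    subst h1
    ring
  · intro p hp
    obtain ⟨s, hs, e⟩ := hϖ.mem_maxIdeal_iff.1 (s1.2 p hp)
    exact eltB_apply_eq_elt13 hϖ hv (s2.2 p hp) (s4.2 p hp) (s5.2 p hp) (s3.2 p hp) hs e rfl rfl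

/-- On the part `a + xb ∈ 𝔭` this quantity is taken as a coordinate in place of `b`, so that powers
of `ϖ` can be extracted from it. -/
theorem avg_trmD_eq_trmE (hϖ : IsUniformizer ϖ) (hχ : χ.IsQuadratic)
    (hcond : HasConductorPrime χ) (hN : 1 ≤ N)
    (hf : InvOn ϖ N (boxMMUU F) (trmE ϖ χ ρ v)) :
    avg hϖ N (sepM (boxMUUU F) fun p => 𝔲(p)) (trmD ϖ χ ρ v) =
      avg hϖ N (boxMMUU F) (trmE ϖ χ ρ v) := by
  have hS := (adm_boxMUUU hϖ).sepM hϖ (nonExp₄.add (nonExp₂.mul nonExp₃))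
  have hT := adm_boxMMUU hϖ
  change avg (V := V) hϖ N ?S _ = avg (V := V) hϖ N ?T _
  set S := ?S
  set T := ?T
  have s1 : MaxOn ϖ S fun p => p.1 := ⟨nonExp₁, fun p hp => hp.1.1⟩
  have s2 : UnitOn ϖ S fun p => p.2.1 := ⟨nonExp₂, fun p hp => hp.1.2.1⟩
  have s3 : UnitOn ϖ S fun p => p.2.2.1 := ⟨nonExp₃, fun p hp => hp.1.2.2.1⟩
  have s4 : UnitOn ϖ S fun p => p.2.2.2 := ⟨nonExp₄, fun p hp => hp.1.2.2.2⟩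
  have s5 : MaxOn ϖ S fun p => 𝔲(p) := ⟨s4.1.add (s2.1.mul s3.1), fun p hp => hp.2⟩
  have nS : ∀ p ∈ S, p.2.1 ≠ 0 ∧ p.2.2.1 ≠ 0 ∧ p.2.2.2 ≠ 0 :=
    fun p hp => ⟨s2.ne_zero hp, s3.ne_zero hp, s4.ne_zero hp⟩
  have t1 : MaxOn ϖ T fun p => p.1 := ⟨nonExp₁, fun p hp => hp.1⟩
  have t2 : MaxOn ϖ T fun p => p.2.1 := ⟨nonExp₂, fun p hp => hp.2.1⟩
  have t3 : UnitOn ϖ T fun p => p.2.2.1 := ⟨nonExp₃, fun p hp => hp.2.2.1⟩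
  have t4 : UnitOn ϖ T fun p => p.2.2.2 := ⟨nonExp₄, fun p hp => hp.2.2.2⟩
  have nT : ∀ p ∈ T, p.2.2.1 ≠ 0 ∧ p.2.2.2 ≠ 0 :=
    fun p hp => ⟨t3.ne_zero hp, t4.ne_zero hp⟩
  have et1 : ∀ p ∈ T, p.2.2.2 + p.2.2.1 * ((p.1 - p.2.2.2) / p.2.2.1) = p.1 := fun p hp => by
    obtain ⟨n3, n4⟩ := nT p hp
    field_simp
    ring
  have t5 := (t1).congr et1
  refine avg_summand_bij (t := fun p => 1) hϖ hχ hcond hN hS hT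
    hf (fun p => (𝔲(p), p.1, p.2.1, p.2.2.2))
    (fun p => (p.2.1, p.2.2.1, (p.1 - p.2.2.2) / p.2.2.1, p.2.2.2))
    (nonExp4 s5.1 s1.1 s2.1 s4.1)
    (nonExp4 t2.1 t3.1 ((t1.1.sub t4.1).div t3) t4.1)
    (fun p hp => ⟨(s5).2 p hp, (s1).2 p hp, (s2).2 p hp, (s4).2 p hp⟩)
    (fun p hp => ⟨⟨(t2).2 p hp, (t3).2 p hp, ((t1.sub_unit t4).div t3).2 p hp, (t4).2 p hp⟩,
      (t5).2 p hp⟩) ?_ ?_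
    (s4.mul (s3.sub (s1.div s4))) (UnitOn.one)
    ((MaxOn.zero).congr fun p hp => ?_) ?_
  · intro p hp
    obtain ⟨n2, n3, n4⟩ := nS p hp
    refine Prod.ext ?_ (Prod.ext ?_ (Prod.ext ?_ ?_)) <;> dsimp only
    all_goals try field_simp
    all_goals ring
  · intro p hp
    obtain ⟨n3, n4⟩ := nT p hp
    refine Prod.ext ?_ (Prod.ext ?_ (Prod.ext ?_ ?_)) <;> dsimp only
    all_goals try field_simp
    all_goals ring
  · obtain ⟨n2, n3, n4⟩ := nS p hp
    dsimp only
    field_simp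
    ring
  · intro p hp
    dsimp only
    rw [add_sub_cancel_left, mul_div_cancel_left₀ _ (unit_ne_zero (s2.2 p hp))]

theorem avg_trmE_eq_trm6 (hϖ : IsUniformizer ϖ) (hχ : χ.IsQuadratic)
    (hcond : HasConductorPrime χ) (hv : v ∈ paramodularVectors ρ ϖ 0) (hN : 1 ≤ N)
    (hf : InvOn ϖ N (boxMUUU F) (trm6 ϖ χ ρ v)) :
    avg hϖ N (unitInt F ×ˢ maxIdeal F ×ˢ unitInt F ×ˢ unitInt F) (summand χ ρ v (fun p => p.2.2.2 *
        (((ϖ : F) * p.1 - p.2.2.2) / p.2.2.1 - p.2.1 / p.2.2.2)) fun p =>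
        eltB ϖ (t4 ϖ) 3 p.2.1 p.2.2.1 (((ϖ : F) * p.1 - p.2.2.2) / p.2.2.1 - p.2.1 / p.2.2.2)
        p.2.2.2) =
      avg hϖ N (boxMUUU F) (trm6 ϖ χ ρ v) := by
  have hS := adm_prod (admF_unitInt hϖ) (admF_maxIdeal hϖ) (admF_unitInt hϖ) (admF_unitInt hϖ)
  have hT := adm_boxMUUU hϖ
  change avg (V := V) hϖ N ?S _ = avg (V := V) hϖ N ?T _
  set S := ?S
  set T := ?T
  have s1 : UnitOn ϖ S fun p => p.1 := ⟨nonExp₁, fun p hp => hp.1⟩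
  have s2 : MaxOn ϖ S fun p => p.2.1 := ⟨nonExp₂, fun p hp => hp.2.1⟩
  have s3 : UnitOn ϖ S fun p => p.2.2.1 := ⟨nonExp₃, fun p hp => hp.2.2.1⟩
  have s4 : UnitOn ϖ S fun p => p.2.2.2 := ⟨nonExp₄, fun p hp => hp.2.2.2⟩
  have nS : ∀ p ∈ S, p.1 ≠ 0 ∧ p.2.2.1 ≠ 0 ∧ p.2.2.2 ≠ 0 :=
    fun p hp => ⟨s1.ne_zero hp, s3.ne_zero hp, s4.ne_zero hp⟩
  have s5 : UnitOn ϖ S fun p => (ϖ : F) * p.1 - p.2.2.2 := (((MaxOn.varpi hϖ)).mul hS s1.1).sub_unit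
      s4
  have t1 : MaxOn ϖ T fun p => p.1 := ⟨nonExp₁, fun p hp => hp.1⟩
  have t2 : UnitOn ϖ T fun p => p.2.1 := ⟨nonExp₂, fun p hp => hp.2.1⟩
  have t3 : UnitOn ϖ T fun p => p.2.2.1 := ⟨nonExp₃, fun p hp => hp.2.2.1⟩
  have t4 : UnitOn ϖ T fun p => p.2.2.2 := ⟨nonExp₄, fun p hp => hp.2.2.2⟩
  have nT : ∀ p ∈ T, p.2.1 ≠ 0 ∧ p.2.2.1 ≠ 0 ∧ p.2.2.2 ≠ 0 :=
    fun p hp => ⟨t2.ne_zero hp, t3.ne_zero hp, t4.ne_zero hp⟩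
  have t5 : UnitOn ϖ T fun p => (ϖ : F) * p.2.1 - 1 := (((MaxOn.varpi hϖ)).mul hT t2.1).sub_unit
      UnitOn.one
  have et1 : ∀ p ∈ T, (ϖ : F) * (-1 / p.2.2.2) - -1 / (p.2.2.2 * p.2.1) = -((ϖ : F) *
      p.2.1 - 1) / (p.2.2.2 * p.2.1) := fun p hp => by
    obtain ⟨n2, n3, n4⟩ := nT p hp
    have n5 := t5.ne_zero hp
    generalize h1 : (ϖ : F) * p.2.1 - 1 = u1 at n5 ⊢
    field_simp
    subst h1
    ring
  -- The new character argument is `t` itself, and the old one is congruent to `t⁻¹`.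
  refine avg_summand_bij (t := fun p => p.2.2.1 / (((ϖ : F) * p.1 - p.2.2.2) *
      p.2.2.2)) hϖ hχ hcond hN hS hT
    hf (fun p => (p.2.1, p.1 / p.2.2.2, p.2.2.1 / (p.1 * ((ϖ : F) * p.1 - p.2.2.2)), -1 / p.1))
    (fun p => (-1 / p.2.2.2, p.1, p.2.2.1 * ((ϖ : F) * p.2.1 - 1) / (p.2.2.2 ^ 2 * p.2.1),
      -1 / (p.2.2.2 * p.2.1)))
    (nonExp4 s2.1 (s1.1.div s4) (s3.1.div (s1.mul s5)) (NonExp.one.neg.div s1))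
    (nonExp4 (NonExp.one.neg.div t4) t1.1 ((t3.1.mul t5.1).div ((t4.pow 2).mul t2))
      (NonExp.one.neg.div (t4.mul t2)))
    (fun p hp => ⟨(s2).2 p hp, (s1.div s4).2 p hp, (s3.div (s1.mul s5)).2 p hp,
      (UnitOn.one.neg.div s1).2 p hp⟩)
    (fun p hp => ⟨(UnitOn.one.neg.div t4).2 p hp, (t1).2 p hp,
      ((t3.mul t5).div ((t4.pow 2).mul t2)).2 p hp, (UnitOn.one.neg.div (t4.mul t2)).2 p hp⟩) ?_ ?_
    (s4.mul ((s5.div s3).sub (s2.div s4))) (s3.div (s5.mul s4))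
    ((s2.mul hS ((s3.1.div (s5.mul s4)).pow 2)).congr fun p hp => ?_) ?_
  · intro p hp
    obtain ⟨n1, n3, n4⟩ := nS p hp
    have n5 := s5.ne_zero hp
    refine Prod.ext ?_ (Prod.ext ?_ (Prod.ext ?_ ?_)) <;> dsimp only
    all_goals generalize h1 : (ϖ : F) * p.1 - p.2.2.2 = u1 at n5 ⊢
    all_goals try field_simp
    all_goals subst h1
    all_goals ring
  · intro p hp
    obtain ⟨n2, n3, n4⟩ := nT p hp
    have n5 := t5.ne_zero hp
    refine Prod.ext ?_ (Prod.ext ?_ (Prod.ext ?_ ?_)) <;> dsimp only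
    all_goals try simp only [et1 p hp]
    all_goals generalize h1 : (ϖ : F) * p.2.1 - 1 = u1 at n5 ⊢
    all_goals try field_simp
  · obtain ⟨n1, n3, n4⟩ := nS p hp
    have n5 := s5.ne_zero hp
    dsimp only
    generalize h1 : (ϖ : F) * p.1 - p.2.2.2 = u1 at n5 ⊢
    field_simp
    subst h1
    ring
  · intro p hp
    obtain ⟨s, hs, e⟩ := hϖ.mem_maxIdeal_iff.1 (s2.2 p hp)
    exact eltB_apply_eq_elt6 hϖ hv (s3.2 p hp) (s4.2 p hp) (s1.2 p hp) (s5.2 p hp) hs e rfl rfl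

theorem avg_trmE_eq_trm9 (hϖ : IsUniformizer ϖ) (hχ : χ.IsQuadratic)
    (hcond : HasConductorPrime χ) (hv : v ∈ paramodularVectors ρ ϖ 0) (hN : 1 ≤ N)
    (hf : InvOn ϖ N (boxMUUU F) (trm9 ϖ χ ρ v)) :
    avg hϖ N (unitInt F ×ˢ maxIdeal F ×ˢ unitInt F ×ˢ unitInt F) (summand χ ρ v (fun p => p.2.2.2 *
        (((ϖ : F) * ((ϖ : F) * p.1) - p.2.2.2) / p.2.2.1 - p.2.1 / p.2.2.2)) fun p =>
        eltB ϖ (t4 ϖ) 3 p.2.1 p.2.2.1 (((ϖ : F) * ((ϖ : F) *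
        p.1) - p.2.2.2) / p.2.2.1 - p.2.1 / p.2.2.2) p.2.2.2) =
      avg hϖ N (boxMUUU F) (trm9 ϖ χ ρ v) := by
  have hS := adm_prod (admF_unitInt hϖ) (admF_maxIdeal hϖ) (admF_unitInt hϖ) (admF_unitInt hϖ)
  have hT := adm_boxMUUU hϖ
  change avg (V := V) hϖ N ?S _ = avg (V := V) hϖ N ?T _
  set S := ?S
  set T := ?T
  have s1 : UnitOn ϖ S fun p => p.1 := ⟨nonExp₁, fun p hp => hp.1⟩
  have s2 : MaxOn ϖ S fun p => p.2.1 := ⟨nonExp₂, fun p hp => hp.2.1⟩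
  have s3 : UnitOn ϖ S fun p => p.2.2.1 := ⟨nonExp₃, fun p hp => hp.2.2.1⟩
  have s4 : UnitOn ϖ S fun p => p.2.2.2 := ⟨nonExp₄, fun p hp => hp.2.2.2⟩
  have nS : ∀ p ∈ S, p.1 ≠ 0 ∧ p.2.2.1 ≠ 0 ∧ p.2.2.2 ≠ 0 :=
    fun p hp => ⟨s1.ne_zero hp, s3.ne_zero hp, s4.ne_zero hp⟩
  have t1 : MaxOn ϖ T fun p => p.1 := ⟨nonExp₁, fun p hp => hp.1⟩
  have t2 : UnitOn ϖ T fun p => p.2.1 := ⟨nonExp₂, fun p hp => hp.2.1⟩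
  have t3 : UnitOn ϖ T fun p => p.2.2.1 := ⟨nonExp₃, fun p hp => hp.2.2.1⟩
  have t4 : UnitOn ϖ T fun p => p.2.2.2 := ⟨nonExp₄, fun p hp => hp.2.2.2⟩
  have nT : ∀ p ∈ T, p.2.1 ≠ 0 ∧ p.2.2.1 ≠ 0 ∧ p.2.2.2 ≠ 0 :=
    fun p hp => ⟨t2.ne_zero hp, t3.ne_zero hp, t4.ne_zero hp⟩
  -- Modulo `𝔭` the old argument is `-a²/x`; multiplied by the square of `x/a²` it becomes `-x/a²`,
  -- the new one.
  refine avg_summand_bij (t := fun p => p.2.2.1 / p.2.2.2 ^ 2) hϖ hχ hcond hN hS hT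
    hf (fun p => (p.2.1, -p.2.2.2 / (p.2.2.1 * p.1), -p.2.2.1 / p.2.2.2 ^ 2, p.2.2.1 / p.2.2.2))
    (fun p => (-1 / (p.2.2.2 * p.2.1), p.1, -p.2.2.2 ^ 2 / p.2.2.1, -p.2.2.2 / p.2.2.1))
    (nonExp4 s2.1 (s4.1.neg.div (s3.mul s1)) (s3.1.neg.div (s4.pow 2)) (s3.1.div s4))
    (nonExp4 (NonExp.one.neg.div (t4.mul t2)) t1.1 (((t4.1.pow 2).neg).div t3) (t4.1.neg.div t3))
    (fun p hp => ⟨(s2).2 p hp, (s4.neg.div (s3.mul s1)).2 p hp, (s3.neg.div (s4.pow 2)).2 p hp,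
      (s3.div s4).2 p hp⟩)
    (fun p hp => ⟨(UnitOn.one.neg.div (t4.mul t2)).2 p hp, (t1).2 p hp,
      (((t4.pow 2).neg).div t3).2 p hp, (t4.neg.div t3).2 p hp⟩) ?_ ?_
    (s4.mul ((((((MaxOn.varpi hϖ)).mul hS (((NonExp.varpi hϖ)).mul s1.1)).sub_unit s4).div s3).sub
      (s2.div s4))) (s3.div (s4.pow 2))
    ((((((((MaxOn.varpi hϖ)).mul hS (((NonExp.varpi hϖ)).mul s1.1)).sub ((s2.mul hS s3.1).div
      s4)).mul hS s3.1).div (s4.pow 3)).neg).congr fun p hp => ?_) ?_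
  · intro p hp
    obtain ⟨n1, n3, n4⟩ := nS p hp
    refine Prod.ext ?_ (Prod.ext ?_ (Prod.ext ?_ ?_)) <;> dsimp only
    all_goals try field_simp
  · intro p hp
    obtain ⟨n2, n3, n4⟩ := nT p hp
    refine Prod.ext ?_ (Prod.ext ?_ (Prod.ext ?_ ?_)) <;> dsimp only
    all_goals try field_simp
  · obtain ⟨n1, n3, n4⟩ := nS p hp
    dsimp only
    field_simp
    ring
  · intro p hp
    obtain ⟨s, hs, e⟩ := hϖ.mem_maxIdeal_iff.1 (s2.2 p hp)
    exact eltB_apply_eq_elt9 hϖ hv (s3.2 p hp) (s4.2 p hp) (s1.2 p hp) hs e rfl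

/-- Neither `z` nor the extracted coordinate affects the coset any more: both become dummy
variables, one in `𝔭` and one in `𝔬`. -/
theorem avg_trmE_eq_trm10 (hϖ : IsUniformizer ϖ) (hχ : χ.IsQuadratic)
    (hcond : HasConductorPrime χ) (hv : v ∈ paramodularVectors ρ ϖ 0) (hN : 1 ≤ N)
    (hf : InvOn ϖ N (boxMOUU F) (trm10 ϖ χ ρ v)) :
    avg hϖ N (boxOMUU F) (summand χ ρ v (fun p => p.2.2.2 * (((ϖ : F) * ((ϖ : F) * ((ϖ : F) *
        p.1)) - p.2.2.2) / p.2.2.1 - p.2.1 / p.2.2.2)) fun p =>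
        eltB ϖ (t4 ϖ) 3 p.2.1 p.2.2.1 (((ϖ : F) * ((ϖ : F) * ((ϖ : F) *
        p.1)) - p.2.2.2) / p.2.2.1 - p.2.1 / p.2.2.2) p.2.2.2) =
      avg hϖ N (boxMOUU F) (trm10 ϖ χ ρ v) := by
  have hS := adm_boxOMUU hϖ
  have hT := adm_boxMOUU hϖ
  change avg (V := V) hϖ N ?S _ = avg (V := V) hϖ N ?T _
  set S := ?S
  set T := ?T
  have s1 : MaxOn ϖ S fun p => p.2.1 := ⟨nonExp₂, fun p hp => hp.2.1⟩
  have s2 : UnitOn ϖ S fun p => p.2.2.1 := ⟨nonExp₃, fun p hp => hp.2.2.1⟩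
  have s3 : UnitOn ϖ S fun p => p.2.2.2 := ⟨nonExp₄, fun p hp => hp.2.2.2⟩
  have nS : ∀ p ∈ S, p.2.2.1 ≠ 0 ∧ p.2.2.2 ≠ 0 :=
    fun p hp => ⟨s2.ne_zero hp, s3.ne_zero hp⟩
  have t1 : MaxOn ϖ T fun p => p.1 := ⟨nonExp₁, fun p hp => hp.1⟩
  have t2 : UnitOn ϖ T fun p => p.2.2.1 := ⟨nonExp₃, fun p hp => hp.2.2.1⟩
  have t3 : UnitOn ϖ T fun p => p.2.2.2 := ⟨nonExp₄, fun p hp => hp.2.2.2⟩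
  have nT : ∀ p ∈ T, p.2.2.1 ≠ 0 ∧ p.2.2.2 ≠ 0 :=
    fun p hp => ⟨t2.ne_zero hp, t3.ne_zero hp⟩
  refine avg_summand_bij (t := fun p => p.2.2.1 / p.2.2.2 ^ 2) hϖ hχ hcond hN hS hT
    hf (fun p => (p.2.1, p.1, -p.2.2.1 / p.2.2.2 ^ 2, p.2.2.1 / p.2.2.2))
    (fun p => (p.2.1, p.1, -p.2.2.2 ^ 2 / p.2.2.1, -p.2.2.2 / p.2.2.1))
    (nonExp4 s1.1 nonExp₁ (s2.1.neg.div (s3.pow 2)) (s2.1.div s3))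
    (nonExp4 nonExp₂ t1.1 (((t3.1.pow 2).neg).div t2) (t3.1.neg.div t2))
    (fun p hp => ⟨(s1).2 p hp, ((nonExp₁).mem_ringInt hS) p hp, (s2.neg.div (s3.pow 2)).2 p hp,
      (s2.div s3).2 p hp⟩)
    (fun p hp => ⟨((nonExp₂).mem_ringInt hT) p hp, (t1).2 p hp, (((t3.pow 2).neg).div t2).2 p hp,
      (t3.neg.div t2).2 p hp⟩) ?_ ?_
    (s3.mul ((((((MaxOn.varpi hϖ)).mul hS (((NonExp.varpi hϖ)).mul (((NonExp.varpi hϖ)).mul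
      nonExp₁))).sub_unit s3).div s2).sub (s1.div s3))) (s2.div (s3.pow 2))
    ((((((((MaxOn.varpi hϖ)).mul hS (((NonExp.varpi hϖ)).mul (((NonExp.varpi hϖ)).mul nonExp₁))).sub
      ((s1.mul hS s2.1).div s3)).mul hS s2.1).div (s3.pow 3)).neg).congr fun p hp => ?_) ?_
  · intro p hp
    obtain ⟨n2, n3⟩ := nS p hp
    refine Prod.ext ?_ (Prod.ext ?_ (Prod.ext ?_ ?_)) <;> dsimp only
    all_goals try field_simp
  · intro p hp
    obtain ⟨n2, n3⟩ := nT p hp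
    refine Prod.ext ?_ (Prod.ext ?_ (Prod.ext ?_ ?_)) <;> dsimp only
    all_goals try field_simp
  · obtain ⟨n2, n3⟩ := nS p hp
    dsimp only
    field_simp
    ring
  · intro p hp
    obtain ⟨s, hs, e⟩ := hϖ.mem_maxIdeal_iff.1 (s1.2 p hp)
    exact eltB_apply_eq_elt10 hϖ hv (s2.2 p hp) (s3.2 p hp) hs ((nonExp₁.mem_ringInt hS) p hp)
      e rfl

end Bijections

/-! ### The forms A, B, C without `t₄` -/

section Elements

variable {F : Type*} [Field F] (ϖ : Fˣ)

/-- Writing the Heisenberg element as `A` times a Siegel unipotent changes only the central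
coordinate. The change is integral at this scale, so a translation of `z ∈ 𝔬` removes it; the B and
C forms behave in the same way. -/
theorem eltA_one_eq (z b a : F) : eltA ϖ 1 4 z b a = elt7 ϖ (z + a * b * ϖ) b a := by
  have := ϖ.ne_zero
  rw [eltA, elt7, one_mul]
  congr 1
  apply toMat_injective
  rw [toMat_mul, toMat_heis, toMat_heis, toMat_siegel, mul_fin_four]
  apply ext_fin_four <;> field_simp <;> ring

theorem eltB_one_eq (z x b a : F) :
    eltB ϖ 1 4 z x b a = elt1 ϖ (z + (a + x * b) * b * ϖ) x b a := by
  have := ϖ.ne_zero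
  rw [eltB, elt1, one_mul]
  apply toMat_injective
  rw [toMat_mul, toMat_mul, toMat_heis, toMat_heis, toMat_siegel, toMat_siegel, mul_fin_four,
    mul_fin_four]
  generalize x⁻¹ = y
  apply ext_fin_four <;> field_simp <;> ring

theorem eltC_one_eq (z x b a : F) :
    eltC ϖ 1 4 z x b a = elt11 ϖ (z - b * (x * b + a * ϖ)) x b a := by
  have := ϖ.ne_zero
  rw [eltC, elt11, one_mul, mul_assoc]
  congr 1
  apply toMat_injective
  rw [toMat_mul, toMat_mul, toMat_heis, toMat_heis, toMat_siegel, toMat_siegel, mul_fin_four,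
    mul_fin_four]
  apply ext_fin_four <;> field_simp <;> ring

end Elements

/-! ### Reduction of the middle block -/

section Decomposition

variable {F : Type*} [Field F] [ValuativeRel F] [TopologicalSpace F]
  [IsNonarchimedeanLocalField F] {ϖ : Fˣ} {χ : MulChar F ℂ}
  {V : Type*} [AddCommGroup V] [Module ℂ V] {ρ : Representation ℂ (GSp4 F) V} {v : V} {N : ℕ}

/-- The lower variable becomes `-1/x`, again a unit. The new character argument is `ab + ϖa²/x`,
congruent to the old one. -/
theorem avg_trm_eq_trmC (g₀ : GSp4 F) (m : ℕ) (hϖ : IsUniformizer ϖ) (hχ : χ.IsQuadratic)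
    (hcond : HasConductorPrime χ) (hv : v ∈ paramodularVectors ρ ϖ 0) (hN : 1 ≤ N)
    (hf : InvOn ϖ N (boxOOUU F) (trmC ϖ χ ρ v g₀ m)) :
    avg hϖ N (sepU (boxOOUU F) fun p => p.2.1) (trm ϖ χ ρ v g₀ m) =
      avg hϖ N (sepU (boxOOUU F) fun p => p.2.1) (trmC ϖ χ ρ v g₀ m) := by
  have hS := (adm_boxOOUU hϖ).sepU hϖ (nonExp₂)
  have hT := (adm_boxOOUU hϖ).sepU hϖ (nonExp₂)
  change avg (V := V) hϖ N ?S _ = avg (V := V) hϖ N ?T _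
  set S := ?S
  set T := ?T
  have s1 : UnitOn ϖ S fun p => p.2.2.1 := ⟨nonExp₃, fun p hp => hp.1.2.2.1⟩
  have s2 : UnitOn ϖ S fun p => p.2.2.2 := ⟨nonExp₄, fun p hp => hp.1.2.2.2⟩
  have s3 : UnitOn ϖ S fun p => p.2.1 := ⟨nonExp₂, fun p hp => hp.2⟩
  have nS : ∀ p ∈ S, p.2.2.1 ≠ 0 ∧ p.2.2.2 ≠ 0 ∧ p.2.1 ≠ 0 :=
    fun p hp => ⟨s1.ne_zero hp, s2.ne_zero hp, s3.ne_zero hp⟩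
  have es1 : ∀ p ∈ S, -(p.2.2.2 * (ϖ : F) + p.2.1 * p.2.2.1) = -(p.2.1 * p.2.2.1 + (ϖ : F) *
      p.2.2.2) := fun p hp => by
    obtain ⟨n1, n2, n3⟩ := nS p hp
    field_simp
    ring
  have s4 := (((s3.mul s1).add (((MaxOn.varpi hϖ)).mul hS s2.1)).neg).congr es1
  have t1 : UnitOn ϖ T fun p => p.2.2.1 := ⟨nonExp₃, fun p hp => hp.1.2.2.1⟩
  have t2 : UnitOn ϖ T fun p => p.2.2.2 := ⟨nonExp₄, fun p hp => hp.1.2.2.2⟩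
  have t3 : UnitOn ϖ T fun p => p.2.1 := ⟨nonExp₂, fun p hp => hp.2⟩
  have nT : ∀ p ∈ T, p.2.2.1 ≠ 0 ∧ p.2.2.2 ≠ 0 ∧ p.2.1 ≠ 0 :=
    fun p hp => ⟨t1.ne_zero hp, t2.ne_zero hp, t3.ne_zero hp⟩
  have et1 : ∀ p ∈ T, p.2.2.1 * p.2.1 + p.2.2.2 * (ϖ : F) = p.2.2.1 * p.2.1 + (ϖ : F) * p.2.2.2 :=
      fun p hp => by
    obtain ⟨n1, n2, n3⟩ := nT p hp
    field_simp
  have t4 := ((t1.mul t3).add (((MaxOn.varpi hϖ)).mul hT t2.1)).congr et1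
  refine avg_summand_bij (t := fun p => 1) hϖ hχ hcond hN hS hT
    (hf.mono fun p hp => hp.1) (fun p => (p.1, -1 / p.2.1, -(p.2.2.2 * (ϖ : F) + p.2.1 * p.2.2.1),
      -p.2.2.2 / p.2.1))
    (fun p => (p.1, -1 / p.2.1, p.2.2.1 * p.2.1 + p.2.2.2 * (ϖ : F), p.2.2.2 / p.2.1))
    (nonExp4 nonExp₁ (NonExp.one.neg.div s3) s4.1 (s2.1.neg.div s3))
    (nonExp4 nonExp₁ (NonExp.one.neg.div t3) t4.1 (t2.1.div t3))
    (fun p hp => ⟨⟨((nonExp₁).mem_ringInt hS) p hp, ((NonExp.one.neg.div s3).mem_ringInt hS) p hp,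
      (s4).2 p hp, (s2.neg.div s3).2 p hp⟩, (UnitOn.one.neg.div s3).2 p hp⟩)
    (fun p hp => ⟨⟨((nonExp₁).mem_ringInt hT) p hp, ((NonExp.one.neg.div t3).mem_ringInt hT) p hp,
      (t4).2 p hp, (t2.div t3).2 p hp⟩, (UnitOn.one.neg.div t3).2 p hp⟩) ?_ ?_
    (s2.mul s1) (UnitOn.one)
    ((((MaxOn.varpi hϖ)).mul hS ((s2.1.mul s2.1).div s3)).congr fun p hp => ?_) ?_
  · intro p hp
    obtain ⟨n1, n2, n3⟩ := nS p hp
    refine Prod.ext ?_ (Prod.ext ?_ (Prod.ext ?_ ?_)) <;> dsimp only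
    all_goals try field_simp
    all_goals ring
  · intro p hp
    obtain ⟨n1, n2, n3⟩ := nT p hp
    refine Prod.ext ?_ (Prod.ext ?_ (Prod.ext ?_ ?_)) <;> dsimp only
    all_goals try field_simp
    all_goals ring
  · obtain ⟨n1, n2, n3⟩ := nS p hp
    dsimp only
    field_simp
    ring
  · intro p hp
    exact elt_apply_of_unit hϖ hv g₀ m _ _ _ (s3.2 p hp)

/-- The variable `x` is brought to the first place, where multiples of `ϖ` are extracted. -/
theorem avg_trm_swap (g₀ : GSp4 F) (m : ℕ) (hϖ : IsUniformizer ϖ) (hχ : χ.IsQuadratic)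
    (hcond : HasConductorPrime χ) (hN : 1 ≤ N)
    (hf : InvOn ϖ N (boxMOUU F) (summand χ ρ v (fun p => p.2.2.2 * p.2.2.1) fun p =>
      elt ϖ g₀ m p.2.1 p.1 p.2.2.1 p.2.2.2)) :
    avg hϖ N (boxOMUU F) (trm ϖ χ ρ v g₀ m) =
      avg hϖ N (boxMOUU F) (summand χ ρ v (fun p => p.2.2.2 * p.2.2.1) fun p =>
          elt ϖ g₀ m p.2.1 p.1 p.2.2.1 p.2.2.2) := by
  have hS := adm_boxOMUU hϖ
  have hT := adm_boxMOUU hϖ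
  change avg (V := V) hϖ N ?S _ = avg (V := V) hϖ N ?T _
  set S := ?S
  set T := ?T
  have s1 : MaxOn ϖ S fun p => p.2.1 := ⟨nonExp₂, fun p hp => hp.2.1⟩
  have s2 : UnitOn ϖ S fun p => p.2.2.1 := ⟨nonExp₃, fun p hp => hp.2.2.1⟩
  have s3 : UnitOn ϖ S fun p => p.2.2.2 := ⟨nonExp₄, fun p hp => hp.2.2.2⟩
  have nS : ∀ p ∈ S, p.2.2.1 ≠ 0 ∧ p.2.2.2 ≠ 0 :=
    fun p hp => ⟨s2.ne_zero hp, s3.ne_zero hp⟩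
  have t1 : MaxOn ϖ T fun p => p.1 := ⟨nonExp₁, fun p hp => hp.1⟩
  have t2 : UnitOn ϖ T fun p => p.2.2.1 := ⟨nonExp₃, fun p hp => hp.2.2.1⟩
  have t3 : UnitOn ϖ T fun p => p.2.2.2 := ⟨nonExp₄, fun p hp => hp.2.2.2⟩
  have nT : ∀ p ∈ T, p.2.2.1 ≠ 0 ∧ p.2.2.2 ≠ 0 :=
    fun p hp => ⟨t2.ne_zero hp, t3.ne_zero hp⟩
  refine avg_summand_bij (t := fun p => 1) hϖ hχ hcond hN hS hT
    hf (fun p => (p.2.1, p.1, p.2.2.1, p.2.2.2))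
    (fun p => (p.2.1, p.1, p.2.2.1, p.2.2.2))
    (nonExp4 s1.1 nonExp₁ s2.1 s3.1)
    (nonExp4 nonExp₂ t1.1 t2.1 t3.1)
    (fun p hp => ⟨(s1).2 p hp, ((nonExp₁).mem_ringInt hS) p hp, (s2).2 p hp, (s3).2 p hp⟩)
    (fun p hp => ⟨((nonExp₂).mem_ringInt hT) p hp, (t1).2 p hp, (t2).2 p hp, (t3).2 p hp⟩) ?_ ?_
    (s3.mul s2) (UnitOn.one)
    ((MaxOn.zero).congr fun p hp => ?_) ?_
  · intro p hp
    obtain ⟨n2, n3⟩ := nS p hp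
    refine Prod.ext ?_ (Prod.ext ?_ (Prod.ext ?_ ?_)) <;> dsimp only
  · intro p hp
    obtain ⟨n2, n3⟩ := nT p hp
    refine Prod.ext ?_ (Prod.ext ?_ (Prod.ext ?_ ?_)) <;> dsimp only
  · obtain ⟨n2, n3⟩ := nS p hp
    dsimp only
    field_simp
    ring
  · intro p hp
    rfl

theorem avg_trm_eq_trmB (g₀ : GSp4 F) (m : ℕ) (hϖ : IsUniformizer ϖ) (hχ : χ.IsQuadratic)
    (hcond : HasConductorPrime χ) (hv : v ∈ paramodularVectors ρ ϖ 0) (hN : 1 ≤ N)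
    (hf : InvOn ϖ N (boxOUUU F) (trmB ϖ χ ρ v g₀ m)) :
    avg hϖ N (unitInt F ×ˢ ringInt F ×ˢ unitInt F ×ˢ unitInt F) (summand χ ρ v (fun p => p.2.2.2 *
        p.2.2.1) fun p => elt ϖ g₀ m p.2.1 ((ϖ : F) * p.1) p.2.2.1 p.2.2.2) =
      avg hϖ N (boxOUUU F) (trmB ϖ χ ρ v g₀ m) := by
  have hS := adm_prod (admF_unitInt hϖ) admF_ringInt (admF_unitInt hϖ) (admF_unitInt hϖ)
  have hT := adm_boxOUUU hϖ
  change avg (V := V) hϖ N ?S _ = avg (V := V) hϖ N ?T _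
  set S := ?S
  set T := ?T
  have s1 : UnitOn ϖ S fun p => p.1 := ⟨nonExp₁, fun p hp => hp.1⟩
  have s2 : UnitOn ϖ S fun p => p.2.2.1 := ⟨nonExp₃, fun p hp => hp.2.2.1⟩
  have s3 : UnitOn ϖ S fun p => p.2.2.2 := ⟨nonExp₄, fun p hp => hp.2.2.2⟩
  have nS : ∀ p ∈ S, p.1 ≠ 0 ∧ p.2.2.1 ≠ 0 ∧ p.2.2.2 ≠ 0 :=
    fun p hp => ⟨s1.ne_zero hp, s2.ne_zero hp, s3.ne_zero hp⟩
  have t1 : UnitOn ϖ T fun p => p.2.1 := ⟨nonExp₂, fun p hp => hp.2.1⟩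
  have t2 : UnitOn ϖ T fun p => p.2.2.1 := ⟨nonExp₃, fun p hp => hp.2.2.1⟩
  have t3 : UnitOn ϖ T fun p => p.2.2.2 := ⟨nonExp₄, fun p hp => hp.2.2.2⟩
  have nT : ∀ p ∈ T, p.2.1 ≠ 0 ∧ p.2.2.1 ≠ 0 ∧ p.2.2.2 ≠ 0 :=
    fun p hp => ⟨t1.ne_zero hp, t2.ne_zero hp, t3.ne_zero hp⟩
  refine avg_summand_bij (t := fun p => 1) hϖ hχ hcond hN hS hT
    hf (fun p => (p.2.1, p.1, p.2.2.1, p.2.2.2))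
    (fun p => (p.2.1, p.1, p.2.2.1, p.2.2.2))
    (nonExp4 nonExp₂ s1.1 s2.1 s3.1)
    (nonExp4 t1.1 nonExp₁ t2.1 t3.1)
    (fun p hp => ⟨((nonExp₂).mem_ringInt hS) p hp, (s1).2 p hp, (s2).2 p hp, (s3).2 p hp⟩)
    (fun p hp => ⟨(t1).2 p hp, ((nonExp₁).mem_ringInt hT) p hp, (t2).2 p hp, (t3).2 p hp⟩) ?_ ?_
    (s3.mul s2) (UnitOn.one)
    ((MaxOn.zero).congr fun p hp => ?_) ?_
  · intro p hp
    obtain ⟨n1, n2, n3⟩ := nS p hp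
    refine Prod.ext ?_ (Prod.ext ?_ (Prod.ext ?_ ?_)) <;> dsimp only
  · intro p hp
    obtain ⟨n1, n2, n3⟩ := nT p hp
    refine Prod.ext ?_ (Prod.ext ?_ (Prod.ext ?_ ?_)) <;> dsimp only
  · obtain ⟨n1, n2, n3⟩ := nS p hp
    dsimp only
    field_simp
    ring
  · intro p hp
    exact elt_apply_of_mul hϖ hv g₀ m _ _ _ (s1.2 p hp)

theorem avg_trm_eq_trmA (g₀ : GSp4 F) (m : ℕ) (hϖ : IsUniformizer ϖ) (hχ : χ.IsQuadratic)
    (hcond : HasConductorPrime χ) (hv : v ∈ paramodularVectors ρ ϖ 0) (hN : 1 ≤ N)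
    (hf : InvOn ϖ N (boxOOUU F) (trmA ϖ χ ρ v g₀ m)) :
    avg hϖ N (boxOOUU F) (summand χ ρ v (fun p => p.2.2.2 * p.2.2.1) fun p =>
        elt ϖ g₀ m p.2.1 ((ϖ : F) * ((ϖ : F) * p.1)) p.2.2.1 p.2.2.2) =
      avg hϖ N (boxOOUU F) (trmA ϖ χ ρ v g₀ m) := by
  have hS := adm_boxOOUU hϖ
  have hT := adm_boxOOUU hϖ
  change avg (V := V) hϖ N ?S _ = avg (V := V) hϖ N ?T _
  set S := ?S
  set T := ?T
  have s1 : UnitOn ϖ S fun p => p.2.2.1 := ⟨nonExp₃, fun p hp => hp.2.2.1⟩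
  have s2 : UnitOn ϖ S fun p => p.2.2.2 := ⟨nonExp₄, fun p hp => hp.2.2.2⟩
  have nS : ∀ p ∈ S, p.2.2.1 ≠ 0 ∧ p.2.2.2 ≠ 0 :=
    fun p hp => ⟨s1.ne_zero hp, s2.ne_zero hp⟩
  have t1 : UnitOn ϖ T fun p => p.2.2.1 := ⟨nonExp₃, fun p hp => hp.2.2.1⟩
  have t2 : UnitOn ϖ T fun p => p.2.2.2 := ⟨nonExp₄, fun p hp => hp.2.2.2⟩
  have nT : ∀ p ∈ T, p.2.2.1 ≠ 0 ∧ p.2.2.2 ≠ 0 :=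
    fun p hp => ⟨t1.ne_zero hp, t2.ne_zero hp⟩
  refine avg_summand_bij (t := fun p => 1) hϖ hχ hcond hN hS hT
    hf (fun p => (p.1, p.2.1, p.2.2.1, p.2.2.2 + (ϖ : F) * p.1 * p.2.2.1))
    (fun p => (p.1, p.2.1, p.2.2.1, p.2.2.2 - (ϖ : F) * p.1 * p.2.2.1))
    (nonExp4 nonExp₁ nonExp₂ s1.1 (s2.1.add ((((NonExp.varpi hϖ)).mul nonExp₁).mul s1.1)))
    (nonExp4 nonExp₁ nonExp₂ t1.1 (t2.1.sub ((((NonExp.varpi hϖ)).mul nonExp₁).mul t1.1)))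
    (fun p hp => ⟨((nonExp₁).mem_ringInt hS) p hp, ((nonExp₂).mem_ringInt hS) p hp, (s1).2 p hp,
      (s2.add ((((MaxOn.varpi hϖ)).mul hS nonExp₁).mul hS s1.1)).2 p hp⟩)
    (fun p hp => ⟨((nonExp₁).mem_ringInt hT) p hp, ((nonExp₂).mem_ringInt hT) p hp, (t1).2 p hp,
      (t2.sub ((((MaxOn.varpi hϖ)).mul hT nonExp₁).mul hT t1.1)).2 p hp⟩) ?_ ?_
    (s2.mul s1) (UnitOn.one)
    ((((((MaxOn.varpi hϖ)).mul hS nonExp₁).mul hS s1.1).mul hS s1.1).congr fun p hp => ?_) ?_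
  · intro p hp
    obtain ⟨n1, n2⟩ := nS p hp
    refine Prod.ext ?_ (Prod.ext ?_ (Prod.ext ?_ ?_)) <;> dsimp only
    all_goals try field_simp
    all_goals ring
  · intro p hp
    obtain ⟨n1, n2⟩ := nT p hp
    refine Prod.ext ?_ (Prod.ext ?_ (Prod.ext ?_ ?_)) <;> dsimp only
    all_goals try field_simp
    all_goals ring
  · obtain ⟨n1, n2⟩ := nS p hp
    dsimp only
    field_simp
    ring
  · intro p hp
    exact elt_apply_of_sq hv g₀ m _ _ _ (nonExp₁.mem_ringInt hS p hp)

theorem avg_trmA_eq_trm7 (hϖ : IsUniformizer ϖ) (hχ : χ.IsQuadratic)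
    (hcond : HasConductorPrime χ) (hN : 1 ≤ N)
    (hf : InvOn ϖ N (boxOOUU F) (trm7 ϖ χ ρ v)) :
    avg hϖ N (boxOOUU F) (trmA ϖ χ ρ v 1 4) =
      avg hϖ N (boxOOUU F) (trm7 ϖ χ ρ v) := by
  have hS := adm_boxOOUU hϖ
  have hT := adm_boxOOUU hϖ
  change avg (V := V) hϖ N ?S _ = avg (V := V) hϖ N ?T _
  set S := ?S
  set T := ?T
  have s1 : UnitOn ϖ S fun p => p.2.2.1 := ⟨nonExp₃, fun p hp => hp.2.2.1⟩
  have s2 : UnitOn ϖ S fun p => p.2.2.2 := ⟨nonExp₄, fun p hp => hp.2.2.2⟩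
  have nS : ∀ p ∈ S, p.2.2.1 ≠ 0 ∧ p.2.2.2 ≠ 0 :=
    fun p hp => ⟨s1.ne_zero hp, s2.ne_zero hp⟩
  have t1 : UnitOn ϖ T fun p => p.2.2.1 := ⟨nonExp₃, fun p hp => hp.2.2.1⟩
  have t2 : UnitOn ϖ T fun p => p.2.2.2 := ⟨nonExp₄, fun p hp => hp.2.2.2⟩
  have nT : ∀ p ∈ T, p.2.2.1 ≠ 0 ∧ p.2.2.2 ≠ 0 :=
    fun p hp => ⟨t1.ne_zero hp, t2.ne_zero hp⟩
  refine avg_summand_bij (t := fun p => 1) hϖ hχ hcond hN hS hT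
    hf (fun p => (p.1, p.2.1 + p.2.2.2 * p.2.2.1 * (ϖ : F), p.2.2.1, p.2.2.2))
    (fun p => (p.1, p.2.1 - p.2.2.2 * p.2.2.1 * (ϖ : F), p.2.2.1, p.2.2.2))
    (nonExp4 nonExp₁ (nonExp₂.add ((s2.1.mul s1.1).mul ((NonExp.varpi hϖ)))) s1.1 s2.1)
    (nonExp4 nonExp₁ (nonExp₂.sub ((t2.1.mul t1.1).mul ((NonExp.varpi hϖ)))) t1.1 t2.1)
    (fun p hp => ⟨((nonExp₁).mem_ringInt hS) p hp, ((nonExp₂.add ((s2.1.mul s1.1).mul ((NonExp.varpi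
      hϖ)))).mem_ringInt hS) p hp, (s1).2 p hp, (s2).2 p hp⟩)
    (fun p hp => ⟨((nonExp₁).mem_ringInt hT) p hp, ((nonExp₂.sub ((t2.1.mul t1.1).mul ((NonExp.varpi
      hϖ)))).mem_ringInt hT) p hp, (t1).2 p hp, (t2).2 p hp⟩) ?_ ?_
    (s2.mul s1) (UnitOn.one)
    ((MaxOn.zero).congr fun p hp => ?_) ?_
  · intro p hp
    obtain ⟨n1, n2⟩ := nS p hp
    refine Prod.ext ?_ (Prod.ext ?_ (Prod.ext ?_ ?_)) <;> dsimp only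
    all_goals try field_simp
    all_goals ring
  · intro p hp
    obtain ⟨n1, n2⟩ := nT p hp
    refine Prod.ext ?_ (Prod.ext ?_ (Prod.ext ?_ ?_)) <;> dsimp only
    all_goals try field_simp
    all_goals ring
  · obtain ⟨n1, n2⟩ := nS p hp
    dsimp only
    field_simp
    ring
  · intro p hp
    exact congrArg (ρ · v) (eltA_one_eq ϖ _ _ _)

theorem avg_trmB_eq_trm1 (hϖ : IsUniformizer ϖ) (hχ : χ.IsQuadratic)
    (hcond : HasConductorPrime χ) (hN : 1 ≤ N)
    (hf : InvOn ϖ N (boxOUUU F) (trm1 ϖ χ ρ v)) :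
    avg hϖ N (boxOUUU F) (trmB ϖ χ ρ v 1 4) =
      avg hϖ N (boxOUUU F) (trm1 ϖ χ ρ v) := by
  have hS := adm_boxOUUU hϖ
  have hT := adm_boxOUUU hϖ
  change avg (V := V) hϖ N ?S _ = avg (V := V) hϖ N ?T _
  set S := ?S
  set T := ?T
  have s1 : UnitOn ϖ S fun p => p.2.1 := ⟨nonExp₂, fun p hp => hp.2.1⟩
  have s2 : UnitOn ϖ S fun p => p.2.2.1 := ⟨nonExp₃, fun p hp => hp.2.2.1⟩
  have s3 : UnitOn ϖ S fun p => p.2.2.2 := ⟨nonExp₄, fun p hp => hp.2.2.2⟩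
  have nS : ∀ p ∈ S, p.2.1 ≠ 0 ∧ p.2.2.1 ≠ 0 ∧ p.2.2.2 ≠ 0 :=
    fun p hp => ⟨s1.ne_zero hp, s2.ne_zero hp, s3.ne_zero hp⟩
  have t1 : UnitOn ϖ T fun p => p.2.1 := ⟨nonExp₂, fun p hp => hp.2.1⟩
  have t2 : UnitOn ϖ T fun p => p.2.2.1 := ⟨nonExp₃, fun p hp => hp.2.2.1⟩
  have t3 : UnitOn ϖ T fun p => p.2.2.2 := ⟨nonExp₄, fun p hp => hp.2.2.2⟩
  have nT : ∀ p ∈ T, p.2.1 ≠ 0 ∧ p.2.2.1 ≠ 0 ∧ p.2.2.2 ≠ 0 :=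
    fun p hp => ⟨t1.ne_zero hp, t2.ne_zero hp, t3.ne_zero hp⟩
  refine avg_summand_bij (t := fun p => 1) hϖ hχ hcond hN hS hT
    hf (fun p => (p.1 + (p.2.2.2 + p.2.1 * p.2.2.1) * p.2.2.1 * (ϖ : F), p.2.1, p.2.2.1, p.2.2.2))
    (fun p => (p.1 - (p.2.2.2 + p.2.1 * p.2.2.1) * p.2.2.1 * (ϖ : F), p.2.1, p.2.2.1, p.2.2.2))
    (nonExp4 (nonExp₁.add (((s3.1.add (s1.1.mul s2.1)).mul s2.1).mul ((NonExp.varpi hϖ)))) s1.1 s2.1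
      s3.1)
    (nonExp4 (nonExp₁.sub (((t3.1.add (t1.1.mul t2.1)).mul t2.1).mul ((NonExp.varpi hϖ)))) t1.1 t2.1
      t3.1)
    (fun p hp => ⟨((nonExp₁.add (((s3.1.add (s1.1.mul s2.1)).mul s2.1).mul ((NonExp.varpi
      hϖ)))).mem_ringInt hS) p hp, (s1).2 p hp, (s2).2 p hp, (s3).2 p hp⟩)
    (fun p hp => ⟨((nonExp₁.sub (((t3.1.add (t1.1.mul t2.1)).mul t2.1).mul ((NonExp.varpi
      hϖ)))).mem_ringInt hT) p hp, (t1).2 p hp, (t2).2 p hp, (t3).2 p hp⟩) ?_ ?_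
    (s3.mul s2) (UnitOn.one)
    ((MaxOn.zero).congr fun p hp => ?_) ?_
  · intro p hp
    obtain ⟨n1, n2, n3⟩ := nS p hp
    refine Prod.ext ?_ (Prod.ext ?_ (Prod.ext ?_ ?_)) <;> dsimp only
    all_goals try field_simp
    all_goals ring
  · intro p hp
    obtain ⟨n1, n2, n3⟩ := nT p hp
    refine Prod.ext ?_ (Prod.ext ?_ (Prod.ext ?_ ?_)) <;> dsimp only
    all_goals try field_simp
    all_goals ring
  · obtain ⟨n1, n2, n3⟩ := nS p hp
    dsimp only
    field_simp
    ring
  · intro p hp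
    exact congrArg (ρ · v) (eltB_one_eq ϖ _ _ _ _)

theorem avg_trmC_eq_trm11 (hϖ : IsUniformizer ϖ) (hχ : χ.IsQuadratic)
    (hcond : HasConductorPrime χ) (hN : 1 ≤ N)
    (hf : InvOn ϖ N (boxOOUU F) (trm11 ϖ χ ρ v)) :
    avg hϖ N (boxOOUU F) (trmC ϖ χ ρ v 1 4) =
      avg hϖ N (boxOOUU F) (trm11 ϖ χ ρ v) := by
  have hS := adm_boxOOUU hϖ
  have hT := adm_boxOOUU hϖ
  change avg (V := V) hϖ N ?S _ = avg (V := V) hϖ N ?T _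
  set S := ?S
  set T := ?T
  have s1 : UnitOn ϖ S fun p => p.2.2.1 := ⟨nonExp₃, fun p hp => hp.2.2.1⟩
  have s2 : UnitOn ϖ S fun p => p.2.2.2 := ⟨nonExp₄, fun p hp => hp.2.2.2⟩
  have nS : ∀ p ∈ S, p.2.2.1 ≠ 0 ∧ p.2.2.2 ≠ 0 :=
    fun p hp => ⟨s1.ne_zero hp, s2.ne_zero hp⟩
  have t1 : UnitOn ϖ T fun p => p.2.2.1 := ⟨nonExp₃, fun p hp => hp.2.2.1⟩
  have t2 : UnitOn ϖ T fun p => p.2.2.2 := ⟨nonExp₄, fun p hp => hp.2.2.2⟩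
  have nT : ∀ p ∈ T, p.2.2.1 ≠ 0 ∧ p.2.2.2 ≠ 0 :=
    fun p hp => ⟨t1.ne_zero hp, t2.ne_zero hp⟩
  refine avg_summand_bij (t := fun p => 1) hϖ hχ hcond hN hS hT
    hf (fun p => (p.1 - p.2.2.1 * (p.2.1 * p.2.2.1 + p.2.2.2 * (ϖ : F)), p.2.1, p.2.2.1, p.2.2.2))
    (fun p => (p.1 + p.2.2.1 * (p.2.1 * p.2.2.1 + p.2.2.2 * (ϖ : F)), p.2.1, p.2.2.1, p.2.2.2))
    (nonExp4 (nonExp₁.sub (s1.1.mul ((nonExp₂.mul s1.1).add (s2.1.mul ((NonExp.varpi hϖ))))))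
      nonExp₂ s1.1 s2.1)
    (nonExp4 (nonExp₁.add (t1.1.mul ((nonExp₂.mul t1.1).add (t2.1.mul ((NonExp.varpi hϖ))))))
      nonExp₂ t1.1 t2.1)
    (fun p hp => ⟨((nonExp₁.sub (s1.1.mul ((nonExp₂.mul s1.1).add (s2.1.mul ((NonExp.varpi
      hϖ)))))).mem_ringInt hS) p hp, ((nonExp₂).mem_ringInt hS) p hp, (s1).2 p hp, (s2).2 p hp⟩)
    (fun p hp => ⟨((nonExp₁.add (t1.1.mul ((nonExp₂.mul t1.1).add (t2.1.mul ((NonExp.varpi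
      hϖ)))))).mem_ringInt hT) p hp, ((nonExp₂).mem_ringInt hT) p hp, (t1).2 p hp,
      (t2).2 p hp⟩) ?_ ?_
    (s2.mul s1) (UnitOn.one)
    ((MaxOn.zero).congr fun p hp => ?_) ?_
  · intro p hp
    obtain ⟨n1, n2⟩ := nS p hp
    refine Prod.ext ?_ (Prod.ext ?_ (Prod.ext ?_ ?_)) <;> dsimp only
    all_goals try field_simp
    all_goals ring
  · intro p hp
    obtain ⟨n1, n2⟩ := nT p hp
    refine Prod.ext ?_ (Prod.ext ?_ (Prod.ext ?_ ?_)) <;> dsimp only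
    all_goals try field_simp
    all_goals ring
  · obtain ⟨n1, n2⟩ := nS p hp
    dsimp only
    field_simp
    ring
  · intro p hp
    exact congrArg (ρ · v) (eltC_one_eq ϖ _ _ _ _)

omit [TopologicalSpace F] [IsNonarchimedeanLocalField F] in
theorem sepU_prod₁ (S₁ : Set F) (R : Set (F × F × F)) (h : unitInt F ⊆ S₁) :
    sepU (S₁ ×ˢ R) (fun p => p.1) = unitInt F ×ˢ R :=
  Set.ext fun _ => ⟨fun hp => ⟨hp.2, hp.1.2⟩, fun hp => ⟨⟨h hp.1, hp.2⟩, hp.1⟩⟩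

omit [TopologicalSpace F] [IsNonarchimedeanLocalField F] in
theorem sepM_prod₁ (S₁ : Set F) (R : Set (F × F × F)) (h : maxIdeal F ⊆ S₁) :
    sepM (S₁ ×ˢ R) (fun p => p.1) = maxIdeal F ×ˢ R :=
  Set.ext fun _ => ⟨fun hp => ⟨hp.2, hp.1.2⟩, fun hp => ⟨⟨h hp.1, hp.2⟩, hp.1⟩⟩

omit [TopologicalSpace F] [IsNonarchimedeanLocalField F] in
theorem sepM_prod₂ (S₁ S₂ : Set F) (R : Set (F × F)) (h : maxIdeal F ⊆ S₂) :
    sepM (S₁ ×ˢ S₂ ×ˢ R) (fun p => p.2.1) = S₁ ×ˢ maxIdeal F ×ˢ R :=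
  Set.ext fun _ => ⟨fun hp => ⟨hp.1.1, hp.2, hp.1.2.2⟩,
    fun hp => ⟨⟨hp.1, h hp.2.1, hp.2.2⟩, hp.2.1⟩⟩

/-- Substitution of `ϖ x` for the first variable. -/
theorem avg_maxIdeal_prod (hϖ : IsUniformizer ϖ) (hN : 1 ≤ N) {S₂ S₃ S₄ : Set F} (h₂ : AdmF ϖ S₂)
    (h₃ : AdmF ϖ S₃) (h₄ : AdmF ϖ S₄) {f : F × F × F × F → V}
    (hf : InvOn ϖ N (maxIdeal F ×ˢ S₂ ×ˢ S₃ ×ˢ S₄) f) :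
    avg hϖ N (maxIdeal F ×ˢ S₂ ×ˢ S₃ ×ˢ S₄) f = (resCard F)⁻¹ •
      avg hϖ N (ringInt F ×ˢ S₂ ×ˢ S₃ ×ˢ S₄) fun p => f ((ϖ : F) * p.1, p.2) :=
  avg_scale hϖ hN (adm_prod (admF_maxIdeal hϖ) h₂ h₃ h₄) hf (fun _ hp => hp.1) fun _ =>
    and_congr_left fun _ => hϖ.mul_mem_maxIdeal_iff.symm

omit [TopologicalSpace F] [IsNonarchimedeanLocalField F] [AddCommGroup V] [Module ℂ V] in
theorem InvOn.varpi_mul (hϖ : IsUniformizer ϖ) {R : Set (F × F × F)} {f : F × F × F × F → V}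
    (hf : InvOn ϖ N (maxIdeal F ×ˢ R) f) :
    InvOn ϖ N (ringInt F ×ˢ R) fun p => f ((ϖ : F) * p.1, p.2) :=
  hf.comp (fun _ hp => ⟨hϖ.mul_mem_maxIdeal_iff.2 hp.1, hp.2⟩)
    (nonExp4 ((NonExp.varpi hϖ).mul nonExp₁) nonExp₂ nonExp₃ nonExp₄)

/-- The range of `x` is split by `v(x) = 0`, `1`, `≥ 2`; each extraction of `ϖ` costs a factor
`q⁻¹`. The part `v(x) = 0` gives the C form over units and the integral with the Weyl element gives
it over `𝔭`, together over all of `𝔬`. -/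
theorem avg_trm_decomposition (g₀ : GSp4 F) (m : ℕ) (hϖ : IsUniformizer ϖ) (hχ : χ.IsQuadratic)
    (hcond : HasConductorPrime χ) (hv : v ∈ paramodularVectors ρ ϖ 0) (hN : 1 ≤ N)
    (hf : InvOn ϖ N (boxOOUU F) (trm ϖ χ ρ v g₀ m))
    (hA : InvOn ϖ N (boxOOUU F) (trmA ϖ χ ρ v g₀ m))
    (hB : InvOn ϖ N (boxOUUU F) (trmB ϖ χ ρ v g₀ m))
    (hC : InvOn ϖ N (boxOOUU F) (trmC ϖ χ ρ v g₀ m)) :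
    avg hϖ N (boxOOUU F) (trm ϖ χ ρ v g₀ m) +
        avg hϖ N (boxOMUU F) (trmW ϖ χ ρ v g₀ m) =
      (resCard F)⁻¹ • (resCard F)⁻¹ •
          avg hϖ N (boxOOUU F) (trmA ϖ χ ρ v g₀ m) +
        (resCard F)⁻¹ •
          avg hϖ N (boxOUUU F) (trmB ϖ χ ρ v g₀ m) +
        avg hϖ N (boxOOUU F) (trmC ϖ χ ρ v g₀ m) := by
  have hU := admF_unitInt hϖ
  have hS : Adm ϖ (boxOOUU F) :=
    adm_boxOOUU hϖ
  have hs : InvOn ϖ N (boxMOUU F) (summand χ ρ v (fun p => p.2.2.2 * p.2.2.1) fun p =>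
      elt ϖ g₀ m p.2.1 p.1 p.2.2.1 p.2.2.2) :=
    fun p hp p' hp' h => by
      have := hf (p.2.1, p.1, p.2.2) ⟨hp.2.1, max_ring hp.1, hp.2.2⟩
        (p'.2.1, p'.1, p'.2.2) ⟨hp'.2.1, max_ring hp'.1, hp'.2.2⟩ ⟨h.2.1, h.1, h.2.2⟩
      simpa only [trm, summand] using this
  have hs' : InvOn ϖ N (boxOOUU F) (summand χ ρ v (fun p => p.2.2.2 * p.2.2.1) fun p =>
      elt ϖ g₀ m p.2.1 ((ϖ : F) * p.1) p.2.2.1 p.2.2.2) := by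
    simpa only [InvOn, summand] using hs.varpi_mul hϖ
  have eW : avg hϖ N (boxOMUU F) (trmW ϖ χ ρ v g₀ m) =
      avg hϖ N (boxOMUU F) (trmC ϖ χ ρ v g₀ m) :=
    avg_congr hϖ fun p _ => congrArg _ (eltW_apply hv g₀ m _ _ _ _)
  have e₁ : avg hϖ N (boxMOUU F) (summand χ ρ v (fun p => p.2.2.2 * p.2.2.1) fun p =>
      elt ϖ g₀ m p.2.1 p.1 p.2.2.1 p.2.2.2) =
      (resCard F)⁻¹ • avg hϖ N (boxOOUU F) (summand χ ρ v (fun p => p.2.2.2 * p.2.2.1) fun p =>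
        elt ϖ g₀ m p.2.1 ((ϖ : F) * p.1) p.2.2.1 p.2.2.2) := by
    rw [avg_maxIdeal_prod hϖ hN admF_ringInt hU hU hs]
    simp only [avg, summand]
  have e₂ : avg hϖ N (boxMOUU F) (summand χ ρ v (fun p => p.2.2.2 * p.2.2.1) fun p =>
      elt ϖ g₀ m p.2.1 ((ϖ : F) * p.1) p.2.2.1 p.2.2.2) =
      (resCard F)⁻¹ • avg hϖ N (boxOOUU F) (summand χ ρ v (fun p => p.2.2.2 * p.2.2.1) fun p =>
        elt ϖ g₀ m p.2.1 ((ϖ : F) * ((ϖ : F) * p.1)) p.2.2.1 p.2.2.2) := by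
    rw [avg_maxIdeal_prod hϖ hN admF_ringInt hU hU
      (hs'.mono fun p hp => ⟨max_ring hp.1, hp.2⟩)]
    simp only [avg, summand]
  -- After one factor `ϖ` has been extracted from `x`, units lead to B and multiples of `ϖ` to A.
  have e₃ := avg_sep (N := N) hϖ hS nonExp₁ (summand χ ρ v (fun p => p.2.2.2 * p.2.2.1) fun p =>
      elt ϖ g₀ m p.2.1 ((ϖ : F) * p.1) p.2.2.1 p.2.2.2)
  rw [sepU_prod₁ _ _ fun _ => unit_ring, sepM_prod₁ _ _ fun _ => max_ring,
    avg_trm_eq_trmB g₀ m hϖ hχ hcond hv hN hB, e₂,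
    avg_trm_eq_trmA g₀ m hϖ hχ hcond hv hN hA] at e₃
  rw [avg_sep hϖ hS nonExp₂ (trm ϖ χ ρ v g₀ m), avg_sep hϖ hS nonExp₂ (trmC ϖ χ ρ v g₀ m),
    avg_trm_eq_trmC g₀ m hϖ hχ hcond hv hN hC, sepM_prod₂ _ _ _ fun _ => max_ring, eW,
    avg_trm_swap g₀ m hϖ hχ hcond hN hs, e₁, e₃, smul_add]
  abel

end Decomposition

/-! ### Assembling the parts and their powers of `q` -/

section Recombination

variable {F : Type*} [Field F] [ValuativeRel F] [TopologicalSpace F]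
  [IsNonarchimedeanLocalField F] {ϖ : Fˣ} {χ : MulChar F ℂ}
  {V : Type*} [AddCommGroup V] [Module ℂ V] {ρ : Representation ℂ (GSp4 F) V} {v : V} {N : ℕ}

/-- Summation of a function that does not depend on the first variable. -/
theorem avg_dummy_prod (hϖ : IsUniformizer ϖ) (hN : 1 ≤ N) {R : Set (F × F × F)}
    (hS : Adm ϖ (maxIdeal F ×ˢ R)) {f : F × F × F × F → V} (hf : InvOn ϖ N (ringInt F ×ˢ R) f)
    (hd : ∀ d d' r, f (d, r) = f (d', r)) :
    avg hϖ N (maxIdeal F ×ˢ R) f = (resCard F)⁻¹ • avg hϖ N (ringInt F ×ˢ R) f := by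
  rw [avg_scale (T := ringInt F ×ˢ R) hϖ hN hS (hf.mono fun p hp => ⟨max_ring hp.1, hp.2⟩)
    (fun p hp => hp.1) fun p => and_congr_left fun _ => hϖ.mul_mem_maxIdeal_iff.symm]
  exact congrArg _ (avg_congr hϖ fun p _ => hd _ _ _)

theorem smul_avg_dummy_prod (hϖ : IsUniformizer ϖ) (hN : 1 ≤ N) {R : Set (F × F × F)}
    (hS : Adm ϖ (maxIdeal F ×ˢ R)) {f : F × F × F × F → V} (hf : InvOn ϖ N (ringInt F ×ˢ R) f)
    (hd : ∀ d d' r, f (d, r) = f (d', r)) :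
    resCard F • avg hϖ N (maxIdeal F ×ˢ R) f = avg hϖ N (ringInt F ×ˢ R) f := by
  rw [avg_dummy_prod hϖ hN hS hf hd, smul_inv_smul₀ resCard_ne_zero]

omit [TopologicalSpace F] [IsNonarchimedeanLocalField F] in
theorem sepU_prod_right (A : Set F) (R : Set (F × F × F)) (e : F × F × F → F) :
    sepU (A ×ˢ R) (fun p => e p.2) = A ×ˢ {r ∈ R | e r ∈ unitInt F} :=
  Set.ext fun _ => and_assoc

/-- The A form has three genuine variables and a dummy one, whereas `T²` has four. The dummy is cut
down from `𝔬` to `𝔭` before it is matched with `x - y`, and this costs the factor `q`. -/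
theorem avg_trmA (hϖ : IsUniformizer ϖ) (hχ : χ.IsQuadratic) (hcond : HasConductorPrime χ)
    (hv : v ∈ paramodularVectors ρ ϖ 0) (hN : 1 ≤ N)
    (hA : InvOn ϖ N (boxOOUU F) (trmA ϖ χ ρ v (t4 ϖ) 3))
    (h₅ : InvOn ϖ N (boxOOUU F) (trm5 ϖ χ ρ v))
    (h₂ : InvOn ϖ N (boxPUUP F) (trm2 ϖ χ ρ v))
    (h₁₃ : InvOn ϖ N (boxOUUU F) (trm13 ϖ χ ρ v)) :
    avg hϖ N (boxOOUU F) (trmA ϖ χ ρ v (t4 ϖ) 3) =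
      avg hϖ N (sepM (boxOOUU F)
        fun p => p.2.2.1 + p.2.2.2 * p.2.1) (trm5 ϖ χ ρ v) +
      resCard F • avg hϖ N (sepM (boxPUUP F) fun p => p.2.2.2 - p.1) (trm2 ϖ χ ρ v) +
      avg hϖ N (sepM (boxOUUU F) fun p => 1 - p.2.1)
        (trm13 ϖ χ ρ v) := by
  have hU := admF_unitInt hϖ
  have hS : Adm ϖ (boxOOUU F) :=
    adm_boxOOUU hϖ
  have hS' : Adm ϖ (boxMOUU F) :=
    adm_boxMOUU hϖ
  have e := smul_avg_dummy_prod (R := {r ∈ {r ∈ ringInt F ×ˢ unitInt F ×ˢ unitInt F |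
      r.1 ∈ unitInt F} | r.1 + r.2.2 * r.2.1 ∈ unitInt F}) hϖ hN
    (by
      rw [← sepU_prod_right _ _ fun r => r.1 + r.2.2 * r.2.1, ← sepU_prod_right _ _ fun r => r.1]
      exact (hS'.sepU hϖ nonExp₂).sepU hϖ (nonExp₂.add (nonExp₄.mul nonExp₃)))
    (hA.mono fun p hp => ⟨hp.1, hp.2.1.1⟩) fun _ _ _ => rfl
  rw [← sepU_prod_right _ _ fun r => r.1 + r.2.2 * r.2.1, ← sepU_prod_right _ _ fun r => r.1,
    ← sepU_prod_right _ _ fun r => r.1 + r.2.2 * r.2.1, ← sepU_prod_right _ _ fun r => r.1,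
    avg_trmA_eq_trm2 hϖ hχ hcond hv hN h₂] at e
  rw [avg_sep hϖ hS nonExp₂, avg_sep hϖ (hS.sepU hϖ nonExp₂) (nonExp₂.add (nonExp₄.mul nonExp₃)),
    avg_trmA_eq_trm5 hϖ hχ hcond hv hN h₅, avg_trmA_eq_trm13 hϖ hχ hcond hv hN h₁₃, ← e]
  abel

/-- For `T⁴` and `T¹⁴` the factor `q` is spent on enlarging a dummy variable from `𝔭` to `𝔬`; `T¹²`
has no dummy variable and keeps it. -/
theorem avg_trmC (hϖ : IsUniformizer ϖ) (hχ : χ.IsQuadratic) (hcond : HasConductorPrime χ)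
    (hv : v ∈ paramodularVectors ρ ϖ 0) (hN : 1 ≤ N)
    (h₁₂ : InvOn ϖ N (boxPOUU F)
      (trm12 ϖ χ ρ v))
    (h₄ : InvOn ϖ N (boxOUUO F) (trm4 ϖ χ ρ v))
    (h₁₄ : InvOn ϖ N (boxOOUU F) (trm14 ϖ χ ρ v)) :
    resCard F • avg hϖ N (boxOOUU F)
        (trmC ϖ χ ρ v (t4 ϖ) 3) =
      resCard F • avg hϖ N (boxPOUU F)
        (trm12 ϖ χ ρ v) +
      avg hϖ N (boxOUUO F) (trm4 ϖ χ ρ v) +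
      avg hϖ N (boxOOUU F) (trm14 ϖ χ ρ v) := by
  have hU := admF_unitInt hϖ
  have hM := admF_maxIdeal hϖ
  have hS : Adm ϖ (boxOOUU F) :=
    adm_boxOOUU hϖ
  rw [avg_sep hϖ hS nonExp₁, avg_sep hϖ (hS.sepU hϖ nonExp₁) (nonExp₁.add (nonExp₄.mul nonExp₃)),
    avg_trmC_eq_trm12 hϖ hχ hcond hv hN h₁₂,
    avg_trmC_eq_trm4 hϖ hχ hcond hv hN (h₄.mono fun p hp => ⟨max_ring hp.1, hp.2⟩),
    avg_trmC_eq_trm14 hϖ hχ hcond hv hN (h₁₄.mono fun p hp => ⟨max_ring hp.1, hp.2⟩),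
    smul_add, smul_add,
    smul_avg_dummy_prod hϖ hN (adm_prod hM hU hU admF_ringInt) h₄ fun _ _ _ => rfl,
    smul_avg_dummy_prod hϖ hN (adm_boxMOUU hϖ) h₁₄ fun _ _ _ => rfl]

/-- One, two or three extractions of `ϖ` give `q⁻¹`, `q⁻²`, `q⁻³`; the dummy variable `z ∈ 𝔭`
contributes one more `q⁻¹` in each case. -/
theorem avg_trmE (hϖ : IsUniformizer ϖ) (hχ : χ.IsQuadratic) (hcond : HasConductorPrime χ)
    (hv : v ∈ paramodularVectors ρ ϖ 0) (hN : 1 ≤ N)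
    (hE : InvOn ϖ N (boxMMUU F) (trmE ϖ χ ρ v))
    (h₆ : InvOn ϖ N (boxOUUU F) (trm6 ϖ χ ρ v))
    (h₉ : InvOn ϖ N (boxOUUU F) (trm9 ϖ χ ρ v))
    (h₁₀ : InvOn ϖ N (boxOOUU F) (trm10 ϖ χ ρ v)) :
    avg hϖ N (boxMMUU F) (trmE ϖ χ ρ v) =
      (resCard F ^ 2)⁻¹ • avg hϖ N (boxOUUU F)
        (trm6 ϖ χ ρ v) +
      (resCard F ^ 3)⁻¹ • avg hϖ N (boxOUUU F)
        (trm9 ϖ χ ρ v) +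
      (resCard F ^ 4)⁻¹ • avg hϖ N (boxOOUU F)
        (trm10 ϖ χ ρ v) := by
  have hU := admF_unitInt hϖ
  have hM := admF_maxIdeal hϖ
  have hmax : ∀ {R : Set (F × F × F)}, maxIdeal F ×ˢ R ⊆ ringInt F ×ˢ R :=
    fun hp => ⟨max_ring hp.1, hp.2⟩
  have hS : Adm ϖ (boxOMUU F) :=
    adm_boxOMUU hϖ
  have i₁ := hE.varpi_mul hϖ
  have i₂ := (i₁.mono hmax).varpi_mul hϖ
  have e₆ := avg_trmE_eq_trm6 hϖ hχ hcond hv hN (h₆.mono hmax)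
  have e₉ := avg_trmE_eq_trm9 hϖ hχ hcond hv hN (h₉.mono hmax)
  have e₁₀ := avg_trmE_eq_trm10 hϖ hχ hcond hv hN (h₁₀.mono hmax)
  rw [avg_dummy_prod hϖ hN (adm_boxMUUU hϖ) h₆ fun _ _ _ => rfl] at e₆
  rw [avg_dummy_prod hϖ hN (adm_boxMUUU hϖ) h₉ fun _ _ _ => rfl] at e₉
  rw [avg_dummy_prod hϖ hN (adm_boxMOUU hϖ) h₁₀ fun _ _ _ => rfl] at e₁₀
  simp only [avg, summand] at e₆ e₉ e₁₀
  rw [avg_maxIdeal_prod hϖ hN hM hU hU hE, avg_sep hϖ hS nonExp₁,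
    sepU_prod₁ _ _ fun _ => unit_ring, sepM_prod₁ _ _ fun _ => max_ring,
    avg_maxIdeal_prod hϖ hN hM hU hU (i₁.mono hmax), avg_sep hϖ hS nonExp₁,
    sepU_prod₁ _ _ fun _ => unit_ring, sepM_prod₁ _ _ fun _ => max_ring,
    avg_maxIdeal_prod hϖ hN hM hU hU (i₂.mono hmax)]
  simp only [avg, trmE, summand]
  rw [e₆, e₉, e₁₀]
  simp only [smul_add, smul_smul]
  ring_nf
  abel

omit [TopologicalSpace F] [IsNonarchimedeanLocalField F] in
-- The substitution keeps `b` a unit, since `z/a ∈ 𝔭`, and preserves congruences. So invariance is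
-- inherited from the B form with the same `N`.
theorem invOn_trmD (hB : InvOn ϖ N (boxOUUU F) (trmB ϖ χ ρ v (t4 ϖ) 3)) :
    InvOn ϖ N (boxMUUU F) (trmD ϖ χ ρ v) := by
  set T := boxMUUU F
  have z : MaxOn ϖ T fun p => p.1 := ⟨nonExp₁, fun p hp => hp.1⟩
  have b : UnitOn ϖ T fun p => p.2.2.1 := ⟨nonExp₃, fun p hp => hp.2.2.1⟩
  have a : UnitOn ϖ T fun p => p.2.2.2 := ⟨nonExp₄, fun p hp => hp.2.2.2⟩
  have := hB.comp (τ := fun p => (p.1, p.2.1, p.2.2.1 - p.1 / p.2.2.2, p.2.2.2))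
    (fun p hp => ⟨max_ring hp.1, hp.2.1, (b.sub (z.div a)).2 p hp, hp.2.2.2⟩)
    (nonExp4 nonExp₁ nonExp₂ (b.sub (z.div a)).1 nonExp₄)
  simpa only [trmD, trmB, InvOn, summand] using this

omit [TopologicalSpace F] [IsNonarchimedeanLocalField F] in
theorem invOn_trmE (hD : InvOn ϖ N (boxMUUU F) (trmD ϖ χ ρ v)) :
    InvOn ϖ N (boxMMUU F) (trmE ϖ χ ρ v) := by
  set T := boxMMUU F
  have e : MaxOn ϖ T fun p => p.1 := ⟨nonExp₁, fun p hp => hp.1⟩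
  have x : UnitOn ϖ T fun p => p.2.2.1 := ⟨nonExp₃, fun p hp => hp.2.2.1⟩
  have a : UnitOn ϖ T fun p => p.2.2.2 := ⟨nonExp₄, fun p hp => hp.2.2.2⟩
  have := hD.comp (τ := fun p => (p.2.1, p.2.2.1, (p.1 - p.2.2.2) / p.2.2.1, p.2.2.2))
    (fun p hp => ⟨hp.2.1, hp.2.2.1, ((e.sub_unit a).div x).2 p hp, hp.2.2.2⟩)
    (nonExp4 nonExp₂ nonExp₃ ((e.sub_unit a).div x).1 nonExp₄)
  simpa only [trmD, trmE, InvOn, summand] using this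

/-- For unit `z` the tests on `z + ab`, `a + xb` and `xz + a(a + xb)` are made in this order, each
only where the previous quantities are units. In every case but `T²` a dummy variable in `𝔭` appears
and consumes the factor `q`. -/
theorem avg_trmB (hϖ : IsUniformizer ϖ) (hχ : χ.IsQuadratic) (hcond : HasConductorPrime χ)
    (hv : v ∈ paramodularVectors ρ ϖ 0) (hN : 1 ≤ N)
    (hB : InvOn ϖ N (boxOUUU F) (trmB ϖ χ ρ v (t4 ϖ) 3))
    (h₂ : InvOn ϖ N (boxPUUP F) (trm2 ϖ χ ρ v))
    (h₃ : InvOn ϖ N (boxOPUU F)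
      (trm3 ϖ χ ρ v))
    (h₅ : InvOn ϖ N (boxOOUU F) (trm5 ϖ χ ρ v))
    (h₆ : InvOn ϖ N (boxOUUU F) (trm6 ϖ χ ρ v))
    (h₈ : InvOn ϖ N (boxOPUU F)
      (trm8 ϖ χ ρ v))
    (h₉ : InvOn ϖ N (boxOUUU F) (trm9 ϖ χ ρ v))
    (h₁₀ : InvOn ϖ N (boxOOUU F) (trm10 ϖ χ ρ v))
    (h₁₃ : InvOn ϖ N (boxOUUU F) (trm13 ϖ χ ρ v)) :
    resCard F • avg hϖ N (boxOUUU F)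
        (trmB ϖ χ ρ v (t4 ϖ) 3) =
      avg hϖ N (sepU (boxOOUU F)
        fun p => p.2.2.1 + p.2.2.2 * p.2.1) (trm5 ϖ χ ρ v) +
      avg hϖ N (boxOPUU F)
        (trm3 ϖ χ ρ v) +
      resCard F • avg hϖ N (sepU (boxPUUP F) fun p => p.2.2.2 - p.1) (trm2 ϖ χ ρ v) +
      avg hϖ N (boxOPUU F)
        (trm8 ϖ χ ρ v) +
      avg hϖ N (sepU (boxOUUU F) fun p => 1 - p.2.1)
        (trm13 ϖ χ ρ v) +
      ((resCard F)⁻¹ • avg hϖ N (boxOUUU F)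
          (trm6 ϖ χ ρ v) +
        (resCard F ^ 2)⁻¹ • avg hϖ N (boxOUUU F)
          (trm9 ϖ χ ρ v) +
        (resCard F ^ 3)⁻¹ • avg hϖ N (boxOOUU F)
          (trm10 ϖ χ ρ v)) := by
  have hU := admF_unitInt hϖ
  have hM := admF_maxIdeal hϖ
  have hP := admF_punctured hϖ
  have hmax : ∀ {R : Set (F × F × F)}, maxIdeal F ×ˢ R ⊆ ringInt F ×ˢ R :=
    fun hp => ⟨max_ring hp.1, hp.2⟩
  have hS : Adm ϖ (boxOUUU F) :=
    adm_boxOUUU hϖ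
  have hS' : Adm ϖ (boxMUUU F) := adm_boxMUUU hϖ
  have n₁ : ∀ {S}, NonExp ϖ S fun p : F × F × F × F => p.1 + p.2.2.2 * p.2.2.1 :=
    nonExp₁.add (nonExp₄.mul nonExp₃)
  have n₂ : ∀ {S}, NonExp ϖ S fun p : F × F × F × F => p.2.2.2 + p.2.1 * p.2.2.1 :=
    nonExp₄.add (nonExp₂.mul nonExp₃)
  have n₃ : ∀ {S}, NonExp ϖ S fun p : F × F × F × F => p.2.1 * p.1 + p.2.2.2 *
    (p.2.2.2 + p.2.1 * p.2.2.1) := (nonExp₂.mul nonExp₁).add (nonExp₄.mul n₂)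
  have hz := hS.sepU hϖ nonExp₁
  have hzu := hz.sepU hϖ n₁
  have hD := invOn_trmD hB
  have hE := invOn_trmE hD
  have q0 := resCard_ne_zero (F := F)
  have e₅ : resCard F • avg hϖ N (sepU (boxMOUU F)
      fun p => p.2.2.1 + p.2.2.2 * p.2.1) (trm5 ϖ χ ρ v) =
      avg hϖ N (sepU (boxOOUU F)
        fun p => p.2.2.1 + p.2.2.2 * p.2.1) (trm5 ϖ χ ρ v) := by
    rw [sepU_prod_right _ _ fun r => r.2.1 + r.2.2 * r.1,
      sepU_prod_right _ _ fun r => r.2.1 + r.2.2 * r.1]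
    refine smul_avg_dummy_prod hϖ hN ?_ (h₅.mono fun p hp => ⟨hp.1, hp.2.1⟩) fun _ _ _ => rfl
    rw [← sepU_prod_right _ _ fun r => r.2.1 + r.2.2 * r.1]
    exact (adm_boxMOUU hϖ).sepU hϖ (nonExp₃.add (nonExp₄.mul nonExp₂))
  have e₁₃ : resCard F • avg hϖ N (sepU (boxMUUU F)
      fun p => 1 - p.2.1) (trm13 ϖ χ ρ v) =
      avg hϖ N (sepU (boxOUUU F) fun p => 1 - p.2.1)
        (trm13 ϖ χ ρ v) := by
    rw [sepU_prod_right _ _ fun r => 1 - r.1, sepU_prod_right _ _ fun r => 1 - r.1]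
    refine smul_avg_dummy_prod hϖ hN ?_ (h₁₃.mono fun p hp => ⟨hp.1, hp.2.1⟩) fun _ _ _ => rfl
    rw [← sepU_prod_right _ _ fun r => 1 - r.1]
    exact hS'.sepU hϖ (NonExp.one.sub nonExp₂)
  have d : avg hϖ N (sepM (boxOUUU F) fun p => p.1)
      (trmB ϖ χ ρ v (t4 ϖ) 3) = avg hϖ N (sepU (boxMUUU F)
        fun p => 1 - p.2.1) (trm13 ϖ χ ρ v) +
      avg hϖ N (boxMMUU F) (trmE ϖ χ ρ v) := by
    rw [avg_trmB_eq_trmD hϖ hχ hcond hN hD, avg_sep hϖ hS' n₂,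
      avg_trmD_eq_trm13 hϖ hχ hcond hv hN (h₁₃.mono hmax),
      avg_trmD_eq_trmE hϖ hχ hcond hN hE]
  rw [avg_sep hϖ hS nonExp₁, avg_sep hϖ hz n₁, avg_sep hϖ hzu n₂,
    avg_sep hϖ (hzu.sepU hϖ n₂) n₃, d, avg_trmE hϖ hχ hcond hv hN hE h₆ h₉ h₁₀,
    avg_trmB_eq_trm2 hϖ hχ hcond hv hN h₂, avg_trmB_eq_trm8 hϖ hχ hcond hv hN (h₈.mono hmax),
    avg_trmB_eq_trm3 hϖ hχ hcond hv hN (h₃.mono hmax),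
    avg_trmB_eq_trm5 hϖ hχ hcond hv hN (h₅.mono hmax)]
  simp only [smul_add]
  rw [e₅, e₁₃, smul_avg_dummy_prod hϖ hN (adm_boxMPUU hϖ) h₃ fun _ _ _ => rfl,
    smul_avg_dummy_prod hϖ hN (adm_boxMPUU hϖ) h₈ fun _ _ _ => rfl, smul_smul, smul_smul,
    smul_smul, show resCard F * (resCard F ^ 2)⁻¹ = (resCard F)⁻¹ by field_simp,
    show resCard F * (resCard F ^ 3)⁻¹ = (resCard F ^ 2)⁻¹ by field_simp,
    show resCard F * (resCard F ^ 4)⁻¹ = (resCard F ^ 3)⁻¹ by field_simp]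
  abel

end Recombination

section Eventually

open Filter

variable {F : Type*} [Field F] [ValuativeRel F] [TopologicalSpace F]
  [IsNonarchimedeanLocalField F] {ϖ : Fˣ} {χ : MulChar F ℂ}
  {V : Type*} [AddCommGroup V] [Module ℂ V] {ρ : Representation ℂ (GSp4 F) V}

/-! ### Local constancy of the summands -/

omit [TopologicalSpace F] [IsNonarchimedeanLocalField F] in
theorem ne_zero_of_mem_punctured {x : F} (h : x ∈ unitInt F \ oneUnits F) : x ≠ 0 :=
  unit_ne_zero h.1

omit [TopologicalSpace F] [IsNonarchimedeanLocalField F] in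
theorem one_sub_ne_zero_of_mem_punctured {x : F} (h : x ∈ unitInt F \ oneUnits F) : 1 - x ≠ 0 :=
  unit_ne_zero (mem_punctured_iff.1 h).2

theorem eventually_invOn_twist (hϖ : IsUniformizer ϖ) (hcond : HasConductorPrime χ)
    (hρ : IsSmooth ρ) (v : V) (g₀ : GSp4 F) (m : ℕ) : ∀ᶠ N in atTop,
      InvOn ϖ N (boxOOUU F) (trm ϖ χ ρ v g₀ m) ∧
      InvOn ϖ N (boxOMUU F) (trmW ϖ χ ρ v g₀ m) ∧
      InvOn ϖ N (boxOOUU F) (trmA ϖ χ ρ v g₀ m) ∧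
      InvOn ϖ N (boxOUUU F) (trmB ϖ χ ρ v g₀ m) ∧
      InvOn ϖ N (boxOOUU F) (trmC ϖ χ ρ v g₀ m) := by
  have key := fun {S} hS {c g} h => eventually_invOn (S := S) (c := c) (g := g) hϖ hρ v hcond.1 hS h
  simp only [eventually_and]
  refine ⟨key (adm_boxOOUU hϖ) fun p hp => ?_,
    key (adm_boxOMUU hϖ) fun p hp => ?_,
    key (adm_boxOOUU hϖ) fun p hp => ?_,
    key (adm_boxOUUU hϖ) fun p hp => ?_,
    key (adm_boxOOUU hϖ) fun p hp => ?_⟩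
  all_goals
    obtain ⟨h1, h2, h3, h4⟩ := hp
    refine ⟨?_, by fun_prop, ?_⟩
    · (repeat' apply mul_ne_zero) <;> exact unit_ne_zero (by assumption)
    simp only [elt, eltW, eltA, eltB, eltC]
    fun_prop (disch := first
        | exact unit_ne_zero (by assumption)
        | exact ne_zero_of_mem_punctured (by assumption)
        | exact one_sub_ne_zero_of_mem_punctured (by assumption)
        | assumption)

theorem eventually_invOn_terms (hϖ : IsUniformizer ϖ) (hcond : HasConductorPrime χ)
    (hρ : IsSmooth ρ) (v : V) : ∀ᶠ N in atTop,
      InvOn ϖ N (boxOUUU F) (trm1 ϖ χ ρ v) ∧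
      InvOn ϖ N (boxPUUP F) (trm2 ϖ χ ρ v) ∧
      InvOn ϖ N (boxOPUU F) (trm3 ϖ χ ρ v) ∧
      InvOn ϖ N (boxOUUO F) (trm4 ϖ χ ρ v) ∧
      InvOn ϖ N (boxOOUU F) (trm5 ϖ χ ρ v) ∧
      InvOn ϖ N (boxOUUU F) (trm6 ϖ χ ρ v) ∧
      InvOn ϖ N (boxOOUU F) (trm7 ϖ χ ρ v) ∧
      InvOn ϖ N (boxOPUU F) (trm8 ϖ χ ρ v) ∧
      InvOn ϖ N (boxOUUU F) (trm9 ϖ χ ρ v) ∧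
      InvOn ϖ N (boxOOUU F) (trm10 ϖ χ ρ v) ∧
      InvOn ϖ N (boxOOUU F) (trm11 ϖ χ ρ v) ∧
      InvOn ϖ N (boxPOUU F) (trm12 ϖ χ ρ v) ∧
      InvOn ϖ N (boxOUUU F) (trm13 ϖ χ ρ v) ∧
      InvOn ϖ N (boxOOUU F) (trm14 ϖ χ ρ v) := by
  have key := fun {S} hS {c g} h => eventually_invOn (S := S) (c := c) (g := g) hϖ hρ v hcond.1 hS h
  simp only [eventually_and]
  refine ⟨key (adm_boxOUUU hϖ) fun p hp => ?_,
    key (adm_boxPUUP hϖ) fun p hp => ?_,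
    key (adm_boxOPUU hϖ) fun p hp => ?_,
    key (adm_boxOUUO hϖ) fun p hp => ?_,
    key (adm_boxOOUU hϖ) fun p hp => ?_,
    key (adm_boxOUUU hϖ) fun p hp => ?_,
    key (adm_boxOOUU hϖ) fun p hp => ?_,
    key (adm_boxOPUU hϖ) fun p hp => ?_,
    key (adm_boxOUUU hϖ) fun p hp => ?_,
    key (adm_boxOOUU hϖ) fun p hp => ?_,
    key (adm_boxOOUU hϖ) fun p hp => ?_,
    key (adm_boxPOUU hϖ) fun p hp => ?_,
    key (adm_boxOUUU hϖ) fun p hp => ?_,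
    key (adm_boxOOUU hϖ) fun p hp => ?_⟩
  all_goals
    obtain ⟨h1, h2, h3, h4⟩ := hp
    refine ⟨?_, by fun_prop, ?_⟩
    · (repeat' apply mul_ne_zero) <;> first
        | exact unit_ne_zero (by assumption)
        | exact ne_zero_of_mem_punctured (by assumption)
        | exact one_sub_ne_zero_of_mem_punctured (by assumption)
    simp only [elt1, elt2, elt3, elt4, elt5, elt6, elt7, elt8, elt9, elt10, elt11, elt12, elt13,
        elt14]
    fun_prop (disch := first
        | exact unit_ne_zero (by assumption)
        | exact ne_zero_of_mem_punctured (by assumption)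
        | exact one_sub_ne_zero_of_mem_punctured (by assumption)
        | assumption)

end Eventually

section Terms

variable {F : Type*} [Field F] [ValuativeRel F] [TopologicalSpace F]
  [IsNonarchimedeanLocalField F] [MeasurableSpace F] [BorelSpace F]
  (μ : MeasureTheory.Measure F) [μ.IsAddHaarMeasure] {ϖ : Fˣ} {χ : MulChar F ℂ}
  {V : Type*} [AddCommGroup V] [Module ℂ V] {ρ : Representation ℂ (GSp4 F) V} {v : V} {N : ℕ}

/-! ### The terms as normalized sums -/

/-- In a term the torus element stands outside the integral, in the summand it stands inside.
Linearity moves it through the finite sum, and invertibility of its action carries invariance back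
to the integrand without it. -/
theorem apply_integ_eq_avg (hϖ : IsUniformizer ϖ) (hμ : μ (ringInt F) = 1) (hN : 1 ≤ N)
    {S₁ S₂ S₃ S₄ : Set F} (h₁ : AdmF ϖ S₁) (h₂ : AdmF ϖ S₂) (h₃ : AdmF ϖ S₃) (h₄ : AdmF ϖ S₄)
    (g₀ : GSp4 F) {c : F × F × F × F → F} {g : F × F × F × F → GSp4 F}
    (hf : InvOn ϖ N (S₁ ×ˢ S₂ ×ˢ S₃ ×ˢ S₄) (summand χ ρ v c fun p => g₀ * g p)) :
    ρ g₀ (integ μ S₁ fun z => integ μ S₂ fun x => integ μ S₃ fun b => integ μ S₄ fun a =>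
      χ (c (z, x, b, a)) • ρ (g (z, x, b, a)) v) =
    avg hϖ N (S₁ ×ˢ S₂ ×ˢ S₃ ×ˢ S₄) (summand χ ρ v c fun p => g₀ * g p) := by
  have hs : ∀ p, summand χ ρ v c (fun p => g₀ * g p) p = ρ g₀ (summand χ ρ v c g p) := fun p => by
    rw [summand, summand, map_smul, map_mul, Module.End.mul_apply]
  have hinj : ∀ w w', ρ g₀ w = ρ g₀ w' → w = w' := fun w w' h => by
    have := congrArg (ρ g₀⁻¹) h
    rwa [← Module.End.mul_apply, ← Module.End.mul_apply, ← map_mul, inv_mul_cancel, map_one] at this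
  have hg : InvOn ϖ N (S₁ ×ˢ S₂ ×ˢ S₃ ×ˢ S₄) (summand χ ρ v c g) := fun p hp p' hp' h =>
    hinj _ _ (by rw [← hs, ← hs]; exact hf p hp p' hp' h)
  have := integ_iterated_eq_avg μ hϖ hμ hN h₁ h₂ h₃ h₄ hg
  simp only [summand] at this
  rw [this, avg_map]
  exact avg_congr hϖ fun p _ => (hs p).symm

theorem term1_eq_avg (hϖ : IsUniformizer ϖ) (hμ : μ (ringInt F) = 1) (hN : 1 ≤ N)
    (hf : InvOn ϖ N (boxOUUU F) (trm1 ϖ χ ρ v)) :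
    term1 μ ϖ χ ρ v = resCard F ^ 2 • avg hϖ N (boxOUUU F) (trm1 ϖ χ ρ v) := by
  rw [term1, ← integ_iterated_eq_avg μ hϖ hμ hN admF_ringInt (admF_unitInt hϖ) (admF_unitInt hϖ)
      (admF_unitInt hϖ) hf]
  simp only [trm1, summand, elt1]

theorem term2_eq_avg (hϖ : IsUniformizer ϖ) (hμ : μ (ringInt F) = 1) (hN : 1 ≤ N)
    (hf : InvOn ϖ N (boxPUUP F) (trm2 ϖ χ ρ v)) :
    term2 μ ϖ χ ρ v = resCard F • avg hϖ N (boxPUUP F) (trm2 ϖ χ ρ v) := by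
  have := apply_integ_eq_avg μ hϖ hμ hN (admF_punctured hϖ) (admF_unitInt hϖ) (admF_unitInt hϖ)
      (admF_punctured hϖ) _ hf
  exact congrArg (_ • ·) this

theorem term3_eq_avg (hϖ : IsUniformizer ϖ) (hμ : μ (ringInt F) = 1) (hN : 1 ≤ N)
    (hf : InvOn ϖ N (boxOPUU F) (trm3 ϖ χ ρ v)) :
    term3 μ ϖ χ ρ v = avg hϖ N (boxOPUU F) (trm3 ϖ χ ρ v) := by
  have := apply_integ_eq_avg μ hϖ hμ hN admF_ringInt (admF_punctured hϖ) (admF_unitInt hϖ)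
      (admF_unitInt hϖ) _ hf
  dsimp only at this
  rw [integ_const μ hμ] at this
  exact this

theorem term4_eq_avg (hϖ : IsUniformizer ϖ) (hμ : μ (ringInt F) = 1) (hN : 1 ≤ N)
    (hf : InvOn ϖ N (boxOUUO F) (trm4 ϖ χ ρ v)) :
    term4 μ ϖ χ ρ v = resCard F • avg hϖ N (boxOUUO F) (trm4 ϖ χ ρ v) := by
  have := apply_integ_eq_avg μ hϖ hμ hN admF_ringInt (admF_unitInt hϖ) (admF_unitInt hϖ)
      admF_ringInt _ hf
  dsimp only at this
  rw [integ_const μ hμ] at this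
  exact congrArg (_ • ·) this

theorem term5_eq_avg (hϖ : IsUniformizer ϖ) (hμ : μ (ringInt F) = 1) (hN : 1 ≤ N)
    (hf : InvOn ϖ N (boxOOUU F) (trm5 ϖ χ ρ v)) :
    term5 μ ϖ χ ρ v = avg hϖ N (boxOOUU F) (trm5 ϖ χ ρ v) := by
  have := apply_integ_eq_avg μ hϖ hμ hN admF_ringInt admF_ringInt (admF_unitInt hϖ) (admF_unitInt
      hϖ) _ hf
  dsimp only at this
  rw [integ_const μ hμ] at this
  exact this

theorem term6_eq_avg (hϖ : IsUniformizer ϖ) (hμ : μ (ringInt F) = 1) (hN : 1 ≤ N)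
    (hf : InvOn ϖ N (boxOUUU F) (trm6 ϖ χ ρ v)) :
    term6 μ ϖ χ ρ v = (resCard F)⁻¹ • avg hϖ N (boxOUUU F) (trm6 ϖ χ ρ v) := by
  have := apply_integ_eq_avg μ hϖ hμ hN admF_ringInt (admF_unitInt hϖ) (admF_unitInt hϖ)
      (admF_unitInt hϖ) _ hf
  dsimp only at this
  rw [integ_const μ hμ] at this
  exact congrArg (_ • ·) this

theorem term7_eq_avg (hϖ : IsUniformizer ϖ) (hμ : μ (ringInt F) = 1) (hN : 1 ≤ N)
    (hf : InvOn ϖ N (boxOOUU F) (trm7 ϖ χ ρ v)) :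
    term7 μ ϖ χ ρ v = resCard F • avg hϖ N (boxOOUU F) (trm7 ϖ χ ρ v) := by
  have := apply_integ_eq_avg μ hϖ hμ hN admF_ringInt admF_ringInt (admF_unitInt hϖ) (admF_unitInt
      hϖ) _ hf
  dsimp only at this
  rw [integ_const μ hμ] at this
  exact congrArg (_ • ·) this

theorem term8_eq_avg (hϖ : IsUniformizer ϖ) (hμ : μ (ringInt F) = 1) (hN : 1 ≤ N)
    (hf : InvOn ϖ N (boxOPUU F) (trm8 ϖ χ ρ v)) :
    term8 μ ϖ χ ρ v = avg hϖ N (boxOPUU F) (trm8 ϖ χ ρ v) := by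
  have := apply_integ_eq_avg μ hϖ hμ hN admF_ringInt (admF_punctured hϖ) (admF_unitInt hϖ)
      (admF_unitInt hϖ) _ hf
  dsimp only at this
  rw [integ_const μ hμ] at this
  exact this

theorem term9_eq_avg (hϖ : IsUniformizer ϖ) (hμ : μ (ringInt F) = 1) (hN : 1 ≤ N)
    (hf : InvOn ϖ N (boxOUUU F) (trm9 ϖ χ ρ v)) :
    term9 μ ϖ χ ρ v = (resCard F ^ 2)⁻¹ • avg hϖ N (boxOUUU F) (trm9 ϖ χ ρ v) := by
  have := apply_integ_eq_avg μ hϖ hμ hN admF_ringInt (admF_unitInt hϖ) (admF_unitInt hϖ)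
      (admF_unitInt hϖ) _ hf
  dsimp only at this
  rw [integ_const μ hμ] at this
  exact congrArg (_ • ·) this

theorem term10_eq_avg (hϖ : IsUniformizer ϖ) (hμ : μ (ringInt F) = 1) (hN : 1 ≤ N)
    (hf : InvOn ϖ N (boxOOUU F) (trm10 ϖ χ ρ v)) :
    term10 μ ϖ χ ρ v = (resCard F ^ 3)⁻¹ • avg hϖ N (boxOOUU F) (trm10 ϖ χ ρ v) := by
  have := apply_integ_eq_avg μ hϖ hμ hN admF_ringInt admF_ringInt (admF_unitInt hϖ) (admF_unitInt
      hϖ) _ hf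
  dsimp only at this
  rw [integ_const μ hμ, integ_const μ hμ] at this
  exact congrArg (_ • ·) this

theorem term11_eq_avg (hϖ : IsUniformizer ϖ) (hμ : μ (ringInt F) = 1) (hN : 1 ≤ N)
    (hf : InvOn ϖ N (boxOOUU F) (trm11 ϖ χ ρ v)) :
    term11 μ ϖ χ ρ v = resCard F ^ 3 • avg hϖ N (boxOOUU F) (trm11 ϖ χ ρ v) := by
  have := apply_integ_eq_avg μ hϖ hμ hN admF_ringInt admF_ringInt (admF_unitInt hϖ) (admF_unitInt
      hϖ) _ hf
  exact congrArg (_ • ·) this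

theorem term12_eq_avg (hϖ : IsUniformizer ϖ) (hμ : μ (ringInt F) = 1) (hN : 1 ≤ N)
    (hf : InvOn ϖ N (boxPOUU F) (trm12 ϖ χ ρ v)) :
    term12 μ ϖ χ ρ v = resCard F ^ 2 • avg hϖ N (boxPOUU F) (trm12 ϖ χ ρ v) := by
  have := apply_integ_eq_avg μ hϖ hμ hN (admF_punctured hϖ) admF_ringInt (admF_unitInt hϖ)
      (admF_unitInt hϖ) _ hf
  exact congrArg (_ • ·) this

theorem term13_eq_avg (hϖ : IsUniformizer ϖ) (hμ : μ (ringInt F) = 1) (hN : 1 ≤ N)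
    (hf : InvOn ϖ N (boxOUUU F) (trm13 ϖ χ ρ v)) :
    term13 μ ϖ χ ρ v = avg hϖ N (boxOUUU F) (trm13 ϖ χ ρ v) := by
  have := apply_integ_eq_avg μ hϖ hμ hN admF_ringInt (admF_unitInt hϖ) (admF_unitInt hϖ)
      (admF_unitInt hϖ) _ hf
  dsimp only at this
  rw [integ_const μ hμ] at this
  exact this

theorem term14_eq_avg (hϖ : IsUniformizer ϖ) (hμ : μ (ringInt F) = 1) (hN : 1 ≤ N)
    (hf : InvOn ϖ N (boxOOUU F) (trm14 ϖ χ ρ v)) :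
    term14 μ ϖ χ ρ v = resCard F • avg hϖ N (boxOOUU F) (trm14 ϖ χ ρ v) := by
  have := apply_integ_eq_avg μ hϖ hμ hN admF_ringInt admF_ringInt (admF_unitInt hϖ) (admF_unitInt
      hϖ) _ hf
  dsimp only at this
  rw [integ_const μ hμ] at this
  exact congrArg (_ • ·) this

end Terms

/-! ### The twisting operator as a sum -/

section Twist

variable {F : Type*} [Field F] [ValuativeRel F] [TopologicalSpace F]
  [IsNonarchimedeanLocalField F] [MeasurableSpace F] [BorelSpace F]
  (μ : MeasureTheory.Measure F) [μ.IsAddHaarMeasure] {ϖ : Fˣ} {χ : MulChar F ℂ}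
  {V : Type*} [AddCommGroup V] [Module ℂ V] {ρ : Representation ℂ (GSp4 F) V} {v : V} {N : ℕ}

theorem twist_eq_avg (hϖ : IsUniformizer ϖ) (hμ : μ (ringInt F) = 1) (hN : 1 ≤ N)
    (h₁ : InvOn ϖ N (boxOOUU F) (trm ϖ χ ρ v 1 4))
    (h₂ : InvOn ϖ N (boxOMUU F) (trmW ϖ χ ρ v 1 4))
    (h₃ : InvOn ϖ N (boxOOUU F) (trm ϖ χ ρ v (t4 ϖ) 3))
    (h₄ : InvOn ϖ N (boxOMUU F)
      (trmW ϖ χ ρ v (t4 ϖ) 3)) :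
    twist μ ϖ χ ρ v =
      resCard F ^ 3 • (avg hϖ N (boxOOUU F)
          (trm ϖ χ ρ v 1 4) +
        avg hϖ N (boxOMUU F) (trmW ϖ χ ρ v 1 4)) +
      resCard F ^ 2 • (avg hϖ N (boxOOUU F)
          (trm ϖ χ ρ v (t4 ϖ) 3) +
        avg hϖ N (boxOMUU F)
          (trmW ϖ χ ρ v (t4 ϖ) 3)) := by
  have hU := admF_unitInt hϖ
  have hM := admF_maxIdeal hϖ
  rw [twist, ← integ_iterated_eq_avg μ hϖ hμ hN admF_ringInt admF_ringInt hU hU h₁,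
    ← integ_iterated_eq_avg μ hϖ hμ hN admF_ringInt hM hU hU h₂,
    ← integ_iterated_eq_avg μ hϖ hμ hN admF_ringInt admF_ringInt hU hU h₃,
    ← integ_iterated_eq_avg μ hϖ hμ hN admF_ringInt hM hU hU h₄]
  simp only [trm, trmW, summand, elt, eltW, one_mul, ← mul_assoc, map_mul ρ _ (tau ϖ),
    Module.End.mul_apply, smul_add, add_assoc]

end Twist
end LocalTwist

end

/-! ### The expansion into fourteen terms -/

open LocalTwist in
theorem theorem4p2
    {F : Type*} [Field F] [ValuativeRel F] [TopologicalSpace F]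
    [IsNonarchimedeanLocalField F] [CharZero F]
    [MeasurableSpace F] [BorelSpace F]
    (μ : MeasureTheory.Measure F) [μ.IsAddHaarMeasure] (hμ : μ (LocalTwist.ringInt F) = 1)
    (ϖ : Fˣ) (hϖ : LocalTwist.IsUniformizer ϖ)
    (χ : MulChar F ℂ) (hχ : χ.IsQuadratic) (hcond : LocalTwist.HasConductorPrime χ)
    {V : Type*} [AddCommGroup V] [Module ℂ V]
    (ρ : Representation ℂ (LocalTwist.GSp4 F) V) (hsmooth : LocalTwist.IsSmooth ρ)
    (hcenter : ∀ z ∈ Subgroup.center (LocalTwist.GSp4 F), ρ z = 1)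
    (v : V) (hv : v ∈ LocalTwist.paramodularVectors ρ ϖ 0) :
    LocalTwist.twist μ ϖ χ ρ v =
      LocalTwist.term1 μ ϖ χ ρ v + LocalTwist.term2 μ ϖ χ ρ v + LocalTwist.term3 μ ϖ χ ρ v
      + LocalTwist.term4 μ ϖ χ ρ v + LocalTwist.term5 μ ϖ χ ρ v + LocalTwist.term6 μ ϖ χ ρ v
      + LocalTwist.term7 μ ϖ χ ρ v + LocalTwist.term8 μ ϖ χ ρ v + LocalTwist.term9 μ ϖ χ ρ v
      + LocalTwist.term10 μ ϖ χ ρ v + LocalTwist.term11 μ ϖ χ ρ v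
      + LocalTwist.term12 μ ϖ χ ρ v + LocalTwist.term13 μ ϖ χ ρ v
      + LocalTwist.term14 μ ϖ χ ρ v := by
  -- Each invariance holds for all large `N`, so one `N ≥ 1` serves all summands at once.
  obtain ⟨N, hN, ⟨a₁, a₂, b₁, b₂, b₃⟩, ⟨a₃, a₄, c₁, c₂, c₃⟩, h₁, h₂, h₃, h₄, h₅, h₆, h₇, h₈, h₉,
      h₁₀, h₁₁, h₁₂, h₁₃, h₁₄⟩ := ((Filter.eventually_ge_atTop 1).and <|
    (eventually_invOn_twist hϖ hcond hsmooth v 1 4).and <|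
    (eventually_invOn_twist hϖ hcond hsmooth v (t4 ϖ) 3).and <|
    eventually_invOn_terms hϖ hcond hsmooth v).exists
  have hU := admF_unitInt hϖ
  have hP := admF_punctured hϖ
  have q0 := resCard_ne_zero (F := F)
  rw [twist_eq_avg μ hϖ hμ hN a₁ a₂ a₃ a₄,
    avg_trm_decomposition 1 4 hϖ hχ hcond hv hN a₁ b₁ b₂ b₃,
    avg_trm_decomposition (t4 ϖ) 3 hϖ hχ hcond hv hN a₃ c₁ c₂ c₃,
    avg_trmA_eq_trm7 hϖ hχ hcond hN h₇, avg_trmB_eq_trm1 hϖ hχ hcond hN h₁,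
    avg_trmC_eq_trm11 hϖ hχ hcond hN h₁₁,
    term1_eq_avg μ hϖ hμ hN h₁, term2_eq_avg μ hϖ hμ hN h₂, term3_eq_avg μ hϖ hμ hN h₃,
    term4_eq_avg μ hϖ hμ hN h₄, term5_eq_avg μ hϖ hμ hN h₅, term6_eq_avg μ hϖ hμ hN h₆,
    term7_eq_avg μ hϖ hμ hN h₇, term8_eq_avg μ hϖ hμ hN h₈, term9_eq_avg μ hϖ hμ hN h₉,
    term10_eq_avg μ hϖ hμ hN h₁₀, term11_eq_avg μ hϖ hμ hN h₁₁, term12_eq_avg μ hϖ hμ hN h₁₂,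
    term13_eq_avg μ hϖ hμ hN h₁₃, term14_eq_avg μ hϖ hμ hN h₁₄]
  have eA := avg_trmA hϖ hχ hcond hv hN c₁ h₅ h₂ h₁₃
  have eB := avg_trmB hϖ hχ hcond hv hN c₂ h₂ h₃ h₅ h₆ h₈ h₉ h₁₀ h₁₃
  have eC := avg_trmC hϖ hχ hcond hv hN h₁₂ h₄ h₁₄
  -- The three terms that come partly from A and partly from B are split along the same conditions:
  -- `x - y`, `b + ax` and `1 - x`, respectively, a unit or not.
  have e₂ := avg_sep (N := N) hϖ (adm_boxPUUP hϖ) (nonExp₄.sub nonExp₁) (trm2 ϖ χ ρ v)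
  have e₅ := avg_sep (N := N) hϖ (adm_boxOOUU hϖ)
    (nonExp₃.add (nonExp₄.mul nonExp₂)) (trm5 ϖ χ ρ v)
  have e₁₃ := avg_sep (N := N) hϖ (adm_boxOUUU hϖ) (NonExp.one.sub nonExp₂)
    (trm13 ϖ χ ρ v)
  -- With `q²` in front, the forms A, B, C enter with coefficients `1`, `q`, `q²`. One `q` in the
  -- last is kept apart because the identity for C is stated with a factor `q`.
  have hq : ∀ x y z : V, resCard F ^ 2 • ((resCard F)⁻¹ • (resCard F)⁻¹ • x + (resCard F)⁻¹ • y +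
      z) = x + resCard F • y + resCard F • resCard F • z := fun x y z => by
    match_scalars <;> field_simp
  have hq' : ∀ x y z : V, resCard F ^ 3 • ((resCard F)⁻¹ • (resCard F)⁻¹ • x + (resCard F)⁻¹ • y +
      z) = resCard F • x + resCard F ^ 2 • y + resCard F ^ 3 • z := fun x y z => by
    match_scalars <;> field_simp
  rw [hq, hq', eA, eB, eC, e₂, e₅, e₁₃]
  simp only [smul_add, smul_smul, ← pow_two]
  abel
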